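/- Let $L_2$ be the language of second-order arithmetic, and let $\mathbf{L}_2$ be its extension by a constant $C_X$ for every set $X\subseteq\mathbb N$. Inside $\mathsf{ACA}_0$, a formula of $\mathbf{L}_2$ is coded by (a number coding) an $L_2$-formula with symbols for set constants, together with a sequence of sets interpreting these symbols, and an $\mathbf{L}_2$-theory $T$ is (a set coding) a countable set of $\mathbf{L}_2$-sentences. All theories $T$ are assumed to extend $\mathsf{ACA}_0$, that is, to contain a finite set $A$ of $L_2$-sentences that axiomatizes $\mathsf{ACA}_0$ (it suffices that all axioms of $\mathsf{ACA}_0$ follow from $A$ in first-order logic). Definitions, made in $\mathsf{ACA}_0$. $\mathbf\Pi^1_0=\mathbf\Sigma^1_0$ is the class of $\mathbf L_2$-formulas without set quantifiers; a $\mathbf\Pi^1_{n+1}$- (resp. $\mathbf\Sigma^1_{n+1}$-) formula is a block of universal (resp. existential) number and set quantifiers followed by a $\mathbf\Sigma^1_n$- (resp. $\mathbf\Pi^1_n$-) formula; $\mathsf{Tr}_{\mathbf\Pi^1_n}$ is the truth definition for $\mathbf\Pi^1_n$-sentences. An $\omega$-model $\mathfrak M$ is a code of a nonempty countable family of sets;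 $X\in\mathfrak M$ means that $X$ belongs to the family; $\mathfrak M\models\varphi$ means that all constants of the sentence $\varphi$ name members of $\mathfrak M$ and that $\varphi$ is true according to some satisfaction class for $\mathfrak M$, i.e. some assignment of truth values to all sentences with constants for members of $\mathfrak M$ that satisfies Tarski's clauses; $\mathfrak M\models T$ means $\mathfrak M\models\varphi$ for all axioms $\varphi$ of $T$. $\mathbf\Pi^1_n\text{-}\omega\mathsf{RFN}(T)$ says: for every $\mathbf\Pi^1_n$-sentence $\varphi$, if $\mathfrak M\models\varphi$ for every $\omega$-model $\mathfrak M\models T$ that contains the sets named in $\varphi$, then $\mathsf{Tr}_{\mathbf\Pi^1_n}(\varphi)$. Formulas are in negation normal form. An $\omega$-proof is a well-founded tree of sequents (countable sets of $\mathbf L_2$-formulas without free number variables, possibly with free set variables) built with the following axioms and rules, where $\mathsf{val}(t)$ is the value of the closed term $t$ and $\Gamma$ is an arbitrary sequent. Axioms: $\Gamma,t=v$ if $\mathsf{val}(t)=\mathsf{val}(v)$; $\Gamma,t\neq v$ if $\mathsf{val}(t)\ne\mathsf{val}(v)$; $\Gamma,t\in C_A$ if $\mathsf{val}(t)\in A$;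 $\Gamma,t\notin C_A$ if $\mathsf{val}(t)\notin A$; $\Gamma,t\in X,v\notin X$ if $\mathsf{val}(t)=\mathsf{val}(v)$. Rules: from $\Gamma,\varphi$ and $\Gamma,\psi$ infer $\Gamma,\varphi\land\psi$; from $\Gamma,\varphi,\psi$ infer $\Gamma,\varphi\lor\psi$; from $\Gamma,\varphi(\underline n)$ for all $n\in\mathbb N$ infer $\Gamma,\forall x\,\varphi(x)$; from $\Gamma,\varphi(t)$ with a closed term $t$ infer $\Gamma,\exists x\,\varphi(x)$; from $\Gamma,\varphi(Y)$ infer $\Gamma,\forall X\,\varphi(X)$ if the set variable $Y$ is not free in the conclusion; from $\Gamma,\varphi(C_A)$ or from $\Gamma,\varphi(Y)$ infer $\Gamma,\exists X\,\varphi(X)$; from $\Gamma,\varphi$ and $\Gamma,\neg\varphi$ infer $\Gamma$ (cut); from $\Gamma$ infer $\Gamma$ (repetition). Write $\vdash_\omega\Gamma$ (resp. $\vdash_0\Gamma$) if $\Gamma$ has an $\omega$-proof (resp. one without cuts). $\neg T$ is the sequent of the negations of the axioms of $T$. Theorem. $\mathsf{ACA}_0$ proves that, for every $\mathbf L_2$-theory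 $T$ extending $\mathsf{ACA}_0$, the following are equivalent: 1. $\mathbf\Pi^1_1\text{-}\omega\mathsf{RFN}(T)$; 2. $\mathbf\Pi^1_2\text{-}\omega\mathsf{RFN}(T)$; 3. $\forall X\,\exists\mathfrak M\,(X\in\mathfrak M\land\mathfrak M\models T)$; 4. $\nvdash_\omega\neg T$; 5. $\nvdash_0\neg T$; 6. for every $\mathbf\Pi^1_2$-sentence $\varphi$, if $\vdash_\omega\neg T,\varphi$, then $\mathsf{Tr}_{\mathbf\Pi^1_2}(\varphi)$; 7. for every $\mathbf\Pi^1_2$-sentence $\varphi$, if $\vdash_0\neg T,\varphi$, then $\mathsf{Tr}_{\mathbf\Pi^1_2}(\varphi)$. -/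

import Mathlib

namespace SOA

/-! ## The language `L₂` of second-order arithmetic

Formulas are in negation normal form and variables are de Bruijn indices, separately for the two
sorts: an index not bound by a quantifier of its sort is a free variable. -/

/-- Number terms over `0, S, +, ·`. -/
inductive Tm : Type
  | zero : Tm
  | var (i : ℕ) : Tm
  | succ (t : Tm) : Tm
  | add (t u : Tm) : Tm
  | mul (t u : Tm) : Tm

/-- Formulas of `L₂`: literals `t = u`, `t ≠ u`, `t ∈ X`, `t ∉ X`, the connectives `∧`, `∨`, the
number quantifiers `all`, `ex`, and the set quantifiers `all2`, `ex2`. -/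
inductive Fm : Type
  | eq (t u : Tm) : Fm
  | neq (t u : Tm) : Fm
  | mem (t : Tm) (X : ℕ) : Fm
  | nmem (t : Tm) (X : ℕ) : Fm
  | and (φ ψ : Fm) : Fm
  | or (φ ψ : Fm) : Fm
  | all (φ : Fm) : Fm
  | ex (φ : Fm) : Fm
  | all2 (φ : Fm) : Fm
  | ex2 (φ : Fm) : Fm

/-- Simultaneous substitution in terms. -/
def Tm.sub (σ : ℕ → Tm) : Tm → Tm
  | .zero => .zero
  | .var i => σ i
  | .succ t => .succ (t.sub σ)
  | .add t u => .add (t.sub σ) (u.sub σ)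
  | .mul t u => .mul (t.sub σ) (u.sub σ)

/-- The number variables shifted by one. -/
def shiftN : ℕ → Tm := fun i => .var (i + 1)

/-- A number substitution carried under a number quantifier. -/
def upN (σ : ℕ → Tm) : ℕ → Tm
  | 0 => .var 0
  | i + 1 => (σ i).sub shiftN

/-- A renaming of set variables carried under a set quantifier. -/
def upS (ρ : ℕ → ℕ) : ℕ → ℕ
  | 0 => 0
  | i + 1 => ρ i + 1

/-- Capture-avoiding substitution of terms for number variables and set variables for set
variables. -/
def Fm.sub : (ℕ → Tm) → (ℕ → ℕ) → Fm → Fm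
  | σ, _, .eq t u => .eq (t.sub σ) (u.sub σ)
  | σ, _, .neq t u => .neq (t.sub σ) (u.sub σ)
  | σ, ρ, .mem t X => .mem (t.sub σ) (ρ X)
  | σ, ρ, .nmem t X => .nmem (t.sub σ) (ρ X)
  | σ, ρ, .and φ ψ => .and (φ.sub σ ρ) (ψ.sub σ ρ)
  | σ, ρ, .or φ ψ => .or (φ.sub σ ρ) (ψ.sub σ ρ)
  | σ, ρ, .all φ => .all (φ.sub (upN σ) ρ)
  | σ, ρ, .ex φ => .ex (φ.sub (upN σ) ρ)
  | σ, ρ, .all2 φ => .all2 (φ.sub σ (upS ρ))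
  | σ, ρ, .ex2 φ => .ex2 (φ.sub σ (upS ρ))

/-- The body `φ` of a number quantifier, instantiated by `t`. -/
def Fm.inst (φ : Fm) (t : Tm) : Fm :=
  φ.sub (fun i => match i with | 0 => t | j + 1 => .var j) id

/-- The body `φ` of a set quantifier, instantiated by the set variable `X`. -/
def Fm.inst2 (φ : Fm) (X : ℕ) : Fm :=
  φ.sub .var (fun i => match i with | 0 => X | j + 1 => j)

/-- The negation of a formula: every literal, connective and quantifier is dualized. -/
def Fm.neg : Fm → Fm
  | .eq t u => .neq t u
  | .neq t u => .eq t u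
  | .mem t X => .nmem t X
  | .nmem t X => .mem t X
  | .and φ ψ => .or φ.neg ψ.neg
  | .or φ ψ => .and φ.neg ψ.neg
  | .all φ => .ex φ.neg
  | .ex φ => .all φ.neg
  | .all2 φ => .ex2 φ.neg
  | .ex2 φ => .all2 φ.neg

/-- All number variables are `< k`. -/
def Tm.Closed (k : ℕ) : Tm → Prop
  | .zero => True
  | .var i => i < k
  | .succ t => t.Closed k
  | .add t u => t.Closed k ∧ u.Closed k
  | .mul t u => t.Closed k ∧ u.Closed k

/-- All free number variables are `< k` and all free set variables are `< l`. -/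
def Fm.Closed : ℕ → ℕ → Fm → Prop
  | k, _, .eq t u => t.Closed k ∧ u.Closed k
  | k, _, .neq t u => t.Closed k ∧ u.Closed k
  | k, l, .mem t X => t.Closed k ∧ X < l
  | k, l, .nmem t X => t.Closed k ∧ X < l
  | k, l, .and φ ψ => φ.Closed k l ∧ ψ.Closed k l
  | k, l, .or φ ψ => φ.Closed k l ∧ ψ.Closed k l
  | k, l, .all φ => φ.Closed (k + 1) l
  | k, l, .ex φ => φ.Closed (k + 1) l
  | k, l, .all2 φ => φ.Closed k (l + 1)
  | k, l, .ex2 φ => φ.Closed k (l + 1)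

/-- Sentences of `L₂`. -/
def Fm.IsSentence (φ : Fm) : Prop := φ.Closed 0 0

/-- Formulas without set quantifiers. -/
def Fm.IsArith : Fm → Prop
  | .eq _ _ => True
  | .neq _ _ => True
  | .mem _ _ => True
  | .nmem _ _ => True
  | .and φ ψ => φ.IsArith ∧ ψ.IsArith
  | .or φ ψ => φ.IsArith ∧ ψ.IsArith
  | .all φ => φ.IsArith
  | .ex φ => φ.IsArith
  | .all2 _ => False
  | .ex2 _ => False

/-! ## Provability in two-sorted first-order logic with equality -/

/-- `Derives T Γ`: the disjunction of the finite sequent `Γ` has a derivation from the axioms `T`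
in a one-sided sequent calculus for classical two-sorted first-order logic, with equality for the
number sort, and with cut. -/
inductive Derives (T : Set Fm) : List Fm → Prop
  | ax {Γ : List Fm} {φ : Fm} : φ ∈ T → Derives T (φ :: Γ)
  | em {Γ : List Fm} {φ : Fm} : φ ∈ Γ → φ.neg ∈ Γ → Derives T Γ
  | weak {Γ Δ : List Fm} : Γ ⊆ Δ → Derives T Γ → Derives T Δ
  | cut {Γ : List Fm} (φ : Fm) : Derives T (φ :: Γ) → Derives T (φ.neg :: Γ) → Derives T Γ
  | refl {Γ : List Fm} (t : Tm) : Derives T (.eq t t :: Γ)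
  | leibniz {Γ : List Fm} (t u : Tm) (φ : Fm) :
      Derives T (.eq t u :: Γ) → Derives T (φ.inst t :: Γ) → Derives T (φ.inst u :: Γ)
  | and {Γ : List Fm} {φ ψ : Fm} :
      Derives T (φ :: Γ) → Derives T (ψ :: Γ) → Derives T (.and φ ψ :: Γ)
  | or {Γ : List Fm} {φ ψ : Fm} : Derives T (φ :: ψ :: Γ) → Derives T (.or φ ψ :: Γ)
  | all {Γ : List Fm} {φ : Fm} :
      Derives T (φ :: Γ.map (Fm.sub shiftN id)) → Derives T (.all φ :: Γ)
  | ex {Γ : List Fm} {φ : Fm} (t : Tm) : Derives T (φ.inst t :: Γ) → Derives T (.ex φ :: Γ)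
  | all2 {Γ : List Fm} {φ : Fm} :
      Derives T (φ :: Γ.map (Fm.sub .var Nat.succ)) → Derives T (.all2 φ :: Γ)
  | ex2 {Γ : List Fm} {φ : Fm} (X : ℕ) : Derives T (φ.inst2 X :: Γ) → Derives T (.ex2 φ :: Γ)

/-- `T ⊢ φ` in first-order logic. -/
def Proves (T : Set Fm) (φ : Fm) : Prop := Derives T [φ]

/-! ## The theory `ACA₀` -/

/-- `φ → ψ`. -/
def Fm.imp (φ ψ : Fm) : Fm := .or φ.neg ψ

/-- `φ ↔ ψ`. -/
def Fm.iff (φ ψ : Fm) : Fm := .and (φ.imp ψ) (ψ.imp φ)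

/-- `∃ X ∀ n (n ∈ X ↔ φ(n))`, where the number variable `0` of `φ` is `n`, and `X` is not free in
`φ`. -/
def compr (φ : Fm) : Fm :=
  .ex2 (.all (Fm.iff (.mem (.var 0) 0) (φ.sub .var Nat.succ)))

/-- `∀ X (0 ∈ X ∧ ∀ n (n ∈ X → S n ∈ X) → ∀ n (n ∈ X))`. -/
def inductionAxiom : Fm :=
  .all2 (Fm.imp
    (.and (.mem .zero 0) (.all (Fm.imp (.mem (.var 0) 0) (.mem (.succ (.var 0)) 0))))
    (.all (.mem (.var 0) 0)))

/-- The axioms of `ACA₀`: the basic axioms on `0, S, +, ·`, the induction axiom, and the universal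
closures of all instances of arithmetical comprehension. -/
inductive ACA0 : Set Fm
  | succ_ne_zero : ACA0 (.all (.neq (.succ (.var 0)) .zero))
  | succ_inj : ACA0 (.all (.all
      (Fm.imp (.eq (.succ (.var 0)) (.succ (.var 1))) (.eq (.var 0) (.var 1)))))
  | add_zero : ACA0 (.all (.eq (.add (.var 0) .zero) (.var 0)))
  | add_succ : ACA0 (.all (.all
      (.eq (.add (.var 0) (.succ (.var 1))) (.succ (.add (.var 0) (.var 1))))))
  | mul_zero : ACA0 (.all (.eq (.mul (.var 0) .zero) .zero))
  | mul_succ : ACA0 (.all (.all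
      (.eq (.mul (.var 0) (.succ (.var 1))) (.add (.mul (.var 0) (.var 1)) (.var 0)))))
  | ind : ACA0 inductionAxiom
  | comp (φ : Fm) (a b : ℕ) : φ.IsArith → φ.Closed (a + 1) b →
      ACA0 (Fm.all2^[b] (Fm.all^[a] (compr φ)))

/-! ## Gödel numbers of `L₂`-formulas -/

/-- The (injective) pairing function `(x + y)² + x`. -/
def pr (x y : ℕ) : ℕ := (x + y) * (x + y) + x

/-- The code of a term. -/
def Tm.code : Tm → ℕ
  | .zero => pr 0 0
  | .var i => pr 1 i
  | .succ t => pr 2 t.code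
  | .add t u => pr 3 (pr t.code u.code)
  | .mul t u => pr 4 (pr t.code u.code)

/-- The code of a formula; `pr 0 X` is the code of the bound set variable with index `X`. -/
def Fm.code : Fm → ℕ
  | .eq t u => pr 0 (pr t.code u.code)
  | .neq t u => pr 1 (pr t.code u.code)
  | .mem t X => pr 2 (pr t.code (pr 0 X))
  | .nmem t X => pr 3 (pr t.code (pr 0 X))
  | .and φ ψ => pr 4 (pr φ.code ψ.code)
  | .or φ ψ => pr 5 (pr φ.code ψ.code)
  | .all φ => pr 6 φ.code
  | .ex φ => pr 7 φ.code
  | .all2 φ => pr 8 φ.code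
  | .ex2 φ => pr 9 φ.code

/-! ## Writing `L₂`-formulas with named variables

`Num`, `SetV`, `Form` are number terms, set variables and formulas of `L₂` as functions of the
numbers `a`, `b` of number and set quantifiers in whose scope they are placed. -/

abbrev Num := ℕ → Tm
abbrev SetV := ℕ → ℕ
abbrev Form := ℕ → ℕ → Fm

/-- The `L₂`-formula given by an expression outside the scope of any quantifier. -/
def Form.toFm (φ : Form) : Fm := φ 0 0

def allN (f : Num → Form) : Form :=
  fun a b => .all (f (fun a' => .var (a' - 1 - a)) (a + 1) b)
def exN (f : Num → Form) : Form :=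
  fun a b => .ex (f (fun a' => .var (a' - 1 - a)) (a + 1) b)
def allS (f : SetV → Form) : Form :=
  fun a b => .all2 (f (fun b' => b' - 1 - b) a (b + 1))
def exS (f : SetV → Form) : Form :=
  fun a b => .ex2 (f (fun b' => b' - 1 - b) a (b + 1))

def eqF (s t : Num) : Form := fun a _ => .eq (s a) (t a)
def memF (s : Num) (X : SetV) : Form := fun a b => .mem (s a) (X b)
def notF (φ : Form) : Form := fun a b => (φ a b).neg
def andF (φ ψ : Form) : Form := fun a b => .and (φ a b) (ψ a b)
def orF (φ ψ : Form) : Form := fun a b => .or (φ a b) (ψ a b)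
def impF (φ ψ : Form) : Form := orF (notF φ) ψ
def iffF (φ ψ : Form) : Form := andF (impF φ ψ) (impF ψ φ)

infix:50 " ≐ " => SOA.eqF
infix:50 " ∊ " => SOA.memF
prefix:60 "∼" => SOA.notF
infixr:35 " ⋏ " => SOA.andF
infixr:30 " ⋎ " => SOA.orF
infixr:25 " ⟶' " => SOA.impF
infix:20 " ⟷' " => SOA.iffF

/-- The numeral `S (⋯ S 0)`. -/
def numeral : ℕ → Tm
  | 0 => .zero
  | n + 1 => .succ (numeral n)

def lit (n : ℕ) : Num := fun _ => numeral n
def suc (t : Num) : Num := fun a => .succ (t a)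
/-- The term `(x + y) · (x + y) + x`. -/
def pair (x y : Num) : Num :=
  fun a => .add (.mul (.add (x a) (y a)) (.add (x a) (y a))) (x a)
/-- `x < y`. -/
def ltF (x y : Num) : Form := exN fun z => (fun a => .add (x a) (.succ (z a))) ≐ y

/-! ## Codes of syntactic objects, as terms -/

def cZero : Num := pair (lit 0) (lit 0)
def cVar (i : Num) : Num := pair (lit 1) i
def cSucc (t : Num) : Num := pair (lit 2) t
def cAdd (t u : Num) : Num := pair (lit 3) (pair t u)
def cMul (t u : Num) : Num := pair (lit 4) (pair t u)

/-- A bound set variable (de Bruijn index `i`). -/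
def cBound (i : Num) : Num := pair (lit 0) i
/-- The `i`-th free set variable; free and bound set variables are distinct symbols. -/
def cFree (i : Num) : Num := pair (lit 1) i
/-- The `i`-th symbol for a set constant. -/
def cConst (i : Num) : Num := pair (lit 2) i

def cEq (t u : Num) : Num := pair (lit 0) (pair t u)
def cNeq (t u : Num) : Num := pair (lit 1) (pair t u)
def cMem (t s : Num) : Num := pair (lit 2) (pair t s)
def cNmem (t s : Num) : Num := pair (lit 3) (pair t s)
def cAnd (f g : Num) : Num := pair (lit 4) (pair f g)
def cOr (f g : Num) : Num := pair (lit 5) (pair f g)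
def cAll (f : Num) : Num := pair (lit 6) f
def cEx (f : Num) : Num := pair (lit 7) f
def cAll2 (f : Num) : Num := pair (lit 8) f
def cEx2 (f : Num) : Num := pair (lit 9) f

/-! ## Coded families of sets

A set `Y` codes the family of the sets `Yᵢ = {x | ⟨i, x + 1⟩ ∈ Y}`, for the `i` with
`⟨i, 0⟩ ∈ Y`. -/

/-- `i` is an index of the family `Y`. -/
def inDom (i : Num) (Y : SetV) : Form := pair i (lit 0) ∊ Y
/-- `x ∈ Yᵢ`. -/
def inSec (x i : Num) (Y : SetV) : Form := pair i (suc x) ∊ Y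
/-- `X` is a member of the family `Y`. -/
def memFam (X Y : SetV) : Form :=
  exN fun z => inDom z Y ⋏ allN fun x => x ∊ X ⟷' inSec x z Y

/-! ## Coded terms

Primitive recursive notions are given by their recursion equations: a set `R` satisfying the
recursion clauses is asserted to exist, and the tuple in question to belong to it. -/

/-- `t` is a term all of whose variables are `< k`. -/
def isTm (t k : Num) : Form := exS fun R =>
  (allN fun t => allN fun k => pair t k ∊ R ⟷'
    (t ≐ cZero
    ⋎ (exN fun i => t ≐ cVar i ⋏ ltF i k)
    ⋎ (exN fun u => t ≐ cSucc u ⋏ pair u k ∊ R)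
    ⋎ (exN fun u => exN fun v => (t ≐ cAdd u v ⋎ t ≐ cMul u v) ⋏ pair u k ∊ R ⋏ pair v k ∊ R)))
  ⋏ pair t k ∊ R

/-- The closed term `t` has the value `n`. -/
def val (t n : Num) : Form := exS fun R =>
  (allN fun t => allN fun n => pair t n ∊ R ⟷'
    ((t ≐ cZero ⋏ n ≐ lit 0)
    ⋎ (exN fun u => exN fun m => t ≐ cSucc u ⋏ n ≐ suc m ⋏ pair u m ∊ R)
    ⋎ (exN fun u => exN fun v => exN fun m => exN fun p =>
        t ≐ cAdd u v ⋏ n ≐ (fun a => .add (m a) (p a)) ⋏ pair u m ∊ R ⋏ pair v p ∊ R)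
    ⋎ (exN fun u => exN fun v => exN fun m => exN fun p =>
        t ≐ cMul u v ⋏ n ≐ (fun a => .mul (m a) (p a)) ⋏ pair u m ∊ R ⋏ pair v p ∊ R)))
  ⋏ pair t n ∊ R

/-- The closed terms `t` and `u` have the same value. -/
def sameVal (t u : Num) : Form := exN fun n => val t n ⋏ val u n

/-- `c` is the `n`-th numeral. -/
def isNumeral (n c : Num) : Form := exS fun R =>
  (allN fun n => allN fun c => pair n c ∊ R ⟷'
    ((n ≐ lit 0 ⋏ c ≐ cZero)
    ⋎ (exN fun m => exN fun d => n ≐ suc m ⋏ c ≐ cSucc d ⋏ pair m d ∊ R)))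
  ⋏ pair n c ∊ R

/-- `t'` is the term `t` with the closed term `c` substituted for the variable with index `k`. -/
def tmSub (c t k t' : Num) : Form := exS fun R =>
  (allN fun t => allN fun t' => pair t t' ∊ R ⟷'
    ((t ≐ cZero ⋏ t' ≐ cZero)
    ⋎ (t ≐ cVar k ⋏ t' ≐ c)
    ⋎ (exN fun i => ∼(i ≐ k) ⋏ t ≐ cVar i ⋏ t' ≐ cVar i)
    ⋎ (exN fun u => exN fun u' => t ≐ cSucc u ⋏ t' ≐ cSucc u' ⋏ pair u u' ∊ R)
    ⋎ (exN fun u => exN fun u' => exN fun v => exN fun v' =>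
        ((t ≐ cAdd u v ⋏ t' ≐ cAdd u' v') ⋎ (t ≐ cMul u v ⋏ t' ≐ cMul u' v'))
        ⋏ pair u u' ∊ R ⋏ pair v v' ∊ R)))
  ⋏ pair t t' ∊ R

/-! ## Coded formulas

A formula of the language `𝐋₂` with constants for all sets is given by a pair `(f, Y)`: the number
`f` codes a formula with constant symbols, and the set `Y` codes a family of sets, the `i`-th
constant symbol standing for `C_{Yᵢ}`. -/

/-- `f`, with the family `Y`, is a formula of `𝐋₂` without free number variables. -/
def isFm (f : Num) (Y : SetV) : Form := exS fun R =>
  (allN fun f => allN fun k => allN fun l => pair f (pair k l) ∊ R ⟷'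
    ((exN fun t => exN fun u => (f ≐ cEq t u ⋎ f ≐ cNeq t u) ⋏ isTm t k ⋏ isTm u k)
    ⋎ (exN fun t => exN fun s => (f ≐ cMem t s ⋎ f ≐ cNmem t s) ⋏ isTm t k ⋏
        exN fun i => (s ≐ cBound i ⋏ ltF i l) ⋎ s ≐ cFree i ⋎ (s ≐ cConst i ⋏ inDom i Y))
    ⋎ (exN fun g => exN fun h => (f ≐ cAnd g h ⋎ f ≐ cOr g h)
        ⋏ pair g (pair k l) ∊ R ⋏ pair h (pair k l) ∊ R)
    ⋎ (exN fun g => (f ≐ cAll g ⋎ f ≐ cEx g) ⋏ pair g (pair (suc k) l) ∊ R)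
    ⋎ (exN fun g => (f ≐ cAll2 g ⋎ f ≐ cEx2 g) ⋏ pair g (pair k (suc l)) ∊ R)))
  ⋏ pair f (pair (lit 0) (lit 0)) ∊ R

/-- The `u`-th free set variable occurs in `f`. -/
def occurs (u f : Num) : Form := exS fun R =>
  (allN fun f => f ∊ R ⟷'
    ((exN fun t => f ≐ cMem t (cFree u) ⋎ f ≐ cNmem t (cFree u))
    ⋎ (exN fun g => exN fun h => (f ≐ cAnd g h ⋎ f ≐ cOr g h) ⋏ (g ∊ R ⋎ h ∊ R))
    ⋎ (exN fun g => (f ≐ cAll g ⋎ f ≐ cEx g ⋎ f ≐ cAll2 g ⋎ f ≐ cEx2 g) ⋏ g ∊ R)))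
  ⋏ f ∊ R

/-- `f`, with the family `Y`, is a sentence of `𝐋₂`. -/
def isSent (f : Num) (Y : SetV) : Form := isFm f Y ⋏ allN fun u => ∼(occurs u f)

/-- `f'` arises from `f` by replacing the literals as described by `litMap`, whose second argument
is a counter that starts at `0` and is changed by `goN` (by `goS`) below a number (set) quantifier.
All connectives and quantifiers are dualized if `dual` is true, and kept otherwise. -/
def mapFm (dual : Bool) (litMap : Num → Num → Num → Form) (goN goS : Num → Num)
    (f f' : Num) : Form := exS fun R =>
  (allN fun f => allN fun k => allN fun f' => pair f (pair k f') ∊ R ⟷'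
    (litMap f k f'
    ⋎ (exN fun g => exN fun h => exN fun g' => exN fun h' =>
        ((f ≐ cAnd g h ⋏ f' ≐ (bif dual then cOr g' h' else cAnd g' h'))
          ⋎ (f ≐ cOr g h ⋏ f' ≐ (bif dual then cAnd g' h' else cOr g' h')))
        ⋏ pair g (pair k g') ∊ R ⋏ pair h (pair k h') ∊ R)
    ⋎ (exN fun g => exN fun g' =>
        ((f ≐ cAll g ⋏ f' ≐ (bif dual then cEx g' else cAll g'))
          ⋎ (f ≐ cEx g ⋏ f' ≐ (bif dual then cAll g' else cEx g')))
        ⋏ pair g (pair (goN k) g') ∊ R)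
    ⋎ (exN fun g => exN fun g' =>
        ((f ≐ cAll2 g ⋏ f' ≐ (bif dual then cEx2 g' else cAll2 g'))
          ⋎ (f ≐ cEx2 g ⋏ f' ≐ (bif dual then cAll2 g' else cEx2 g')))
        ⋏ pair g (pair (goS k) g') ∊ R)))
  ⋏ pair f (pair (lit 0) f') ∊ R

/-- `f'` is the negation of `f`. -/
def isNeg (f f' : Num) : Form :=
  mapFm true (fun f _ f' => exN fun t => exN fun s =>
      (f ≐ cEq t s ⋏ f' ≐ cNeq t s) ⋎ (f ≐ cNeq t s ⋏ f' ≐ cEq t s)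
      ⋎ (f ≐ cMem t s ⋏ f' ≐ cNmem t s) ⋎ (f ≐ cNmem t s ⋏ f' ≐ cMem t s))
    id id f f'

/-- `f'` is the body `f` of a number quantifier, instantiated by the closed term `c`. -/
def instTm (f c f' : Num) : Form :=
  mapFm false (fun f k f' => exN fun t => exN fun t' => tmSub c t k t' ⋏
      ((exN fun u => exN fun u' => tmSub c u k u' ⋏
        ((f ≐ cEq t u ⋏ f' ≐ cEq t' u') ⋎ (f ≐ cNeq t u ⋏ f' ≐ cNeq t' u')))
      ⋎ (exN fun s => (f ≐ cMem t s ⋏ f' ≐ cMem t' s) ⋎ (f ≐ cNmem t s ⋏ f' ≐ cNmem t' s))))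
    suc id f f'

/-- `f'` is the body `f` of a number quantifier, instantiated by the `n`-th numeral. -/
def instNum (f n f' : Num) : Form := exN fun c => isNumeral n c ⋏ instTm f c f'

/-- `f'` is the body `f` of a set quantifier, instantiated by `r`, which is a free set variable or a
set constant. -/
def instSet (f r f' : Num) : Form :=
  mapFm false (fun f k f' => exN fun t =>
      (exN fun u => (f ≐ cEq t u ⋏ f' ≐ cEq t u) ⋎ (f ≐ cNeq t u ⋏ f' ≐ cNeq t u))
      ⋎ (exN fun s => exN fun s' =>
          ((s ≐ cBound k ⋏ s' ≐ r) ⋎ (∼(s ≐ cBound k) ⋏ s' ≐ s)) ⋏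
          ((f ≐ cMem t s ⋏ f' ≐ cMem t s') ⋎ (f ≐ cNmem t s ⋏ f' ≐ cNmem t s'))))
    id suc f f'

/-- `(f, Y)` and `(f', W)` are the same formula of `𝐋₂`: they differ only in the constant symbols
used for one and the same set. -/
def same (f : Num) (Y : SetV) (f' : Num) (W : SetV) : Form :=
  mapFm false (fun f _ f' => exN fun t =>
      (exN fun u => (f ≐ cEq t u ⋏ f' ≐ cEq t u) ⋎ (f ≐ cNeq t u ⋏ f' ≐ cNeq t u))
      ⋎ (exN fun s => exN fun s' =>
          ((exN fun i => (s ≐ cBound i ⋎ s ≐ cFree i) ⋏ s' ≐ s)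
            ⋎ (exN fun i => exN fun j => s ≐ cConst i ⋏ s' ≐ cConst j ⋏ inDom i Y ⋏ inDom j W ⋏
                allN fun x => inSec x i Y ⟷' inSec x j W)) ⋏
          ((f ≐ cMem t s ⋏ f' ≐ cMem t s') ⋎ (f ≐ cNmem t s ⋏ f' ≐ cNmem t s'))))
    id id f f'

/-! ## The classes `𝚷¹ₙ` and `𝚺¹ₙ` -/

/-- `f` has no set quantifiers. -/
def isArith (f : Num) : Form := exS fun R =>
  (allN fun f => f ∊ R ⟷'
    ((exN fun t => exN fun s => f ≐ cEq t s ⋎ f ≐ cNeq t s ⋎ f ≐ cMem t s ⋎ f ≐ cNmem t s)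
    ⋎ (exN fun g => exN fun h => (f ≐ cAnd g h ⋎ f ≐ cOr g h) ⋏ g ∊ R ⋏ h ∊ R)
    ⋎ (exN fun g => (f ≐ cAll g ⋎ f ≐ cEx g) ⋏ g ∊ R)))
  ⋏ f ∊ R

/-- `f` is a `𝚷¹ₙ`-formula (`pol = true`), a `𝚺¹ₙ`-formula (`pol = false`): a block of universal
(existential) number and set quantifiers in front of a formula of the dual class of index
`n - 1`. -/
def isClass (pol : Bool) : ℕ → Num → Form
  | 0, f => isArith f
  | n + 1, f => exS fun R =>
      (allN fun f => f ∊ R ⟷'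
        (isClass (!pol) n f
        ⋎ (exN fun g => (bif pol then f ≐ cAll g ⋎ f ≐ cAll2 g else f ≐ cEx g ⋎ f ≐ cEx2 g)
            ⋏ g ∊ R)))
      ⋏ f ∊ R
  termination_by n => n

/-! ## Satisfaction classes and `ω`-models -/

/-- The set `S` satisfies Tarski's clauses on the set `D` of sentences, which contains the
immediate constituents of its members, where the set quantifiers and the constant symbols range
over the family `M`. -/
def tarski (M D S : SetV) : Form := allN fun f => f ∊ D ⟶'
  (allN fun t => allN fun u => f ≐ cEq t u ⟶' (f ∊ S ⟷' sameVal t u)) ⋏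
  (allN fun t => allN fun u => f ≐ cNeq t u ⟶' (f ∊ S ⟷' ∼(sameVal t u))) ⋏
  (allN fun t => allN fun i => f ≐ cMem t (cConst i) ⟶'
    (f ∊ S ⟷' exN fun n => val t n ⋏ inSec n i M)) ⋏
  (allN fun t => allN fun i => f ≐ cNmem t (cConst i) ⟶'
    (f ∊ S ⟷' ∼(exN fun n => val t n ⋏ inSec n i M))) ⋏
  (allN fun g => allN fun h => f ≐ cAnd g h ⟶' g ∊ D ⋏ h ∊ D ⋏ (f ∊ S ⟷' g ∊ S ⋏ h ∊ S)) ⋏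
  (allN fun g => allN fun h => f ≐ cOr g h ⟶' g ∊ D ⋏ h ∊ D ⋏ (f ∊ S ⟷' g ∊ S ⋎ h ∊ S)) ⋏
  (allN fun g => f ≐ cAll g ⟶'
    (allN fun n => allN fun g' => instNum g n g' ⟶' g' ∊ D) ⋏
    (f ∊ S ⟷' allN fun n => allN fun g' => instNum g n g' ⟶' g' ∊ S)) ⋏
  (allN fun g => f ≐ cEx g ⟶'
    (allN fun n => allN fun g' => instNum g n g' ⟶' g' ∊ D) ⋏
    (f ∊ S ⟷' exN fun n => exN fun g' => instNum g n g' ⋏ g' ∊ S)) ⋏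
  (allN fun g => f ≐ cAll2 g ⟶'
    (allN fun i => allN fun g' => inDom i M ⋏ instSet g (cConst i) g' ⟶' g' ∊ D) ⋏
    (f ∊ S ⟷' allN fun i => allN fun g' => inDom i M ⋏ instSet g (cConst i) g' ⟶' g' ∊ S)) ⋏
  (allN fun g => f ≐ cEx2 g ⟶'
    (allN fun i => allN fun g' => inDom i M ⋏ instSet g (cConst i) g' ⟶' g' ∊ D) ⋏
    (f ∊ S ⟷' exN fun i => exN fun g' => inDom i M ⋏ instSet g (cConst i) g' ⋏ g' ∊ S))

/-- `M` codes an `ω`-model: a nonempty countable family of sets. -/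
def isModel (M : SetV) : Form := exN fun i => inDom i M

/-- The sentence `(f, Y)` contains only constants for members of `M`. -/
def inLang (f : Num) (Y M : SetV) : Form := exN fun f' => isSent f' M ⋏ same f Y f' M

/-- `𝔐 ⊨ φ` for the sentence `φ = (f, Y)`: it is true according to some satisfaction class for
all sentences with constants for members of `M`. -/
def models (M : SetV) (f : Num) (Y : SetV) : Form := exS fun D => exS fun S =>
  (allN fun g => g ∊ D ⟷' isSent g M) ⋏ tarski M D S ⋏
  exN fun f' => same f Y f' M ⋏ f' ∊ D ⋏ f' ∊ S

/-! ## Partial truth definitions -/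

/-- Truth of an arithmetical sentence `(f, Y)`. -/
def trArith (f : Num) (Y : SetV) : Form := exS fun D => exS fun S =>
  tarski Y D S ⋏ f ∊ D ⋏ f ∊ S

/-- `g` arises from `f` by instantiating some (possibly no) leading existential quantifiers by
numerals and by constants for members of `W`. -/
def instEx (W : SetV) (f g : Num) : Form := allS fun S =>
  f ∊ S ⋏ (allN fun h => allN fun b => allN fun h' => h ∊ S ⋏
      ((h ≐ cEx b ⋏ exN fun n => instNum b n h')
        ⋎ (h ≐ cEx2 b ⋏ exN fun i => inDom i W ⋏ instSet b (cConst i) h')) ⟶' h' ∊ S)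
  ⟶' g ∊ S

/-- Truth of a `𝚷¹ₙ`-sentence `(f, Y)`. For `n > 0`, it is the failure of the negation of the
sentence, and the negation, a `𝚺¹ₙ`-sentence, is true if, for some numbers and some sets `W`
substituted in its existential quantifiers, the resulting `𝚷¹ₙ₋₁`-sentence is true. -/
def trPi : ℕ → Num → SetV → Form
  | 0, f, Y => trArith f Y
  | n + 1, f, Y => exN fun f' => isNeg f f' ⋏ ∼(exS fun W => exN fun h => exN fun g =>
      same f' Y h W ⋏ instEx W h g ⋏ isClass true n g ⋏ trPi n g W)

/-! ## Theories and reflection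

An `𝐋₂`-theory is given by a set `F` of codes of formulas together with a family `Y` for the
constants; its axioms are the sentences `(f, Y)`, `f ∈ F`. -/

def isTheory (F Y : SetV) : Form := allN fun f => f ∊ F ⟶' isSent f Y

/-- The `L₂`-sentences in the list `A` are axioms of the theory. -/
def contains (A : List Fm) (F : SetV) : Form :=
  A.foldr (fun σ φ => lit σ.code ∊ F ⋏ φ) (lit 0 ≐ lit 0)

/-- `𝔐 ⊨ T`. -/
def modelsTh (M F Y : SetV) : Form := isModel M ⋏ allN fun f => f ∊ F ⟶' models M f Y

/-- `𝚷¹ₙ`-`ωRFN(T)`: every `𝚷¹ₙ`-sentence that holds in all `ω`-models of `T` containing its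
constants is true. -/
def omegaRFN (n : ℕ) (F Y : SetV) : Form := allN fun f => allS fun Z =>
  isSent f Z ⋏ isClass true n f ⋏
    (allS fun M => modelsTh M F Y ⋏ inLang f Z M ⟶' models M f Z)
  ⟶' trPi n f Z

/-! ## `ω`-proofs

A pre-proof consists of a set `I` of nodes, a root `r ∈ I`, a set `E` of pairs `⟨⟨i, n⟩, j⟩`
("`j` is the `n`-th premise of `i`"), sets `D` and `G` of pairs `⟨i, f⟩` ("`f` belongs to the
sequent `Δᵢ` of the node `i`", and "... to the side sequent `Γᵢ` of the rule applied at `i`"), and a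
family `W` interpreting the constant symbols in it. -/

/-- `j` is the `n`-th premise of `i`. -/
def prem (E : SetV) (i n j : Num) : Form := pair (pair i n) j ∊ E

/-- The nodes form a tree with root `r`: every node except the root is a premise of exactly one
node, in exactly one place, the root is not a premise, and all nodes are reached from the root. -/
def isTree (I E : SetV) (r : Num) : Form :=
  r ∊ I ⋏
  (allN fun i => allN fun n => allN fun j => prem E i n j ⟶' i ∊ I ⋏ j ∊ I ⋏ ∼(j ≐ r)) ⋏
  (allN fun i => allN fun n => allN fun j => allN fun k =>
    prem E i n j ⋏ prem E i n k ⟶' j ≐ k) ⋏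
  (allN fun j => j ∊ I ⋏ ∼(j ≐ r) ⟶' exN fun i => exN fun n => prem E i n j) ⋏
  (allN fun i => allN fun n => allN fun k => allN fun m => allN fun j =>
    prem E i n j ⋏ prem E k m j ⟶' i ≐ k ⋏ n ≐ m) ⋏
  (allS fun X => r ∊ X ⋏
      (allN fun i => allN fun n => allN fun j => i ∊ X ⋏ prem E i n j ⟶' j ∊ X)
    ⟶' allN fun i => i ∊ I ⟶' i ∊ X)

/-- The premise relation is well-founded. -/
def isWF (I E : SetV) : Form := allS fun X =>
  (exN fun i => i ∊ I ⋏ i ∊ X) ⟶'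
  exN fun i => i ∊ I ⋏ i ∊ X ⋏ allN fun n => allN fun j => prem E i n j ⟶' ∼(j ∊ X)

/-- `Δᵢ` is `Γᵢ` together with the formula `f`. -/
def conclIs (D G : SetV) (i f : Num) : Form :=
  allN fun h => pair i h ∊ D ⟷' pair i h ∊ G ⋎ h ≐ f

/-- The sequent of the `n`-th premise of `i` is `Γᵢ` together with the formula `f`. -/
def premIs (E D G : SetV) (i n f : Num) : Form := exN fun j => prem E i n j ⋏
  allN fun h => pair j h ∊ D ⟷' pair i h ∊ G ⋎ h ≐ f

/-- The node `i` has no premises, one premise, two premises (with the numbers `0`, `1`). -/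
def prem0 (E : SetV) (i : Num) : Form := allN fun n => allN fun j => ∼(prem E i n j)
def prem1 (E : SetV) (i : Num) : Form := allN fun n => allN fun j => prem E i n j ⟶' n ≐ lit 0
def prem2 (E : SetV) (i : Num) : Form :=
  allN fun n => allN fun j => prem E i n j ⟶' n ≐ lit 0 ⋎ n ≐ lit 1

/-- The five kinds of axioms. -/
def axiomAt (D W : SetV) (i : Num) : Form := exN fun t => exN fun u =>
  (pair i (cEq t u) ∊ D ⋏ sameVal t u)
  ⋎ (pair i (cNeq t u) ∊ D ⋏ ∼(sameVal t u))
  ⋎ (exN fun k => pair i (cMem t (cConst k)) ∊ D ⋏ exN fun n => val t n ⋏ inSec n k W)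
  ⋎ (exN fun k => pair i (cNmem t (cConst k)) ∊ D ⋏ exN fun n => val t n ⋏ ∼(inSec n k W))
  ⋎ (exN fun k => pair i (cMem t (cFree k)) ∊ D ⋏ pair i (cNmem u (cFree k)) ∊ D ⋏ sameVal t u)

/-- The rules other than cut, in the order `∧`, `∨`, `∀x` (the `ω`-rule), `∃x`, `∀X`, `∃X` with a
constant, `∃X` with a variable, repetition. -/
def ruleAt (E D G W : SetV) (i : Num) : Form :=
  (exN fun f => exN fun g => conclIs D G i (cAnd f g) ⋏ prem2 E i ⋏
    premIs E D G i (lit 0) f ⋏ premIs E D G i (lit 1) g)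
  ⋎ (exN fun f => exN fun g => conclIs D G i (cOr f g) ⋏ prem1 E i ⋏
    exN fun j => prem E i (lit 0) j ⋏
      allN fun h => pair j h ∊ D ⟷' pair i h ∊ G ⋎ h ≐ f ⋎ h ≐ g)
  ⋎ (exN fun f => conclIs D G i (cAll f) ⋏
    allN fun n => exN fun f' => instNum f n f' ⋏ premIs E D G i n f')
  ⋎ (exN fun f => exN fun t => exN fun f' => conclIs D G i (cEx f) ⋏ prem1 E i ⋏
    isTm t (lit 0) ⋏ instTm f t f' ⋏ premIs E D G i (lit 0) f')
  ⋎ (exN fun f => exN fun u => exN fun f' => conclIs D G i (cAll2 f) ⋏ prem1 E i ⋏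
    (allN fun h => pair i h ∊ D ⟶' ∼(occurs u h)) ⋏
    instSet f (cFree u) f' ⋏ premIs E D G i (lit 0) f')
  ⋎ (exN fun f => exN fun c => exN fun f' => conclIs D G i (cEx2 f) ⋏ prem1 E i ⋏
    inDom c W ⋏ instSet f (cConst c) f' ⋏ premIs E D G i (lit 0) f')
  ⋎ (exN fun f => exN fun u => exN fun f' => conclIs D G i (cEx2 f) ⋏ prem1 E i ⋏
    instSet f (cFree u) f' ⋏ premIs E D G i (lit 0) f')
  ⋎ ((allN fun h => pair i h ∊ D ⟷' pair i h ∊ G) ⋏ prem1 E i ⋏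
    exN fun j => prem E i (lit 0) j ⋏ allN fun h => pair j h ∊ D ⟷' pair i h ∊ G)

/-- The cut rule. -/
def cutAt (E D G : SetV) (i : Num) : Form := exN fun f => exN fun f' => isNeg f f' ⋏
  (allN fun h => pair i h ∊ D ⟷' pair i h ∊ G) ⋏ prem2 E i ⋏
  premIs E D G i (lit 0) f ⋏ premIs E D G i (lit 1) f'

/-- A well-founded derivation tree, with cuts allowed (`cut = true`) or not (`cut = false`). -/
def isProof (cut : Bool) (I E D G W : SetV) (r : Num) : Form :=
  isTree I E r ⋏ isWF I E ⋏
  (allN fun i => i ∊ I ⟶'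
    (allN fun h => pair i h ∊ D ⟶' isFm h W) ⋏
    ((axiomAt D W i ⋏ prem0 E i) ⋎
      bif cut then ruleAt E D G W i ⋎ cutAt E D G i else ruleAt E D G W i))

/-- `(h, W)` is the negation of an axiom of the theory `(F, Y)`. -/
def isNegAx (F Y : SetV) (f h : Num) (W : SetV) : Form :=
  f ∊ F ⋏ exN fun f' => isNeg f f' ⋏ same f' Y h W

/-- `⊢ ¬T`, where `T` is the theory `(F, Y)`: there is an `ω`-proof of the sequent that consists of
the negations of the axioms of `T`, with cuts (`cut = true`) or without. -/
def provesNeg (cut : Bool) (F Y : SetV) : Form :=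
  exS fun I => exS fun E => exS fun D => exS fun G => exS fun W => exN fun r =>
    isProof cut I E D G W r ⋏
    (allN fun h => pair r h ∊ D ⟶' exN fun f => isNegAx F Y f h W) ⋏
    (allN fun f => f ∊ F ⟶' exN fun h => isNegAx F Y f h W ⋏ pair r h ∊ D)

/-- `⊢ ¬T, φ`, where `T` is the theory `(F, Y)` and `φ` is the sentence `(g, Z)`. -/
def provesNegOr (cut : Bool) (F Y : SetV) (g : Num) (Z : SetV) : Form :=
  exS fun I => exS fun E => exS fun D => exS fun G => exS fun W => exN fun r =>
    isProof cut I E D G W r ⋏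
    (allN fun h => pair r h ∊ D ⟶' (exN fun f => isNegAx F Y f h W) ⋎ same g Z h W) ⋏
    (allN fun f => f ∊ F ⟶' exN fun h => isNegAx F Y f h W ⋏ pair r h ∊ D) ⋏
    (exN fun h => same g Z h W ⋏ pair r h ∊ D)

/-- Every `𝚷¹ₙ`-sentence `φ` with `⊢ ¬T, φ` is true. -/
def provSound (n : ℕ) (cut : Bool) (F Y : SetV) : Form := allN fun g => allS fun Z =>
  isSent g Z ⋏ isClass true n g ⋏ provesNegOr cut F Y g Z ⟶' trPi n g Z

/-- Every set lies in an `ω`-model of `T`. -/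
def everySetInModel (F Y : SetV) : Form :=
  allS fun X => exS fun M => memFam X M ⋏ modelsTh M F Y

end SOA

set_option synthInstance.maxSize 5000
set_option synthInstance.maxHeartbeats 400000

namespace SOA

/-- A structure for the number sort. -/
class PreMod (N : Type) extends Zero N, Add N, Mul N where
  succ : N → N

/-- The environment `e` with the value `x` put in front. -/
def scons {β : Type*} (x : β) (e : ℕ → β) : ℕ → β
  | 0 => x
  | i + 1 => e i

@[simp] theorem scons_zero {β : Type*} (x : β) (e : ℕ → β) : scons x e 0 = x := rfl
@[simp] theorem scons_succ {β : Type*} (x : β) (e : ℕ → β) (i : ℕ) : scons x e (i + 1) = e i := rfl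

section semantics
variable {N : Type} [PreMod N]

/-- The value of a term. -/
def Tm.eval (e : ℕ → N) : Tm → N
  | .zero => 0
  | .var i => e i
  | .succ t => PreMod.succ (t.eval e)
  | .add t u => t.eval e + u.eval e
  | .mul t u => t.eval e * u.eval e

/-- Truth in the structure `N`, the set quantifiers ranging over the family `S`. -/
def Sat (S : Set (Set N)) : (ℕ → N) → (ℕ → Set N) → Fm → Prop
  | e, _, .eq t u => t.eval e = u.eval e
  | e, _, .neq t u => t.eval e ≠ u.eval e
  | e, E, .mem t X => t.eval e ∈ E X
  | e, E, .nmem t X => t.eval e ∉ E X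
  | e, E, .and φ ψ => Sat S e E φ ∧ Sat S e E ψ
  | e, E, .or φ ψ => Sat S e E φ ∨ Sat S e E ψ
  | e, E, .all φ => ∀ x, Sat S (scons x e) E φ
  | e, E, .ex φ => ∃ x, Sat S (scons x e) E φ
  | e, E, .all2 φ => ∀ X ∈ S, Sat S e (scons X E) φ
  | e, E, .ex2 φ => ∃ X ∈ S, Sat S e (scons X E) φ

theorem Tm.eval_sub (σ : ℕ → Tm) (e : ℕ → N) (t : Tm) :
    (t.sub σ).eval e = t.eval (fun i => (σ i).eval e) := by
  induction t <;> simp_all [Tm.sub, Tm.eval]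

theorem eval_upN (σ : ℕ → Tm) (e : ℕ → N) (x : N) :
    (fun i => (upN σ i).eval (scons x e)) = scons x (fun i => (σ i).eval e) := by
  funext i
  cases i with
  | zero => rfl
  | succ i => simp only [upN, Tm.eval_sub, scons_succ]; rfl

theorem scons_upS {β : Type*} (ρ : ℕ → ℕ) (E : ℕ → β) (X : β) :
    (fun i => scons X E (upS ρ i)) = scons X (fun i => E (ρ i)) := by
  funext i
  cases i <;> rfl

theorem Sat_sub (S : Set (Set N)) (φ : Fm) : ∀ (σ : ℕ → Tm) (ρ : ℕ → ℕ) (e : ℕ → N) (E : ℕ → Set N),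
    Sat S e E (φ.sub σ ρ) ↔ Sat S (fun i => (σ i).eval e) (fun i => E (ρ i)) φ := by
  induction φ <;> intro σ ρ e E <;> simp_all [Fm.sub, Sat, Tm.eval_sub, eval_upN, scons_upS]

theorem Sat_neg (S : Set (Set N)) (φ : Fm) : ∀ (e : ℕ → N) (E : ℕ → Set N),
    Sat S e E φ.neg ↔ ¬ Sat S e E φ := by
  induction φ <;> intro e E <;> simp_all [Fm.neg, Sat]
  all_goals tauto

theorem Tm.eval_congr {k : ℕ} {e e' : ℕ → N} (h : ∀ i < k, e i = e' i) (t : Tm) (ht : t.Closed k) :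
    t.eval e = t.eval e' := by
  induction t <;> simp_all [Tm.Closed, Tm.eval]

theorem Sat_congr (S : Set (Set N)) (φ : Fm) : ∀ {k l : ℕ} {e e' : ℕ → N} {E E' : ℕ → Set N},
    (∀ i < k, e i = e' i) → (∀ i < l, E i = E' i) → φ.Closed k l → (Sat S e E φ ↔ Sat S e' E' φ) := by
  have up : ∀ {β : Type} {k : ℕ} {e e' : ℕ → β} (x : β), (∀ i < k, e i = e' i) →
      ∀ i < k + 1, scons x e i = scons x e' i := by
    intro β k e e' x h i hi
    cases i with
    | zero => rfl
    | succ i => exact h i (by omega)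
  induction φ <;> intro k l e e' E E' he hE hc
  case eq t u | neq t u => simp only [Sat, Tm.eval_congr he t hc.1, Tm.eval_congr he u hc.2]
  case mem t X | nmem t X => simp only [Sat, Tm.eval_congr he t hc.1, hE X hc.2]
  case and φ ψ h1 h2 | or φ ψ h1 h2 => simp only [Sat, h1 he hE hc.1, h2 he hE hc.2]
  case all φ h => exact forall_congr' fun x => h (up x he) hE hc
  case ex φ h => exact exists_congr fun x => h (up x he) hE hc
  case all2 φ h => exact forall₂_congr fun X _ => h he (up X hE) hc
  case ex2 φ h =>
    exact exists_congr fun X => and_congr_right fun _ => h he (up X hE) hc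

theorem Fm.inst_eq (φ : Fm) (t : Tm) : φ.inst t = φ.sub (scons t .var) id := by
  unfold Fm.inst
  congr 1

theorem Fm.inst2_eq (φ : Fm) (X : ℕ) : φ.inst2 X = φ.sub .var (scons X id) := by
  unfold Fm.inst2
  congr 1

theorem Sat_inst (S : Set (Set N)) (φ : Fm) (t : Tm) (e : ℕ → N) (E : ℕ → Set N) :
    Sat S e E (φ.inst t) ↔ Sat S (scons (t.eval e) e) E φ := by
  rw [Fm.inst_eq, Sat_sub]
  have : (fun i => Tm.eval e (scons t Tm.var i)) = scons (t.eval e) e := by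
    funext i; cases i <;> rfl
  rw [this]; rfl

theorem Sat_inst2 (S : Set (Set N)) (φ : Fm) (X : ℕ) (e : ℕ → N) (E : ℕ → Set N) :
    Sat S e E (φ.inst2 X) ↔ Sat S e (scons (E X) E) φ := by
  rw [Fm.inst2_eq, Sat_sub]
  have : (fun i => E (scons X id i)) = scons (E X) E := by
    funext i; cases i <;> rfl
  rw [this]; rfl

theorem Derives.sound {T : Set Fm} (S : Set (Set N))
    (hT : ∀ φ ∈ T, ∀ e E, (∀ i, E i ∈ S) → Sat S e E φ) {Γ : List Fm} (h : Derives T Γ) :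
    ∀ (e : ℕ → N) (E : ℕ → Set N), (∀ i, E i ∈ S) → ∃ φ ∈ Γ, Sat S e E φ := by
  have cons : ∀ {X : Set N} {E : ℕ → Set N}, X ∈ S → (∀ i, E i ∈ S) → ∀ i, scons X E i ∈ S := by
    intro X E hX hE i
    cases i
    · exact hX
    · exact hE _
  induction h with
  | ax h => exact fun e E hE => ⟨_, List.mem_cons_self, hT _ h e E hE⟩
  | @em Γ φ h1 h2 =>
    intro e E hE
    by_cases h : Sat S e E φ
    · exact ⟨_, h1, h⟩
    · exact ⟨_, h2, (Sat_neg S φ e E).2 h⟩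
  | weak hs _ ih => exact fun e E hE => (ih e E hE).imp fun _ h => ⟨hs h.1, h.2⟩
  | cut φ _ _ ih1 ih2 =>
    intro e E hE
    have h1 := ih1 e E hE
    have h2 := ih2 e E hE
    simp only [List.mem_cons, exists_eq_or_imp, Sat_neg] at h1 h2
    tauto
  | refl t => exact fun e E hE => ⟨_, List.mem_cons_self, rfl⟩
  | leibniz t u φ _ _ ih1 ih2 =>
    intro e E hE
    have h1 := ih1 e E hE
    have h2 := ih2 e E hE
    simp only [List.mem_cons, exists_eq_or_imp, Sat_inst] at h1 h2 ⊢
    refine h1.elim (fun h => h2.imp (fun h' => ?_) id) Or.inr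
    rwa [← show t.eval e = u.eval e from h]
  | and _ _ ih1 ih2 =>
    intro e E hE
    have h1 := ih1 e E hE
    have h2 := ih2 e E hE
    simp only [List.mem_cons, exists_eq_or_imp, Sat] at h1 h2 ⊢
    tauto
  | or _ ih =>
    intro e E hE
    have h := ih e E hE
    simp only [List.mem_cons, exists_eq_or_imp, Sat] at h ⊢
    tauto
  | @all Γ φ _ ih =>
    intro e E hE
    by_contra hn
    simp only [List.mem_cons, exists_eq_or_imp, not_or, Sat, not_forall] at hn
    obtain ⟨⟨x, hx⟩, hn⟩ := hn
    obtain ⟨ψ, h, h'⟩ := ih (scons x e) E hE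
    rcases List.mem_cons.1 h with rfl | h
    · exact hx h'
    obtain ⟨χ, hχ, rfl⟩ := List.mem_map.1 h
    exact hn ⟨χ, hχ, (Sat_sub S χ _ _ _ _).1 h'⟩
  | ex t _ ih =>
    intro e E hE
    have h := ih e E hE
    simp only [List.mem_cons, exists_eq_or_imp, Sat_inst, Sat] at h ⊢
    exact h.imp (fun h => ⟨_, h⟩) id
  | @all2 Γ φ _ ih =>
    intro e E hE
    by_contra hn
    simp only [List.mem_cons, exists_eq_or_imp, not_or, Sat, not_forall] at hn
    obtain ⟨⟨X, hX, hx⟩, hn⟩ := hn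
    obtain ⟨ψ, h, h'⟩ := ih e (scons X E) (cons hX hE)
    rcases List.mem_cons.1 h with rfl | h
    · exact hx h'
    obtain ⟨χ, hχ, rfl⟩ := List.mem_map.1 h
    exact hn ⟨χ, hχ, (Sat_sub S χ _ _ _ _).1 h'⟩
  | ex2 X _ ih =>
    intro e E hE
    have h := ih e E hE
    simp only [List.mem_cons, exists_eq_or_imp, Sat_inst2, Sat] at h ⊢
    exact h.imp (fun h => ⟨_, hE X, h⟩) id

theorem Proves.sound {T : Set Fm} (S : Set (Set N))
    (hT : ∀ φ ∈ T, ∀ e E, (∀ i, E i ∈ S) → Sat S e E φ) {φ : Fm} (h : Proves T φ)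
    (e : ℕ → N) (E : ℕ → Set N) (hE : ∀ i, E i ∈ S) : Sat S e E φ := by
  obtain ⟨ψ, h, h'⟩ := Derives.sound S hT h e E hE
  rwa [List.mem_singleton.1 h] at h'

end semantics

/-! ### Substitution calculus -/

theorem Tm.sub_sub (σ τ : ℕ → Tm) (t : Tm) :
    (t.sub σ).sub τ = t.sub (fun i => (σ i).sub τ) := by
  induction t <;> simp_all [Tm.sub]

theorem upN_comp (σ τ : ℕ → Tm) :
    (fun i => (upN σ i).sub (upN τ)) = upN (fun i => (σ i).sub τ) := by
  funext i
  cases i with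
  | zero => rfl
  | succ i => simp only [upN, Tm.sub_sub]; rfl

theorem upS_comp (ρ π : ℕ → ℕ) : (fun i => upS π (upS ρ i)) = upS (fun i => π (ρ i)) := by
  funext i
  cases i <;> rfl

theorem Fm.sub_sub (φ : Fm) : ∀ (σ τ : ℕ → Tm) (ρ π : ℕ → ℕ),
    (φ.sub σ ρ).sub τ π = φ.sub (fun i => (σ i).sub τ) (fun i => π (ρ i)) := by
  induction φ <;> intro σ τ ρ π <;> simp_all [Fm.sub, Tm.sub_sub, upN_comp, upS_comp]

theorem Tm.sub_congr {k : ℕ} {σ τ : ℕ → Tm} (h : ∀ i < k, σ i = τ i) (t : Tm) (ht : t.Closed k) :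
    t.sub σ = t.sub τ := by
  induction t <;> simp_all [Tm.Closed, Tm.sub]

theorem Fm.sub_congr (φ : Fm) : ∀ {k l : ℕ} {σ τ : ℕ → Tm} {ρ π : ℕ → ℕ}, (∀ i < k, σ i = τ i) →
    (∀ i < l, ρ i = π i) → φ.Closed k l → φ.sub σ ρ = φ.sub τ π := by
  have u1 : ∀ {k : ℕ} {σ τ : ℕ → Tm}, (∀ i < k, σ i = τ i) → ∀ i < k + 1, upN σ i = upN τ i := by
    intro k σ τ h i hi
    cases i with
    | zero => rfl
    | succ i => simp only [upN, h i (by omega)]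
  have u2 : ∀ {k : ℕ} {σ τ : ℕ → ℕ}, (∀ i < k, σ i = τ i) → ∀ i < k + 1, upS σ i = upS τ i := by
    intro k σ τ h i hi
    cases i with
    | zero => rfl
    | succ i => simp only [upS, h i (by omega)]
  induction φ <;> intro k l σ τ ρ π h1 h2 hc
  case eq t u | neq t u => simp only [Fm.sub, Tm.sub_congr h1 t hc.1, Tm.sub_congr h1 u hc.2]
  case mem t X | nmem t X => simp only [Fm.sub, Tm.sub_congr h1 t hc.1, h2 X hc.2]
  case and φ ψ i1 i2 | or φ ψ i1 i2 => simp only [Fm.sub, i1 h1 h2 hc.1, i2 h1 h2 hc.2]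
  case all φ i | ex φ i => simp only [Fm.sub, i (u1 h1) h2 hc]
  case all2 φ i | ex2 φ i => simp only [Fm.sub, i h1 (u2 h2) hc]

theorem upN_var : upN .var = .var := by
  funext i; cases i <;> rfl

theorem upS_id : upS id = id := by
  funext i; cases i <;> rfl

theorem Tm.sub_var (t : Tm) : t.sub .var = t := by
  induction t <;> simp_all [Tm.sub]

theorem Fm.sub_var (φ : Fm) : φ.sub .var id = φ := by
  induction φ <;> simp_all [Fm.sub, Tm.sub_var, upN_var, upS_id]

theorem Fm.neg_sub (φ : Fm) : ∀ (σ : ℕ → Tm) (ρ : ℕ → ℕ), (φ.sub σ ρ).neg = φ.neg.sub σ ρ := by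
  induction φ <;> intro σ ρ <;> simp_all [Fm.sub, Fm.neg]

theorem Fm.sub_sentence {φ : Fm} (h : φ.IsSentence) (σ : ℕ → Tm) (ρ : ℕ → ℕ) : φ.sub σ ρ = φ := by
  conv_rhs => rw [← φ.sub_var]
  exact φ.sub_congr (by simp) (by simp) h

theorem Tm.Closed.mono {k k' : ℕ} (h : k ≤ k') (t : Tm) (ht : t.Closed k) : t.Closed k' := by
  induction t <;> simp_all [Tm.Closed]
  omega

theorem Fm.Closed.mono (φ : Fm) : ∀ {k k' l l' : ℕ}, k ≤ k' → l ≤ l' → φ.Closed k l →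
    φ.Closed k' l' := by
  induction φ <;> intro k k' l l' h1 h2 hc
  case eq t u | neq t u => exact ⟨Tm.Closed.mono h1 t hc.1, Tm.Closed.mono h1 u hc.2⟩
  case mem t X | nmem t X => exact ⟨Tm.Closed.mono h1 t hc.1, lt_of_lt_of_le hc.2 h2⟩
  case and φ ψ i1 i2 | or φ ψ i1 i2 => exact ⟨i1 h1 h2 hc.1, i2 h1 h2 hc.2⟩
  case all φ i | ex φ i => exact i (by omega) h2 hc
  case all2 φ i | ex2 φ i => exact i h1 (by omega) hc

theorem Tm.exists_closed (t : Tm) : ∃ k, t.Closed k := by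
  induction t with
  | zero => exact ⟨0, trivial⟩
  | var i => exact ⟨i + 1, Nat.lt_succ_self i⟩
  | succ t h => exact h
  | add t u h1 h2 | mul t u h1 h2 =>
    obtain ⟨k, hk⟩ := h1
    obtain ⟨l, hl⟩ := h2
    exact ⟨max k l, Tm.Closed.mono (le_max_left _ _) t hk, Tm.Closed.mono (le_max_right _ _) u hl⟩

theorem Fm.exists_closed (φ : Fm) : ∃ k, φ.Closed k k := by
  have two : ∀ {t u : Tm}, ∃ k, t.Closed k ∧ u.Closed k := by
    intro t u
    obtain ⟨k, hk⟩ := t.exists_closed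
    obtain ⟨l, hl⟩ := u.exists_closed
    exact ⟨max k l, Tm.Closed.mono (le_max_left _ _) t hk, Tm.Closed.mono (le_max_right _ _) u hl⟩
  have one : ∀ {t : Tm} {X : ℕ}, ∃ k, t.Closed k ∧ X < k := by
    intro t X
    obtain ⟨k, hk⟩ := t.exists_closed
    exact ⟨k + X + 1, Tm.Closed.mono (by omega) t hk, by omega⟩
  have both : ∀ {φ ψ : Fm}, (∃ k, φ.Closed k k) → (∃ k, ψ.Closed k k) →
      ∃ k, φ.Closed k k ∧ ψ.Closed k k := by
    rintro φ ψ ⟨k, hk⟩ ⟨l, hl⟩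
    exact ⟨max k l, Fm.Closed.mono φ (le_max_left _ _) (le_max_left _ _) hk,
      Fm.Closed.mono ψ (le_max_right _ _) (le_max_right _ _) hl⟩
  induction φ with
  | eq t u | neq t u => exact two
  | mem t X | nmem t X => exact one
  | and φ ψ h1 h2 | or φ ψ h1 h2 => exact both h1 h2
  | all φ h | ex φ h => obtain ⟨k, hk⟩ := h; exact ⟨k, Fm.Closed.mono φ (by omega) le_rfl hk⟩
  | all2 φ h | ex2 φ h => obtain ⟨k, hk⟩ := h; exact ⟨k, Fm.Closed.mono φ le_rfl (by omega) hk⟩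

theorem Tm.sub_shift_scons (t u : Tm) (σ : ℕ → Tm) : (t.sub shiftN).sub (scons u σ) = t.sub σ := by
  rw [Tm.sub_sub]; rfl

theorem Fm.sub_inst (φ : Fm) (t : Tm) (σ : ℕ → Tm) (ρ : ℕ → ℕ) :
    (φ.sub (upN σ) ρ).inst t = φ.sub (scons t σ) ρ := by
  rw [Fm.inst_eq, Fm.sub_sub]
  congr 1
  funext i
  cases i with
  | zero => rfl
  | succ i => simp only [upN, Tm.sub_shift_scons, Tm.sub_var, scons_succ]

theorem Fm.sub_inst2 (φ : Fm) (X : ℕ) (σ : ℕ → Tm) (ρ : ℕ → ℕ) :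
    (φ.sub σ (upS ρ)).inst2 X = φ.sub σ (scons X ρ) := by
  rw [Fm.inst2_eq, Fm.sub_sub]
  congr 1
  · funext i; exact Tm.sub_var _
  · funext i
    cases i <;> rfl

theorem Fm.inst_sub (φ : Fm) (t : Tm) (σ : ℕ → Tm) (ρ : ℕ → ℕ) :
    (φ.inst t).sub σ ρ = (φ.sub (upN σ) ρ).inst (t.sub σ) := by
  rw [Fm.sub_inst, Fm.inst_eq, Fm.sub_sub]
  congr 1
  funext i
  cases i <;> rfl

theorem Fm.inst2_sub (φ : Fm) (X : ℕ) (σ : ℕ → Tm) (ρ : ℕ → ℕ) :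
    (φ.inst2 X).sub σ ρ = (φ.sub σ (upS ρ)).inst2 (ρ X) := by
  rw [Fm.sub_inst2, Fm.inst2_eq, Fm.sub_sub]
  congr 1
  funext i
  cases i <;> rfl

theorem Fm.shift_sub (φ : Fm) (σ : ℕ → Tm) (ρ : ℕ → ℕ) :
    (φ.sub shiftN id).sub (upN σ) ρ = (φ.sub σ ρ).sub shiftN id := by
  simp only [Fm.sub_sub]; rfl

theorem Fm.shift2_sub (φ : Fm) (σ : ℕ → Tm) (ρ : ℕ → ℕ) :
    (φ.sub .var Nat.succ).sub σ (upS ρ) = (φ.sub σ ρ).sub .var Nat.succ := by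
  simp only [Fm.sub_sub]
  congr 1
  funext i
  exact (Tm.sub_var _).symm

theorem Derives.subst {T : Set Fm} (hT : ∀ φ ∈ T, φ.IsSentence) {Γ : List Fm} (h : Derives T Γ) :
    ∀ (σ : ℕ → Tm) (ρ : ℕ → ℕ), Derives T (Γ.map (Fm.sub σ ρ)) := by
  induction h with
  | ax h =>
    intro σ ρ
    rw [List.map_cons, Fm.sub_sentence (hT _ h)]
    exact .ax h
  | @em Γ φ h1 h2 =>
    intro σ ρ
    refine .em (φ := φ.sub σ ρ) (List.mem_map_of_mem h1) ?_
    rw [Fm.neg_sub]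
    exact List.mem_map_of_mem h2
  | weak hs _ ih => exact fun σ ρ => .weak (List.map_subset _ hs) (ih σ ρ)
  | cut φ _ _ ih1 ih2 =>
    intro σ ρ
    refine .cut (φ.sub σ ρ) (ih1 σ ρ) ?_
    rw [Fm.neg_sub]
    exact ih2 σ ρ
  | refl t => exact fun σ ρ => .refl _
  | leibniz t u φ _ _ ih1 ih2 =>
    intro σ ρ
    have h2 := ih2 σ ρ
    rw [List.map_cons, Fm.inst_sub] at h2 ⊢
    exact .leibniz (t.sub σ) _ _ (ih1 σ ρ) h2
  | and _ _ ih1 ih2 => exact fun σ ρ => .and (ih1 σ ρ) (ih2 σ ρ)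
  | or _ ih => exact fun σ ρ => .or (ih σ ρ)
  | @all Γ φ _ ih =>
    intro σ ρ
    refine .all ?_
    have := ih (upN σ) ρ
    simpa only [List.map_cons, List.map_map, Function.comp_def, Fm.shift_sub] using this
  | ex t _ ih =>
    intro σ ρ
    refine .ex (t.sub σ) ?_
    have := ih σ ρ
    rwa [List.map_cons, Fm.inst_sub] at this
  | @all2 Γ φ _ ih =>
    intro σ ρ
    refine .all2 ?_
    have := ih σ (upS ρ)
    simpa only [List.map_cons, List.map_map, Function.comp_def, Fm.shift2_sub] using this
  | ex2 X _ ih =>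
    intro σ ρ
    refine .ex2 (ρ X) ?_
    have := ih σ ρ
    rwa [List.map_cons, Fm.inst2_sub] at this

theorem exists_closed_list (Γ : List Fm) : ∃ k, ∀ φ ∈ Γ, φ.Closed k k := by
  induction Γ with
  | nil => exact ⟨0, by simp⟩
  | cons φ Γ ih =>
    obtain ⟨k, hk⟩ := ih
    obtain ⟨l, hl⟩ := φ.exists_closed
    refine ⟨max k l, fun ψ hψ => ?_⟩
    rcases List.mem_cons.1 hψ with rfl | hψ
    · exact Fm.Closed.mono _ (le_max_right _ _) (le_max_right _ _) hl
    · exact Fm.Closed.mono _ (le_max_left _ _) (le_max_left _ _) (hk _ hψ)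

section
variable {T : Set Fm} (hT : ∀ φ ∈ T, φ.IsSentence)
include hT

theorem exists_witness {Γ : List Fm} {χ : Fm} (h : Fm.all χ ∈ Γ) (hΓ : ¬ Derives T Γ) :
    ∃ t, ¬ Derives T (χ.inst t :: Γ) := by
  obtain ⟨k, hk⟩ := exists_closed_list Γ
  refine ⟨.var k, fun hd => hΓ ?_⟩
  have := hd.subst hT (fun i => if i < k then .var (i + 1) else .var 0) id
  refine .weak (Γ := .all χ :: Γ) (by simp [h]) (.all ?_)
  have e1 : (χ.inst (.var k)).sub (fun i => if i < k then Tm.var (i + 1) else .var 0) id = χ := by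
    rw [Fm.inst_eq, Fm.sub_sub]
    conv_rhs => rw [← χ.sub_var]
    have hc : χ.Closed (k + 1) k := hk _ h
    refine χ.sub_congr (k := k + 1) (l := k) ?_ (by simp) hc
    intro i hi
    cases i with
    | zero => simp [Tm.sub]
    | succ i => simp [Tm.sub, show i < k by omega]
  have e2 : Γ.map (Fm.sub (fun i => if i < k then .var (i + 1) else .var 0) id) =
      Γ.map (Fm.sub shiftN id) := by
    refine List.map_congr_left fun φ hφ => φ.sub_congr (k := k) (l := k) ?_ (by simp) (hk _ hφ)
    intro i hi
    simp [hi, shiftN]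
  rwa [List.map_cons, e1, e2] at this

theorem exists_witness2 {Γ : List Fm} {χ : Fm} (h : Fm.all2 χ ∈ Γ) (hΓ : ¬ Derives T Γ) :
    ∃ X, ¬ Derives T (χ.inst2 X :: Γ) := by
  obtain ⟨k, hk⟩ := exists_closed_list Γ
  refine ⟨k, fun hd => hΓ ?_⟩
  have := hd.subst hT .var (fun i => if i < k then i + 1 else 0)
  refine .weak (Γ := .all2 χ :: Γ) (by simp [h]) (.all2 ?_)
  have e1 : (χ.inst2 k).sub .var (fun i => if i < k then i + 1 else 0) = χ := by
    rw [Fm.inst2_eq, Fm.sub_sub]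
    conv_rhs => rw [← χ.sub_var]
    have hc : χ.Closed k (k + 1) := hk _ h
    refine χ.sub_congr (k := k) (l := k + 1) (by simp [Tm.sub]) ?_ hc
    intro i hi
    cases i with
    | zero => simp
    | succ i => simp [show i < k by omega]
  have e2 : Γ.map (Fm.sub .var (fun i => if i < k then i + 1 else 0)) =
      Γ.map (Fm.sub .var Nat.succ) := by
    refine List.map_congr_left fun φ hφ => φ.sub_congr (k := k) (l := k) (by simp) ?_ (hk _ hφ)
    intro i hi
    simp [hi]
  rwa [List.map_cons, e1, e2] at this

theorem exists_decided {Γ : List Fm} (hΓ : ¬ Derives T Γ) (ψ : Fm) :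
    ∃ Δ, Γ ⊆ Δ ∧ ¬ Derives T Δ ∧ (ψ ∈ Δ ∨ ψ.neg ∈ Δ) ∧
      (∀ χ, ψ = .all χ → ψ ∈ Δ → ∃ t, χ.inst t ∈ Δ) ∧
      (∀ χ, ψ = .all2 χ → ψ ∈ Δ → ∃ X, χ.inst2 X ∈ Δ) := by
  by_cases h : Derives T (ψ :: Γ)
  · refine ⟨ψ.neg :: Γ, by simp, fun h' => hΓ (.cut ψ h h'), by simp, ?_, ?_⟩ <;>
    · rintro χ rfl hm
      exact absurd (.em hm (by simp)) (fun h' => hΓ (.cut _ h h'))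
  · by_cases h1 : ∃ χ, ψ = .all χ
    · obtain ⟨χ, rfl⟩ := h1
      obtain ⟨t, ht⟩ := exists_witness hT (List.mem_cons_self (l := Γ)) h
      refine ⟨_, by simp, ht, by simp, ?_, by simp⟩
      rintro χ' ⟨⟩ -
      exact ⟨t, by simp⟩
    by_cases h2 : ∃ χ, ψ = .all2 χ
    · obtain ⟨χ, rfl⟩ := h2
      obtain ⟨t, ht⟩ := exists_witness2 hT (List.mem_cons_self (l := Γ)) h
      refine ⟨_, by simp, ht, by simp, by simp, ?_⟩
      rintro χ' ⟨⟩ -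
      exact ⟨t, by simp⟩
    exact ⟨ψ :: Γ, by simp, h, by simp, fun χ hχ => absurd ⟨χ, hχ⟩ h1,
      fun χ hχ => absurd ⟨χ, hχ⟩ h2⟩
omit hT

theorem pr_inj {a b c d : ℕ} (h : pr a b = pr c d) : a = c ∧ b = d := by
  unfold pr at h
  have : a + b = c + d := by
    by_contra hne
    rcases Nat.lt_or_gt_of_ne hne with h' | h' <;> nlinarith
  rw [this] at h
  omega

theorem Tm.code_inj : ∀ {t u : Tm}, t.code = u.code → t = u := by
  intro t
  induction t <;> intro u h <;> cases u <;>
    first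
    | rfl
    | (have h' := pr_inj h; simp at h'; done)
    | (obtain ⟨-, h'⟩ := pr_inj h; rw [h'])
    | (rename_i i _; obtain ⟨-, h'⟩ := pr_inj h; rw [i h'])
    | (rename_i i1 i2 _ _; obtain ⟨-, h'⟩ := pr_inj h; obtain ⟨h1, h2⟩ := pr_inj h'
       rw [i1 h1, i2 h2])

theorem Fm.code_inj : ∀ {φ ψ : Fm}, φ.code = ψ.code → φ = ψ := by
  intro φ
  induction φ <;> intro u h <;> cases u <;>
    first
    | (have h' := pr_inj h; simp at h'; done)
    | (obtain ⟨-, h'⟩ := pr_inj h; obtain ⟨h1, h2⟩ := pr_inj h'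
       rw [Tm.code_inj h1, Tm.code_inj h2])
    | (obtain ⟨-, h'⟩ := pr_inj h; obtain ⟨h1, h2⟩ := pr_inj h'
       rw [Tm.code_inj h1, (pr_inj h2).2])
    | (rename_i i _; obtain ⟨-, h'⟩ := pr_inj h; rw [i h'])
    | (rename_i i1 i2 _ _; obtain ⟨-, h'⟩ := pr_inj h; obtain ⟨h1, h2⟩ := pr_inj h'
       rw [i1 h1, i2 h2])

/-- A maximal set of formulas that may be assumed false, with witnesses. -/
structure Refutable (T : Set Fm) (H : Set Fm) : Prop where
  not_derives : ∀ Γ : List Fm, (∀ φ ∈ Γ, φ ∈ H) → ¬ Derives T Γ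
  total : ∀ φ, φ ∈ H ∨ φ.neg ∈ H
  wit : ∀ χ, Fm.all χ ∈ H → ∃ t, χ.inst t ∈ H
  wit2 : ∀ χ, Fm.all2 χ ∈ H → ∃ X, χ.inst2 X ∈ H

include hT in
theorem exists_refutable {Γ : List Fm} (hΓ : ¬ Derives T Γ) :
    ∃ H, Refutable T H ∧ ∀ φ ∈ Γ, φ ∈ H := by
  classical
  have : Countable Fm := ⟨⟨Fm.code, fun _ _ => Fm.code_inj⟩⟩
  have : Nonempty Fm := ⟨.eq .zero .zero⟩
  obtain ⟨en, hen⟩ := exists_surjective_nat Fm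
  choose! f hf1 hf2 hf3 hf4 hf5 using fun (Δ : List Fm) (h : ¬ Derives T Δ) (ψ : Fm) =>
    exists_decided hT h ψ
  let G : ℕ → List Fm := fun n => Nat.rec Γ (fun n Δ => f Δ (en n)) n
  have hG : ∀ n, ¬ Derives T (G n) := by
    intro n
    induction n with
    | zero => exact hΓ
    | succ n ih => exact hf2 _ ih _
  have mono : ∀ n m, n ≤ m → G n ⊆ G m := by
    intro n m h
    induction h with
    | refl => exact fun _ h => h
    | step _ ih => exact fun _ h => hf1 _ (hG _) _ (ih h)
  have nd : ∀ Γ' : List Fm, (∀ φ ∈ Γ', ∃ n, φ ∈ G n) → ¬ Derives T Γ' := by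
    intro Γ' h hd
    have : ∃ n, Γ' ⊆ G n := by
      clear hd
      induction Γ' with
      | nil => exact ⟨0, by simp⟩
      | cons φ Δ ih =>
        obtain ⟨n, hn⟩ := ih fun φ hφ => h φ (by simp [hφ])
        obtain ⟨m, hm⟩ := h φ (by simp)
        refine ⟨max n m, ?_⟩
        intro ψ hψ
        rcases List.mem_cons.1 hψ with rfl | hψ
        · exact mono _ _ (le_max_right _ _) hm
        · exact mono _ _ (le_max_left _ _) (hn hψ)
    obtain ⟨n, hn⟩ := this
    exact hG n (.weak hn hd)
  have hmem : ∀ n ψ, ψ = en n → (∃ m, ψ ∈ G m) → ψ ∈ G (n + 1) := by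
    rintro n ψ rfl ⟨m, hm⟩
    rcases hf3 _ (hG n) (en n) with h | h
    · exact h
    · refine absurd (Derives.em (T := T) (Γ := [en n, (en n).neg]) (φ := en n) (by simp)
        (by simp)) (nd _ ?_)
      simp only [List.mem_cons, List.not_mem_nil, or_false, forall_eq_or_imp, forall_eq]
      exact ⟨⟨m, hm⟩, n + 1, h⟩
  refine ⟨{φ | ∃ n, φ ∈ G n}, ⟨nd, ?_, ?_, ?_⟩, fun φ hφ => ⟨0, hφ⟩⟩
  · intro φ
    obtain ⟨n, rfl⟩ := hen φ
    exact (hf3 _ (hG n) (en n)).imp (fun h => ⟨n + 1, h⟩) (fun h => ⟨n + 1, h⟩)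
  · intro χ h
    obtain ⟨n, hn⟩ := hen (.all χ)
    obtain ⟨t, ht⟩ := hf4 _ (hG n) (en n) χ hn (hmem n _ rfl (hn ▸ h))
    exact ⟨t, n + 1, ht⟩
  · intro χ h
    obtain ⟨n, hn⟩ := hen (.all2 χ)
    obtain ⟨t, ht⟩ := hf5 _ (hG n) (en n) χ hn (hmem n _ rfl (hn ▸ h))
    exact ⟨t, n + 1, ht⟩

end

namespace Refutable
variable {T H : Set Fm} (h : Refutable T H)
include h

theorem neg_mem_iff (φ : Fm) : φ.neg ∈ H ↔ φ ∉ H := by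
  refine ⟨fun h1 h2 => ?_, fun h1 => (h.total φ).resolve_left h1⟩
  refine h.not_derives [φ, φ.neg] ?_ (.em (φ := φ) (by simp) (by simp))
  simp [h1, h2]

theorem not_mem {φ : Fm} (Γ : List Fm) (hd : Derives T (φ :: Γ)) (hΓ : ∀ ψ ∈ Γ, ψ ∈ H) : φ ∉ H :=
  fun hφ => h.not_derives _ (by simpa [hφ] using hΓ) hd

theorem and_mem_iff (φ ψ : Fm) : Fm.and φ ψ ∈ H ↔ φ ∈ H ∨ ψ ∈ H := by
  constructor
  · intro h1
    by_contra! h2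
    have h3 := (h.neg_mem_iff φ).2 h2.1
    have h4 := (h.neg_mem_iff ψ).2 h2.2
    refine h.not_mem [φ.neg, ψ.neg] (.and ?_ ?_) (by simp [h3, h4]) h1
    · exact .em (φ := φ) (by simp) (by simp)
    · exact .em (φ := ψ) (by simp) (by simp)
  · intro h1
    by_contra h2
    rw [← h.neg_mem_iff] at h2
    rcases h1 with h1 | h1
    · refine h.not_mem [φ] (.or ?_) (by simp [h1]) h2
      exact .em (φ := φ) (by simp) (by simp)
    · refine h.not_mem [ψ] (.or ?_) (by simp [h1]) h2
      exact .em (φ := ψ) (by simp) (by simp)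

theorem or_mem_iff (φ ψ : Fm) : Fm.or φ ψ ∈ H ↔ φ ∈ H ∧ ψ ∈ H := by
  have := h.and_mem_iff φ.neg ψ.neg
  rw [show Fm.and φ.neg ψ.neg = (Fm.or φ ψ).neg from rfl, h.neg_mem_iff, h.neg_mem_iff,
    h.neg_mem_iff] at this
  tauto

theorem all_mem_iff (φ : Fm) : Fm.all φ ∈ H ↔ ∃ t, φ.inst t ∈ H := by
  refine ⟨h.wit φ, ?_⟩
  rintro ⟨t, ht⟩
  by_contra h2
  rw [← h.neg_mem_iff] at h2
  refine h.not_mem [φ.inst t] (.ex t ?_) (by simp [ht]) h2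
  refine .em (φ := φ.inst t) (by simp) ?_
  simp [Fm.inst_eq, Fm.neg_sub]

theorem ex_mem_iff (φ : Fm) : Fm.ex φ ∈ H ↔ ∀ t, φ.inst t ∈ H := by
  have := h.all_mem_iff φ.neg
  rw [show Fm.all φ.neg = (Fm.ex φ).neg from rfl, h.neg_mem_iff] at this
  simp only [Fm.inst_eq, ← Fm.neg_sub, h.neg_mem_iff] at this ⊢
  rw [← not_iff_not, this]
  simp

theorem all2_mem_iff (φ : Fm) : Fm.all2 φ ∈ H ↔ ∃ t, φ.inst2 t ∈ H := by
  refine ⟨h.wit2 φ, ?_⟩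
  rintro ⟨t, ht⟩
  by_contra h2
  rw [← h.neg_mem_iff] at h2
  refine h.not_mem [φ.inst2 t] (.ex2 t ?_) (by simp [ht]) h2
  refine .em (φ := φ.inst2 t) (by simp) ?_
  simp [Fm.inst2_eq, Fm.neg_sub]

theorem ex2_mem_iff (φ : Fm) : Fm.ex2 φ ∈ H ↔ ∀ t, φ.inst2 t ∈ H := by
  have := h.all2_mem_iff φ.neg
  rw [show Fm.all2 φ.neg = (Fm.ex2 φ).neg from rfl, h.neg_mem_iff] at this
  simp only [Fm.inst2_eq, ← Fm.neg_sub, h.neg_mem_iff] at this ⊢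
  rw [← not_iff_not, this]
  simp

theorem leibniz {t u : Tm} (htu : Fm.eq t u ∉ H) (φ : Fm) (ht : φ.inst t ∉ H) : φ.inst u ∉ H := by
  have h1 := (h.neg_mem_iff _).2 htu
  have h2 := (h.neg_mem_iff _).2 ht
  refine h.not_mem [(Fm.eq t u).neg, (φ.inst t).neg] (.leibniz t u φ ?_ ?_) (by simp [h1, h2])
  · exact .em (φ := .eq t u) (by simp) (by simp)
  · exact .em (φ := φ.inst t) (by simp) (by simp)

theorem eq_refl (t : Tm) : Fm.eq t t ∉ H := h.not_mem [] (.refl t) (by simp)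

/-- Provable equality is preserved by term contexts. -/
theorem eq_congr {t u : Tm} (htu : Fm.eq t u ∉ H) (v : Tm) :
    Fm.eq (v.sub (scons t .var)) (v.sub (scons u .var)) ∉ H := by
  have h1 := h.leibniz htu (.eq ((v.sub (scons t .var)).sub shiftN) v)
  simp only [Fm.inst_eq, Fm.sub, Tm.sub_shift_scons, Tm.sub_var] at h1
  exact h1 (h.eq_refl _)

theorem eq_symm {t u : Tm} (htu : Fm.eq t u ∉ H) : Fm.eq u t ∉ H := by
  have h1 := h.leibniz htu (.eq (.var 0) (t.sub shiftN))
  simp only [Fm.inst_eq, Fm.sub, Tm.sub_shift_scons, Tm.sub_var] at h1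
  exact h1 (h.eq_refl _)

theorem eq_trans {t u v : Tm} (htu : Fm.eq t u ∉ H) (huv : Fm.eq u v ∉ H) : Fm.eq t v ∉ H := by
  have h1 := h.leibniz huv (.eq (t.sub shiftN) (.var 0))
  simp only [Fm.inst_eq, Fm.sub, Tm.sub_shift_scons, Tm.sub_var] at h1
  exact h1 htu

theorem succ_congr {t u : Tm} (htu : Fm.eq t u ∉ H) : Fm.eq (.succ t) (.succ u) ∉ H :=
  h.eq_congr htu (.succ (.var 0))

theorem add_congr {t u v w : Tm} (htu : Fm.eq t u ∉ H) (hvw : Fm.eq v w ∉ H) :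
    Fm.eq (.add t v) (.add u w) ∉ H := by
  have h1 := h.eq_congr htu (.add (.var 0) (v.sub shiftN))
  have h2 := h.eq_congr hvw (.add (u.sub shiftN) (.var 0))
  simp only [Tm.sub, Tm.sub_shift_scons, Tm.sub_var] at h1 h2
  exact h.eq_trans h1 h2

theorem mul_congr {t u v w : Tm} (htu : Fm.eq t u ∉ H) (hvw : Fm.eq v w ∉ H) :
    Fm.eq (.mul t v) (.mul u w) ∉ H := by
  have h1 := h.eq_congr htu (.mul (.var 0) (v.sub shiftN))
  have h2 := h.eq_congr hvw (.mul (u.sub shiftN) (.var 0))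
  simp only [Tm.sub, Tm.sub_shift_scons, Tm.sub_var] at h1 h2
  exact h.eq_trans h1 h2

theorem mem_congr {t u : Tm} (htu : Fm.eq t u ∉ H) {X : ℕ} (ht : Fm.mem t X ∉ H) :
    Fm.mem u X ∉ H := by
  have h1 := h.leibniz htu (.mem (.var 0) X)
  simp only [Fm.inst_eq, Fm.sub] at h1
  exact h1 ht

/-- Terms modulo provable equality. -/
def termSetoid : Setoid Tm where
  r t u := Fm.eq t u ∉ H
  iseqv := ⟨h.eq_refl, h.eq_symm, h.eq_trans⟩

/-- The term model. -/
@[reducible]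
def termModel : PreMod (Quotient h.termSetoid) where
  zero := Quotient.mk _ .zero
  succ := Quotient.map Tm.succ fun _ _ h1 => h.succ_congr h1
  add := Quotient.map₂ Tm.add fun _ _ h1 _ _ h2 => h.add_congr h1 h2
  mul := Quotient.map₂ Tm.mul fun _ _ h1 _ _ h2 => h.mul_congr h1 h2

/-- The set named by a set variable in the term model. -/
def termSet (X : ℕ) : Set (Quotient h.termSetoid) :=
  {q | ∃ t, Quotient.mk _ t = q ∧ Fm.mem t X ∉ H}

theorem mem_termSet (t : Tm) (X : ℕ) :
    Quotient.mk h.termSetoid t ∈ h.termSet X ↔ Fm.mem t X ∉ H :=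
  ⟨fun ⟨_, hu, hm⟩ => h.mem_congr (Quotient.exact hu) hm, fun hm => ⟨t, rfl, hm⟩⟩

theorem eval_termModel (t : Tm) (σ : ℕ → Tm) :
    @Tm.eval _ h.termModel (fun i => Quotient.mk _ (σ i)) t = Quotient.mk _ (t.sub σ) := by
  let _ := h.termModel
  induction t with
  | zero => rfl
  | var i => rfl
  | succ t ih => rw [Tm.eval, ih]; rfl
  | add t u ih1 ih2 | mul t u ih1 ih2 => rw [Tm.eval, ih1, ih2]; rfl

theorem sat_termModel (φ : Fm) : ∀ (σ : ℕ → Tm) (ρ : ℕ → ℕ),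
    @Sat _ h.termModel (Set.range h.termSet) (fun i => Quotient.mk _ (σ i))
      (fun i => h.termSet (ρ i)) φ ↔ φ.sub σ ρ ∉ H := by
  let _ := h.termModel
  have he : ∀ (t : Tm) (σ : ℕ → Tm), scons (Quotient.mk h.termSetoid t)
      (fun i => Quotient.mk h.termSetoid (σ i)) = fun i => Quotient.mk _ (scons t σ i) := by
    intro t σ; funext i; cases i <;> rfl
  have hE : ∀ (X : ℕ) (ρ : ℕ → ℕ), scons (h.termSet X) (fun i => h.termSet (ρ i)) =
      fun i => h.termSet (scons X ρ i) := by
    intro t σ; funext i; cases i <;> rfl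
  induction φ with
  | eq t u =>
    intro σ ρ
    simp only [Sat, h.eval_termModel, Fm.sub]
    exact Quotient.eq
  | neq t u =>
    intro σ ρ
    simp only [Sat, h.eval_termModel, Fm.sub]
    rw [show Fm.neq (t.sub σ) (u.sub σ) = (Fm.eq (t.sub σ) (u.sub σ)).neg from rfl,
      h.neg_mem_iff]
    exact not_congr Quotient.eq
  | mem t X => intro σ ρ; simp only [Sat, h.eval_termModel, Fm.sub, h.mem_termSet]
  | nmem t X =>
    intro σ ρ
    simp only [Sat, h.eval_termModel, Fm.sub, h.mem_termSet]
    rw [show Fm.nmem (t.sub σ) (ρ X) = (Fm.mem (t.sub σ) (ρ X)).neg from rfl, h.neg_mem_iff]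
  | and φ ψ i1 i2 => intro σ ρ; simp only [Sat, i1, i2, Fm.sub, h.and_mem_iff, not_or]
  | or φ ψ i1 i2 => intro σ ρ; simp only [Sat, i1, i2, Fm.sub, h.or_mem_iff]; tauto
  | all φ ih =>
    intro σ ρ
    simp only [Sat, Fm.sub, h.all_mem_iff, Fm.sub_inst, not_exists]
    rw [Quotient.forall]
    exact forall_congr' fun t => by rw [he]; exact ih _ _
  | ex φ ih =>
    intro σ ρ
    simp only [Sat, Fm.sub, h.ex_mem_iff, Fm.sub_inst, not_forall]
    rw [Quotient.exists]
    exact exists_congr fun t => by rw [he]; exact ih _ _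
  | all2 φ ih =>
    intro σ ρ
    simp only [Sat, Fm.sub, h.all2_mem_iff, Fm.sub_inst2, not_exists, Set.forall_mem_range]
    exact forall_congr' fun t => by rw [hE]; exact ih _ _
  | ex2 φ ih =>
    intro σ ρ
    simp only [Sat, Fm.sub, h.ex2_mem_iff, Fm.sub_inst2, not_forall, Set.exists_range_iff]
    exact exists_congr fun t => by rw [hE]; exact ih _ _

end Refutable

/-- Completeness of the sequent calculus for countable theories of sentences. -/
theorem Proves.complete {T : Set Fm} (hT : ∀ φ ∈ T, φ.IsSentence) (φ : Fm)
    (hφ : ∀ (N : Type) [PreMod N] (S : Set (Set N)), S.Nonempty →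
      (∀ α ∈ T, ∀ e E, (∀ i, E i ∈ S) → Sat S e E α) →
      ∀ e E, (∀ i, E i ∈ S) → Sat S e E φ) : Proves T φ := by
  by_contra hn
  obtain ⟨H, h, hH⟩ := exists_refutable hT hn
  let _ := h.termModel
  refine (h.sat_termModel φ .var id).1 ?_ (by rw [Fm.sub_var]; exact hH φ (by simp))
  refine hφ _ (Set.range h.termSet) ⟨_, 0, rfl⟩ ?_ _ _ fun i => ⟨_, rfl⟩
  intro α hα e E hE
  choose σ hσ using fun i => Quotient.exists_rep (e i)
  choose ρ hρ using hE
  obtain rfl : (fun i => Quotient.mk h.termSetoid (σ i)) = e := funext hσ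
  obtain rfl : (fun i => h.termSet (ρ i)) = E := funext hρ
  rw [h.sat_termModel, Fm.sub_sentence (hT α hα)]
  exact h.not_mem [] (.ax hα) (by simp)

/-- A model of `ACA₀`. -/
class ACAM (N : Type) extends PreMod N where
  S : Set (Set N)
  nonempty : S.Nonempty
  sound : ∀ α ∈ ACA0, ∀ e E, (∀ i, E i ∈ S) → Sat S e E α

/-- The sets of a model of `ACA₀`. -/
notation:max "𝒮" N:max => (ACAM.S : Set (Set N))

/-- The comprehension scheme in semantic form. -/
def HasCompr {N : Type} [PreMod N] (F : Set (Set N)) : Prop :=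
  ∀ φ : Fm, φ.IsArith → ∀ e E, (∀ i, E i ∈ F) → {x | Sat F (scons x e) E φ} ∈ F

theorem sat_of_all_iter {N : Type} [PreMod N] (S : Set (Set N)) (φ : Fm) (a : ℕ)
    (E : ℕ → Set N) : (∀ e, Sat S e E (Fm.all^[a] φ)) → ∀ e, Sat S e E φ := by
  induction a with
  | zero => exact fun h => h
  | succ a ih =>
    intro h
    refine ih fun e => ?_
    have := h (fun i => e (i + 1))
    rw [Function.iterate_succ_apply'] at this
    have := this (e 0)
    rwa [show scons (e 0) (fun i => e (i + 1)) = e by funext i; cases i <;> rfl] at this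

theorem sat_of_all2_iter {N : Type} [PreMod N] (S : Set (Set N)) (φ : Fm) (e : ℕ → N) (b : ℕ) :
    (∀ E, (∀ i, E i ∈ S) → Sat S e E (Fm.all2^[b] φ)) → ∀ E, (∀ i, E i ∈ S) → Sat S e E φ := by
  induction b with
  | zero => exact fun h => h
  | succ b ih =>
    intro h
    refine ih fun E hE => ?_
    have := h (fun i => E (i + 1)) fun i => hE _
    rw [Function.iterate_succ_apply'] at this
    have := this (E 0) (hE 0)
    rwa [show scons (E 0) (fun i => E (i + 1)) = E by funext i; cases i <;> rfl] at this

theorem Sat_compr {N : Type} [PreMod N] (S : Set (Set N)) (φ : Fm) (e : ℕ → N) (E : ℕ → Set N) :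
    Sat S e E (compr φ) ↔ {x | Sat S (scons x e) E φ} ∈ S := by
  simp only [compr, Fm.iff, Fm.imp, Sat, Sat_neg, Sat_sub]
  constructor
  · rintro ⟨X, hX, h⟩
    convert hX using 1
    ext x
    have := h x
    simp only [Tm.eval, scons_zero, scons_succ] at this
    simp only [Set.mem_ofPred_eq]
    tauto
  · intro h
    refine ⟨_, h, fun x => ?_⟩
    simp only [Tm.eval, scons_zero, scons_succ, Set.mem_ofPred_eq]
    tauto

theorem hasCompr_of_sat {N : Type} [PreMod N] {S : Set (Set N)}
    (h : ∀ α ∈ ACA0, ∀ e E, (∀ i, E i ∈ S) → Sat S e E α) : HasCompr S := by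
  intro φ hφ e E hE
  obtain ⟨k, hk⟩ := φ.exists_closed
  rw [← Sat_compr]
  have := fun e E hE => h _ (ACA0.comp φ k k hφ (Fm.Closed.mono _ (by omega) le_rfl hk)) e E hE
  have := fun e => sat_of_all2_iter S _ e k (this e)
  exact sat_of_all_iter S _ k E (fun e => this e E hE) e

section
variable {N : Type} [ACAM N]

theorem ACAM.compr : HasCompr 𝒮 N := hasCompr_of_sat ACAM.sound

theorem ACAM.exists_env : ∃ E : ℕ → Set N, ∀ i, E i ∈ 𝒮 N :=
  ⟨fun _ => (ACAM.nonempty (N := N)).some, fun _ => (ACAM.nonempty (N := N)).some_mem⟩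

open PreMod (succ)

theorem ACAM.succ_ne_zero (x : N) : succ x ≠ 0 := by
  obtain ⟨E, hE⟩ := ACAM.exists_env (N := N)
  exact ACAM.sound _ .succ_ne_zero (fun _ => x) E hE x

theorem ACAM.succ_inj {x y : N} (h : succ x = succ y) : x = y := by
  obtain ⟨E, hE⟩ := ACAM.exists_env (N := N)
  have h1 := ACAM.sound _ .succ_inj (fun _ => x) E hE y x
  simp only [Fm.imp, Fm.neg, Sat, Tm.eval, scons_zero, scons_succ] at h1
  tauto

theorem ACAM.add_zero (x : N) : x + 0 = x := by
  obtain ⟨E, hE⟩ := ACAM.exists_env (N := N)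
  exact ACAM.sound _ .add_zero (fun _ => x) E hE x

theorem ACAM.add_succ (x y : N) : x + succ y = succ (x + y) := by
  obtain ⟨E, hE⟩ := ACAM.exists_env (N := N)
  exact ACAM.sound _ .add_succ (fun _ => x) E hE y x

theorem ACAM.mul_zero (x : N) : x * 0 = 0 := by
  obtain ⟨E, hE⟩ := ACAM.exists_env (N := N)
  exact ACAM.sound _ .mul_zero (fun _ => x) E hE x

theorem ACAM.mul_succ (x y : N) : x * succ y = x * y + x := by
  obtain ⟨E, hE⟩ := ACAM.exists_env (N := N)
  exact ACAM.sound _ .mul_succ (fun _ => x) E hE y x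

theorem ACAM.ind_set {X : Set N} (hX : X ∈ 𝒮 N) (h0 : 0 ∈ X)
    (hs : ∀ x ∈ X, succ x ∈ X) (x : N) : x ∈ X := by
  obtain ⟨E, hE⟩ := ACAM.exists_env (N := N)
  have h1 := ACAM.sound _ .ind (fun _ => x) E hE X hX
  simp only [Fm.imp, Fm.neg, Sat, Tm.eval, scons_zero] at h1
  rcases h1 with (h1 | ⟨y, h1, h2⟩) | h1
  · exact absurd h0 h1
  · exact absurd (hs y (by tauto)) h2
  · exact h1 x

/-- Induction for an arithmetical formula without set parameters. -/
theorem ACAM.ind_fm (φ : Fm) (hφ : φ.IsArith) (e : ℕ → N) {P : N → Prop}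
    (hP : ∀ x, P x ↔ Sat ACAM.S (scons x e) (fun _ => ∅) φ) (hc : φ.Closed 10 0) (h0 : P 0) (hs : ∀ x, P x → P (succ x)) (x : N) : P x := by
  obtain ⟨E, hE⟩ := ACAM.exists_env (N := N)
  have h1 := ACAM.compr φ hφ e E hE
  have h2 : {x | Sat ACAM.S (scons x e) E φ} = {x | P x} := by
    ext y
    rw [Set.mem_ofPred_eq, Set.mem_ofPred_eq, hP]
    exact Sat_congr _ φ (k := 10) (l := 0) (by simp) (by simp) hc
  rw [h2] at h1
  exact ACAM.ind_set h1 h0 hs x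

namespace ACAM

theorem zero_add (x : N) : 0 + x = x := by
  refine ind_fm (.eq (.add .zero (.var 0)) (.var 0)) trivial (fun _ => x)
    (P := fun x : N => 0 + x = x) (fun _ => Iff.rfl) (by simp [Fm.Closed, Tm.Closed])
    (add_zero 0) (fun x h => ?_) x
  rw [add_succ, h]

theorem succ_add (x y : N) : succ x + y = succ (x + y) := by
  refine ind_fm (.eq (.add (.succ (.var 1)) (.var 0)) (.succ (.add (.var 1) (.var 0)))) trivial
    (fun _ => x) (P := fun y : N => succ x + y = succ (x + y)) (fun _ => Iff.rfl)
    (by simp [Fm.Closed, Tm.Closed]) ?_ (fun y h => ?_) y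
  · rw [add_zero, add_zero]
  · rw [add_succ, add_succ, h]

theorem add_comm (x y : N) : x + y = y + x := by
  refine ind_fm (.eq (.add (.var 1) (.var 0)) (.add (.var 0) (.var 1))) trivial
    (fun _ => x) (P := fun y : N => x + y = y + x) (fun _ => Iff.rfl)
    (by simp [Fm.Closed, Tm.Closed]) ?_ (fun y h => ?_) y
  · rw [add_zero, zero_add]
  · rw [add_succ, succ_add, h]

theorem add_assoc (x y z : N) : x + y + z = x + (y + z) := by
  refine ind_fm (.eq (.add (.add (.var 2) (.var 1)) (.var 0)) (.add (.var 2)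
    (.add (.var 1) (.var 0)))) trivial
    (scons y fun _ => x) (P := fun z : N => x + y + z = x + (y + z)) (fun _ => Iff.rfl)
    (by simp [Fm.Closed, Tm.Closed]) ?_ (fun z h => ?_) z
  · rw [add_zero, add_zero]
  · rw [add_succ, add_succ, add_succ, h]

theorem zero_mul (x : N) : 0 * x = 0 := by
  refine ind_fm (.eq (.mul .zero (.var 0)) .zero) trivial (fun _ => x)
    (P := fun x : N => 0 * x = 0) (fun _ => Iff.rfl) (by simp [Fm.Closed, Tm.Closed])
    (mul_zero 0) (fun x h => ?_) x
  rw [mul_succ, h, add_zero]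

theorem succ_mul (x y : N) : succ x * y = x * y + y := by
  refine ind_fm (.eq (.mul (.succ (.var 1)) (.var 0)) (.add (.mul (.var 1) (.var 0)) (.var 0)))
    trivial (fun _ => x) (P := fun y : N => succ x * y = x * y + y) (fun _ => Iff.rfl)
    (by simp [Fm.Closed, Tm.Closed]) ?_ (fun y h => ?_) y
  · rw [mul_zero, mul_zero, add_zero]
  · rw [mul_succ, mul_succ, h, add_succ, add_succ, add_assoc, add_assoc, add_comm x y]

theorem mul_comm (x y : N) : x * y = y * x := by
  refine ind_fm (.eq (.mul (.var 1) (.var 0)) (.mul (.var 0) (.var 1))) trivial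
    (fun _ => x) (P := fun y : N => x * y = y * x) (fun _ => Iff.rfl)
    (by simp [Fm.Closed, Tm.Closed]) ?_ (fun y h => ?_) y
  · rw [mul_zero, zero_mul]
  · rw [mul_succ, succ_mul, h]

theorem mul_add (x y z : N) : x * (y + z) = x * y + x * z := by
  refine ind_fm (.eq (.mul (.var 2) (.add (.var 1) (.var 0))) (.add (.mul (.var 2) (.var 1))
    (.mul (.var 2) (.var 0)))) trivial
    (scons y fun _ => x) (P := fun z : N => x * (y + z) = x * y + x * z) (fun _ => Iff.rfl)
    (by simp [Fm.Closed, Tm.Closed]) ?_ (fun z h => ?_) z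
  · rw [add_zero, mul_zero, add_zero]
  · rw [add_succ, mul_succ, mul_succ, h, add_assoc]

theorem mul_assoc (x y z : N) : x * y * z = x * (y * z) := by
  refine ind_fm (.eq (.mul (.mul (.var 2) (.var 1)) (.var 0)) (.mul (.var 2)
    (.mul (.var 1) (.var 0)))) trivial
    (scons y fun _ => x) (P := fun z : N => x * y * z = x * (y * z)) (fun _ => Iff.rfl)
    (by simp [Fm.Closed, Tm.Closed]) ?_ (fun z h => ?_) z
  · rw [mul_zero, mul_zero, mul_zero]
  · rw [mul_succ, mul_succ, h, mul_add]

theorem add_right_cancel (x y z : N) : x + z = y + z → x = y := by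
  refine ind_fm (.or (.neq (.add (.var 2) (.var 0)) (.add (.var 1) (.var 0)))
    (.eq (.var 2) (.var 1))) (by simp [Fm.IsArith])
    (scons y fun _ => x) (P := fun z : N => x + z = y + z → x = y) (fun _ => ?_)
    (by simp [Fm.Closed, Tm.Closed]) ?_ (fun z h => ?_) z
  · exact imp_iff_not_or
  · rw [add_zero, add_zero]; exact id
  · rw [add_succ, add_succ]; exact fun h1 => h (succ_inj h1)

theorem zero_or_succ (x : N) : x = 0 ∨ ∃ y, x = succ y := by
  refine ind_fm (.or (.eq (.var 0) .zero) (.ex (.eq (.var 1) (.succ (.var 0)))))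
    (by simp [Fm.IsArith]) (fun _ => x) (P := fun x : N => x = 0 ∨ ∃ y, x = succ y)
    (fun _ => Iff.rfl)
    (by simp [Fm.Closed, Tm.Closed]) (Or.inl rfl) (fun z h => Or.inr ⟨z, rfl⟩) x

theorem total (x y : N) : (∃ z, y = x + z) ∨ ∃ z, x = y + z := by
  refine ind_fm (.or (.ex (.eq (.var 1) (.add (.var 2) (.var 0))))
    (.ex (.eq (.var 2) (.add (.var 1) (.var 0)))))
    (by simp [Fm.IsArith]) (fun _ => x) (P := fun y : N => (∃ z, y = x + z) ∨ ∃ z, x = y + z)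
    (fun _ => Iff.rfl)
    (by simp [Fm.Closed, Tm.Closed]) (Or.inr ⟨x, (zero_add x).symm⟩) (fun y h => ?_) y
  rcases h with ⟨z, rfl⟩ | ⟨z, rfl⟩
  · exact Or.inl ⟨succ z, (add_succ _ _).symm⟩
  · rcases zero_or_succ z with rfl | ⟨w, rfl⟩
    · exact Or.inl ⟨succ 0, by rw [add_zero, add_succ, add_zero]⟩
    · exact Or.inr ⟨w, by rw [add_succ, succ_add]⟩

end ACAM

instance : One N := ⟨succ 0⟩

theorem succ_eq (x : N) : succ x = x + 1 := by
  rw [show (1 : N) = succ 0 from rfl, ACAM.add_succ, ACAM.add_zero]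

noncomputable instance : CommSemiring N where
  add_assoc := ACAM.add_assoc
  zero_add := ACAM.zero_add
  add_zero := ACAM.add_zero
  add_comm := ACAM.add_comm
  left_distrib := ACAM.mul_add
  right_distrib x y z := by
    rw [ACAM.mul_comm, ACAM.mul_add, ACAM.mul_comm z, ACAM.mul_comm z]
  zero_mul := ACAM.zero_mul
  mul_zero := ACAM.mul_zero
  mul_assoc := ACAM.mul_assoc
  one_mul x := by rw [show (1 : N) = succ 0 from rfl, ACAM.succ_mul, ACAM.zero_mul, ACAM.zero_add]
  mul_one x := by rw [show (1 : N) = succ 0 from rfl, ACAM.mul_succ, ACAM.mul_zero, ACAM.zero_add]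
  mul_comm := ACAM.mul_comm
  nsmul := nsmulRec

instance : IsCancelAdd N where
  add_left_cancel z x y h := by
    refine ACAM.add_right_cancel x y z ?_
    rw [add_comm x, add_comm y]; exact h
  add_right_cancel z x y h := ACAM.add_right_cancel x y z h

theorem ACAM.eq_zero_of_add {x y : N} (h : x + y = 0) : x = 0 := by
  rcases ACAM.zero_or_succ y with rfl | ⟨z, rfl⟩
  · rwa [_root_.add_zero] at h
  · rw [ACAM.add_succ] at h
    exact absurd h (ACAM.succ_ne_zero _)

open Classical in
noncomputable instance : LinearOrder N where
  le x y := ∃ z, y = x + z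
  le_refl x := ⟨0, (add_zero x).symm⟩
  le_trans x y z := by
    rintro ⟨a, rfl⟩ ⟨b, rfl⟩
    exact ⟨a + b, add_assoc _ _ _⟩
  le_antisymm x y := by
    rintro ⟨a, rfl⟩ ⟨b, h⟩
    rw [add_assoc] at h
    have := ACAM.eq_zero_of_add (left_eq_add.1 h)
    rw [this, add_zero]
  le_total := ACAM.total
  toDecidableLE := inferInstance

theorem ACAM.le_def {x y : N} : x ≤ y ↔ ∃ z, y = x + z := Iff.rfl

instance : IsOrderedAddMonoid N where
  add_le_add_left x y := by
    rintro ⟨a, rfl⟩ z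
    exact ⟨a, by ring⟩

instance : CanonicallyOrderedAdd N where
  exists_add_of_le h := h
  le_add_self _ y := ⟨y, add_comm _ _⟩
  le_self_add _ y := ⟨y, rfl⟩

theorem ACAM.lt_iff {x y : N} : x < y ↔ x + 1 ≤ y := by
  constructor
  · intro h
    obtain ⟨z, rfl⟩ := ACAM.le_def.1 h.le
    rcases ACAM.zero_or_succ z with rfl | ⟨w, rfl⟩
    · simp at h
    · exact ⟨w, by rw [succ_eq]; ring⟩
  · rintro ⟨z, rfl⟩
    refine lt_of_le_of_ne ⟨1 + z, by ring⟩ fun h => ?_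
    have h2 : x + 0 = x + succ z := by rw [succ_eq, add_zero]; linear_combination h
    exact ACAM.succ_ne_zero _ (add_left_cancel h2).symm

theorem ACAM.lt_add_one_iff {x y : N} : x < y + 1 ↔ x ≤ y := by
  rw [ACAM.lt_iff]
  exact add_le_add_iff_right 1

instance : IsStrictOrderedRing N where
  le_of_add_le_add_left x y z := by
    rintro ⟨w, h⟩
    exact ⟨w, by rw [add_assoc] at h; exact add_left_cancel h⟩
  zero_le_one := ⟨1, (zero_add 1).symm⟩
  exists_pair_ne := ⟨0, 1, fun h => ACAM.succ_ne_zero _ h.symm⟩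
  mul_lt_mul_of_pos_left x hx y z h := by
    obtain ⟨a, rfl⟩ := ACAM.lt_iff.1 hx
    obtain ⟨b, rfl⟩ := ACAM.lt_iff.1 h
    refine ACAM.lt_iff.2 ⟨b + a + a * b, ?_⟩
    ring
  mul_lt_mul_of_pos_right x hx y z h := by
    obtain ⟨a, rfl⟩ := ACAM.lt_iff.1 hx
    obtain ⟨b, rfl⟩ := ACAM.lt_iff.1 h
    refine ACAM.lt_iff.2 ⟨b + a + a * b, ?_⟩
    ring

/-- The pairing function in a model. -/
def pp (x y : N) : N := (x + y) * (x + y) + x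

@[simp] theorem pp_inj {a b c d : N} : pp a b = pp c d ↔ a = c ∧ b = d := by
  refine ⟨fun h => ?_, by rintro ⟨rfl, rfl⟩; rfl⟩
  unfold pp at h
  have key : ∀ a b c d : N, a + b < c + d → (a + b) * (a + b) + a < (c + d) * (c + d) + c := by
    intro a b c d h
    obtain ⟨z, hz⟩ := ACAM.lt_iff.1 h
    rw [hz]
    refine ACAM.lt_iff.2 ⟨a + b + b + z * z + z + z + z * (a + b) * 2 + c, ?_⟩
    ring
  have h1 : a + b = c + d := by
    rcases lt_trichotomy (a + b) (c + d) with h' | h' | h'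
    · exact absurd h (key _ _ _ _ h').ne
    · exact h'
    · exact absurd h (key _ _ _ _ h').ne'
  rw [h1] at h
  have h2 := add_left_cancel h
  subst h2
  exact ⟨rfl, add_left_cancel h1⟩

theorem le_pp_left (x y : N) : x ≤ pp x y := ⟨(x + y) * (x + y), add_comm _ _⟩

theorem le_mul_self (x : N) : x ≤ x * x := by
  rcases ACAM.zero_or_succ x with rfl | ⟨w, rfl⟩
  · simp
  · exact ⟨w * (w + 1), by rw [succ_eq]; ring⟩

theorem le_pp_right (x y : N) : y ≤ pp x y :=
  (le_add_self.trans (le_mul_self (x + y))).trans le_self_add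

theorem pp_mono {a b c d : N} (h1 : a ≤ c) (h2 : b ≤ d) : pp a b ≤ pp c d := by
  obtain ⟨x, rfl⟩ := h1
  obtain ⟨y, rfl⟩ := h2
  exact ⟨(x + y) * (x + y) + 2 * (a + b) * (x + y) + x, by unfold pp; ring⟩

theorem pp_lt_left {a b c d : N} (h1 : a < c) (h2 : b ≤ d + 1) : pp a b < pp c d := by
  refine lt_of_le_of_lt (pp_mono le_rfl h2) ?_
  obtain ⟨x, rfl⟩ := ACAM.lt_iff.1 h1
  exact ACAM.lt_iff.2 ⟨x * x + 2 * x * (a + (d + 1)) + x, by unfold pp; ring⟩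

theorem pp_lt_right {a b c d : N} (h1 : a ≤ c) (h2 : b < d) : pp a b < pp c d := by
  refine lt_of_lt_of_le ?_ (pp_mono h1 le_rfl)
  obtain ⟨x, rfl⟩ := ACAM.lt_iff.1 h2
  exact ACAM.lt_iff.2 ⟨2 * (a + b) * (1 + x) + x * x + 2 * x, by unfold pp; ring⟩

theorem lt_pp_right {x : N} (hx : 1 ≤ x) (y : N) : y < pp x y := by
  obtain ⟨z, rfl⟩ := hx
  refine ACAM.lt_iff.2 ⟨y * y + y + 2 * z * y + z * z + z + z + z + 1 , ?_⟩
  unfold pp; ring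

end

variable {N : Type} [ACAM N]

/-- A nonempty family of sets that is closed under arithmetical comprehension. -/
class Closed (F : Set (Set N)) : Prop where
  sub : F ⊆ 𝒮 N
  nonempty : F.Nonempty
  compr : HasCompr F

instance : Closed 𝒮 N := ⟨subset_rfl, ACAM.nonempty, ACAM.compr⟩

/-- Types of tuples over `N`. -/
class Ctx (N : Type) (α : Type) where
  enc : α → N

instance : Ctx N N := ⟨id⟩

noncomputable instance {α β : Type} [Ctx N α] [Ctx N β] : Ctx N (α × β) :=
  ⟨fun p => pp (Ctx.enc p.1) (Ctx.enc p.2)⟩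

open Ctx (enc)

@[simp] theorem enc_self (x : N) : enc x = x := rfl

theorem enc_mk {α β : Type} [Ctx N α] [Ctx N β] (p : α × β) :
    (enc p : N) = pp (enc p.1) (enc p.2) := rfl

/-- The predicate `P` is arithmetically definable with set parameters from `F`. -/
class Def (F : Set (Set N)) {α : Type} [Ctx N α] (P : α → Prop) : Prop where intro ::
  out : ∃ X ∈ F, ∀ a, P a ↔ enc a ∈ X

/-- The function `f` is arithmetically definable with set parameters from `F`. -/
class DefM (F : Set (Set N)) {α β : Type} [Ctx N α] [Ctx N β] (f : α → β) : Prop where intro ::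
  out : ∃ X ∈ F, ∀ a, ∀ y : N, pp (enc a) y ∈ X ↔ y = enc (f a)

/-- The pairing term. -/
def Tm.pp (t u : Tm) : Tm := .add (.mul (.add t u) (.add t u)) t

@[simp] theorem Tm.eval_pp (e : ℕ → N) (t u : Tm) :
    (t.pp u).eval e = SOA.pp (t.eval e) (u.eval e) := rfl

section
variable {F : Set (Set N)} [hF : Closed F]

theorem Closed.compr_two (φ : Fm) (hφ : φ.IsArith) (e : ℕ → N) {X Y : Set N} (hX : X ∈ F)
    (hY : Y ∈ F) : {x | Sat F (scons x e) (scons X (fun _ => Y)) φ} ∈ F := by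
  refine hF.compr φ hφ e _ fun i => ?_
  cases i
  · exact hX
  · exact hY

theorem Closed.compr_zero (φ : Fm) (hφ : φ.IsArith) (e : ℕ → N) :
    ∃ Y, {x | Sat F (scons x e) (fun _ => Y) φ} ∈ F :=
  ⟨_, hF.compr φ hφ e _ fun _ => hF.nonempty.some_mem⟩

variable {α β γ : Type} [Ctx N α] [Ctx N β] [Ctx N γ]

instance Def.not {P : α → Prop} [hP : Def F P] : Def F (fun a => ¬ P a) := by
  obtain ⟨X, hX, h⟩ := hP.out
  refine ⟨_, Closed.compr_two (.nmem (.var 0) 0) trivial (fun _ => 0) hX hX, fun a => ?_⟩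
  rw [h]; rfl

instance Def.and {P Q : α → Prop} [hP : Def F P] [hQ : Def F Q] : Def F (fun a => P a ∧ Q a) := by
  obtain ⟨X, hX, h⟩ := hP.out
  obtain ⟨Y, hY, h'⟩ := hQ.out
  refine ⟨_, Closed.compr_two (.and (.mem (.var 0) 0) (.mem (.var 0) 1)) (by simp [Fm.IsArith])
    (fun _ => 0) hX hY, fun a => ?_⟩
  rw [h, h']; rfl

theorem Def.congr {P Q : α → Prop} (hP : Def F P) (h : ∀ a, P a ↔ Q a) : Def F Q := by
  rwa [show Q = P from funext fun a => propext (h a).symm]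

instance Def.or {P Q : α → Prop} [Def F P] [Def F Q] : Def F (fun a => P a ∨ Q a) :=
  Def.congr (P := fun a => ¬ (¬ P a ∧ ¬ Q a)) inferInstance fun a => by tauto

instance Def.imp {P Q : α → Prop} [Def F P] [Def F Q] : Def F (fun a => P a → Q a) :=
  Def.congr (P := fun a => ¬ (P a ∧ ¬ Q a)) inferInstance fun a => by tauto

instance Def.iff {P Q : α → Prop} [Def F P] [Def F Q] : Def F (fun a => P a ↔ Q a) :=
  Def.congr (P := fun a => (P a → Q a) ∧ (Q a → P a)) inferInstance fun a => by tauto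

instance Def.ex {P : α → N → Prop} [hP : Def F (fun p : α × N => P p.1 p.2)] :
    Def F (fun a => ∃ y, P a y) := by
  obtain ⟨X, hX, h⟩ := hP.out
  refine ⟨_, Closed.compr_two (.ex (.mem (Tm.pp (.var 1) (.var 0)) 0)) trivial
    (fun _ => 0) hX hX, fun a => ?_⟩
  exact exists_congr fun y => h (a, y)

instance Def.all {P : α → N → Prop} [Def F (fun p : α × N => P p.1 p.2)] :
    Def F (fun a => ∀ y, P a y) :=
  Def.congr (P := fun a => ¬ ∃ y, ¬ P a y) inferInstance fun a => by simp

instance Def.const {p : Prop} : Def F (fun _ : α => p) := by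
  by_cases h : p
  · obtain ⟨Y, hY⟩ := Closed.compr_zero (F := F) (.eq (.var 0) (.var 0)) trivial (fun _ => (0 : N))
    exact ⟨_, hY, fun a => iff_of_true h rfl⟩
  · obtain ⟨Y, hY⟩ := Closed.compr_zero (F := F) (.neq (.var 0) (.var 0)) trivial (fun _ => (0 : N))
    exact ⟨_, hY, fun a => iff_of_false h fun h => h rfl⟩

theorem Def.comp {P : β → Prop} (hP : Def F P) (f : α → β) [hf : DefM F f] :
    Def F (fun a => P (f a)) := by
  obtain ⟨X, hX, h⟩ := hP.out
  obtain ⟨Y, hY, h'⟩ := hf.out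
  refine ⟨_, Closed.compr_two (.ex (.and (.mem (Tm.pp (.var 1) (.var 0)) 1) (.mem (.var 0) 0)))
    (by simp [Fm.IsArith]) (fun _ => 0) hX hY, fun a => ?_⟩
  rw [h]
  constructor
  · exact fun hm => ⟨enc (f a), (h' a _).2 rfl, hm⟩
  · rintro ⟨y, h1, h2⟩
    rw [(h' a y).1 h1] at h2
    exact h2

theorem DefM.id : DefM F (fun a : α => a) := by
  obtain ⟨Y, hY⟩ := Closed.compr_zero (F := F) (.ex (.eq (.var 1) (Tm.pp (.var 0) (.var 0))))
    trivial (fun _ => (0 : N))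
  refine ⟨_, hY, fun a y => ?_⟩
  change (∃ u, pp _ _ = pp u u) ↔ _
  simp only [pp_inj]
  exact ⟨fun ⟨u, h1, h2⟩ => h2.trans h1.symm, fun h => ⟨y, h.symm, rfl⟩⟩

instance DefM.const {c : β} : DefM F (fun _ : α => c) := by
  obtain ⟨Y, hY⟩ := Closed.compr_zero (F := F) (.ex (.eq (.var 1) (Tm.pp (.var 0) (.var 2))))
    trivial (fun _ => (enc c : N))
  refine ⟨_, hY, fun a y => ?_⟩
  change (∃ u, pp _ _ = pp u _) ↔ _
  simp only [pp_inj]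
  exact ⟨fun ⟨u, h1, h2⟩ => h2, fun h => ⟨_, rfl, h⟩⟩

theorem DefM.op {f : α → β} {g : α → γ} {h : α → N} (hf : DefM F f) (hg : DefM F g) (ψ : Fm)
    (hψ : ψ.IsArith)
    (hh : ∀ a y e E, Sat F (scons (enc (g a)) (scons (enc (f a)) (scons y e))) E ψ ↔ y = h a) :
    ∃ X ∈ F, ∀ a, ∀ y : N, pp (enc a) y ∈ X ↔ y = h a := by
  obtain ⟨X, hX, h1⟩ := hf.out
  obtain ⟨Y, hY, h2⟩ := hg.out
  refine ⟨_, Closed.compr_two (.ex (.ex (.ex (.ex (.and (.eq (.var 4) (Tm.pp (.var 3) (.var 2)))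
    (.and (.mem (Tm.pp (.var 3) (.var 1)) 0) (.and (.mem (Tm.pp (.var 3) (.var 0)) 1) ψ)))))))
    (by simp [Fm.IsArith, hψ]) (fun _ => 0) hX hY, fun a y => ?_⟩
  constructor
  · rintro ⟨a', y', u, v, e1, e2, e3, e4⟩
    obtain ⟨rfl, rfl⟩ := pp_inj.1 e1
    obtain rfl := (h1 _ _).1 e2
    obtain rfl := (h2 _ _).1 e3
    exact (hh _ _ _ _).1 e4
  · intro e
    exact ⟨_, _, _, _, rfl, (h1 _ _).2 rfl, (h2 _ _).2 rfl, (hh a y _ _).2 e⟩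

theorem DefM.mk {f : α → β} {g : α → γ} [hf : DefM F f] [hg : DefM F g] :
    DefM F (fun a => (f a, g a)) :=
  ⟨DefM.op hf hg (.eq (.var 2) (Tm.pp (.var 1) (.var 0))) trivial fun _ _ _ _ => Iff.rfl⟩

theorem DefM.fst {f : α → β × γ} (hf : DefM F f) : DefM F (fun a => (f a).1) :=
  ⟨DefM.op hf hf (.ex (.eq (.var 1) (Tm.pp (.var 3) (.var 0)))) trivial fun a y e E => by
    change (∃ u, (enc (f a) : N) = pp y u) ↔ _
    rw [enc_mk]
    simp only [pp_inj]
    exact ⟨fun ⟨u, h, _⟩ => h.symm, fun h => ⟨_, h.symm, rfl⟩⟩⟩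

theorem DefM.snd {f : α → β × γ} (hf : DefM F f) : DefM F (fun a => (f a).2) :=
  ⟨DefM.op hf hf (.ex (.eq (.var 1) (Tm.pp (.var 0) (.var 3)))) trivial fun a y e E => by
    change (∃ u, (enc (f a) : N) = pp u y) ↔ _
    rw [enc_mk]
    simp only [pp_inj]
    exact ⟨fun ⟨u, _, h⟩ => h.symm, fun h => ⟨_, rfl, h.symm⟩⟩⟩

/-- Compositions of projections. -/
class Proj {α β : Type} [Ctx N α] [Ctx N β] (f : α → β) : Prop where
  out : ∀ (F : Set (Set N)) [Closed F], DefM F f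

instance Proj.id : Proj (N := N) (fun a : α => a) := ⟨fun _ _ => DefM.id⟩

instance Proj.fst' : Proj (N := N) (Prod.fst : α × β → α) := ⟨fun _ _ => DefM.fst DefM.id⟩

instance Proj.snd' : Proj (N := N) (Prod.snd : α × β → β) := ⟨fun _ _ => DefM.snd DefM.id⟩

instance Proj.fst {f : α → β × γ} [hf : Proj (N := N) f] : Proj (N := N) (fun a => (f a).1) :=
  ⟨fun F _ => DefM.fst (hf.out F)⟩

instance Proj.snd {f : α → β × γ} [hf : Proj (N := N) f] : Proj (N := N) (fun a => (f a).2) :=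
  ⟨fun F _ => DefM.snd (hf.out F)⟩

instance DefM.of_proj {f : α → β} [hf : Proj (N := N) f] : DefM F f := hf.out F

instance DefM.add {f g : α → N} [hf : DefM F f] [hg : DefM F g] : DefM F (fun a => f a + g a) :=
  ⟨DefM.op hf hg (.eq (.var 2) (.add (.var 1) (.var 0))) trivial fun _ _ _ _ => Iff.rfl⟩

instance DefM.mul {f g : α → N} [hf : DefM F f] [hg : DefM F g] : DefM F (fun a => f a * g a) :=
  ⟨DefM.op hf hg (.eq (.var 2) (.mul (.var 1) (.var 0))) trivial fun _ _ _ _ => Iff.rfl⟩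

instance defM_pp {f g : α → N} [hf : DefM F f] [hg : DefM F g] : DefM F (fun a => pp (f a) (g a)) :=
  ⟨DefM.op hf hg (.eq (.var 2) (Tm.pp (.var 1) (.var 0))) trivial fun _ _ _ _ => Iff.rfl⟩

instance Def.eq {f g : α → N} [hf : DefM F f] [hg : DefM F g] : Def F (fun a => f a = g a) := by
  obtain ⟨X, hX, h1⟩ := hf.out
  obtain ⟨Y, hY, h2⟩ := hg.out
  refine ⟨_, Closed.compr_two (.ex (.and (.mem (Tm.pp (.var 1) (.var 0)) 0)
    (.mem (Tm.pp (.var 1) (.var 0)) 1))) (by simp [Fm.IsArith]) (fun _ => 0) hX hY, fun a => ?_⟩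
  constructor
  · intro h
    exact ⟨_, (h1 a _).2 rfl, (h2 a _).2 h⟩
  · rintro ⟨u, e1, e2⟩
    exact ((h1 a u).1 e1).symm.trans ((h2 a u).1 e2)

instance Def.mem {f : α → N} [DefM F f] {X : Set N} [hX : Fact (X ∈ F)] :
    Def F (fun a => f a ∈ X) :=
  Def.comp (P := fun x => x ∈ X) ⟨X, hX.out, fun _ => Iff.rfl⟩ f

instance Def.le {f g : α → N} [DefM F f] [DefM F g] : Def F (fun a => f a ≤ g a) :=
  Def.comp (P := fun p : N × N => p.1 ≤ p.2) (Def.congr (P := fun p : N × N => ∃ z, p.2 = p.1 + z)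
    inferInstance fun _ => ACAM.le_def.symm) (hf := DefM.mk) fun a => (f a, g a)

instance Def.lt {f g : α → N} [DefM F f] [DefM F g] : Def F (fun a => f a < g a) :=
  Def.congr (P := fun a => ¬ g a ≤ f a) inferInstance fun _ => not_le

theorem DefM.of_graph {f : α → N} (h : Def F (fun p : α × N => p.2 = f p.1)) : DefM F f := by
  obtain ⟨X, hX, h⟩ := h.out
  exact ⟨X, hX, fun a y => (h (a, y)).symm⟩

theorem DefM.comp {f : β → γ} (hf : DefM F f) (g : α → β) [hg : DefM F g] :
    DefM F (fun a => f (g a)) := by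
  obtain ⟨X, hX, h⟩ := hf.out
  have : Def F (fun p : β × N => p.2 = enc (f p.1)) :=
    ⟨X, hX, fun p => (h p.1 p.2).symm⟩
  obtain ⟨Z, hZ, k⟩ := hg.out
  have : DefM F (fun p : α × N => g p.1) :=
    ⟨_, Closed.compr_two (.ex (.ex (.ex (.and (.eq (.var 3) (Tm.pp (Tm.pp (.var 2) (.var 1)) (.var 0)))
      (.mem (Tm.pp (.var 2) (.var 0)) 0))))) (by simp [Fm.IsArith]) (fun _ => 0) hZ hZ, fun p y => by
      constructor
      · rintro ⟨a, b, c, e1, e2⟩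
        obtain ⟨h1, rfl⟩ := pp_inj.1 e1
        rw [enc_mk] at h1
        obtain ⟨rfl, rfl⟩ := pp_inj.1 h1
        exact (k _ _).1 e2
      · rintro rfl
        exact ⟨_, _, _, rfl, (k _ _).2 rfl⟩⟩
  obtain ⟨Y, hY, h'⟩ := (Def.comp ‹Def F _› (fun p : α × N => (g p.1, p.2)) (hf := DefM.mk)).out
  exact ⟨Y, hY, fun a y => (h' (a, y)).symm⟩

instance DefM.ite {P : α → Prop} {_ : ∀ a, Decidable (P a)} {f g : α → N} [Def F P] [DefM F f]
    [DefM F g] : DefM F (fun a => if P a then f a else g a) :=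
  DefM.of_graph (Def.congr
    (P := fun p : α × N => (P p.1 ∧ p.2 = f p.1) ∨ (¬ P p.1 ∧ p.2 = g p.1))
    (by
      have := Def.comp (F := F) (P := P) inferInstance (fun p : α × N => p.1)
      have := DefM.comp (F := F) (f := f) inferInstance (fun p : α × N => p.1)
      have := DefM.comp (F := F) (f := g) inferInstance (fun p : α × N => p.1)
      infer_instance) fun p => by
    by_cases h : P p.1 <;> simp [h])

/-- Comprehension. -/
theorem setOf_mem {P : N → Prop} (hP : Def F (fun p : N × N => P p.2)) : {x | P x} ∈ F := by
  obtain ⟨X, hX, h⟩ := (Def.comp hP (fun x => (x, x)) (hf := DefM.mk)).out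
  convert hX using 1
  ext x
  exact h x

variable (F) in
theorem ind {P : N → Prop} [hP : Def F (fun p : N × N => P p.2)] (h0 : P 0)
    (hs : ∀ x, P x → P (x + 1)) (x : N) : P x :=
  ACAM.ind_set (hF.sub (setOf_mem hP)) h0 (fun x hx => by rw [succ_eq]; exact hs x hx) x

variable (F) in
/-- Course-of-values induction. -/
theorem sind {P : N → Prop} [hP : Def F (fun p : N × N => P p.2)] (hs : ∀ x, (∀ y < x, P y) → P x)
    (x : N) : P x := by
  have := Def.comp hP (fun p : (N × N) × N => (p.2, p.2)) (hf := DefM.mk)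
  refine hs x (ind F (P := fun x => ∀ y, y < x → P y) ?_ ?_ x)
  · intro y hy
    exact absurd hy not_lt_zero
  · intro x ih y hy
    rcases (ACAM.lt_add_one_iff.1 hy).lt_or_eq with h | rfl
    · exact ih y h
    · exact hs _ ih

variable (F) in
theorem exists_least {P : N → Prop} [Def F (fun p : N × N => P p.2)] (h : ∃ x, P x) :
    ∃ x, P x ∧ ∀ y < x, ¬ P y := by
  by_contra! hn
  obtain ⟨x, hx⟩ := h
  exact sind F (P := fun x => ¬ P x) (fun x ih hx => by
    obtain ⟨y, h1, h2⟩ := hn x hx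
    exact ih y h1 h2) x hx

end

section
variable {F : Set (Set N)} [hF : Closed F] {α β γ δ : Type} [Ctx N α] [Ctx N β] [Ctx N γ] [Ctx N δ]

theorem Def.lift {P : N → Prop} (hP : Def F (fun p : N × N => P p.2)) (f : α → N) [DefM F f] :
    Def F (fun a => P (f a)) :=
  Def.comp hP (fun a => (f a, f a)) (hf := DefM.mk)

theorem Def.lift2 {P : N → N → Prop} (hP : Def F (fun p : N × N => P p.1 p.2)) (f g : α → N)
    [DefM F f] [DefM F g] : Def F (fun a => P (f a) (g a)) :=
  Def.comp hP (fun a => (f a, g a)) (hf := DefM.mk)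

theorem DefM.lift {P : N → N} (hP : DefM F (fun p : N × N => P p.2)) (f : α → N) [DefM F f] :
    DefM F (fun a => P (f a)) :=
  DefM.comp hP (fun a => (f a, f a)) (hg := DefM.mk)

theorem DefM.lift2 {P : β → γ → δ} (hP : DefM F (fun p : β × γ => P p.1 p.2)) (f : α → β)
    (g : α → γ) [DefM F f] [DefM F g] : DefM F (fun a => P (f a) (g a)) :=
  DefM.comp hP (fun a => (f a, g a)) (hg := DefM.mk)

instance Def.dvd {f g : α → N} [DefM F f] [DefM F g] : Def F (fun a => f a ∣ g a) :=
  Def.lift2 (P := fun x y => x ∣ y) (Def.congr (P := fun p : N × N => ∃ z, p.2 = p.1 * z)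
    inferInstance fun _ => Iff.rfl) f g

theorem dvd_of_dvd_add {a u v : N} (h : a ∣ u + v) (hu : a ∣ u) : a ∣ v := by
  obtain ⟨k, rfl⟩ := hu
  obtain ⟨l, hl⟩ := h
  rcases le_total k l with ⟨m, rfl⟩ | ⟨m, rfl⟩
  · exact ⟨m, by rw [mul_add] at hl; exact add_left_cancel hl⟩
  · have : a * m + v = 0 := by
      rw [mul_add, add_assoc] at hl
      exact left_eq_add.1 hl.symm
    rw [add_comm] at this
    rw [ACAM.eq_zero_of_add this]
    exact dvd_zero a

/-- A form of coprimality. -/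
def Cop (a b : N) : Prop := ∀ c, a ∣ b * c → a ∣ c

instance Def.cop {f g : α → N} [DefM F f] [DefM F g] : Def F (fun a => Cop (f a) (g a)) :=
  Def.lift2 (P := Cop) (Def.congr (P := fun p : N × N => ∀ c, p.1 ∣ p.2 * c → p.1 ∣ c)
    inferInstance fun _ => Iff.rfl) f g

theorem Cop.mul {a b c : N} (h1 : Cop a b) (h2 : Cop a c) : Cop a (b * c) :=
  fun d hd => h2 d (h1 _ (by rwa [mul_assoc] at hd))

/-- The moduli used for coding finite sets. -/
def modulus (m x : N) : N := 1 + (x + 1) * m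

instance defM_modulus {f g : α → N} [DefM F f] [DefM F g] :
    DefM F (fun a => modulus (f a) (g a)) := by
  unfold modulus; infer_instance

theorem cop_modulus_aux {m x z : N} (hz : z + 1 ∣ m) : Cop (modulus m x) ((z + 1) * m) := by
  have h1 : Cop (modulus m x) m := by
    intro c hc
    have h2 : modulus m x ∣ (x + 1) * m * c := by
      rw [mul_assoc]; exact dvd_mul_of_dvd_right hc _
    refine dvd_of_dvd_add (u := (x + 1) * m * c) ⟨c, ?_⟩ h2
    unfold modulus; ring
  refine Cop.mul (fun c hc => h1 c ?_) h1
  obtain ⟨k, hk⟩ := hz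
  have : m * c = k * ((z + 1) * c) := by rw [hk]; ring
  rw [this]
  exact dvd_mul_of_dvd_right hc _

theorem cop_modulus {m b x y : N} (hm : ∀ d, d ≠ 0 → d ≤ b → d ∣ m) (hx : x < b) (hy : y < b)
    (hxy : x ≠ y) : Cop (modulus m x) (modulus m y) := by
  intro c hc
  have key : ∀ x z : N, z + 1 ≤ b → modulus m (x + z + 1) = modulus m x + (z + 1) * m := by
    intro x z _; unfold modulus; ring
  rcases lt_or_gt_of_ne hxy with h | h
  · obtain ⟨z, rfl⟩ := ACAM.lt_iff.1 h
    have hz : z + 1 ≤ b := le_trans ⟨x, by ring⟩ hy.le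
    rw [show x + 1 + z = x + z + 1 by ring, key x z hz, add_mul] at hc
    exact cop_modulus_aux (hm _ (by simp) hz) c (dvd_of_dvd_add hc (dvd_mul_right _ _))
  · obtain ⟨z, rfl⟩ := ACAM.lt_iff.1 h
    have hz : z + 1 ≤ b := le_trans ⟨y, by ring⟩ hx.le
    have e : modulus m (y + 1 + z) = modulus m y + (z + 1) * m := by
      rw [show y + 1 + z = y + z + 1 by ring, key y z hz]
    refine cop_modulus_aux (hm _ (by simp) hz) c ?_
    refine dvd_of_dvd_add (u := modulus m y * c) ?_ hc
    exact ⟨c, by rw [e]; ring⟩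

theorem exists_common_multiple (b : N) : ∃ m : N, m ≠ 0 ∧ ∀ d, d ≠ 0 → d ≤ b → d ∣ m := by
  refine ind 𝒮 N (P := fun b : N => ∃ m, m ≠ 0 ∧ ∀ d, d ≠ 0 → d ≤ b → d ∣ m) ?_ ?_ b
  · exact ⟨1, one_ne_zero, fun d hd h => absurd (le_antisymm h (zero_le (a := _))) hd⟩
  · rintro b ⟨m, hm, h⟩
    refine ⟨m * (b + 1), mul_ne_zero hm (by simp), fun d hd hdb => ?_⟩
    rcases hdb.lt_or_eq with h1 | rfl
    · exact dvd_mul_of_dvd_left (h d hd (ACAM.lt_add_one_iff.1 h1)) _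
    · exact dvd_mul_left _ _

/-- `x` belongs to the finite set coded by `s`. -/
def Bit (x s : N) : Prop := ∃ m c, s = pp m c ∧ modulus m x ∣ c

instance Def.bit {f g : α → N} [DefM F f] [DefM F g] : Def F (fun a => Bit (f a) (g a)) :=
  Def.lift2 (P := Bit) (Def.congr (P := fun p : N × N => ∃ m c, p.2 = pp m c ∧ modulus m p.1 ∣ c)
    inferInstance fun _ => Iff.rfl) f g

variable (F) in
/-- Bounded arithmetical sets have codes. -/
theorem exists_code {P : N → Prop} (hP : Def F (fun p : N × N => P p.2)) (b : N) :
    ∃ s, ∀ x < b, (Bit x s ↔ P x) := by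
  obtain ⟨m, hm, hd⟩ := exists_common_multiple b
  have hP' : ∀ {α : Type} [Ctx N α] (f : α → N) [DefM F f], Def F (fun a => P (f a)) :=
    fun f => Def.lift hP f
  have h : ∀ n : N, ∃ c, ∀ x, x < b → ((x < n ∧ P x) → modulus m x ∣ c) ∧
      (¬ (x < n ∧ P x) → Cop (modulus m x) c) := by
    refine ind F (P := fun n : N => ∃ c, ∀ x, x < b → ((x < n ∧ P x) → modulus m x ∣ c) ∧
      (¬ (x < n ∧ P x) → Cop (modulus m x) c)) ?_ ?_
    · refine ⟨1, fun x _ => ⟨fun h => absurd h.1 not_lt_zero, fun _ c hc => ?_⟩⟩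
      rwa [one_mul] at hc
    · rintro n ⟨c, hc⟩
      by_cases hn : n < b ∧ P n
      · refine ⟨modulus m n * c, fun x hx => ⟨fun h => ?_, fun h => ?_⟩⟩
        · rcases (ACAM.lt_add_one_iff.1 h.1).lt_or_eq with h1 | rfl
          · exact dvd_mul_of_dvd_right ((hc x hx).1 ⟨h1, h.2⟩) _
          · exact dvd_mul_right _ _
        · refine Cop.mul (cop_modulus hd hx hn.1 ?_) ((hc x hx).2 ?_)
          · rintro rfl
            exact h ⟨ACAM.lt_add_one_iff.2 le_rfl, hn.2⟩
          · exact fun h1 => h ⟨h1.1.trans (ACAM.lt_add_one_iff.2 le_rfl), h1.2⟩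
      · refine ⟨c, fun x hx => ?_⟩
        have : (x < n + 1 ∧ P x) ↔ (x < n ∧ P x) := by
          rw [ACAM.lt_add_one_iff, le_iff_lt_or_eq]
          refine ⟨fun h => ⟨h.1.resolve_right ?_, h.2⟩, fun h => ⟨Or.inl h.1, h.2⟩⟩
          rintro rfl
          exact hn ⟨hx, h.2⟩
        rw [this]
        exact hc x hx
  obtain ⟨c, hc⟩ := h b
  refine ⟨pp m c, fun x hx => ⟨?_, fun h => ⟨m, c, rfl, (hc x hx).1 ⟨hx, h⟩⟩⟩⟩
  rintro ⟨m', c', e, hdv⟩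
  obtain ⟨rfl, rfl⟩ := pp_inj.1 e
  by_contra hn
  have h1 := (hc x hx).2 (fun h => hn h.2) 1 (by rwa [mul_one])
  obtain ⟨q, hq⟩ := h1
  rcases ACAM.zero_or_succ q with rfl | ⟨q, rfl⟩
  · simp at hq
  · rw [succ_eq] at hq
    have h2 : (1 : N) + 0 = 1 + ((x + 1) * m * (q + 1) + q) := by
      rw [add_zero]; conv_lhs => rw [hq]
      unfold modulus; ring
    have h3 := add_left_cancel h2
    have h4 := ACAM.eq_zero_of_add h3.symm
    simp [hm] at h4

/-- `v` is the value at `x` of the finite function coded by `s`. -/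
def IsAp (s x v : N) : Prop := Bit (pp x v) s ∧ ∀ w < v, ¬ Bit (pp x w) s

open Classical in
/-- The value at `x` of the finite function coded by `s`. -/
noncomputable def ap (s x : N) : N := if h : ∃ v, IsAp s x v then h.choose else 0

theorem IsAp.unique {s x v w : N} (h : IsAp s x v) (h' : IsAp s x w) : v = w := by
  rcases lt_trichotomy v w with h1 | h1 | h1
  · exact absurd h.1 (h'.2 v h1)
  · exact h1
  · exact absurd h'.1 (h.2 w h1)

theorem IsAp.ap_eq {s x v : N} (h : IsAp s x v) : ap s x = v := by
  have h' : ∃ v, IsAp s x v := ⟨v, h⟩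
  rw [ap, dif_pos h']
  exact h'.choose_spec.unique h

theorem eq_ap_iff (s x v : N) :
    v = ap s x ↔ IsAp s x v ∨ ((¬ ∃ w, IsAp s x w) ∧ v = 0) := by
  by_cases h : ∃ w, IsAp s x w
  · obtain ⟨w, hw⟩ := h
    rw [hw.ap_eq]
    exact ⟨fun h => Or.inl (h ▸ hw), fun h => h.elim (fun h => h.unique hw)
      fun h => absurd ⟨w, hw⟩ h.1⟩
  · rw [ap, dif_neg h]
    exact ⟨fun e => Or.inr ⟨h, e⟩, fun e => e.elim (fun e => absurd ⟨_, e⟩ h) fun e => e.2⟩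

instance defM_ap {f g : α → N} [DefM F f] [DefM F g] : DefM F (fun a => ap (f a) (g a)) :=
  DefM.lift2 (P := ap) (DefM.of_graph (Def.congr (P := fun p : (N × N) × N =>
    (Bit (pp p.1.2 p.2) p.1.1 ∧ ∀ w < p.2, ¬ Bit (pp p.1.2 w) p.1.1) ∨
    ((¬ ∃ v, (Bit (pp p.1.2 v) p.1.1 ∧ ∀ w < v, ¬ Bit (pp p.1.2 w) p.1.1)) ∧ p.2 = 0))
    inferInstance fun p => (eq_ap_iff p.1.1 p.1.2 p.2).symm)) f g

variable (F) in
theorem exists_bound {f : N → N} (hf : DefM F (fun p : N × N => f p.2)) (n : N) :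
    ∃ b, ∀ x < n, f x < b := by
  have hf' : ∀ {α : Type} [Ctx N α] (g : α → N) [DefM F g], DefM F (fun a => f (g a)) :=
    fun g => DefM.lift hf g
  refine ind F (P := fun n : N => ∃ b, ∀ x < n, f x < b) ⟨0, by simp⟩ ?_ n
  rintro n ⟨b, hb⟩
  refine ⟨b + (f n + 1), fun x hx => ?_⟩
  rcases (ACAM.lt_add_one_iff.1 hx).lt_or_eq with h1 | rfl
  · exact (hb x h1).trans_le le_self_add
  · exact (ACAM.lt_add_one_iff.2 le_rfl).trans_le le_add_self

variable (F) in
/-- Finite restrictions of arithmetical functions have codes. -/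
theorem exists_seq {f : N → N} (hf : DefM F (fun p : N × N => f p.2)) (n : N) :
    ∃ s, ∀ x < n, ap s x = f x := by
  have hf' : ∀ {α : Type} [Ctx N α] (g : α → N) [DefM F g], DefM F (fun a => f (g a)) :=
    fun g => DefM.lift hf g
  obtain ⟨b, hb⟩ := exists_bound F (f := fun x => pp x (f x)) inferInstance n
  obtain ⟨s, hs⟩ := exists_code F (P := fun z => ∃ x, z = pp x (f x)) inferInstance b
  refine ⟨s, fun x hx => IsAp.ap_eq ⟨(hs _ (hb x hx)).2 ⟨x, rfl⟩, fun w hw h => ?_⟩⟩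
  obtain ⟨y, e⟩ := (hs _ ((pp_lt_right le_rfl hw).trans (hb x hx))).1 h
  obtain ⟨rfl, rfl⟩ := pp_inj.1 e
  exact lt_irrefl _ hw

/-! ### Recursion -/

/-- `G p x f` depends only on the values of `f` below `x`. -/
def Local (G : α → N → (N → N) → N) : Prop :=
  ∀ p x f g, (∀ y < x, f y = g y) → G p x f = G p x g

open Classical in
/-- The function defined by course-of-values recursion from `G`. -/
noncomputable def recN (G : α → N → (N → N) → N) (p : α) (x : N) : N :=
  if h : ∃ s, ∀ y, y ≤ x → ap s y = G p y (ap s) then ap h.choose x else 0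

theorem approx_unique (F : Set (Set N)) [Closed F] {G : α → N → (N → N) → N} (hl : Local G) {p : α}
    {x s t : N} (hs : ∀ y ≤ x, ap s y = G p y (ap s))
    (ht : ∀ y ≤ x, ap t y = G p y (ap t)) : ∀ y, y ≤ x → ap s y = ap t y := by
  refine sind F (P := fun y => y ≤ x → ap s y = ap t y) fun y ih hy => ?_
  rw [hs y hy, ht y hy]
  exact hl _ _ _ _ fun z hz => ih z hz (hz.le.trans hy)

theorem exists_approx (F : Set (Set N)) [Closed F] {G : α → N → (N → N) → N} (hl : Local G)
    (hG : DefM F (fun a : (α × N) × N => G a.1.1 a.1.2 (ap a.2))) (p : α) (x : N) :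
    ∃ s, ∀ y, y ≤ x → ap s y = G p y (ap s) := by
  have hG' : ∀ {β : Type} [Ctx N β] (f g : β → N) [DefM F f] [DefM F g],
      DefM F (fun a => G p (f a) (ap (g a))) := fun f g _ _ =>
    DefM.comp hG (fun a => ((p, f a), g a)) (hg := DefM.mk (hf := DefM.mk))
  refine ind F (P := fun x => ∃ s, ∀ y, y ≤ x → ap s y = G p y (ap s)) ?_ (fun x => ?_) x
  · obtain ⟨s, hs⟩ := exists_seq F (f := fun _ => G p 0 (ap 0)) inferInstance 1
    refine ⟨s, fun y hy => ?_⟩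
    obtain rfl := le_antisymm hy (zero_le (a := _))
    rw [hs 0 one_pos]
    exact hl _ _ _ _ fun z hz => absurd hz not_lt_zero
  · rintro ⟨s, hs⟩
    classical
    have hD : DefM F fun q : N × N => if q.2 ≤ x then ap s q.2 else G p (x + 1) (ap s) :=
      inferInstance
    obtain ⟨t, ht⟩ := exists_seq F (f := fun y => if y ≤ x then ap s y else G p (x + 1) (ap s))
      hD (x + 1 + 1)
    have h1 : ∀ y ≤ x, ap t y = ap s y := fun y hy => by
      rw [ht y (ACAM.lt_add_one_iff.2 (hy.trans le_self_add)), if_pos hy]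
    refine ⟨t, fun y hy => ?_⟩
    rcases hy.lt_or_eq with h | rfl
    · have hy' := ACAM.lt_add_one_iff.1 h
      rw [h1 y hy', hs y hy']
      exact hl _ _ _ _ fun z hz => (h1 z (hz.le.trans hy')).symm
    · rw [ht _ (ACAM.lt_add_one_iff.2 le_rfl), if_neg (not_le.2 (ACAM.lt_add_one_iff.2 le_rfl))]
      exact hl _ _ _ _ fun z hz => (h1 z (ACAM.lt_add_one_iff.1 hz)).symm

theorem recN_eq_ap (F : Set (Set N)) [Closed F] {G : α → N → (N → N) → N} (hl : Local G) {p : α}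
    {x s : N} (hs : ∀ y ≤ x, ap s y = G p y (ap s)) : recN G p x = ap s x := by
  have h : ∃ s, ∀ y, y ≤ x → ap s y = G p y (ap s) := ⟨s, hs⟩
  rw [recN, dif_pos h]
  exact approx_unique F hl h.choose_spec hs x le_rfl

theorem recN_eq (F : Set (Set N)) [Closed F] {G : α → N → (N → N) → N} (hl : Local G)
    (hG : DefM F (fun a : (α × N) × N => G a.1.1 a.1.2 (ap a.2))) (p : α) (x : N) :
    recN G p x = G p x (recN G p) := by
  obtain ⟨s, hs⟩ := exists_approx F hl hG p x
  rw [recN_eq_ap F hl hs, hs x le_rfl]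
  refine hl _ _ _ _ fun y hy => ?_
  rw [recN_eq_ap F hl fun z hz => hs z (hz.trans hy.le)]

theorem defM_recN {G : α → N → (N → N) → N} (hl : Local G)
    (hG : DefM F (fun a : (α × N) × N => G a.1.1 a.1.2 (ap a.2))) :
    DefM F (fun a : α × N => recN G a.1 a.2) := by
  have hG' : ∀ {β : Type} [Ctx N β] (e : β → α) (f g : β → N) [DefM F e] [DefM F f] [DefM F g],
      DefM F (fun a => G (e a) (f a) (ap (g a))) := fun e f g _ _ _ =>
    DefM.comp hG (fun a => ((e a, f a), g a)) (hg := DefM.mk (hf := DefM.mk))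
  refine DefM.of_graph (Def.congr (P := fun q : (α × N) × N =>
    ∃ s, (∀ y, y ≤ q.1.2 → ap s y = G q.1.1 y (ap s)) ∧ q.2 = ap s q.1.2) inferInstance fun q => ?_)
  constructor
  · rintro ⟨s, hs, e⟩
    rw [e, recN_eq_ap F hl hs]
  · intro e
    obtain ⟨s, hs⟩ := exists_approx F hl hG q.1.1 q.1.2
    exact ⟨s, hs, e.trans (recN_eq_ap F hl hs)⟩

end

open Classical

section
variable {F : Set (Set N)} [hF : Closed F] {α β γ δ : Type} [Ctx N α] [Ctx N β] [Ctx N γ] [Ctx N δ]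

/-- The least number with the property `P`, and `0` if there is none. -/
noncomputable def leastN (P : N → Prop) : N :=
  if h : ∃ v, P v ∧ ∀ w < v, ¬ P w then h.choose else 0

theorem least_unique {P : N → Prop} {v w : N} (h : P v ∧ ∀ u < v, ¬ P u)
    (h' : P w ∧ ∀ u < w, ¬ P u) : v = w := by
  rcases lt_trichotomy v w with h1 | h1 | h1
  · exact absurd h.1 (h'.2 v h1)
  · exact h1
  · exact absurd h'.1 (h.2 w h1)

theorem eq_leastN_iff (P : N → Prop) (v : N) : v = leastN P ↔
    (P v ∧ ∀ w < v, ¬ P w) ∨ ((¬ ∃ v, P v ∧ ∀ w < v, ¬ P w) ∧ v = 0) := by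
  by_cases h : ∃ v, P v ∧ ∀ w < v, ¬ P w
  · rw [leastN, dif_pos h]
    exact ⟨fun e => Or.inl (e ▸ h.choose_spec), fun e => e.elim
      (fun e => least_unique e h.choose_spec) fun e => absurd h e.1⟩
  · rw [leastN, dif_neg h]
    exact ⟨fun e => Or.inr ⟨h, e⟩, fun e => e.elim (fun e => absurd ⟨_, e⟩ h) fun e => e.2⟩

instance defM_leastN {P : α → N → Prop} [hP : Def F (fun p : α × N => P p.1 p.2)] :
    DefM F (fun a => leastN (P a)) := by
  have hP' : ∀ {β : Type} [Ctx N β] (f : β → α) (g : β → N) [DefM F f] [DefM F g],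
      Def F (fun a => P (f a) (g a)) := fun f g _ _ =>
    Def.comp hP (fun a => (f a, g a)) (hf := DefM.mk)
  exact DefM.of_graph (Def.congr (P := fun q : α × N => (P q.1 q.2 ∧ ∀ w < q.2, ¬ P q.1 w) ∨
    ((¬ ∃ v, P q.1 v ∧ ∀ w < v, ¬ P q.1 w) ∧ q.2 = 0)) inferInstance
    fun q => (eq_leastN_iff _ _).symm)

theorem leastN_spec (F : Set (Set N)) [Closed F] {P : N → Prop}
    [Def F (fun p : N × N => P p.2)] (h : ∃ x, P x) : P (leastN P) := by
  obtain ⟨v, hv⟩ := exists_least F h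
  rw [← (eq_leastN_iff P v).2 (Or.inl hv)]
  exact hv.1

theorem leastN_eq_of_unique {P : N → Prop} {v : N} (h : ∀ w, P w ↔ w = v) : leastN P = v := by
  refine ((eq_leastN_iff P v).2 (Or.inl ⟨(h v).2 rfl, fun w hw h' => ?_⟩)).symm
  exact hw.ne ((h w).1 h')

/-- The components of a pair. -/
noncomputable def fstN (z : N) : N := leastN fun x => ∃ y, z = pp x y

noncomputable def sndN (z : N) : N := leastN fun y => ∃ x, z = pp x y

@[simp] theorem fstN_pp (x y : N) : fstN (pp x y) = x :=
  leastN_eq_of_unique fun w => by simp only [pp_inj]; exact ⟨fun h => h.choose_spec.1.symm,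
    fun h => ⟨y, h.symm, rfl⟩⟩

@[simp] theorem sndN_pp (x y : N) : sndN (pp x y) = y :=
  leastN_eq_of_unique fun w => by simp only [pp_inj]; exact ⟨fun h => h.choose_spec.2.symm,
    fun h => ⟨x, rfl, h.symm⟩⟩

instance defM_fstN {f : α → N} [DefM F f] : DefM F (fun a => fstN (f a)) :=
  DefM.lift (P := fstN) (by unfold fstN; infer_instance) f

instance defM_sndN {f : α → N} [DefM F f] : DefM F (fun a => sndN (f a)) :=
  DefM.lift (P := sndN) (by unfold sndN; infer_instance) f

/-- The predecessor. -/
noncomputable def predN (z : N) : N := leastN fun x => z = x + 1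

@[simp] theorem predN_succ (x : N) : predN (x + 1) = x :=
  leastN_eq_of_unique fun w => by simp [eq_comm]

instance defM_predN {f : α → N} [DefM F f] : DefM F (fun a => predN (f a)) :=
  DefM.lift (P := predN) (by unfold predN; infer_instance) f

theorem eq_zero_or_succ (x : N) : x = 0 ∨ ∃ y, x = y + 1 := by
  rcases ACAM.zero_or_succ x with h | ⟨y, h⟩
  · exact Or.inl h
  · exact Or.inr ⟨y, by rw [h, succ_eq]⟩

theorem pp_zero : pp (0 : N) 0 = 0 := by simp [pp]

/-! ### Recursion on terms -/

/-- The data of a definition by recursion on term codes, with a parameter from `α`. -/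
structure TAlg (N α : Type) where
  zero : N
  var : α → N → N
  succ : N → N
  add : N → N → N
  mul : N → N → N
  junk : N → N

/-- Definability of the data. -/
class DefT (F : Set (Set N)) (a : TAlg N α) : Prop where
  var : DefM F (fun q : α × N => a.var q.1 q.2)
  succ : DefM F (fun q : N × N => a.succ q.2)
  add : DefM F (fun q : N × N => a.add q.1 q.2)
  mul : DefM F (fun q : N × N => a.mul q.1 q.2)
  junk : DefM F (fun q : N × N => a.junk q.2)

/-- The recursion step. -/
noncomputable def TAlg.step (a : TAlg N α) (p : α) (t : N) (f : N → N) : N :=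
  if t = pp 0 0 then a.zero
  else if t = pp 1 (sndN t) then a.var p (sndN t)
  else if t = pp 2 (sndN t) then a.succ (f (sndN t))
  else if t = pp 3 (pp (fstN (sndN t)) (sndN (sndN t))) then
    a.add (f (fstN (sndN t))) (f (sndN (sndN t)))
  else if t = pp 4 (pp (fstN (sndN t)) (sndN (sndN t))) then
    a.mul (f (fstN (sndN t))) (f (sndN (sndN t)))
  else a.junk t

theorem TAlg.step_local (a : TAlg N α) : Local a.step := by
  intro p t f g h
  have h2 : ∀ (j : N), 1 ≤ j → t = pp j (sndN t) → f (sndN t) = g (sndN t) := by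
    intro j hj e
    refine h _ ?_
    conv_rhs => rw [e]
    exact lt_pp_right hj _
  have h3 : ∀ (j : N), 1 ≤ j → t = pp j (pp (fstN (sndN t)) (sndN (sndN t))) →
      f (fstN (sndN t)) = g (fstN (sndN t)) ∧ f (sndN (sndN t)) = g (sndN (sndN t)) := by
    intro j hj e
    refine ⟨h _ ?_, h _ ?_⟩
    · conv_rhs => rw [e]
      exact lt_of_le_of_lt (le_pp_left _ _) (lt_pp_right hj _)
    · conv_rhs => rw [e]
      exact lt_of_le_of_lt (le_pp_right _ _) (lt_pp_right hj _)
  unfold TAlg.step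
  split_ifs with e1 e2 e3 e4 e5
  · rfl
  · rfl
  · rw [h2 2 (by norm_num) e3]
  · rw [(h3 3 (by norm_num) e4).1, (h3 3 (by norm_num) e4).2]
  · rw [(h3 4 (by norm_num) e5).1, (h3 4 (by norm_num) e5).2]
  · rfl

theorem TAlg.step_def (a : TAlg N α) [h : DefT F a] :
    DefM F (fun q : (α × N) × N => a.step q.1.1 q.1.2 (ap q.2)) := by
  have i1 : ∀ {β : Type} [Ctx N β] (f : β → α) (g : β → N) [DefM F f] [DefM F g],
    DefM F (fun q => a.var (f q) (g q)) := fun f g => DefM.lift2 h.var f g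
  have i2 : ∀ {β : Type} [Ctx N β] (f : β → N) [DefM F f],
    DefM F (fun q => a.succ (f q)) := fun f => DefM.lift h.succ f
  have i3 : ∀ {β : Type} [Ctx N β] (f g : β → N) [DefM F f] [DefM F g],
    DefM F (fun q => a.add (f q) (g q)) := fun f g => DefM.lift2 h.add f g
  have i4 : ∀ {β : Type} [Ctx N β] (f g : β → N) [DefM F f] [DefM F g],
    DefM F (fun q => a.mul (f q) (g q)) := fun f g => DefM.lift2 h.mul f g
  have i5 : ∀ {β : Type} [Ctx N β] (f : β → N) [DefM F f],
    DefM F (fun q => a.junk (f q)) := fun f => DefM.lift h.junk f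
  unfold TAlg.step
  infer_instance

/-- The function defined by recursion on term codes. -/
noncomputable def tcata (a : TAlg N α) (p : α) (t : N) : N := recN a.step p t

instance defM_tcata (a : TAlg N α) [DefT F a] {f : β → α} {g : β → N} [DefM F f] [DefM F g] :
    DefM F (fun q => tcata a (f q) (g q)) :=
  DefM.lift2 (P := tcata a) (defM_recN a.step_local a.step_def) f g

section
variable (a : TAlg N α) [DefT 𝒮 N a] (p : α)

theorem tcata_eq (t : N) : tcata a p t = a.step p t (tcata a p) :=
  recN_eq 𝒮 N a.step_local a.step_def p t

theorem tcata_zero : tcata a p (pp 0 0) = a.zero := by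
  rw [tcata_eq]; simp [TAlg.step]

theorem tcata_var (i : N) : tcata a p (pp 1 i) = a.var p i := by
  rw [tcata_eq]; simp [TAlg.step, pp_inj]

theorem tcata_succ (t : N) : tcata a p (pp 2 t) = a.succ (tcata a p t) := by
  rw [tcata_eq]; simp [TAlg.step, pp_inj]

theorem tcata_add (t u : N) : tcata a p (pp 3 (pp t u)) = a.add (tcata a p t) (tcata a p u) := by
  rw [tcata_eq]; simp [TAlg.step, pp_inj]

theorem tcata_mul (t u : N) : tcata a p (pp 4 (pp t u)) = a.mul (tcata a p t) (tcata a p u) := by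
  rw [tcata_eq]; simp [TAlg.step, pp_inj]

/-- `t` is not of the form of a term code. -/
def TJunk (t : N) : Prop := t ≠ pp 0 0 ∧ (∀ u, t ≠ pp 1 u) ∧ (∀ u, t ≠ pp 2 u) ∧
  (∀ u v, t ≠ pp 3 (pp u v)) ∧ ∀ u v, t ≠ pp 4 (pp u v)

theorem tcata_junk {t : N} (h : TJunk t) : tcata a p t = a.junk t := by
  obtain ⟨h1, h2, h3, h4, h5⟩ := h
  rw [tcata_eq, TAlg.step, if_neg h1, if_neg (h2 _), if_neg (h3 _), if_neg (h4 _ _),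
    if_neg (h5 _ _)]

end

variable (F) in
/-- Induction on term codes. -/
theorem term_ind {P : N → Prop} [Def F (fun p : N × N => P p.2)] (h0 : P (pp 0 0))
    (h1 : ∀ i, P (pp 1 i)) (h2 : ∀ t, P t → P (pp 2 t))
    (h3 : ∀ t u, P t → P u → P (pp 3 (pp t u))) (h4 : ∀ t u, P t → P u → P (pp 4 (pp t u)))
    (h5 : ∀ t, TJunk t → P t) (t : N) : P t := by
  refine sind F (P := P) (fun t ih => ?_) t
  by_cases h : TJunk t
  · exact h5 t h
  · simp only [TJunk, not_and_or, not_forall, not_not] at h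
    rcases h with rfl | ⟨u, rfl⟩ | ⟨u, rfl⟩ | ⟨u, v, rfl⟩ | ⟨u, v, rfl⟩
    · exact h0
    · exact h1 u
    · exact h2 u (ih u (lt_pp_right (by norm_num) _))
    · exact h3 u v (ih u (lt_of_le_of_lt (le_pp_left _ _) (lt_pp_right (by norm_num) _)))
        (ih v (lt_of_le_of_lt (le_pp_right _ _) (lt_pp_right (by norm_num) _)))
    · exact h4 u v (ih u (lt_of_le_of_lt (le_pp_left _ _) (lt_pp_right (by norm_num) _)))
        (ih v (lt_of_le_of_lt (le_pp_right _ _) (lt_pp_right (by norm_num) _)))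

/-! ### Recursion on formulas -/

/-- The tags of literals, binary connectives, and quantifiers. -/
def TagL (j : N) : Prop := j = 0 ∨ j = 1 ∨ j = 2 ∨ j = 3
def TagB (j : N) : Prop := j = 4 ∨ j = 5
def TagU (j : N) : Prop := j = 6 ∨ j = 7 ∨ j = 8 ∨ j = 9

instance def_tagL {f : α → N} [DefM F f] : Def F (fun a => TagL (f a)) := by
  unfold TagL; infer_instance
instance def_tagB {f : α → N} [DefM F f] : Def F (fun a => TagB (f a)) := by
  unfold TagB; infer_instance
instance def_tagU {f : α → N} [DefM F f] : Def F (fun a => TagU (f a)) := by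
  unfold TagU; infer_instance

/-- The number of number (set) quantifiers above the body of a quantifier with tag `j`. -/
noncomputable def kk (j k : N) : N := if j = 6 ∨ j = 7 then k + 1 else k
noncomputable def ll (j l : N) : N := if j = 8 ∨ j = 9 then l + 1 else l

instance defM_kk {f g : α → N} [DefM F f] [DefM F g] : DefM F (fun a => kk (f a) (g a)) := by
  unfold kk; infer_instance
instance defM_ll {f g : α → N} [DefM F f] [DefM F g] : DefM F (fun a => ll (f a) (g a)) := by
  unfold ll; infer_instance

theorem kk_le (j k : N) : kk j k ≤ k + 1 := by
  unfold kk; split_ifs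
  · exact le_rfl
  · exact le_self_add

theorem ll_le (j k : N) : ll j k ≤ k + 1 := by
  unfold ll; split_ifs
  · exact le_rfl
  · exact le_self_add

/-- The data of a definition by recursion on formula codes, with a parameter from `α`. -/
structure FAlg (N α : Type) where
  lit : α → N → N → N → N → N → N
  bin : N → N → N → N
  un : N → N → N
  junk : N → N

/-- Definability of the data. -/
class DefA (F : Set (Set N)) (a : FAlg N α) : Prop where
  lit : DefM F (fun q : ((((α × N) × N) × N) × N) × N =>
    a.lit q.1.1.1.1.1 q.1.1.1.1.2 q.1.1.1.2 q.1.1.2 q.1.2 q.2)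
  bin : DefM F (fun q : (N × N) × N => a.bin q.1.1 q.1.2 q.2)
  un : DefM F (fun q : N × N => a.un q.1 q.2)
  junk : DefM F (fun q : N × N => a.junk q.2)

/-- The recursion step for a formula code with the given components. -/
noncomputable def FAlg.stepAux (a : FAlg N α) (p : α) (x k l j b : N) (f : N → N) : N :=
  if x = pp j (pp (fstN b) (sndN b)) ∧ TagL j then a.lit p k l j (fstN b) (sndN b)
  else if x = pp j (pp (fstN b) (sndN b)) ∧ TagB j then
    a.bin j (f (pp (pp (fstN b) k) l)) (f (pp (pp (sndN b) k) l))
  else if x = pp j b ∧ TagU j then a.un j (f (pp (pp b (kk j k)) (ll j l)))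
  else a.junk x

/-- The recursion step. -/
noncomputable def FAlg.step (a : FAlg N α) (p : α) (z : N) (f : N → N) : N :=
  if z = pp (pp (fstN (fstN z)) (sndN (fstN z))) (sndN z) then
    a.stepAux p (fstN (fstN z)) (sndN (fstN z)) (sndN z) (fstN (fstN (fstN z)))
      (sndN (fstN (fstN z))) f
  else 0

theorem FAlg.step_pp (a : FAlg N α) (p : α) (x k l : N) (f : N → N) :
    a.step p (pp (pp x k) l) f = a.stepAux p x k l (fstN x) (sndN x) f := by
  simp [FAlg.step]

theorem TagB.pos {j : N} (h : TagB j) : 1 ≤ j := by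
  rcases h with rfl | rfl <;> norm_num

theorem TagU.pos {j : N} (h : TagU j) : 1 ≤ j := by
  rcases h with rfl | rfl | rfl | rfl <;> norm_num

theorem key_lt {x y k k' l l' : N} (h : x < y) (hk : k ≤ k' + 1) (hl : l ≤ l' + 1) :
    pp (pp x k) l < pp (pp y k') l' := pp_lt_left (pp_lt_left h hk) hl

theorem FAlg.step_local (a : FAlg N α) : Local a.step := by
  intro p z f g h
  unfold FAlg.step
  split_ifs with e0
  · generalize fstN (fstN z) = x at *
    generalize sndN (fstN z) = k at *
    generalize sndN z = l at *
    subst e0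
    have hk : k ≤ k + 1 := le_self_add
    have hl : l ≤ l + 1 := le_self_add
    unfold FAlg.stepAux
    split_ifs with e1 e2 e3
    · rfl
    · have hp := e2.2.pos
      congr 1 <;> refine h _ (key_lt ?_ hk hl) <;> (conv_rhs => rw [e2.1])
      · exact lt_of_le_of_lt (le_pp_left _ _) (lt_pp_right hp _)
      · exact lt_of_le_of_lt (le_pp_right _ _) (lt_pp_right hp _)
    · have hp := e3.2.pos
      congr 1
      refine h _ (key_lt ?_ (kk_le _ _) (ll_le _ _))
      conv_rhs => rw [e3.1]
      exact lt_pp_right hp _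
    · rfl
  · rfl

theorem FAlg.step_def (a : FAlg N α) [h : DefA F a] :
    DefM F (fun q : (α × N) × N => a.step q.1.1 q.1.2 (ap q.2)) := by
  have i1 : ∀ {β : Type} [Ctx N β] (f : β → α) (g1 g2 g3 g4 g5 : β → N) [DefM F f] [DefM F g1]
      [DefM F g2] [DefM F g3] [DefM F g4] [DefM F g5],
      DefM F (fun q => a.lit (f q) (g1 q) (g2 q) (g3 q) (g4 q) (g5 q)) :=
    fun f g1 g2 g3 g4 g5 => DefM.comp h.lit
      (fun q => (((((f q, g1 q), g2 q), g3 q), g4 q), g5 q)) (hg := DefM.mk (hf :=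
        DefM.mk (hf := DefM.mk (hf := DefM.mk (hf := DefM.mk)))))
  have i2 : ∀ {β : Type} [Ctx N β] (g1 g2 g3 : β → N) [DefM F g1]
      [DefM F g2] [DefM F g3], DefM F (fun q => a.bin (g1 q) (g2 q) (g3 q)) :=
    fun g1 g2 g3 => DefM.comp h.bin
      (fun q => ((g1 q, g2 q), g3 q)) (hg := DefM.mk (hf := DefM.mk))
  have i3 : ∀ {β : Type} [Ctx N β] (f g : β → N) [DefM F f] [DefM F g],
    DefM F (fun q => a.un (f q) (g q)) := fun f g => DefM.lift2 h.un f g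
  have i4 : ∀ {β : Type} [Ctx N β] (f : β → N) [DefM F f],
    DefM F (fun q => a.junk (f q)) := fun f => DefM.lift h.junk f
  unfold FAlg.step FAlg.stepAux
  infer_instance

/-- The function defined by recursion on formula codes; `k` and `l` are the numbers of number and
set quantifiers above the formula. -/
noncomputable def fcata (a : FAlg N α) (p : α) (x k l : N) : N := recN a.step p (pp (pp x k) l)

instance defM_fcata (a : FAlg N α) [DefA F a] {f : β → α} {g k l : β → N} [DefM F f] [DefM F g]
    [DefM F k] [DefM F l] : DefM F (fun q => fcata a (f q) (g q) (k q) (l q)) :=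
  DefM.lift2 (P := recN a.step) (defM_recN a.step_local a.step_def) f
    (fun q => pp (pp (g q) (k q)) (l q))

/-- `x` is not of the form of a formula code. -/
def FJunk (x : N) : Prop := (∀ j t s, TagL j → x ≠ pp j (pp t s)) ∧
  (∀ j t s, TagB j → x ≠ pp j (pp t s)) ∧ ∀ j t, TagU j → x ≠ pp j t

theorem TagB.not_tagL {j : N} (h : TagB j) : ¬ TagL j := by
  rcases h with rfl | rfl <;> simp [TagL]
theorem TagU.not_tagL {j : N} (h : TagU j) : ¬ TagL j := by
  rcases h with rfl | rfl | rfl | rfl <;> simp [TagL]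
theorem TagU.not_tagB {j : N} (h : TagU j) : ¬ TagB j := by
  rcases h with rfl | rfl | rfl | rfl <;> simp [TagB]

section
variable (a : FAlg N α) [DefA 𝒮 N a] (p : α)

theorem fcata_eq (x k l : N) : fcata a p x k l =
    a.stepAux p x k l (fstN x) (sndN x) (recN a.step p) := by
  rw [fcata, recN_eq 𝒮 N a.step_local a.step_def, FAlg.step_pp]

theorem fcata_lit {j : N} (hj : TagL j) (t s k l : N) :
    fcata a p (pp j (pp t s)) k l = a.lit p k l j t s := by
  rw [fcata_eq]; simp [FAlg.stepAux, hj]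

theorem fcata_bin {j : N} (hj : TagB j) (t s k l : N) :
    fcata a p (pp j (pp t s)) k l = a.bin j (fcata a p t k l) (fcata a p s k l) := by
  rw [fcata_eq]; simp [FAlg.stepAux, hj, hj.not_tagL, fcata]

theorem fcata_un {j : N} (hj : TagU j) (t k l : N) :
    fcata a p (pp j t) k l = a.un j (fcata a p t (kk j k) (ll j l)) := by
  rw [fcata_eq]; simp [FAlg.stepAux, hj, hj.not_tagL, hj.not_tagB, fcata]

theorem fcata_junk {x : N} (h : FJunk x) (k l : N) : fcata a p x k l = a.junk x := by
  obtain ⟨h1, h2, h3⟩ := h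
  rw [fcata_eq, FAlg.stepAux, if_neg fun e => h1 _ _ _ e.2 e.1, if_neg fun e => h2 _ _ _ e.2 e.1,
    if_neg fun e => h3 _ _ e.2 e.1]

end

variable (F) in
/-- Induction on formula codes. -/
theorem form_ind {P : N → Prop} [Def F (fun p : N × N => P p.2)]
    (h1 : ∀ j t s, TagL j → P (pp j (pp t s)))
    (h2 : ∀ j g h, TagB j → P g → P h → P (pp j (pp g h)))
    (h3 : ∀ j g, TagU j → P g → P (pp j g)) (h4 : ∀ x, FJunk x → P x) (x : N) : P x := by
  refine sind F (P := P) (fun t ih => ?_) x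
  by_cases h : FJunk t
  · exact h4 t h
  · simp only [FJunk, not_and_or, not_forall, not_not, exists_prop] at h
    rcases h with ⟨j, t, s, hj, rfl⟩ | ⟨j, t, s, hj, rfl⟩ | ⟨j, t, hj, rfl⟩
    · exact h1 j t s hj
    · exact h2 j t s hj (ih t (lt_of_le_of_lt (le_pp_left _ _) (lt_pp_right hj.pos _)))
        (ih s (lt_of_le_of_lt (le_pp_right _ _) (lt_pp_right hj.pos _)))
    · exact h3 j t hj (ih t (lt_pp_right hj.pos _))

/-! ### Association lists -/

/-- The association list `ν` updated by the value `k` at `u`. -/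
noncomputable def upd (ν u k : N) : N := pp 1 (pp (pp u k) ν)

/-- The recursion step of the lookup function. -/
noncomputable def lkStep (x ν : N) (f : N → N) : N :=
  if ν = pp 1 (pp (pp (fstN (fstN (sndN ν))) (sndN (fstN (sndN ν)))) (sndN (sndN ν))) then
    if fstN (fstN (sndN ν)) = x then sndN (fstN (sndN ν)) else f (sndN (sndN ν))
  else 0

theorem lkStep_local : Local (lkStep (N := N)) := by
  intro x ν f g h
  unfold lkStep
  split_ifs with h1 h2
  · rfl
  · refine h _ ?_
    conv_rhs => rw [h1]
    exact lt_of_le_of_lt (le_pp_right _ _) (lt_pp_right le_rfl _)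
  · rfl

theorem lkStep_def : DefM F (fun q : (N × N) × N => lkStep q.1.1 q.1.2 (ap q.2)) := by
  unfold lkStep; infer_instance

/-- The value of the association list `ν` at `x`. -/
noncomputable def lk (ν x : N) : N := recN lkStep x ν

instance defM_lk {f g : α → N} [DefM F f] [DefM F g] : DefM F (fun a => lk (f a) (g a)) :=
  DefM.lift2 (P := recN lkStep) (defM_recN lkStep_local lkStep_def) g f

instance defM_upd {f g h : α → N} [DefM F f] [DefM F g] [DefM F h] :
    DefM F (fun a => upd (f a) (g a) (h a)) := by unfold upd; infer_instance

theorem lk_upd (ν u k x : N) : lk (upd ν u k) x = if u = x then k else lk ν x := by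
  rw [lk, recN_eq 𝒮 N lkStep_local lkStep_def, lkStep]
  simp [upd, lk]

/-! ### Numerals -/

/-- The recursion step of the numeral function. -/
noncomputable def numStep (_ n : N) (f : N → N) : N :=
  if n = predN n + 1 then pp 2 (f (predN n)) else pp 0 0

theorem numStep_local : Local (numStep (N := N)) := by
  intro x n f g h
  unfold numStep
  split_ifs with h1
  · rw [h]
    conv_rhs => rw [h1]
    exact ACAM.lt_add_one_iff.2 le_rfl
  · rfl

theorem numStep_def : DefM F (fun q : (N × N) × N => numStep q.1.1 q.1.2 (ap q.2)) := by
  unfold numStep; infer_instance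

/-- The code of the `n`-th numeral. -/
noncomputable def num (n : N) : N := recN numStep 0 n

instance defM_num {f : α → N} [DefM F f] : DefM F (fun a => num (f a)) :=
  DefM.lift2 (P := recN numStep) (defM_recN numStep_local numStep_def) (fun _ => 0) f

theorem num_zero : num (0 : N) = pp 0 0 := by
  rw [num, recN_eq 𝒮 N numStep_local numStep_def, numStep,
    if_neg (fun h : (0 : N) = predN 0 + 1 => absurd h.symm (by simp))]

theorem num_succ (n : N) : num (n + 1) = pp 2 (num n) := by
  rw [num, recN_eq 𝒮 N numStep_local numStep_def, numStep]
  simp [num]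

/-! ### Terms -/

/-- Boolean values of propositions. -/
noncomputable def tv (P : Prop) : N := if P then 1 else 0

@[simp] theorem tv_eq_one {P : Prop} : tv P = (1 : N) ↔ P := by
  unfold tv; split_ifs with h <;> simp [h]

instance defM_tv {P : α → Prop} [Def F P] : DefM F (fun a => (tv (P a) : N)) := by
  unfold tv; infer_instance

noncomputable def tmAlg : TAlg N N where
  zero := 1
  var k i := tv (i < k)
  succ x := x
  add x y := tv (x = 1 ∧ y = 1)
  mul x y := tv (x = 1 ∧ y = 1)
  junk _ := 0

instance : DefT F (tmAlg : TAlg N N) := by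
  constructor <;> (unfold tmAlg; dsimp only; infer_instance)

/-- `t` is a term with variables below `k`. -/
def IsTm (k t : N) : Prop := tcata tmAlg k t = 1

instance def_isTm {f g : α → N} [DefM F f] [DefM F g] : Def F (fun a => IsTm (f a) (g a)) := by
  unfold IsTm; infer_instance

theorem isTm_zero (k : N) : IsTm k (pp 0 0) := by unfold IsTm; rw [tcata_zero]; rfl
theorem isTm_var (k i : N) : IsTm k (pp 1 i) ↔ i < k := by
  unfold IsTm; rw [tcata_var]; simp [tmAlg]
theorem isTm_succ (k t : N) : IsTm k (pp 2 t) ↔ IsTm k t := by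
  unfold IsTm; rw [tcata_succ]; simp [tmAlg]
theorem isTm_add (k t u : N) : IsTm k (pp 3 (pp t u)) ↔ IsTm k t ∧ IsTm k u := by
  unfold IsTm; rw [tcata_add]; simp [tmAlg]
theorem isTm_mul (k t u : N) : IsTm k (pp 4 (pp t u)) ↔ IsTm k t ∧ IsTm k u := by
  unfold IsTm; rw [tcata_mul]; simp [tmAlg]
theorem isTm_junk {k t : N} (h : TJunk t) : ¬ IsTm k t := by
  unfold IsTm; rw [tcata_junk _ _ h]; simp [tmAlg]

noncomputable def tshAlg : TAlg N N where
  zero := 1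
  var _ _ := 1
  succ x := x
  add x y := tv (x = 1 ∧ y = 1)
  mul x y := tv (x = 1 ∧ y = 1)
  junk _ := 0

instance : DefT F (tshAlg : TAlg N N) := by
  constructor <;> (unfold tshAlg; dsimp only; infer_instance)

/-- `t` is a term. -/
def TSh (t : N) : Prop := tcata tshAlg (0 : N) t = 1

instance def_tSh {f : α → N} [DefM F f] : Def F (fun a => TSh (f a)) := by
  unfold TSh; infer_instance

theorem tSh_zero : TSh (pp 0 0 : N) := by unfold TSh; rw [tcata_zero]; rfl
theorem tSh_var (i : N) : TSh (pp 1 i) := by unfold TSh; rw [tcata_var]; rfl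
theorem tSh_succ (t : N) : TSh (pp 2 t) ↔ TSh t := by
  unfold TSh; rw [tcata_succ]; simp [tshAlg]
theorem tSh_add (t u : N) : TSh (pp 3 (pp t u)) ↔ TSh t ∧ TSh u := by
  unfold TSh; rw [tcata_add]; simp [tshAlg]
theorem tSh_mul (t u : N) : TSh (pp 4 (pp t u)) ↔ TSh t ∧ TSh u := by
  unfold TSh; rw [tcata_mul]; simp [tshAlg]
theorem tSh_junk {t : N} (h : TJunk t) : ¬ TSh t := by
  unfold TSh; rw [tcata_junk _ _ h]; simp [tshAlg]

theorem IsTm.tSh {k t : N} : IsTm k t → TSh t := by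
  refine term_ind 𝒮 N (P := fun t => IsTm k t → TSh t) ?_ ?_ ?_ ?_ ?_ ?_ t
  · exact fun _ => tSh_zero
  · exact fun i _ => tSh_var i
  · exact fun t ih h => (tSh_succ t).2 (ih ((isTm_succ k t).1 h))
  · exact fun t u ih ih' h => (tSh_add t u).2 (((isTm_add k t u).1 h).imp ih ih')
  · exact fun t u ih ih' h => (tSh_mul t u).2 (((isTm_mul k t u).1 h).imp ih ih')
  · exact fun t ht h => absurd h (isTm_junk ht)

theorem IsTm.mono {k l t : N} (hkl : k ≤ l) : IsTm k t → IsTm l t := by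
  refine term_ind 𝒮 N (P := fun t => IsTm k t → IsTm l t) ?_ ?_ ?_ ?_ ?_ ?_ t
  · exact fun _ => isTm_zero l
  · exact fun i h => (isTm_var l i).2 (lt_of_lt_of_le ((isTm_var k i).1 h) hkl)
  · exact fun t ih h => (isTm_succ l t).2 (ih ((isTm_succ k t).1 h))
  · exact fun t u ih ih' h => (isTm_add l t u).2 (((isTm_add k t u).1 h).imp ih ih')
  · exact fun t u ih ih' h => (isTm_mul l t u).2 (((isTm_mul k t u).1 h).imp ih ih')
  · exact fun t ht h => absurd h (isTm_junk ht)

noncomputable def tevAlg : TAlg N N where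
  zero := 0
  var p i := lk p i
  succ x := x + 1
  add x y := x + y
  mul x y := x * y
  junk _ := 0

instance : DefT F (tevAlg : TAlg N N) := by
  constructor <;> (unfold tevAlg; dsimp only; infer_instance)

/-- The value of the term `t` under the assignment coded by `p`. -/
noncomputable def teval (p t : N) : N := tcata tevAlg p t

instance defM_teval {f g : α → N} [DefM F f] [DefM F g] :
    DefM F (fun a => teval (f a) (g a)) := by unfold teval; infer_instance

theorem teval_zero (p : N) : teval p (pp 0 0) = 0 := by unfold teval; rw [tcata_zero]; rfl
theorem teval_var (p i : N) : teval p (pp 1 i) = lk p i := by unfold teval; rw [tcata_var]; rfl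
theorem teval_succ (p t : N) : teval p (pp 2 t) = teval p t + 1 := by
  unfold teval; rw [tcata_succ]; rfl
theorem teval_add (p t u : N) : teval p (pp 3 (pp t u)) = teval p t + teval p u := by
  unfold teval; rw [tcata_add]; rfl
theorem teval_mul (p t u : N) : teval p (pp 4 (pp t u)) = teval p t * teval p u := by
  unfold teval; rw [tcata_mul]; rfl
theorem teval_junk {p t : N} (h : TJunk t) : teval p t = 0 := by
  unfold teval; rw [tcata_junk _ _ h]; rfl

theorem teval_congr {p q k t : N} (hpq : ∀ i < k, lk p i = lk q i) :
    IsTm k t → teval p t = teval q t := by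
  refine term_ind 𝒮 N (P := fun t => IsTm k t → teval p t = teval q t) ?_ ?_ ?_ ?_ ?_ ?_ t
  · intro _; rw [teval_zero, teval_zero]
  · intro i h; rw [teval_var, teval_var, hpq i ((isTm_var k i).1 h)]
  · intro t ih h; rw [teval_succ, teval_succ, ih ((isTm_succ k t).1 h)]
  · intro t u ih ih' h
    rw [teval_add, teval_add, ih ((isTm_add k t u).1 h).1, ih' ((isTm_add k t u).1 h).2]
  · intro t u ih ih' h
    rw [teval_mul, teval_mul, ih ((isTm_mul k t u).1 h).1, ih' ((isTm_mul k t u).1 h).2]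
  · exact fun t ht h => absurd h (isTm_junk ht)

theorem not_lt_zero' (i : N) : ¬ i < 0 := not_lt_of_ge (zero_le (a := i))

theorem teval_closed {p q t : N} (h : IsTm 0 t) : teval p t = teval q t :=
  teval_congr (fun i hi => absurd hi (not_lt_zero' i)) h

noncomputable def tsubAlg : TAlg N (N × N) where
  zero := pp 0 0
  var p i := if i = p.2 then p.1 else pp 1 i
  succ x := pp 2 x
  add x y := pp 3 (pp x y)
  mul x y := pp 4 (pp x y)
  junk t := t

instance : DefT F (tsubAlg : TAlg N (N × N)) := by
  constructor <;> (unfold tsubAlg; dsimp only; infer_instance)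

/-- The term `t` with `c` substituted for the variable `k`. -/
noncomputable def tsub (c k t : N) : N := tcata tsubAlg (c, k) t

instance defM_tsub {f g h : α → N} [DefM F f] [DefM F g] [DefM F h] :
    DefM F (fun a => tsub (f a) (g a) (h a)) := by
  have : DefM F (fun a => (f a, g a)) := DefM.mk
  unfold tsub; infer_instance

section
variable (c k : N)
theorem tsub_zero : tsub c k (pp 0 0) = pp 0 0 := by unfold tsub; rw [tcata_zero]; rfl
theorem tsub_var (i : N) : tsub c k (pp 1 i) = if i = k then c else pp 1 i := by
  unfold tsub; rw [tcata_var]; rfl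
theorem tsub_succ (t : N) : tsub c k (pp 2 t) = pp 2 (tsub c k t) := by
  unfold tsub; rw [tcata_succ]; rfl
theorem tsub_add (t u : N) : tsub c k (pp 3 (pp t u)) = pp 3 (pp (tsub c k t) (tsub c k u)) := by
  unfold tsub; rw [tcata_add]; rfl
theorem tsub_mul (t u : N) : tsub c k (pp 4 (pp t u)) = pp 4 (pp (tsub c k t) (tsub c k u)) := by
  unfold tsub; rw [tcata_mul]; rfl
theorem tsub_junk {t : N} (h : TJunk t) : tsub c k t = t := by
  unfold tsub; rw [tcata_junk _ _ h]; rfl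

theorem teval_tsub (p t : N) : teval p (tsub c k t) = teval (upd p k (teval p c)) t := by
  refine term_ind 𝒮 N
    (P := fun t => teval p (tsub c k t) = teval (upd p k (teval p c)) t) ?_ ?_ ?_ ?_ ?_ ?_ t
  · rw [tsub_zero, teval_zero, teval_zero]
  · intro i
    rw [tsub_var, teval_var, lk_upd]
    by_cases h : i = k
    · rw [if_pos h, if_pos h.symm]
    · rw [if_neg h, if_neg (Ne.symm h), teval_var]
  · intro t h; rw [tsub_succ, teval_succ, teval_succ, h]
  · intro t u h h'; rw [tsub_add, teval_add, teval_add, h, h']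
  · intro t u h h'; rw [tsub_mul, teval_mul, teval_mul, h, h']
  · intro t h; rw [tsub_junk _ _ h, teval_junk h, teval_junk h]

theorem isTm_tsub {t : N} (hc : IsTm 0 c) : IsTm (k + 1) t → IsTm k (tsub c k t) := by
  refine term_ind 𝒮 N
    (P := fun t => IsTm (k + 1) t → IsTm k (tsub c k t)) ?_ ?_ ?_ ?_ ?_ ?_ t
  · intro _; rw [tsub_zero]; exact isTm_zero k
  · intro i h
    rw [tsub_var]
    split_ifs with h1
    · exact hc.mono (zero_le (a := k))
    · rw [isTm_var] at h ⊢
      exact lt_of_le_of_ne (ACAM.lt_add_one_iff.1 h) h1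
  · intro t ih h; rw [tsub_succ, isTm_succ]; exact ih ((isTm_succ _ _).1 h)
  · intro t u ih ih' h; rw [tsub_add, isTm_add]; exact ((isTm_add _ _ _).1 h).imp ih ih'
  · intro t u ih ih' h; rw [tsub_mul, isTm_mul]; exact ((isTm_mul _ _ _).1 h).imp ih ih'
  · exact fun t ht h => absurd h (isTm_junk ht)
end

theorem isTm_num (k n : N) : IsTm k (num n) :=
  ind 𝒮 N (P := fun n => IsTm k (num n)) (by rw [num_zero]; exact isTm_zero k)
    (fun n h => by rw [num_succ, isTm_succ]; exact h) n

theorem teval_num (p n : N) : teval p (num n) = n :=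
  ind 𝒮 N (P := fun n => teval p (num n) = n) (by rw [num_zero, teval_zero])
    (fun n h => by rw [num_succ, teval_succ, h]) n

/-- A canonical term with the same values as `t`. -/
noncomputable def can (t : N) : N := leastN fun u => ∀ p, teval p u = teval p t

instance defM_can {f : α → N} [DefM F f] : DefM F (fun a => can (f a)) :=
  DefM.lift (P := can) (by unfold can; infer_instance) f

theorem teval_can (p t : N) : teval p (can t) = teval p t := by
  have : ∃ u, ∀ p, teval p u = teval p t := ⟨t, fun p => rfl⟩
  exact leastN_spec 𝒮 N (P := fun u => ∀ p, teval p u = teval p t) this p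

theorem can_eq_iff {t u : N} : can t = can u ↔ ∀ p, teval p t = teval p u := by
  refine ⟨fun h p => by rw [← teval_can, h, teval_can], fun h => ?_⟩
  unfold can
  congr 1; funext v
  simp [h]

end

/-! ### Operations on formulas -/

section
variable {F : Set (Set N)} [hF : Closed F] {α β γ δ : Type} [Ctx N α] [Ctx N β] [Ctx N γ] [Ctx N δ]

/-- Definability of functions and relations with a parameter, a counter and an argument. -/
abbrev DefM3 (F : Set (Set N)) (T : N → N → N → N) : Prop :=
  DefM F (fun q : (N × N) × N => T q.1.1 q.1.2 q.2)
abbrev Def3 (F : Set (Set N)) (T : N → N → N → Prop) : Prop :=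
  Def F (fun q : (N × N) × N => T q.1.1 q.1.2 q.2)

theorem DefM3.app {T : N → N → N → N} (h : DefM3 F T) (f g k : α → N) [DefM F f] [DefM F g]
    [DefM F k] : DefM F (fun a => T (f a) (g a) (k a)) :=
  DefM.comp h (fun a => ((f a, g a), k a)) (hg := DefM.mk (hf := DefM.mk))

theorem Def3.app {T : N → N → N → Prop} (h : Def3 F T) (f g k : α → N) [DefM F f] [DefM F g]
    [DefM F k] : Def F (fun a => T (f a) (g a) (k a)) :=
  Def.comp h (fun a => ((f a, g a), k a)) (hf := DefM.mk (hf := DefM.mk))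

/-- The tag `j`, dualized if `d` is true. -/
noncomputable def dl (d : Bool) (j : N) : N :=
  bif d then
    if j = 0 then 1 else if j = 1 then 0 else if j = 2 then 3 else if j = 3 then 2
    else if j = 4 then 5 else if j = 5 then 4 else if j = 6 then 7 else if j = 7 then 6
    else if j = 8 then 9 else if j = 9 then 8 else j
  else j

instance defM_dl {d : Bool} {f : α → N} [DefM F f] : DefM F (fun a => dl d (f a)) := by
  cases d <;> (simp only [dl, cond_true, cond_false]; infer_instance)

@[simp] theorem dl_false (j : N) : dl false j = j := rfl

theorem TagL.dl {j : N} (h : TagL j) (d : Bool) : TagL (dl d j) := by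
  cases d
  · exact h
  · rcases h with rfl | rfl | rfl | rfl <;> simp [SOA.dl, TagL]

theorem TagB.dl {j : N} (h : TagB j) (d : Bool) : TagB (dl d j) := by
  cases d
  · exact h
  · rcases h with rfl | rfl <;> simp [SOA.dl, TagB]

theorem TagU.dl {j : N} (h : TagU j) (d : Bool) : TagU (dl d j) := by
  cases d
  · exact h
  · rcases h with rfl | rfl | rfl | rfl <;> simp [SOA.dl, TagU]

/-- The tags of equations and inequations. -/
def TagE (j : N) : Prop := j = 0 ∨ j = 1

instance def_tagE {f : α → N} [DefM F f] : Def F (fun a => TagE (f a)) := by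
  unfold TagE; infer_instance

theorem tagE_dl {j : N} (h : TagL j) (d : Bool) : TagE (dl d j) ↔ TagE j := by
  cases d
  · exact Iff.rfl
  · rcases h with rfl | rfl | rfl | rfl <;> simp [SOA.dl, TagE]

theorem dl_dl {j : N} (h : TagL j ∨ TagB j ∨ TagU j) (d d' : Bool) :
    dl d (dl d' j) = dl (d ^^ d') j := by
  cases d <;> cases d' <;> try rfl
  rcases h with (rfl | rfl | rfl | rfl) | (rfl | rfl) | (rfl | rfl | rfl | rfl) <;> simp [SOA.dl]

theorem kk_dl {j : N} (h : TagU j) (d : Bool) (k : N) : kk (dl d j) k = kk j k := by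
  cases d
  · rfl
  · rcases h with rfl | rfl | rfl | rfl <;> simp [SOA.dl, kk]

theorem ll_dl {j : N} (h : TagU j) (d : Bool) (k : N) : ll (dl d j) k = ll j k := by
  cases d
  · rfl
  · rcases h with rfl | rfl | rfl | rfl <;> simp [SOA.dl, ll]

theorem kk_add (j k a : N) : kk j (k + a) = k + kk j a := by
  unfold kk; split_ifs <;> ring
theorem ll_add (j k a : N) : ll j (k + a) = k + ll j a := by
  unfold ll; split_ifs <;> ring

noncomputable def fmAlg (d : Bool) (T S : N → N → N → N) : FAlg N N where
  lit p k l j t s := pp (dl d j) (pp (T p k t) (if TagE j then T p k s else S p l s))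
  bin j x y := pp (dl d j) (pp x y)
  un j x := pp (dl d j) x
  junk x := x

instance {d : Bool} {T S : N → N → N → N} [hT : DefM3 F T] [hS : DefM3 F S] :
    DefA F (fmAlg d T S) := by
  have iT : ∀ {α : Type} [Ctx N α] (f g k : α → N) [DefM F f] [DefM F g] [DefM F k],
    DefM F (fun a => T (f a) (g a) (k a)) := fun f g k => hT.app f g k
  have iS : ∀ {α : Type} [Ctx N α] (f g k : α → N) [DefM F f] [DefM F g] [DefM F k],
    DefM F (fun a => S (f a) (g a) (k a)) := fun f g k => hS.app f g k
  constructor <;> (unfold fmAlg; dsimp only; infer_instance)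

/-- The formula `f` with the terms replaced according to `T`, the set symbols replaced according to
`S` (where `k` and `l` are the numbers of number and set quantifiers above `f`), and dualized if `d`
is true. -/
noncomputable def fmap (d : Bool) (T S : N → N → N → N) (p f k l : N) : N :=
  fcata (fmAlg d T S) p f k l

instance defM_fmap {d : Bool} {T S : N → N → N → N} [hT : DefM3 F T] [hS : DefM3 F S]
    {p f k l : α → N} [DefM F p] [DefM F f] [DefM F k] [DefM F l] :
    DefM F (fun a => fmap d T S (p a) (f a) (k a) (l a)) := by
  unfold fmap; infer_instance

section
variable (d : Bool) (T S : N → N → N → N) [hT : DefM3 𝒮 N T] [hS : DefM3 𝒮 N S]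
  (p k l : N)

theorem fmap_lit {j : N} (hj : TagL j) (t s : N) : fmap d T S p (pp j (pp t s)) k l =
    pp (dl d j) (pp (T p k t) (if TagE j then T p k s else S p l s)) := by
  unfold fmap; rw [fcata_lit _ _ hj]; rfl

theorem fmap_bin {j : N} (hj : TagB j) (g h : N) : fmap d T S p (pp j (pp g h)) k l =
    pp (dl d j) (pp (fmap d T S p g k l) (fmap d T S p h k l)) := by
  unfold fmap; rw [fcata_bin _ _ hj]; rfl

theorem fmap_un {j : N} (hj : TagU j) (g : N) : fmap d T S p (pp j g) k l =
    pp (dl d j) (fmap d T S p g (kk j k) (ll j l)) := by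
  unfold fmap; rw [fcata_un _ _ hj]; rfl

end

noncomputable def wfAlg (T S : N → N → N → Prop) : FAlg N N where
  lit p k l j t s := tv (T p k t ∧ (TagE j → T p k s) ∧ (¬ TagE j → S p l s))
  bin _ x y := tv (x = 1 ∧ y = 1)
  un _ x := x
  junk _ := 0

instance {T S : N → N → N → Prop} [hT : Def3 F T] [hS : Def3 F S] :
    DefA F (wfAlg T S) := by
  have iT : ∀ {α : Type} [Ctx N α] (f g k : α → N) [DefM F f] [DefM F g] [DefM F k],
    Def F (fun a => T (f a) (g a) (k a)) := fun f g k => hT.app f g k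
  have iS : ∀ {α : Type} [Ctx N α] (f g k : α → N) [DefM F f] [DefM F g] [DefM F k],
    Def F (fun a => S (f a) (g a) (k a)) := fun f g k => hS.app f g k
  constructor <;> (unfold wfAlg; dsimp only; infer_instance)

/-- `f` is a formula code all of whose terms satisfy `T`, and all of whose set symbols satisfy
`S`. -/
def Wf (T S : N → N → N → Prop) (p f k l : N) : Prop := fcata (wfAlg T S) p f k l = 1

instance def_wf {T S : N → N → N → Prop} [hT : Def3 F T] [hS : Def3 F S]
    {p f k l : α → N} [DefM F p] [DefM F f] [DefM F k] [DefM F l] :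
    Def F (fun a => Wf T S (p a) (f a) (k a) (l a)) := by
  unfold Wf; infer_instance

section
variable (T S : N → N → N → Prop) [hT : Def3 𝒮 N T] [hS : Def3 𝒮 N S] (p k l : N)

theorem wf_lit {j : N} (hj : TagL j) (t s : N) : Wf T S p (pp j (pp t s)) k l ↔
    T p k t ∧ (TagE j → T p k s) ∧ (¬ TagE j → S p l s) := by
  unfold Wf; rw [fcata_lit _ _ hj]; simp [wfAlg]

theorem wf_bin {j : N} (hj : TagB j) (g h : N) : Wf T S p (pp j (pp g h)) k l ↔
    Wf T S p g k l ∧ Wf T S p h k l := by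
  unfold Wf; rw [fcata_bin _ _ hj]; simp [wfAlg]

theorem wf_un {j : N} (hj : TagU j) (g : N) : Wf T S p (pp j g) k l ↔
    Wf T S p g (kk j k) (ll j l) := by
  unfold Wf; rw [fcata_un _ _ hj]; simp [wfAlg]

theorem wf_junk {x : N} (hx : FJunk x) : ¬ Wf T S p x k l := by
  unfold Wf; rw [fcata_junk _ _ hx]; simp [wfAlg]

end

variable {T S : N → N → N → Prop} [hT : Def3 𝒮 N T] [hS : Def3 𝒮 N S]

/-- Induction on well-formed formulas. -/
theorem wf_ind {p k l : N} {P : N → N → N → Prop}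
    [hP : Def 𝒮 N (fun q : (N × N) × N => P q.1.1 q.1.2 q.2)]
    (h1 : ∀ j t s a b : N, TagL j → T p (k + a) t → (TagE j → T p (k + a) s) →
      (¬ TagE j → S p (l + b) s) → P (pp j (pp t s)) a b)
    (h2 : ∀ j g h a b : N, TagB j → P g a b → P h a b → P (pp j (pp g h)) a b)
    (h3 : ∀ j g a b : N, TagU j → P g (kk j a) (ll j b) → P (pp j g) a b)
    {f a b : N} (hf : Wf T S p f (k + a) (l + b)) : P f a b := by
  have iP : ∀ {α : Type} [Ctx N α] (f g k : α → N) [DefM 𝒮 N f] [DefM 𝒮 N g]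
    [DefM 𝒮 N k], Def 𝒮 N (fun a => P (f a) (g a) (k a)) := fun f g k => Def3.app hP f g k
  refine form_ind 𝒮 N (P := fun f => ∀ a b, Wf T S p f (k + a) (l + b) → P f a b)
    ?_ ?_ ?_ ?_ f a b hf
  · intro j t s hj a b h
    rw [wf_lit _ _ _ _ _ hj] at h
    exact h1 j t s a b hj h.1 h.2.1 h.2.2
  · intro j g h hj ih ih' a b hf
    rw [wf_bin _ _ _ _ _ hj] at hf
    exact h2 j g h a b hj (ih a b hf.1) (ih' a b hf.2)
  · intro j g hj ih a b hf
    rw [wf_un _ _ _ _ _ hj, kk_add, ll_add] at hf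
    exact h3 j g a b hj (ih _ _ hf)
  · intro x hx a b hf
    exact absurd hf (wf_junk _ _ _ _ _ hx)

theorem Wf.cases {p k l f : N} (hf : Wf T S p f k l) :
    (∃ j t s, TagL j ∧ f = pp j (pp t s) ∧ T p k t ∧ (TagE j → T p k s) ∧ (¬ TagE j → S p l s)) ∨
    (∃ j g h, TagB j ∧ f = pp j (pp g h) ∧ Wf T S p g k l ∧ Wf T S p h k l) ∨
    (∃ j g, TagU j ∧ f = pp j g ∧ Wf T S p g (kk j k) (ll j l)) := by
  by_cases h : FJunk f
  · exact absurd hf (wf_junk _ _ _ _ _ h)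
  · simp only [FJunk, not_and_or, not_forall, not_not, exists_prop] at h
    rcases h with ⟨j, t, s, hj, rfl⟩ | ⟨j, t, s, hj, rfl⟩ | ⟨j, t, hj, rfl⟩
    · exact Or.inl ⟨j, t, s, hj, rfl, (wf_lit _ _ _ _ _ hj _ _).1 hf⟩
    · exact Or.inr (Or.inl ⟨j, t, s, hj, rfl, (wf_bin _ _ _ _ _ hj _ _).1 hf⟩)
    · exact Or.inr (Or.inr ⟨j, t, hj, rfl, (wf_un _ _ _ _ _ hj _).1 hf⟩)

theorem wf_fmap {T' S' : N → N → N → Prop} [Def3 𝒮 N T'] [Def3 𝒮 N S']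
    {T1 S1 : N → N → N → N} [DefM3 𝒮 N T1] [DefM3 𝒮 N S1] (d : Bool)
    {p q p' f k l k1 l1 k' l' : N}
    (hT : ∀ a t, T p (k + a) t → T' p' (k' + a) (T1 q (k1 + a) t))
    (hS : ∀ b s, S p (l + b) s → S' p' (l' + b) (S1 q (l1 + b) s)) (hf : Wf T S p f k l) :
    Wf T' S' p' (fmap d T1 S1 q f k1 l1) k' l' := by
  have := wf_ind (T := T) (S := S) (p := p) (k := k) (l := l) (f := f) (a := 0) (b := 0)
    (P := fun f a b => Wf T' S' p' (fmap d T1 S1 q f (k1 + a) (l1 + b)) (k' + a) (l' + b))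
    ?_ ?_ ?_ (by simpa using hf)
  · simpa using this
  · intro j t s a b hj h1 h2 h3
    rw [fmap_lit _ _ _ _ _ _ hj, wf_lit _ _ _ _ _ (hj.dl d), tagE_dl hj]
    refine ⟨hT _ _ h1, fun h => ?_, fun h => ?_⟩
    · rw [if_pos h]; exact hT _ _ (h2 h)
    · rw [if_neg h]; exact hS _ _ (h3 h)
  · intro j g h a b hj ih ih'
    rw [fmap_bin _ _ _ _ _ _ hj, wf_bin _ _ _ _ _ (hj.dl d)]
    exact ⟨ih, ih'⟩
  · intro j g a b hj ih
    rw [fmap_un _ _ _ _ _ _ hj, wf_un _ _ _ _ _ (hj.dl d), kk_dl hj, ll_dl hj]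
    simpa only [kk_add, ll_add] using ih

theorem fmap_fmap {T1 S1 T2 S2 T3 S3 : N → N → N → N} [DefM3 𝒮 N T1] [DefM3 𝒮 N S1]
    [DefM3 𝒮 N T2] [DefM3 𝒮 N S2] [DefM3 𝒮 N T3] [DefM3 𝒮 N S3]
    {d1 d2 : Bool} {p q1 q2 q3 f k l k1 l1 k2 l2 k3 l3 : N}
    (hT : ∀ a t, T p (k + a) t → T2 q2 (k2 + a) (T1 q1 (k1 + a) t) = T3 q3 (k3 + a) t)
    (hS : ∀ b s, S p (l + b) s → S2 q2 (l2 + b) (S1 q1 (l1 + b) s) = S3 q3 (l3 + b) s)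
    (hf : Wf T S p f k l) :
    fmap d2 T2 S2 q2 (fmap d1 T1 S1 q1 f k1 l1) k2 l2 = fmap (d2 ^^ d1) T3 S3 q3 f k3 l3 := by
  have := wf_ind (T := T) (S := S) (p := p) (k := k) (l := l) (f := f) (a := 0) (b := 0)
    (P := fun f a b => fmap d2 T2 S2 q2 (fmap d1 T1 S1 q1 f (k1 + a) (l1 + b)) (k2 + a) (l2 + b) =
      fmap (d2 ^^ d1) T3 S3 q3 f (k3 + a) (l3 + b))
    ?_ ?_ ?_ (by simpa using hf)
  · simpa using this
  · intro j t s a b hj h1 h2 h3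
    rw [fmap_lit _ _ _ _ _ _ hj, fmap_lit _ _ _ _ _ _ (hj.dl d1), fmap_lit _ _ _ _ _ _ hj,
      tagE_dl hj, dl_dl (Or.inl hj), hT _ _ h1]
    split_ifs with h
    · rw [hT _ _ (h2 h)]
    · rw [hS _ _ (h3 h)]
  · intro j g h a b hj ih ih'
    rw [fmap_bin _ _ _ _ _ _ hj, fmap_bin _ _ _ _ _ _ (hj.dl d1), fmap_bin _ _ _ _ _ _ hj,
      dl_dl (Or.inr (Or.inl hj)), ih, ih']
  · intro j g a b hj ih
    rw [fmap_un _ _ _ _ _ _ hj, fmap_un _ _ _ _ _ _ (hj.dl d1), fmap_un _ _ _ _ _ _ hj,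
      dl_dl (Or.inr (Or.inr hj)), kk_dl hj, ll_dl hj]
    simp only [kk_add, ll_add]
    rw [ih]

theorem fmap_congr {T1 S1 T3 S3 : N → N → N → N} [DefM3 𝒮 N T1] [DefM3 𝒮 N S1]
    [DefM3 𝒮 N T3] [DefM3 𝒮 N S3]
    {d : Bool} {p q1 q3 f k l k1 l1 k3 l3 : N}
    (hT : ∀ a t, T p (k + a) t → T1 q1 (k1 + a) t = T3 q3 (k3 + a) t)
    (hS : ∀ b s, S p (l + b) s → S1 q1 (l1 + b) s = S3 q3 (l3 + b) s)
    (hf : Wf T S p f k l) :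
    fmap d T1 S1 q1 f k1 l1 = fmap d T3 S3 q3 f k3 l3 := by
  have := wf_ind (T := T) (S := S) (p := p) (k := k) (l := l) (f := f) (a := 0) (b := 0)
    (P := fun f a b => fmap d T1 S1 q1 f (k1 + a) (l1 + b) =
      fmap d T3 S3 q3 f (k3 + a) (l3 + b))
    ?_ ?_ ?_ (by simpa using hf)
  · simpa using this
  · intro j t s a b hj h1 h2 h3
    rw [fmap_lit _ _ _ _ _ _ hj, fmap_lit _ _ _ _ _ _ hj, hT _ _ h1]
    split_ifs with h
    · rw [hT _ _ (h2 h)]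
    · rw [hS _ _ (h3 h)]
  · intro j g h a b hj ih ih'
    rw [fmap_bin _ _ _ _ _ _ hj, fmap_bin _ _ _ _ _ _ hj, ih, ih']
  · intro j g a b hj ih
    rw [fmap_un _ _ _ _ _ _ hj, fmap_un _ _ _ _ _ _ hj]
    simp only [kk_add, ll_add]
    rw [ih]

/-- The identity as a replacement. -/
def idT (_ _ t : N) : N := t

instance defM3_idT : DefM3 F (idT : N → N → N → N) := by unfold idT; infer_instance

theorem fmap_id {T1 S1 : N → N → N → N} [DefM3 𝒮 N T1] [DefM3 𝒮 N S1]
    {p q f k l k1 l1 : N} (hT : ∀ a t, T p (k + a) t → T1 q (k1 + a) t = t)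
    (hS : ∀ b s, S p (l + b) s → S1 q (l1 + b) s = s) (hf : Wf T S p f k l) :
    fmap false T1 S1 q f k1 l1 = f := by
  have := wf_ind (T := T) (S := S) (p := p) (k := k) (l := l) (f := f) (a := 0) (b := 0)
    (P := fun f a b => fmap false T1 S1 q f (k1 + a) (l1 + b) = f)
    ?_ ?_ ?_ (by simpa using hf)
  · simpa using this
  · intro j t s a b hj h1 h2 h3
    rw [fmap_lit _ _ _ _ _ _ hj, hT _ _ h1, dl_false]
    split_ifs with h
    · rw [hT _ _ (h2 h)]
    · rw [hS _ _ (h3 h)]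
  · intro j g h a b hj ih ih'
    rw [fmap_bin _ _ _ _ _ _ hj, ih, ih', dl_false]
  · intro j g a b hj ih
    rw [fmap_un _ _ _ _ _ _ hj, dl_false, kk_add, ll_add, ih]

theorem Wf.imp {T' S' : N → N → N → Prop} [Def3 𝒮 N T'] [Def3 𝒮 N S']
    {p p' f k l k' l' : N} (hf : Wf T S p f k l)
    (hT : ∀ a t, T p (k + a) t → T' p' (k' + a) t)
    (hS : ∀ b s, S p (l + b) s → S' p' (l' + b) s) : Wf T' S' p' f k' l' := by
  have := wf_fmap (T1 := idT) (S1 := idT) (q := 0) (k1 := 0) (l1 := 0) (T' := T') (S' := S')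
    (p' := p') (k' := k') (l' := l') false hT hS hf
  rwa [fmap_id (fun _ _ _ => rfl) (fun _ _ _ => rfl) hf] at this

theorem wf_of_fmap {T' S' T'' S'' : N → N → N → Prop} [Def3 𝒮 N T'] [Def3 𝒮 N S']
    [Def3 𝒮 N T''] [Def3 𝒮 N S'']
    {T1 S1 : N → N → N → N} [DefM3 𝒮 N T1] [DefM3 𝒮 N S1] {d : Bool}
    {p q p' p'' f k l k1 l1 k' l' k'' l'' : N} (hf : Wf T S p f k l)
    (hT : ∀ a t, T p (k + a) t → T' p' (k' + a) (T1 q (k1 + a) t) → T'' p'' (k'' + a) t)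
    (hS : ∀ b s, S p (l + b) s → S' p' (l' + b) (S1 q (l1 + b) s) → S'' p'' (l'' + b) s)
    (h : Wf T' S' p' (fmap d T1 S1 q f k1 l1) k' l') : Wf T'' S'' p'' f k'' l'' := by
  have := wf_ind (T := T) (S := S) (p := p) (k := k) (l := l) (f := f) (a := 0) (b := 0)
    (P := fun f a b => Wf T' S' p' (fmap d T1 S1 q f (k1 + a) (l1 + b)) (k' + a) (l' + b) →
      Wf T'' S'' p'' f (k'' + a) (l'' + b))
    ?_ ?_ ?_ (by simpa using hf)
  · simpa using this (by simpa using h)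
  · intro j t s a b hj h1 h2 h3
    rw [fmap_lit _ _ _ _ _ _ hj, wf_lit _ _ _ _ _ (hj.dl d), tagE_dl hj, wf_lit _ _ _ _ _ hj]
    rintro ⟨h4, h5, h6⟩
    refine ⟨hT _ _ h1 h4, fun h => hT _ _ (h2 h) ?_, fun h => hS _ _ (h3 h) ?_⟩
    · have := h5 h; rwa [if_pos h] at this
    · have := h6 h; rwa [if_neg h] at this
  · intro j g h a b hj ih ih'
    rw [fmap_bin _ _ _ _ _ _ hj, wf_bin _ _ _ _ _ (hj.dl d), wf_bin _ _ _ _ _ hj]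
    exact fun h => h.imp ih ih'
  · intro j g a b hj ih
    rw [fmap_un _ _ _ _ _ _ hj, wf_un _ _ _ _ _ (hj.dl d), wf_un _ _ _ _ _ hj, kk_dl hj, ll_dl hj]
    simpa only [kk_add, ll_add] using ih

/-- Conjunction of relations. -/
def andT (A B : N → N → N → Prop) (p l s : N) : Prop := A p l s ∧ B p l s

instance def3_andT {A B : N → N → N → Prop} [Def3 F A] [Def3 F B] : Def3 F (andT A B) :=
  Def.and

theorem Wf.and {T' S' : N → N → N → Prop} [Def3 𝒮 N T'] [Def3 𝒮 N S'] {p f k l : N}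
    (h : Wf T S p f k l) (h' : Wf T' S' p f k l) : Wf (andT T T') (andT S S') p f k l := by
  refine wf_of_fmap (T1 := idT) (S1 := idT) (q := 0) (k1 := 0) (l1 := 0) (d := false)
    (T' := T') (S' := S') (p' := p) (k' := k) (l' := l) h
    (fun a t h1 h2 => ⟨h1, h2⟩) (fun b s h1 h2 => ⟨h1, h2⟩) ?_
  rw [fmap_id (fun _ _ _ => rfl) (fun _ _ _ => rfl) h]
  exact h'

/-- Everything. -/
def topT (_ _ _ : N) : Prop := True

instance def3_topT : Def3 F (topT : N → N → N → Prop) := by unfold topT; infer_instance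

/-- `f` has the shape of a formula. -/
def Shape (f : N) : Prop := Wf topT topT 0 f 0 0

instance def_shape {f : α → N} [DefM F f] : Def F (fun a => Shape (f a)) := by
  unfold Shape; infer_instance

theorem Wf.shape {p f k l : N} (hf : Wf T S p f k l) : Shape f :=
  hf.imp (fun _ _ _ => trivial) (fun _ _ _ => trivial)

theorem Shape.wf {p f k l : N} (hf : Shape f) : Wf topT topT p f k l :=
  Wf.imp hf (fun _ _ _ => trivial) (fun _ _ _ => trivial)

theorem Shape.cases {f : N} (hf : Shape f) :
    (∃ j t s, TagL j ∧ f = pp j (pp t s)) ∨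
    (∃ j g h, TagB j ∧ f = pp j (pp g h) ∧ Shape g ∧ Shape h) ∨
    (∃ j g, TagU j ∧ f = pp j g ∧ Shape g) := by
  rcases Wf.cases hf with ⟨j, t, s, h1, h2, -⟩ | ⟨j, g, h, h1, h2, h3, h4⟩ | ⟨j, g, h1, h2, h3⟩
  · exact Or.inl ⟨j, t, s, h1, h2⟩
  · exact Or.inr (Or.inl ⟨j, g, h, h1, h2, h3, h4⟩)
  · exact Or.inr (Or.inr ⟨j, g, h1, h2, h3.shape⟩)

theorem shape_bin {j g h : N} (hj : TagB j) : Shape (pp j (pp g h)) ↔ Shape g ∧ Shape h :=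
  wf_bin _ _ _ _ _ hj _ _

theorem shape_un {j g : N} (hj : TagU j) : Shape (pp j g) ↔ Shape g := by
  unfold Shape
  rw [wf_un _ _ _ _ _ hj]
  exact ⟨fun h => Wf.shape h, fun h => Shape.wf h⟩

theorem shape_lit {j t s : N} (hj : TagL j) : Shape (pp j (pp t s)) :=
  (wf_lit _ _ _ _ _ hj _ _).2 ⟨trivial, fun _ => trivial, fun _ => trivial⟩

theorem shape_fmap {T1 S1 : N → N → N → N} [DefM3 𝒮 N T1] [DefM3 𝒮 N S1] {d : Bool}
    {q f k l : N} (hf : Shape f) : Shape (fmap d T1 S1 q f k l) :=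
  wf_fmap d (fun _ _ _ => trivial) (fun _ _ _ => trivial) hf

theorem shape_ind {P : N → Prop} [hP : Def 𝒮 N (fun q : N × N => P q.2)]
    (h1 : ∀ j t s : N, TagL j → P (pp j (pp t s)))
    (h2 : ∀ j g h : N, TagB j → Shape g → Shape h → P g → P h → P (pp j (pp g h)))
    (h3 : ∀ j g : N, TagU j → Shape g → P g → P (pp j g)) {f : N} (hf : Shape f) : P f := by
  have hP' : ∀ {α : Type} [Ctx N α] (f : α → N) [DefM 𝒮 N f], Def 𝒮 N (fun a => P (f a)) :=
    fun f => Def.lift hP f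
  refine form_ind 𝒮 N (P := fun f => Shape f → P f) ?_ ?_ ?_ ?_ f hf
  · exact fun j t s hj _ => h1 j t s hj
  · intro j g h hj ih ih' hf
    rw [shape_bin hj] at hf
    exact h2 j g h hj hf.1 hf.2 (ih hf.1) (ih' hf.2)
  · intro j g hj ih hf
    rw [shape_un hj] at hf
    exact h3 j g hj hf (ih hf)
  · intro x hx hf
    exact absurd hf (wf_junk _ _ _ _ _ hx)

end

section
variable {F : Set (Set N)} [hF : Closed F] {α β γ δ : Type} [Ctx N α] [Ctx N β] [Ctx N γ] [Ctx N δ]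

/-! ### Negation and instantiation -/

/-- The negation of a formula. -/
noncomputable def neg (f : N) : N := fmap true idT idT 0 f 0 0

instance defM_neg {f : α → N} [DefM F f] : DefM F (fun a => neg (f a)) := by
  unfold neg; infer_instance

theorem idT_idT (p q k l t : N) : idT p k (idT q l t) = idT p k t := rfl

theorem fmap_idT_counters (d : Bool) {f : N} (hf : Shape f) (p q k l k' l' : N) :
    fmap d idT idT p f k l = fmap d idT idT q f k' l' :=
  fmap_congr (T := topT) (S := topT) (p := 0) (k := 0) (l := 0)
    (fun _ _ _ => rfl) (fun _ _ _ => rfl) hf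

theorem neg_lit {j : N} (hj : TagL j) (t s : N) : neg (pp j (pp t s)) = pp (dl true j) (pp t s) := by
  unfold neg; rw [fmap_lit _ _ _ _ _ _ hj]; simp [idT]

theorem neg_bin {j : N} (hj : TagB j) (g h : N) :
    neg (pp j (pp g h)) = pp (dl true j) (pp (neg g) (neg h)) := by
  unfold neg; rw [fmap_bin _ _ _ _ _ _ hj]

theorem neg_un {j : N} (hj : TagU j) {g : N} (hg : Shape g) :
    neg (pp j g) = pp (dl true j) (neg g) := by
  unfold neg; rw [fmap_un _ _ _ _ _ _ hj, fmap_idT_counters true hg 0 0 _ _ 0 0]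

theorem neg_neg' {f : N} (hf : Shape f) : neg (neg f) = f := by
  unfold neg
  rw [fmap_fmap (T3 := idT) (S3 := idT) (q3 := 0) (k3 := 0) (l3 := 0)
    (T := topT) (S := topT) (p := 0) (k := 0) (l := 0) (fun _ _ _ => rfl) (fun _ _ _ => rfl) hf]
  exact fmap_id (fun _ _ _ => rfl) (fun _ _ _ => rfl) hf

/-- The set symbol `r` in place of the bound variable `l`. -/
noncomputable def setS (r l s : N) : N := if s = pp 0 l then r else s

instance defM3_setS : DefM3 F (setS : N → N → N → N) := by unfold setS; infer_instance
instance defM3_tsub : DefM3 F (tsub : N → N → N → N) := inferInstance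

/-- The body of a number quantifier, instantiated by the closed term `c`. -/
noncomputable def inst (c f : N) : N := fmap false tsub idT c f 0 0

/-- The body of a set quantifier, instantiated by the symbol `r`. -/
noncomputable def inst2 (r f : N) : N := fmap false idT setS r f 0 0

instance defM_inst {f g : α → N} [DefM F f] [DefM F g] : DefM F (fun a => inst (f a) (g a)) := by
  unfold inst; infer_instance
instance defM_inst2 {f g : α → N} [DefM F f] [DefM F g] : DefM F (fun a => inst2 (f a) (g a)) := by
  unfold inst2; infer_instance

/-! ### Formulas and sentences -/

def tmT (_ k t : N) : Prop := IsTm k t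
instance def3_tmT : Def3 F (tmT : N → N → N → Prop) := by unfold tmT; infer_instance

/-- `i` is an index of the family `Y`. -/
def dom (Y : Set N) (i : N) : Prop := pp i 0 ∈ Y
/-- `x` belongs to the set with the index `i` in the family `Y`. -/
def sec (Y : Set N) (i x : N) : Prop := pp i (x + 1) ∈ Y

instance def_dom {Y : Set N} [Fact (Y ∈ F)] {f : α → N} [DefM F f] :
    Def F (fun a => dom Y (f a)) := by unfold dom; infer_instance
instance def_sec {Y : Set N} [Fact (Y ∈ F)] {f g : α → N} [DefM F f] [DefM F g] :
    Def F (fun a => sec Y (f a) (g a)) := by unfold sec; infer_instance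

/-- `s` is a symbol for a bound set variable, a free set variable (if `fr`) or a set constant. -/
def symT (fr : Prop) (Y : Set N) (_ l s : N) : Prop :=
  (∃ i, i < l ∧ s = pp 0 i) ∨ (fr ∧ ∃ i, s = pp 1 i) ∨ ∃ i, s = pp 2 i ∧ dom Y i

instance def3_symT {fr : Prop} {Y : Set N} [Fact (Y ∈ F)] : Def3 F (symT fr Y) := by
  unfold symT; infer_instance

/-- `f` is a formula over `Y`, without free set variables unless `fr`. -/
def FmK (fr : Prop) (Y : Set N) (f k l : N) : Prop := Wf tmT (symT fr Y) 0 f k l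

/-- `f` is a formula over `Y` without free number variables. -/
def IsFm (Y : Set N) (f : N) : Prop := FmK True Y f 0 0
/-- `f` is a sentence over `Y`. -/
def Sent (Y : Set N) (f : N) : Prop := FmK False Y f 0 0

instance def_fmK {fr : Prop} {Y : Set N} [Fact (Y ∈ F)] {f k l : α → N} [DefM F f] [DefM F k]
    [DefM F l] : Def F (fun a => FmK fr Y (f a) (k a) (l a)) := by unfold FmK; infer_instance
instance def_isFm {Y : Set N} [Fact (Y ∈ F)] {f : α → N} [DefM F f] :
    Def F (fun a => IsFm Y (f a)) := by unfold IsFm; infer_instance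
instance def_sent {Y : Set N} [Fact (Y ∈ F)] {f : α → N} [DefM F f] :
    Def F (fun a => Sent Y (f a)) := by unfold Sent; infer_instance

section
variable {fr : Prop} {Y : Set N} [hY : Fact (Y ∈ 𝒮 N)]

theorem FmK.shape {f k l : N} (h : FmK fr Y f k l) : Shape f := Wf.shape h

theorem fmK_neg {f k l : N} (h : FmK fr Y f k l) : FmK fr Y (neg f) k l :=
  wf_fmap true (fun _ _ h => h) (fun _ _ h => h) h

theorem fmK_inst {f k l c : N} (hc : IsTm 0 c) (h : FmK fr Y f (k + 1) l) :
    FmK fr Y (fmap false tsub idT c f k l) k l := by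
  refine wf_fmap false (fun a t (ht : IsTm _ _) => ?_) (fun _ _ h => h) h
  refine isTm_tsub c _ hc ?_
  convert ht using 1; ring

theorem fmK_inst2 {f k l r : N} (hr : ∀ l, symT fr Y 0 l r) (h : FmK fr Y f k (l + 1)) :
    FmK fr Y (fmap false idT setS r f k l) k l := by
  refine wf_fmap false (fun a t h => h) (fun b s hs => ?_) h
  unfold setS
  split_ifs with h1
  · exact hr _
  · rcases hs with ⟨i, hi, rfl⟩ | hs | hs
    · refine Or.inl ⟨i, lt_of_le_of_ne (ACAM.lt_add_one_iff.1 (lt_of_lt_of_eq hi (by ring)))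
        fun e => h1 (by rw [e]), rfl⟩
    · exact Or.inr (Or.inl hs)
    · exact Or.inr (Or.inr hs)

theorem tagU_cases {j : N} (hj : TagU j) : (j = 6 ∨ j = 7) ∨ j = 8 ∨ j = 9 := by
  unfold TagU at hj; tauto

theorem fmK_lit {j t s k l : N} (hj : TagL j) : FmK fr Y (pp j (pp t s)) k l ↔
    IsTm k t ∧ (TagE j → IsTm k s) ∧ (¬ TagE j → symT fr Y 0 l s) := wf_lit _ _ _ _ _ hj _ _

theorem fmK_bin {j g h k l : N} (hj : TagB j) : FmK fr Y (pp j (pp g h)) k l ↔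
    FmK fr Y g k l ∧ FmK fr Y h k l := wf_bin _ _ _ _ _ hj _ _

theorem kk_num {j : N} (hj : j = 6 ∨ j = 7) (k : N) : kk j k = k + 1 := if_pos hj
theorem ll_num {j : N} (hj : j = 6 ∨ j = 7) (k : N) : ll j k = k := by
  unfold ll; rcases hj with rfl | rfl <;> simp
theorem kk_set {j : N} (hj : j = 8 ∨ j = 9) (k : N) : kk j k = k := by
  unfold kk; rcases hj with rfl | rfl <;> simp
theorem ll_set {j : N} (hj : j = 8 ∨ j = 9) (k : N) : ll j k = k + 1 := if_pos hj

theorem tagU_num {j : N} (hj : j = 6 ∨ j = 7) : TagU j := by unfold TagU; tauto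
theorem tagU_set {j : N} (hj : j = 8 ∨ j = 9) : TagU j := by unfold TagU; tauto

theorem fmK_num {j g k l : N} (hj : j = 6 ∨ j = 7) : FmK fr Y (pp j g) k l ↔
    FmK fr Y g (k + 1) l := by
  unfold FmK; rw [wf_un _ _ _ _ _ (tagU_num hj), kk_num hj, ll_num hj]

theorem fmK_set {j g k l : N} (hj : j = 8 ∨ j = 9) : FmK fr Y (pp j g) k l ↔
    FmK fr Y g k (l + 1) := by
  unfold FmK; rw [wf_un _ _ _ _ _ (tagU_set hj), kk_set hj, ll_set hj]

theorem fmK_inst_body {j g c : N} (hj : j = 6 ∨ j = 7) (hc : IsTm 0 c)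
    (h : FmK fr Y (pp j g) 0 0) : FmK fr Y (inst c g) 0 0 :=
  fmK_inst hc ((fmK_num hj).1 h)

theorem fmK_inst2_body {j g r : N} (hj : j = 8 ∨ j = 9) (hr : ∀ l, symT fr Y 0 l r)
    (h : FmK fr Y (pp j g) 0 0) : FmK fr Y (inst2 r g) 0 0 :=
  fmK_inst2 hr ((fmK_set hj).1 h)

theorem symT_const {i : N} (hi : dom Y i) (l : N) : symT fr Y 0 l (pp 2 i) :=
  Or.inr (Or.inr ⟨i, rfl, hi⟩)

theorem symT_free (hfr : fr) (i l : N) : symT fr Y 0 l (pp 1 i) := Or.inr (Or.inl ⟨hfr, i, rfl⟩)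

theorem Sent.isFm {f : N} (h : Sent Y f) : IsFm Y f :=
  Wf.imp h (fun _ _ h => h) fun _ _ h => h.imp id fun h => Or.inr (h.resolve_left fun h => h.1)

end

/-! ### Occurrences of free set variables, depth, arithmetical formulas -/

theorem fcata_counters (a : FAlg N α) [DefA 𝒮 N a] (p : α)
    (h : ∀ k l j t s, a.lit p k l j t s = a.lit p 0 0 j t s) (f k l : N) :
    fcata a p f k l = fcata a p f 0 0 := by
  have hd : DefM 𝒮 N (fun _ : ((N × N) × N) × N => p) := inferInstance
  refine form_ind 𝒮 N (P := fun f => ∀ k l, fcata a p f k l = fcata a p f 0 0) ?_ ?_ ?_ ?_ f k l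
  · intro j t s hj k l
    rw [fcata_lit _ _ hj, fcata_lit _ _ hj, h]
  · intro j g g' hj ih ih' k l
    rw [fcata_bin _ _ hj, fcata_bin _ _ hj, ih, ih']
  · intro j g hj ih k l
    rw [fcata_un _ _ hj, fcata_un _ _ hj, ih, ← ih (kk j 0)]
  · intro x hx k l
    rw [fcata_junk _ _ hx, fcata_junk _ _ hx]

noncomputable def occAlg : FAlg N N where
  lit p _ _ j _ s := tv (¬ TagE j ∧ s = pp 1 p)
  bin _ x y := tv (x = 1 ∨ y = 1)
  un _ x := x
  junk _ := 0

instance : DefA F (occAlg : FAlg N N) := by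
  constructor <;> (unfold occAlg; dsimp only; infer_instance)

/-- The free set variable `u` occurs in `f`. -/
def Occ (u f : N) : Prop := fcata occAlg u f 0 0 = 1

instance def_occ {f g : α → N} [DefM F f] [DefM F g] : Def F (fun a => Occ (f a) (g a)) := by
  unfold Occ; infer_instance

theorem occ_lit {u j t s : N} (hj : TagL j) : Occ u (pp j (pp t s)) ↔ ¬ TagE j ∧ s = pp 1 u := by
  unfold Occ; rw [fcata_lit _ _ hj]; simp [occAlg]
theorem occ_bin {u j g h : N} (hj : TagB j) : Occ u (pp j (pp g h)) ↔ Occ u g ∨ Occ u h := by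
  unfold Occ; rw [fcata_bin _ _ hj]; simp [occAlg]
theorem occ_un {u j g : N} (hj : TagU j) : Occ u (pp j g) ↔ Occ u g := by
  unfold Occ; rw [fcata_un _ _ hj, fcata_counters occAlg u (fun _ _ _ _ _ => rfl)]; simp [occAlg]
theorem occ_junk {u x : N} (hx : FJunk x) : ¬ Occ u x := by
  unfold Occ; rw [fcata_junk _ _ hx]; simp [occAlg]

theorem Wf.not_occ {T S S' : N → N → N → Prop} [hT : Def3 𝒮 N T] [hS : Def3 𝒮 N S]
    [Def3 𝒮 N S'] {p f u k l : N} (hf : Wf T S p f k l)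
    (h : ∀ l s, S p l s → s ≠ pp 1 u → S' p l s) (hu : ¬ Occ u f) : Wf T S' p f k l := by
  have := wf_ind (T := T) (S := S) (p := p) (k := k) (l := l) (f := f) (a := 0) (b := 0)
    (P := fun f a b => ¬ Occ u f → Wf T S' p f (k + a) (l + b))
    ?_ ?_ ?_ (by simpa using hf)
  · simpa using this hu
  · intro j t s a b hj h1 h2 h3 ho
    rw [occ_lit hj, not_and] at ho
    rw [wf_lit _ _ _ _ _ hj]
    exact ⟨h1, h2, fun hE => h _ _ (h3 hE) (ho hE)⟩
  · intro j g g' a b hj ih ih' ho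
    rw [occ_bin hj, not_or] at ho
    rw [wf_bin _ _ _ _ _ hj]
    exact ⟨ih ho.1, ih' ho.2⟩
  · intro j g a b hj ih ho
    rw [occ_un hj] at ho
    rw [wf_un _ _ _ _ _ hj, kk_add, ll_add]
    exact ih ho

theorem Wf.occ_sym {T S : N → N → N → Prop} [hT : Def3 𝒮 N T] [hS : Def3 𝒮 N S]
    {p f u k l : N} (hf : Wf T S p f k l) (hu : ∀ l, ¬ S p l (pp 1 u)) : ¬ Occ u f := by
  refine wf_ind (T := T) (S := S) (p := p) (k := k) (l := l) (f := f) (a := 0) (b := 0)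
    (P := fun f a b => ¬ Occ u f) ?_ ?_ ?_ (by simpa using hf)
  · intro j t s a b hj h1 h2 h3 ho
    rw [occ_lit hj] at ho
    exact hu _ (ho.2 ▸ h3 ho.1)
  · intro j g g' a b hj ih ih' ho
    rw [occ_bin hj] at ho
    exact ho.elim ih ih'
  · intro j g a b hj ih ho
    rw [occ_un hj] at ho
    exact ih ho

theorem sent_iff {Y : Set N} [hY : Fact (Y ∈ 𝒮 N)] {f : N} :
    Sent Y f ↔ IsFm Y f ∧ ∀ u, ¬ Occ u f := by
  refine ⟨fun h => ⟨h.isFm, fun u => Wf.occ_sym h fun l => ?_⟩, fun h => ?_⟩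
  · rintro (⟨i, hi, e⟩ | h | ⟨i, e, -⟩)
    · simp at e
    · exact h.1
    · simp at e
  · have := wf_ind (T := tmT) (S := symT True Y) (p := 0) (k := 0) (l := 0) (f := f) (a := 0)
      (b := 0) (P := fun f a b => (∀ u, ¬ Occ u f) → FmK False Y f (0 + a) (0 + b))
      (hP := by infer_instance) ?_ ?_ ?_ (by
        rw [add_zero]; exact h.1)
    · rw [add_zero] at this; exact this h.2
    · intro j t s a b hj h1 h2 h3 ho
      rw [fmK_lit hj]
      refine ⟨h1, h2, fun hE => (h3 hE).imp id fun h => Or.inr (h.resolve_left fun h => ?_)⟩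
      obtain ⟨-, i, rfl⟩ := h
      exact ho i ((occ_lit hj).2 ⟨hE, rfl⟩)
    · intro j g g' a b hj ih ih' ho
      rw [fmK_bin hj]
      exact ⟨ih fun u hu => ho u ((occ_bin hj).2 (Or.inl hu)),
        ih' fun u hu => ho u ((occ_bin hj).2 (Or.inr hu))⟩
    · intro j g a b hj ih ho
      unfold FmK
      rw [wf_un _ _ _ _ _ hj, kk_add, ll_add]
      exact ih fun u hu => ho u ((occ_un hj).2 hu)

noncomputable def dpAlg : FAlg N N where
  lit _ _ _ _ _ _ := 0
  bin _ x y := x + y + 1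
  un _ x := x + 1
  junk _ := 0

instance : DefA F (dpAlg : FAlg N N) := by
  constructor <;> (unfold dpAlg; dsimp only; infer_instance)

/-- The number of logical symbols in `f`. -/
noncomputable def dp (f : N) : N := fcata dpAlg (0 : N) f 0 0

instance defM_dp {f : α → N} [DefM F f] : DefM F (fun a => dp (f a)) := by
  unfold dp; infer_instance

theorem dp_lit {j t s : N} (hj : TagL j) : dp (pp j (pp t s)) = 0 := by
  unfold dp; rw [fcata_lit _ _ hj]; rfl
theorem dp_bin {j g h : N} (hj : TagB j) : dp (pp j (pp g h)) = dp g + dp h + 1 := by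
  unfold dp; rw [fcata_bin _ _ hj]; rfl
theorem dp_un {j g : N} (hj : TagU j) : dp (pp j g) = dp g + 1 := by
  unfold dp; rw [fcata_un _ _ hj, fcata_counters dpAlg _ (fun _ _ _ _ _ => rfl)]; rfl

noncomputable def arAlg : FAlg N N where
  lit _ _ _ _ _ _ := 1
  bin _ x y := tv (x = 1 ∧ y = 1)
  un j x := tv ((j = 6 ∨ j = 7) ∧ x = 1)
  junk _ := 0

instance : DefA F (arAlg : FAlg N N) := by
  constructor <;> (unfold arAlg; dsimp only; infer_instance)

/-- `f` has no set quantifiers. -/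
def IsAr (f : N) : Prop := fcata arAlg (0 : N) f 0 0 = 1

instance def_isAr {f : α → N} [DefM F f] : Def F (fun a => IsAr (f a)) := by
  unfold IsAr; infer_instance

theorem isAr_lit {j t s : N} (hj : TagL j) : IsAr (pp j (pp t s)) := by
  unfold IsAr; rw [fcata_lit _ _ hj]; rfl
theorem isAr_bin {j g h : N} (hj : TagB j) : IsAr (pp j (pp g h)) ↔ IsAr g ∧ IsAr h := by
  unfold IsAr; rw [fcata_bin _ _ hj]; simp [arAlg]
theorem isAr_un {j g : N} (hj : TagU j) : IsAr (pp j g) ↔ (j = 6 ∨ j = 7) ∧ IsAr g := by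
  unfold IsAr; rw [fcata_un _ _ hj, fcata_counters arAlg _ (fun _ _ _ _ _ => rfl)]; simp [arAlg]
theorem isAr_junk {x : N} (hx : FJunk x) : ¬ IsAr x := by
  unfold IsAr; rw [fcata_junk _ _ hx]; simp [arAlg]

section
variable {T1 S1 : N → N → N → N} [DefM3 𝒮 N T1] [DefM3 𝒮 N S1] {d : Bool} {q f k l : N}

theorem dp_fmap (hf : Shape f) : dp (fmap d T1 S1 q f k l) = dp f := by
  refine shape_ind (P := fun f => ∀ k l, dp (fmap d T1 S1 q f k l) = dp f) ?_ ?_ ?_ hf k l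
  · intro j t s hj k l
    rw [fmap_lit _ _ _ _ _ _ hj, dp_lit hj, dp_lit (hj.dl d)]
  · intro j g h hj _ _ ih ih' k l
    rw [fmap_bin _ _ _ _ _ _ hj, dp_bin hj, dp_bin (hj.dl d), ih, ih']
  · intro j g hj _ ih k l
    rw [fmap_un _ _ _ _ _ _ hj, dp_un hj, dp_un (hj.dl d), ih]

theorem dl_num {j : N} (hj : TagU j) (d : Bool) : (dl d j = 6 ∨ dl d j = 7) ↔ j = 6 ∨ j = 7 := by
  cases d
  · rfl
  · rcases hj with rfl | rfl | rfl | rfl <;> simp [dl]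

theorem isAr_fmap (hf : Shape f) : IsAr (fmap d T1 S1 q f k l) ↔ IsAr f := by
  refine shape_ind (P := fun f => ∀ k l, IsAr (fmap d T1 S1 q f k l) ↔ IsAr f) ?_ ?_ ?_ hf k l
  · intro j t s hj k l
    rw [fmap_lit _ _ _ _ _ _ hj]
    exact iff_of_true (isAr_lit (hj.dl d)) (isAr_lit hj)
  · intro j g h hj _ _ ih ih' k l
    rw [fmap_bin _ _ _ _ _ _ hj, isAr_bin hj, isAr_bin (hj.dl d), ih, ih']
  · intro j g hj _ ih k l
    rw [fmap_un _ _ _ _ _ _ hj, isAr_un hj, isAr_un (hj.dl d), ih, dl_num hj]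

end

theorem dp_inst {c f : N} (hf : Shape f) : dp (inst c f) = dp f := dp_fmap hf
theorem dp_inst2 {c f : N} (hf : Shape f) : dp (inst2 c f) = dp f := dp_fmap hf
theorem isAr_inst {c f : N} (hf : Shape f) : IsAr (inst c f) ↔ IsAr f := isAr_fmap hf

/-! ### The classes `Π¹ₙ` and `Σ¹ₙ` -/

noncomputable def clsStep (pol : Bool) (P : N → Prop) (_ x : N) (f : N → N) : N :=
  tv (P x ∨ ((x = pp (bif pol then 6 else 7) (sndN x) ∨ x = pp (bif pol then 8 else 9) (sndN x)) ∧
    f (sndN x) = 1))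

/-- `x` is a `Π¹ₙ`-formula or a `Σ¹ₙ`-formula. -/
def Cls (pol : Bool) : ℕ → N → Prop
  | 0, x => IsAr x
  | n + 1, x => recN (clsStep pol (Cls (!pol) n)) (0 : N) x = 1
  termination_by n => n

theorem clsStep_local (pol : Bool) (P : N → Prop) : Local (clsStep pol P) := by
  intro p x f g h
  have h1 : ∀ j : N, 1 ≤ j → x = pp j (sndN x) → f (sndN x) = g (sndN x) := fun j hj e => h _ (by
    conv_rhs => rw [e]
    exact lt_pp_right hj _)
  have e1 : (1 : N) ≤ bif pol then 6 else 7 := by cases pol <;> norm_num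
  have e2 : (1 : N) ≤ bif pol then 8 else 9 := by cases pol <;> norm_num
  unfold clsStep
  congr 2
  refine propext (and_congr_right fun h => ?_)
  rcases h with h | h
  · rw [h1 _ e1 h]
  · rw [h1 _ e2 h]

theorem clsStep_def (pol : Bool) (P : N → Prop) (hP : Def F (fun q : N × N => P q.2)) :
    DefM F (fun q : (N × N) × N => clsStep pol P q.1.1 q.1.2 (ap q.2)) := by
  have hP' : ∀ {α : Type} [Ctx N α] (f : α → N) [DefM F f], Def F (fun a => P (f a)) :=
    fun f => Def.lift hP f
  unfold clsStep
  cases pol <;> (dsimp only [cond_true, cond_false]; infer_instance)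

theorem cls_def (pol : Bool) (n : ℕ) : Def F (fun q : N × N => Cls pol n q.2) := by
  induction n generalizing pol with
  | zero => unfold Cls; infer_instance
  | succ n ih =>
    unfold Cls
    have hD : DefM F (fun a : N × N => recN (clsStep pol (Cls (!pol) n)) (0 : N) a.2) :=
      DefM.lift2 (P := recN (clsStep pol (Cls (!pol) n)))
        (defM_recN (clsStep_local _ _) (clsStep_def _ _ (ih _))) (fun _ => (0 : N))
        (fun a : N × N => a.2)
    infer_instance

instance def_cls {pol : Bool} {n : ℕ} {f : α → N} [DefM F f] : Def F (fun a => Cls pol n (f a)) :=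
  Def.lift (P := Cls pol n) (cls_def pol n) f

theorem cls_zero (pol : Bool) (x : N) : Cls pol 0 x ↔ IsAr x := by rw [Cls]

theorem cls_succ (pol : Bool) (n : ℕ) (x : N) : Cls pol (n + 1) x ↔ Cls (!pol) n x ∨
    ∃ g, (x = pp (bif pol then 6 else 7) g ∨ x = pp (bif pol then 8 else 9) g) ∧
      Cls pol (n + 1) g := by
  have key : ∀ y : N, Cls pol (n + 1) y ↔ recN (clsStep pol (Cls (!pol) n)) (0 : N) y = 1 := by
    intro y; rw [Cls]
  rw [key, recN_eq 𝒮 N (clsStep_local _ _) (clsStep_def _ _ (cls_def _ _)), clsStep, tv_eq_one]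
  refine or_congr Iff.rfl ⟨fun h => ⟨sndN x, h.1, (key _).2 h.2⟩, ?_⟩
  rintro ⟨g, rfl | rfl, h⟩
  · rw [sndN_pp]; exact ⟨Or.inl rfl, (key _).1 h⟩
  · rw [sndN_pp]; exact ⟨Or.inr rfl, (key _).1 h⟩

theorem cls_lit (pol : Bool) (n : ℕ) {j t s : N} (hj : TagL j) : Cls pol n (pp j (pp t s)) := by
  induction n generalizing pol with
  | zero => rw [cls_zero]; exact isAr_lit hj
  | succ n ih => rw [cls_succ]; exact Or.inl (ih _)

theorem cls_bin (pol : Bool) (n : ℕ) {j g h : N} (hj : TagB j) :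
    Cls pol n (pp j (pp g h)) ↔ IsAr g ∧ IsAr h := by
  induction n generalizing pol with
  | zero => rw [cls_zero, isAr_bin hj]
  | succ n ih =>
    rw [cls_succ, ih]
    refine or_iff_left ?_
    rintro ⟨g, h, -⟩
    cases pol <;> rcases hj with rfl | rfl <;> simp at h

theorem cls_un (pol : Bool) (n : ℕ) {j g : N} :
    Cls pol (n + 1) (pp j g) ↔ Cls (!pol) n (pp j g) ∨
      (j = (bif pol then 6 else 7) ∨ j = (bif pol then 8 else 9)) ∧ Cls pol (n + 1) g := by
  rw [cls_succ]
  refine or_congr Iff.rfl ⟨?_, fun h => ⟨g, h.1.imp (fun h => by rw [h]) (fun h => by rw [h]), h.2⟩⟩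
  rintro ⟨g', h, hg⟩
  simp only [pp_inj] at h
  rcases h with ⟨h, rfl⟩ | ⟨h, rfl⟩
  · exact ⟨Or.inl h, hg⟩
  · exact ⟨Or.inr h, hg⟩

theorem dl_pol {j : N} (hj : TagU j) (d pol : Bool) :
    (dl d j = (bif (pol ^^ d) then 6 else 7) ∨ dl d j = (bif (pol ^^ d) then 8 else 9)) ↔
      (j = (bif pol then 6 else 7) ∨ j = (bif pol then 8 else 9)) := by
  cases d <;> cases pol <;> rcases hj with rfl | rfl | rfl | rfl <;> simp [dl]

theorem cls_fmap {T1 S1 : N → N → N → N} [DefM3 𝒮 N T1] [DefM3 𝒮 N S1] {d pol : Bool}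
    {n : ℕ} {q f k l : N} (hf : Shape f) :
    Cls (pol ^^ d) n (fmap d T1 S1 q f k l) ↔ Cls pol n f := by
  induction n generalizing pol f k l with
  | zero => rw [cls_zero, cls_zero, isAr_fmap hf]
  | succ n ih =>
    refine shape_ind (P := fun f => ∀ k l, Cls (pol ^^ d) (n + 1) (fmap d T1 S1 q f k l) ↔
      Cls pol (n + 1) f) ?_ ?_ ?_ hf k l
    · intro j t s hj k l
      rw [fmap_lit _ _ _ _ _ _ hj]
      exact iff_of_true (cls_lit _ _ (hj.dl d)) (cls_lit _ _ hj)
    · intro j g h hj hg hh _ _ k l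
      rw [fmap_bin _ _ _ _ _ _ hj, cls_bin _ _ hj, cls_bin _ _ (hj.dl d), isAr_fmap hg,
        isAr_fmap hh]
    · intro j g hj hg ih' k l
      have := ih (pol := !pol) (k := k) (l := l) ((shape_un hj).2 hg)
      rw [fmap_un _ _ _ _ _ _ hj] at this ⊢
      rw [cls_un, cls_un, ih', dl_pol hj, ← this]
      cases pol <;> cases d <;> rfl

theorem fmap_fmap_shape {T1 S1 T2 S2 : N → N → N → N} (T3 S3 : N → N → N → N) [DefM3 𝒮 N T1]
    [DefM3 𝒮 N S1] [DefM3 𝒮 N T2] [DefM3 𝒮 N S2] [DefM3 𝒮 N T3] [DefM3 𝒮 N S3]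
    {d1 d2 : Bool} {q1 q2 f : N} (q3 : N)
    (hT : ∀ a t, T2 q2 (0 + a) (T1 q1 (0 + a) t) = T3 q3 (0 + a) t)
    (hS : ∀ b s, S2 q2 (0 + b) (S1 q1 (0 + b) s) = S3 q3 (0 + b) s) (hf : Shape f) :
    fmap d2 T2 S2 q2 (fmap d1 T1 S1 q1 f 0 0) 0 0 = fmap (d2 ^^ d1) T3 S3 q3 f 0 0 :=
  fmap_fmap (T := topT) (S := topT) (p := 0) (fun _ _ _ => hT _ _) (fun _ _ _ => hS _ _) hf

/-! ### Identification of equal sets and of equal terms -/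

/-- `j` is an index in `W'` of the set with the index `i` in `W`. -/
def matchI (W W' : Set N) (i j : N) : Prop := dom W' j ∧ ∀ x, sec W i x ↔ sec W' j x

instance def_matchI {W W' : Set N} [Fact (W ∈ F)] [Fact (W' ∈ F)] {f g : α → N} [DefM F f]
    [DefM F g] : Def F (fun a => matchI W W' (f a) (g a)) :=
  Def.lift2 (P := matchI W W') (by unfold matchI; infer_instance) f g

/-- The symbols for constants in `W` are replaced by canonical symbols for the same sets in
`W'`. -/
noncomputable def canS (W W' : Set N) (_ _ s : N) : N :=
  if s = pp 2 (sndN s) then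
    if ∃ j, matchI W W' (sndN s) j then pp 2 (leastN (matchI W W' (sndN s))) else pp 3 0
  else s

instance defM3_canS {W W' : Set N} [Fact (W ∈ F)] [Fact (W' ∈ F)] : DefM3 F (canS W W') := by
  unfold canS; infer_instance

section
variable {W W' V : Set N} [hW : Fact (W ∈ 𝒮 N)] [hW' : Fact (W' ∈ 𝒮 N)] [hV : Fact (V ∈ 𝒮 N)]

theorem canS_other {p l s : N} (h : ∀ i, s ≠ pp 2 i) : canS W W' p l s = s := if_neg (h _)

theorem canS_const_match {p l i j : N} (h : matchI W W' i j) :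
    ∃ m, canS W W' p l (pp 2 i) = pp 2 m ∧ matchI W W' i m := by
  refine ⟨leastN (matchI W W' i), ?_, leastN_spec 𝒮 N (P := matchI W W' i) ⟨j, h⟩⟩
  rw [canS, sndN_pp, if_pos rfl, if_pos ⟨j, h⟩]

theorem canS_const_of_not {p l i : N} (h : ¬ ∃ j, matchI W W' i j) :
    canS W W' p l (pp 2 i) = pp 3 0 := by
  rw [canS, sndN_pp, if_pos rfl, if_neg h]

theorem canS_congr {p l p' l' i i' : N} (h : ∀ x, sec W i x ↔ sec V i' x)
    (hi : ∃ j, matchI W W' i j) :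
    canS W W' p l (pp 2 i) = canS V W' p' l' (pp 2 i') := by
  have e : matchI W W' i = matchI V W' i' := by
    funext j; simp only [matchI, h]
  rw [canS, canS, sndN_pp, sndN_pp, if_pos rfl, if_pos rfl, ← e, if_pos hi]

theorem matchI_self {i : N} (h : dom W i) : matchI W W i i := ⟨h, fun _ => Iff.rfl⟩

theorem canS_eq {p l p' l' i i' : N} (hi : dom W' i')
    (h : canS W W' p l (pp 2 i) = canS W' W' p' l' (pp 2 i')) : matchI W W' i i' := by
  obtain ⟨m, hm, hm'⟩ := canS_const_match (p := p') (l := l') (matchI_self hi)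
  by_cases h1 : ∃ j, matchI W W' i j
  · obtain ⟨j, hj⟩ := h1
    obtain ⟨m', hn, hn'⟩ := canS_const_match (p := p) (l := l) hj
    rw [hm, hn, pp_inj] at h
    obtain ⟨-, rfl⟩ := h
    exact ⟨hi, fun x => (hn'.2 x).trans (hm'.2 x).symm⟩
  · rw [hm, canS_const_of_not h1, pp_inj] at h
    exact absurd h.1 (by norm_num)

theorem canS_eq_bound {p l s k : N} : canS W W' p l s = pp 0 k ↔ s = pp 0 k := by
  by_cases h : s = pp 2 (sndN s)
  · rw [h]
    by_cases h1 : ∃ j, matchI W W' (sndN s) j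
    · obtain ⟨j, hj⟩ := h1
      obtain ⟨m, hm, -⟩ := canS_const_match (p := p) (l := l) hj
      rw [hm]; simp
    · rw [canS_const_of_not h1]; simp
  · rw [canS, if_neg h]

/-- `s` is not a constant, or a constant in `W` for a set in `W'`. -/
def symM (W W' : Set N) (_ _ s : N) : Prop :=
  (∃ i, s = pp 0 i) ∨ (∃ i, s = pp 1 i) ∨ ∃ i, s = pp 2 i ∧ dom W i ∧ ∃ j, matchI W W' i j

theorem canS_canS {p l p' l' q m s : N} (h : symM W W' q m s) :
    canS W' V p l (canS W W' p' l' s) = canS W V p l s := by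
  rcases h with ⟨i, rfl⟩ | ⟨i, rfl⟩ | ⟨i, rfl, hi, j, hj⟩
  · rw [canS_other (W := W) (W' := W') fun i => by simp,
      canS_other fun i => by simp,
      canS_other fun i => by simp]
  · rw [canS_other (W := W) (W' := W') fun i => by simp,
      canS_other fun i => by simp,
      canS_other fun i => by simp]
  · obtain ⟨m, hm, hm'⟩ := canS_const_match (p := p') (l := l') hj
    rw [hm]
    by_cases h1 : ∃ j, matchI W' V m j
    · exact canS_congr (fun x => (hm'.2 x).symm) h1
    · rw [canS_const_of_not h1, canS_const_of_not]
      rintro ⟨j, hj⟩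
      exact h1 ⟨j, hj.1, fun x => (hm'.2 x).symm.trans (hj.2 x)⟩

end

noncomputable def canT (_ _ t : N) : N := can t
instance : DefM3 F (canT : N → N → N → N) := by unfold canT; infer_instance

noncomputable def canTsub (c k t : N) : N := can (tsub c k t)
instance defM3_canTsub : DefM3 F (canTsub : N → N → N → N) := by unfold canTsub; infer_instance

theorem canTsub_canT (c k t p k' : N) : canTsub c k (canT p k' t) = canTsub c k t := by
  unfold canTsub canT
  rw [can_eq_iff]
  intro p; rw [teval_tsub, teval_tsub, teval_can]

theorem canTsub_congr {c c' : N} (h : can c = can c') (k t : N) :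
    canTsub c k t = canTsub c' k t := by
  unfold canTsub
  rw [can_eq_iff] at h ⊢
  intro p; rw [teval_tsub, teval_tsub, h]

/-- The normal form of a formula. -/
noncomputable def nf (d : Bool) (W W' : Set N) (y : N) : N :=
  fmap d canT (canS W W') 0 y 0 0

instance defM_nf {d : Bool} {W W' : Set N} [Fact (W ∈ F)] [Fact (W' ∈ F)] {f : α → N} [DefM F f] :
    DefM F (fun a => nf d W W' (f a)) := by unfold nf; infer_instance

/-- `y` over `W` and `x` over `W'` are the same formula, or negations of each other if `d`, up to
the values of terms. -/
def NR (d : Bool) (W W' : Set N) (y x : N) : Prop := nf d W W' y = nf false W' W' x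

instance def_NR {d : Bool} {W W' : Set N} [Fact (W ∈ F)] [Fact (W' ∈ F)] {f g : α → N} [DefM F f]
    [DefM F g] : Def F (fun a => NR d W W' (f a) (g a)) := by unfold NR; infer_instance

section
variable {d : Bool} {W W' V : Set N} [hW : Fact (W ∈ 𝒮 N)]
  [hW' : Fact (W' ∈ 𝒮 N)] [hV : Fact (V ∈ 𝒮 N)]

theorem nf_lit {j t s : N} (hj : TagL j) : nf d W W' (pp j (pp t s)) =
    pp (dl d j) (pp (can t) (if TagE j then can s else canS W W' 0 0 s)) := by
  unfold nf; rw [fmap_lit _ _ _ _ _ _ hj]; rfl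

theorem nf_bin {j g h : N} (hj : TagB j) : nf d W W' (pp j (pp g h)) =
    pp (dl d j) (pp (nf d W W' g) (nf d W W' h)) := by
  unfold nf; rw [fmap_bin _ _ _ _ _ _ hj]

theorem nf_un {j g : N} (hj : TagU j) (hg : Shape g) : nf d W W' (pp j g) =
    pp (dl d j) (nf d W W' g) := by
  unfold nf
  rw [fmap_un _ _ _ _ _ _ hj]
  congr 1
  exact fmap_congr (fun _ _ _ => rfl) (fun _ _ _ => rfl) (Shape.wf (p := 0) (k := 0) (l := 0) hg)

theorem TagL.ne_tagB {j j' : N} (h : TagL j) (h' : TagB j') : j ≠ j' := fun e =>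
  h'.not_tagL (e ▸ h)
theorem TagL.ne_tagU {j j' : N} (h : TagL j) (h' : TagU j') : j ≠ j' := fun e =>
  h'.not_tagL (e ▸ h)
theorem TagB.ne_tagU {j j' : N} (h : TagB j) (h' : TagU j') : j ≠ j' := fun e =>
  h'.not_tagB (e ▸ h)

theorem NR.lit {x j t s : N} (hx : Shape x) (hj : TagL j) (h : NR d W W' (pp j (pp t s)) x) :
    ∃ t' s', x = pp (dl d j) (pp t' s') ∧ can t = can t' ∧ (TagE j → can s = can s') ∧
      (¬ TagE j → canS W W' 0 0 s = canS W' W' 0 0 s') := by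
  unfold NR at h
  rw [nf_lit hj] at h
  rcases hx.cases with ⟨j', t', s', hj', rfl⟩ | ⟨j', g, g', hj', rfl, -, -⟩ | ⟨j', g, hj', rfl, hg⟩
  · rw [nf_lit hj', pp_inj, pp_inj, dl_false] at h
    obtain ⟨rfl, h1, h2⟩ := h
    refine ⟨t', s', rfl, h1, fun hE => ?_, fun hE => ?_⟩
    · rwa [if_pos hE, if_pos ((tagE_dl hj d).2 hE)] at h2
    · rwa [if_neg hE, if_neg (mt (tagE_dl hj d).1 hE)] at h2
  · rw [nf_bin hj', pp_inj] at h
    exact absurd h.1 ((hj.dl d).ne_tagB hj')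
  · rw [nf_un hj' hg, pp_inj] at h
    exact absurd h.1 ((hj.dl d).ne_tagU hj')

theorem NR.bin {x j g h : N} (hx : Shape x) (hj : TagB j) (hn : NR d W W' (pp j (pp g h)) x) :
    ∃ g' h', x = pp (dl d j) (pp g' h') ∧ NR d W W' g g' ∧ NR d W W' h h' := by
  unfold NR at hn
  rw [nf_bin hj] at hn
  rcases hx.cases with ⟨j', t', s', hj', rfl⟩ | ⟨j', g', h', hj', rfl, -, -⟩ | ⟨j', g', hj', rfl, hg⟩
  · rw [nf_lit hj', pp_inj] at hn
    exact absurd hn.1.symm (hj'.ne_tagB (hj.dl d))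
  · rw [nf_bin hj', pp_inj, pp_inj, dl_false] at hn
    obtain ⟨rfl, h1, h2⟩ := hn
    exact ⟨g', h', rfl, h1, h2⟩
  · rw [nf_un hj' hg, pp_inj] at hn
    exact absurd hn.1 ((hj.dl d).ne_tagU hj')

theorem NR.un {x j g : N} (hx : Shape x) (hg : Shape g) (hj : TagU j)
    (hn : NR d W W' (pp j g) x) :
    ∃ g', x = pp (dl d j) g' ∧ Shape g' ∧ NR d W W' g g' := by
  unfold NR at hn
  rw [nf_un hj hg] at hn
  rcases hx.cases with ⟨j', t', s', hj', rfl⟩ | ⟨j', g', h', hj', rfl, -, -⟩ | ⟨j', g', hj', rfl, hg⟩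
  · rw [nf_lit hj', pp_inj] at hn
    exact absurd hn.1.symm (hj'.ne_tagU (hj.dl d))
  · rw [nf_bin hj', pp_inj] at hn
    exact absurd hn.1.symm (hj'.ne_tagU (hj.dl d))
  · rw [nf_un hj' hg, pp_inj, dl_false] at hn
    obtain ⟨rfl, h1⟩ := hn
    exact ⟨g', rfl, hg, h1⟩

theorem nf_inst {c g : N} (hg : Shape g) :
    nf d W W' (inst c g) = fmap false canTsub idT c (nf d W W' g) 0 0 := by
  unfold nf inst
  rw [fmap_fmap_shape canTsub (canS W W') c (fun _ _ => rfl) (fun _ _ => rfl) hg,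
    fmap_fmap_shape canTsub (canS W W') c (fun _ _ => canTsub_canT _ _ _ _ _)
    (fun _ _ => rfl) hg]
  cases d <;> rfl

/-- Substitution of a set symbol, followed by `canS`. -/
noncomputable def canSset (W W' : Set N) (r l s : N) : N := canS W W' r l (setS r l s)

omit hW hW' hV in
theorem defM3_canSset [Fact (W ∈ F)] [Fact (W' ∈ F)] : DefM3 F (canSset W W') := by
  unfold canSset DefM3
  exact (defM3_canS (F := F) (W := W) (W' := W')).app (fun q : (N × N) × N => q.1.1)
    (fun q => q.1.2) (fun q => setS q.1.1 q.1.2 q.2)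

theorem nf_inst2 {r g : N} (hg : Shape g) :
    nf d W W' (inst2 r g) = fmap false idT setS (canS W W' 0 0 r) (nf d W W' g) 0 0 := by
  have hd : DefM3 𝒮 N (canSset W W') := defM3_canSset
  unfold nf inst2
  rw [fmap_fmap_shape canT (canSset W W') r (fun _ _ => rfl) (fun b s => show canS W W' 0 (0 + b) _ = _ from rfl) hg,
    fmap_fmap_shape canT (canSset W W') r (fun _ _ => rfl) (fun b s => ?_) hg]
  · cases d <;> rfl
  · unfold canSset setS
    simp only [canS_eq_bound]
    split_ifs <;> rfl

theorem NR.inst {g h c c' : N} (hg : Shape g) (hh : Shape h) (hc : can c = can c')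
    (hn : NR d W W' g h) : NR d W W' (inst c g) (inst c' h) := by
  unfold NR at hn ⊢
  rw [nf_inst hg, nf_inst hh, hn]
  exact fmap_congr (T := topT) (S := topT) (p := 0) (k := 0) (l := 0)
    (fun _ _ _ => canTsub_congr hc _ _) (fun _ _ _ => rfl) (shape_fmap hh)

theorem NR.inst2 {g h r r' : N} (hg : Shape g) (hh : Shape h)
    (hr : canS W W' 0 0 r = canS W' W' 0 0 r') (hn : NR d W W' g h) :
    NR d W W' (inst2 r g) (inst2 r' h) := by
  unfold NR at hn ⊢
  rw [nf_inst2 hg, nf_inst2 hh, hn, hr]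

theorem NR.neg {f : N} (hf : Shape f) : NR true W W (neg f) f := by
  unfold NR nf SOA.neg
  exact fmap_fmap_shape _ _ _ (fun _ _ => rfl) (fun _ _ => rfl) hf

end

/-! ### Renaming of set symbols -/

/-- `σ p l s` depends only on `p` and `s`, and fixes exactly the symbols for bound variables. -/
class Ren (σ : N → N → N → N) : Prop where
  defM : DefM3 𝒮 N σ
  const : ∀ p l s, σ p l s = σ p 0 s
  bound : ∀ p l s k, σ p l s = pp 0 k ↔ s = pp 0 k

instance defM3_ren {σ : N → N → N → N} [h : Ren σ] : DefM3 𝒮 N σ := h.defM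

section
variable (σ : N → N → N → N) [hσ : Ren σ]

/-- The formula `f`, with the set symbols renamed. -/
noncomputable def rn (p f : N) : N := fmap false idT σ p f 0 0

instance defM_rn {α : Type} [Ctx N α] {p f : α → N} [DefM 𝒮 N p]
    [DefM 𝒮 N f] : DefM 𝒮 N (fun a => rn σ (p a) (f a)) := by
  unfold rn; infer_instance

variable {σ} {p : N}

theorem rn_lit {j t s : N} (hj : TagL j) : rn σ p (pp j (pp t s)) =
    pp j (pp t (if TagE j then s else σ p 0 s)) := by
  unfold rn; rw [fmap_lit _ _ _ _ _ _ hj]; rfl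

theorem rn_bin {j g h : N} (hj : TagB j) : rn σ p (pp j (pp g h)) =
    pp j (pp (rn σ p g) (rn σ p h)) := by
  unfold rn; rw [fmap_bin _ _ _ _ _ _ hj]; rfl

theorem rn_un {j g : N} (hj : TagU j) (hg : Shape g) : rn σ p (pp j g) = pp j (rn σ p g) := by
  unfold rn
  rw [fmap_un _ _ _ _ _ _ hj, dl_false]
  congr 1
  exact fmap_congr (fun _ _ _ => rfl) (fun b s _ => by rw [hσ.const, hσ.const p (0 + b)])
    (Shape.wf (p := 0) (k := 0) (l := 0) hg)

theorem rn_inst {c g : N} (hg : Shape g) : rn σ p (inst c g) = inst c (rn σ p g) := by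
  have hσ2 : DefM3 𝒮 N (fun _ b s => σ p b s) := by
    have := (hσ.defM).app (fun _ : (N × N) × N => p) (fun q => q.1.2) (fun q => q.2)
    exact this
  unfold rn inst
  rw [fmap_fmap_shape tsub (fun _ b s => σ p b s) c (fun _ _ => rfl) (fun _ _ => rfl) hg,
    fmap_fmap_shape tsub (fun _ b s => σ p b s) c (fun _ _ => rfl) (fun _ _ => rfl) hg]

theorem rn_inst2 {r g : N} (hg : Shape g) :
    rn σ p (inst2 r g) = inst2 (σ p 0 r) (rn σ p g) := by
  have hd : DefM3 𝒮 N (fun q b s => σ p b (setS q b s)) := by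
    have := (hσ.defM).app (fun _ : (N × N) × N => p) (fun q => q.1.2)
      (fun q => setS q.1.1 q.1.2 q.2)
    exact this
  unfold rn inst2
  rw [fmap_fmap_shape idT (fun q b s => σ p b (setS q b s)) r (fun _ _ => rfl) (fun _ _ => rfl) hg,
    fmap_fmap_shape idT (fun q b s => σ p b (setS q b s)) r (fun _ _ => rfl) (fun b s => ?_) hg]
  unfold setS
  simp only [hσ.bound]
  split_ifs
  · exact (hσ.const _ _ _).symm
  · rfl

theorem rn_neg {g : N} (hg : Shape g) : rn σ p (neg g) = neg (rn σ p g) := by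
  unfold rn neg
  rw [fmap_fmap_shape idT σ p (fun _ _ => rfl) (fun _ _ => rfl) hg,
    fmap_fmap_shape idT σ p (fun _ _ => rfl) (fun _ _ => rfl) hg]
  rfl

theorem rn_sent {fr : Prop} {W M : Set N} [Fact (W ∈ 𝒮 N)] [Fact (M ∈ 𝒮 N)]
    (h : ∀ b s, symT fr W 0 b s → symT False M 0 b (σ p 0 s)) {f : N} (hf : FmK fr W f 0 0) :
    Sent M (rn σ p f) :=
  wf_fmap false (fun _ _ h => h) (fun b s hs => by rw [hσ.const]; exact h _ _ hs) hf

theorem rn_shape {f : N} (hf : Shape f) : Shape (rn σ p f) := shape_fmap hf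

end

/-! ### The same formula with other constant symbols -/

instance def3_symM {W W' : Set N} [Fact (W ∈ F)] [Fact (W' ∈ F)] : Def3 F (symM W W') := by
  unfold symM; infer_instance

/-- The formula `f`, with constant symbols referring to `W'` in place of `W`. -/
noncomputable def sm (W W' : Set N) (f : N) : N := fmap false idT (canS W W') 0 f 0 0

instance defM_sm {W W' : Set N} [Fact (W ∈ F)] [Fact (W' ∈ F)] {f : α → N} [DefM F f] :
    DefM F (fun a => sm W W' (f a)) := by unfold sm; infer_instance

instance ren_canS {W W' : Set N} [Fact (W ∈ 𝒮 N)] [Fact (W' ∈ 𝒮 N)] : Ren (canS W W') where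
  defM := defM3_canS
  const _ _ _ := rfl
  bound _ _ _ _ := canS_eq_bound

/-- `f` and `f'` differ only in the constant symbols used for the same set. -/
def Same (f : N) (Y : Set N) (f' : N) (W : Set N) : Prop :=
  Wf topT (symM Y W) 0 f 0 0 ∧ Wf topT (symM W Y) 0 f' 0 0 ∧ sm Y W f = sm W W f'

instance def_same {Y W : Set N} [Fact (Y ∈ F)] [Fact (W ∈ F)] {f g : α → N} [DefM F f]
    [DefM F g] : Def F (fun a => Same (f a) Y (g a) W) := by unfold Same; infer_instance

section
variable {d fr : Bool} {W Y V : Set N} [hW : Fact (W ∈ 𝒮 N)]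
  [hY : Fact (Y ∈ 𝒮 N)] [hV : Fact (V ∈ 𝒮 N)]

theorem matchI.symm {i j : N} (hi : dom Y i) (h : matchI Y W i j) : matchI W Y j i :=
  ⟨hi, fun x => (h.2 x).symm⟩

theorem matchI.trans {i j k : N} (h : matchI Y W i j) (h' : matchI W V j k) : matchI Y V i k :=
  ⟨h'.1, fun x => (h.2 x).trans (h'.2 x)⟩

theorem sm_sm {f : N} (hf : Wf topT (symM Y W) 0 f 0 0) : sm W V (sm Y W f) = sm Y V f :=
  fmap_fmap (fun _ _ _ => rfl) (fun _ _ h => canS_canS h) hf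

theorem symM_self {p l s : N} (h : symM W Y p l s) : symM W W p l s := by
  rcases h with h | h | ⟨i, rfl, hi, -⟩
  · exact Or.inl h
  · exact Or.inr (Or.inl h)
  · exact Or.inr (Or.inr ⟨i, rfl, hi, i, matchI_self hi⟩)

theorem Same.symm {f f' : N} (h : Same f Y f' W) : Same f' W f Y := by
  obtain ⟨h1, h2, h3⟩ := h
  refine ⟨h2, h1, ?_⟩
  have := congrArg (sm W Y) h3
  rwa [sm_sm h1, sm_sm (h2.imp (fun _ _ _ => trivial) (fun _ _ => symM_self)), eq_comm] at this

theorem symM_canS {p l q m s : N} (h : symM Y W p l s) : symM W Y p l (canS Y W q m s) := by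
  rcases h with ⟨i, rfl⟩ | ⟨i, rfl⟩ | ⟨i, rfl, hi, j, hj⟩
  · rw [canS_other fun i => by simp]
    exact Or.inl ⟨i, rfl⟩
  · rw [canS_other fun i => by simp]
    exact Or.inr (Or.inl ⟨i, rfl⟩)
  · obtain ⟨m, hm, hm'⟩ := canS_const_match (p := q) (l := m) hj
    rw [hm]
    exact Or.inr (Or.inr ⟨m, rfl, hm'.1, i, hm'.symm hi⟩)

theorem Same.of_wf {f : N} (h : Wf topT (symM Y W) 0 f 0 0) : Same f Y (sm Y W f) W :=
  ⟨h, wf_fmap false (fun _ _ _ => trivial) (fun _ _ h => symM_canS h) h, (sm_sm h).symm⟩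

theorem Same.refl {f k l : N} {fr : Prop} (hf : FmK fr Y f k l) : Same f Y f Y := by
  have : Wf topT (symM Y Y) 0 f 0 0 := hf.imp (fun _ _ _ => trivial) fun b s h => by
    rcases h with ⟨i, -, h⟩ | ⟨-, h⟩ | ⟨i, h, hi⟩
    · exact Or.inl ⟨i, h⟩
    · exact Or.inr (Or.inl h)
    · exact Or.inr (Or.inr ⟨i, h, hi, i, matchI_self hi⟩)
  exact ⟨this, this, rfl⟩

theorem Same.trans {f f' f'' : N} (h : Same f Y f' W) (h' : Same f' W f'' V) : Same f Y f'' V := by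
  have key : ∀ {Y W V : Set N} [Fact (Y ∈ 𝒮 N)] [Fact (W ∈ 𝒮 N)] [Fact (V ∈ 𝒮 N)] {f f' f'' : N},
      Same f Y f' W → Same f' W f'' V → Wf topT (symM Y V) 0 f 0 0 := by
    intro Y W V _ _ _ f f' f'' h h'
    have h1 : Wf topT (symM Y V) 0 (sm W Y f') 0 0 := by
      refine wf_fmap (T' := topT) (S' := symM Y V) false (fun _ _ _ => trivial) (fun b s hs => ?_)
        (h.2.1.and h'.1)
      obtain ⟨h1, h2⟩ := hs
      rcases h1 with ⟨i, rfl⟩ | ⟨i, rfl⟩ | ⟨i, rfl, hi, j, hj⟩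
      · rw [canS_other fun i => by simp]
        exact Or.inl ⟨i, rfl⟩
      · rw [canS_other fun i => by simp]
        exact Or.inr (Or.inl ⟨i, rfl⟩)
      · obtain ⟨m, hm, hm'⟩ := canS_const_match (p := 0) (l := 0 + b) hj
        rw [hm]
        rcases h2 with ⟨i', h2⟩ | ⟨i', h2⟩ | ⟨i', h2, -, j', hj'⟩
        · simp at h2
        · simp at h2
        · obtain rfl := (pp_inj.1 h2).2
          exact Or.inr (Or.inr ⟨m, rfl, hm'.1, j', (hm'.symm hi).trans hj'⟩)
    rw [h.symm.2.2] at h1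
    refine wf_of_fmap h.1 (fun _ _ _ _ => trivial) (fun b s hs h2 => ?_) h1
    rcases hs with ⟨i, rfl⟩ | ⟨i, rfl⟩ | ⟨i, rfl, hi, j, hj⟩
    · exact Or.inl ⟨i, rfl⟩
    · exact Or.inr (Or.inl ⟨i, rfl⟩)
    · obtain ⟨m, hm, hm'⟩ := canS_const_match (p := 0) (l := 0 + b) (matchI_self hi)
      rw [hm] at h2
      rcases h2 with ⟨i', h2⟩ | ⟨i', h2⟩ | ⟨i', h2, -, j', hj'⟩
      · simp at h2
      · simp at h2
      · obtain rfl := (pp_inj.1 h2).2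
        exact Or.inr (Or.inr ⟨i, rfl, hi, j', hm'.trans hj'⟩)
  have h1 := key h h'
  have h2 := key h'.symm h.symm
  refine ⟨h1, h2, ?_⟩
  rw [← sm_sm h.1, h.2.2, sm_sm (h.2.1.imp (fun _ _ _ => trivial) fun _ _ => symM_self), h'.2.2]

theorem Same.sent {f f' : N} (h : Same f Y f' W) (hf : Sent Y f) : Sent W f' := by
  have h1 : Sent W (sm Y W f) := by
    refine wf_fmap false (fun _ _ h => h.1) (fun b s hs => ?_)
      (Wf.and hf h.1)
    obtain ⟨h1, h2⟩ := hs
    rcases h1 with ⟨i, hi, rfl⟩ | h1 | ⟨i, rfl, hi⟩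
    · rw [canS_other fun i => by simp]
      exact Or.inl ⟨i, hi, rfl⟩
    · exact absurd h1.1 id
    · rcases h2 with ⟨i', h2⟩ | ⟨i', h2⟩ | ⟨i', h2, -, j', hj'⟩
      · simp at h2
      · simp at h2
      · obtain rfl := (pp_inj.1 h2).2
        obtain ⟨m, hm, hm'⟩ := canS_const_match (p := 0) (l := 0 + b) hj'
        rw [hm]
        exact symT_const hm'.1 _
  rw [h.2.2] at h1
  refine wf_of_fmap h.2.1 (fun _ _ _ h => h) (fun b s hs h2 => ?_) h1
  rcases hs with ⟨i, rfl⟩ | ⟨i, rfl⟩ | ⟨i, rfl, hi, -⟩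
  · rwa [canS_other fun i => by simp] at h2
  · rwa [canS_other fun i => by simp] at h2
  · exact symT_const hi _

theorem Same.neg {f f' : N} (h : Same f Y f' W) : Same (neg f) Y (neg f') W := by
  refine ⟨wf_fmap true (fun _ _ h => h) (fun _ _ h => h) h.1,
    wf_fmap true (fun _ _ h => h) (fun _ _ h => h) h.2.1, ?_⟩
  show rn (canS Y W) 0 (SOA.neg f) = rn (canS W W) 0 (SOA.neg f')
  rw [rn_neg h.1.shape, rn_neg h.2.1.shape]
  exact congrArg SOA.neg h.2.2

theorem nf_sm {f : N} (hf : Wf topT (symM Y W) 0 f 0 0) : nf false W W (sm Y W f) = nf false Y W f :=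
  fmap_fmap (fun _ _ _ => rfl) (fun _ _ h => canS_canS h) hf

theorem Same.nr {f f' : N} (h : Same f Y f' W) : NR false Y W f f' := by
  unfold NR
  rw [← nf_sm h.1, h.2.2, nf_sm (h.2.1.imp (fun _ _ _ => trivial) fun _ _ => symM_self)]

theorem Same.isAr {f f' : N} (h : Same f Y f' W) : IsAr f ↔ IsAr f' := by
  rw [← isAr_fmap (d := false) (T1 := idT) (S1 := canS Y W) (q := 0) (k := 0) (l := 0) h.1.shape,
    ← isAr_fmap (d := false) (T1 := idT) (S1 := canS W W) (q := 0) (k := 0) (l := 0) h.2.1.shape]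
  exact iff_of_eq (congrArg IsAr h.2.2)

theorem Same.cls {f f' : N} (h : Same f Y f' W) (pol : Bool) (n : ℕ) :
    Cls pol n f ↔ Cls pol n f' := by
  rw [← cls_fmap (d := false) (T1 := idT) (S1 := canS Y W) (q := 0) (k := 0) (l := 0) h.1.shape,
    ← cls_fmap (d := false) (T1 := idT) (S1 := canS W W) (q := 0) (k := 0) (l := 0) h.2.1.shape]
  exact iff_of_eq (congrArg (Cls _ n) h.2.2)

/-- If every set of the family `Y` belongs to `W`, then every formula over `Y` is the same as some
formula over `W`. -/
theorem Same.exists {f : N} {fr : Prop} (hf : FmK fr Y f 0 0)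
    (h : ∀ i, dom Y i → ∃ j, matchI Y W i j) : Same f Y (sm Y W f) W :=
  Same.of_wf (hf.imp (fun _ _ _ => trivial) fun b s hs => by
    rcases hs with ⟨i, -, h⟩ | ⟨-, h⟩ | ⟨i, e, hi⟩
    · exact Or.inl ⟨i, h⟩
    · exact Or.inr (Or.inl h)
    · exact Or.inr (Or.inr ⟨i, e, hi, h i hi⟩))

end

/-! ### Satisfaction classes -/

/-- The literal with the given components is true in `M`. -/
def LitV (M : Set N) (j t s : N) : Prop :=
  (j = 0 → teval 0 t = teval 0 s) ∧ (j = 1 → teval 0 t ≠ teval 0 s) ∧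
    (j = 2 → sec M (sndN s) (teval 0 t)) ∧ (j = 3 → ¬ sec M (sndN s) (teval 0 t))

instance def_litV {M : Set N} [Fact (M ∈ F)] {f g h : α → N} [DefM F f] [DefM F g] [DefM F h] :
    Def F (fun a => LitV M (f a) (g a) (h a)) := by unfold LitV; infer_instance

/-- `S` satisfies Tarski's clauses on the set `D` of sentences over `M`. -/
structure TC (M D S : Set N) : Prop where
  sent : ∀ f ∈ D, Sent M f
  lit : ∀ j t s, TagL j → pp j (pp t s) ∈ D → (pp j (pp t s) ∈ S ↔ LitV M j t s)
  bin : ∀ j g h, TagB j → pp j (pp g h) ∈ D → (g ∈ D ∧ h ∈ D) ∧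
    (pp j (pp g h) ∈ S ↔ if j = 4 then g ∈ S ∧ h ∈ S else g ∈ S ∨ h ∈ S)
  num : ∀ j g, j = 6 ∨ j = 7 → pp j g ∈ D → (∀ n, inst (num n) g ∈ D) ∧
    (pp j g ∈ S ↔ if j = 6 then ∀ n, inst (num n) g ∈ S else ∃ n, inst (num n) g ∈ S)
  set : ∀ j g, j = 8 ∨ j = 9 → pp j g ∈ D → (∀ i, dom M i → inst2 (pp 2 i) g ∈ D) ∧
    (pp j g ∈ S ↔ if j = 8 then ∀ i, dom M i → inst2 (pp 2 i) g ∈ S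
      else ∃ i, dom M i ∧ inst2 (pp 2 i) g ∈ S)

section
variable {W W' D D' S S' : Set N} [hW : Fact (W ∈ 𝒮 N)]
  [hW' : Fact (W' ∈ 𝒮 N)] [hD : Fact (D ∈ 𝒮 N)] [hD' : Fact (D' ∈ 𝒮 N)] [hS : Fact (S ∈ 𝒮 N)]
  [hS' : Fact (S' ∈ 𝒮 N)]

theorem teval_eq_of_can {t t' : N} (h : can t = can t') : teval 0 t = teval 0 t' :=
  can_eq_iff.1 h 0

theorem LitV.dual {j t s t' s' : N} (hj : TagL j) (ht : teval 0 t = teval 0 t')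
    (hs : TagE j → teval 0 s = teval 0 s')
    (hs' : ¬ TagE j → ∀ x, sec W (sndN s) x ↔ sec W' (sndN s') x) (d : Bool) :
    LitV W' (dl d j) t' s' ↔ (bif d then ¬ LitV W j t s else LitV W j t s) := by
  rcases hj with rfl | rfl | rfl | rfl
  · cases d <;> simp [LitV, dl, ht, hs (Or.inl rfl)]
  · cases d <;> simp [LitV, dl, ht, hs (Or.inr rfl)]
  · cases d <;> simp [LitV, dl, ht, hs' (by simp [TagE])]
  · cases d <;> simp [LitV, dl, ht, hs' (by simp [TagE])]

theorem Sent.lit_sym {j t s : N} (hj : TagL j) (h : Sent W (pp j (pp t s))) :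
    IsTm 0 t ∧ (TagE j → IsTm 0 s) ∧ (¬ TagE j → ∃ i, s = pp 2 i ∧ dom W i) := by
  obtain ⟨h1, h2, h3⟩ := (fmK_lit hj).1 h
  refine ⟨h1, h2, fun hE => ?_⟩
  rcases h3 hE with ⟨i, hi, -⟩ | h | h
  · exact absurd hi (not_lt_zero' i)
  · exact absurd h.1 id
  · exact h

set_option maxHeartbeats 400000 in
/-- Truth of a sentence depends only on the sets denoted by its constants and on the values of
its terms. -/
theorem TC.nr (h : TC W D S) (h' : TC W' D' S') (d : Bool) {y x : N} (hy : y ∈ D) (hx : x ∈ D')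
    (hA : W = W' ∨ IsAr y) (hn : NR d W W' y x) :
    x ∈ S' ↔ (bif d then y ∉ S else y ∈ S) := by
  have H : ∀ n y x : N, dp y = n → y ∈ D → x ∈ D' → W = W' ∨ IsAr y → NR d W W' y x →
      (d = true → (x ∈ S' ↔ y ∉ S)) ∧ (d = false → (x ∈ S' ↔ y ∈ S)) := by
    refine sind 𝒮 N fun n ih y x hn hy hx hA hNR => ?_
    have hsx := (h'.sent x hx).shape
    have lt1 : ∀ a : N, a < a + 1 := fun a => ACAM.lt_add_one_iff.2 le_rfl
    rcases (h.sent y hy).shape.cases with ⟨j, t, s, hj, rfl⟩ | ⟨j, g, k, hj, rfl, hg, hk⟩ |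
      ⟨j, g, hj, rfl, hg⟩
    · obtain ⟨t', s', rfl, h1, h2, h3⟩ := hNR.lit hsx hj
      have := LitV.dual (W := W) (W' := W') hj (teval_eq_of_can h1)
        (fun hE => teval_eq_of_can (h2 hE)) (fun hE => ?_) d
      · rw [h.lit _ _ _ hj hy, h'.lit _ _ _ (hj.dl d) hx, this]
        cases d <;> simp
      · obtain ⟨i, rfl, hi⟩ := (Sent.lit_sym hj (h.sent _ hy)).2.2 hE
        obtain ⟨i', rfl, hi'⟩ := (Sent.lit_sym (hj.dl d) (h'.sent _ hx)).2.2
          (mt (tagE_dl hj d).1 hE)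
        rw [sndN_pp, sndN_pp]
        exact (canS_eq hi' (h3 hE)).2
    · obtain ⟨g', k', rfl, h1, h2⟩ := hNR.bin hsx hj
      obtain ⟨⟨hg1, hk1⟩, e1⟩ := h.bin _ _ _ hj hy
      obtain ⟨⟨hg2, hk2⟩, e2⟩ := h'.bin _ _ _ (hj.dl d) hx
      rw [dp_bin hj] at hn
      have l1 : dp g < n := hn ▸ ACAM.lt_add_one_iff.2 le_self_add
      have l2 : dp k < n := by
        have : dp k ≤ dp k + dp g := le_self_add
        rw [add_comm] at this
        exact hn ▸ ACAM.lt_add_one_iff.2 this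
      have i1 := ih (dp g) l1 g g' rfl hg1 hg2
        (hA.imp id fun hA => ((isAr_bin hj).1 hA).1) h1
      have i2 := ih (dp k) l2 k k' rfl hk1 hk2
        (hA.imp id fun hA => ((isAr_bin hj).1 hA).2) h2
      rw [e1, e2]
      cases d
      · have a1 := i1.2 rfl
        have a2 := i2.2 rfl
        rw [dl_false]
        simp [a1, a2]
      · have a1 := i1.1 rfl
        have a2 := i2.1 rfl
        rcases hj with rfl | rfl
        · simp [dl, a1, a2, -not_and, not_and_or]
        · simp [dl, a1, a2]
    · obtain ⟨g', rfl, hg', h1⟩ := hNR.un hsx hg hj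
      have hdn : dp g + 1 = n := by rw [← hn, dp_un hj]
      rcases tagU_cases hj with hq | hq
      · obtain ⟨m1, e1⟩ := h.num _ _ hq hy
        obtain ⟨m2, e2⟩ := h'.num _ _ ((dl_num hj d).2 hq) hx
        have i1 := fun m : N => ih (dp g) (hdn ▸ lt1 _) (SOA.inst (SOA.num m) g)
          (SOA.inst (SOA.num m) g') (dp_inst hg) (m1 m) (m2 m)
          (hA.imp id fun hA => (isAr_inst hg).2 ((isAr_un hj).1 hA).2) (h1.inst hg hg' rfl)
        rw [e1, e2]
        cases d
        · have a1 := fun m => (i1 m).2 rfl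
          rw [dl_false]
          simp [a1]
        · have a1 := fun m => (i1 m).1 rfl
          rcases hq with rfl | rfl <;> simp [dl, a1]
      · have hWW : W = W' := hA.resolve_right fun hA => by
          have := ((isAr_un hj).1 hA).1
          rcases hq with rfl | rfl <;> simp at this
        subst hWW
        obtain ⟨m1, e1⟩ := h.set _ _ hq hy
        obtain ⟨m2, e2⟩ := h'.set _ _ (by cases d <;> rcases hq with rfl | rfl <;> simp [dl]) hx
        have i1 := fun (m : N) hm => ih (dp g) (hdn ▸ lt1 _) (inst2 (pp 2 m) g)
          (inst2 (pp 2 m) g') (dp_inst2 hg) (m1 m hm) (m2 m hm)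
          (Or.inl rfl) (h1.inst2 hg hg' rfl)
        rw [e1, e2]
        cases d
        · have a1 := fun m hm => (i1 m hm).2 rfl
          rcases hq with rfl | rfl <;> simp [dl]
          exacts [forall₂_congr a1, exists_congr fun m => and_congr_right (a1 m)]
        · have a1 := fun m hm => (i1 m hm).1 rfl
          rcases hq with rfl | rfl <;> simp [dl]
          exacts [exists_congr fun m => and_congr_right (a1 m), forall₂_congr a1]
  cases d
  · exact (H _ y x rfl hy hx hA hn).2 rfl
  · exact (H _ y x rfl hy hx hA hn).1 rfl

end

end

/-! ### Evaluation of formulas with named variables -/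

section

/-- A position in a formula, together with values of the variables. -/
structure Pos (N : Type) where
  a : ℕ
  b : ℕ
  e : ℕ → N
  E : ℕ → Set N

/-- The position `c'` lies in the scope of further quantifiers. -/
def Pos.Le (c c' : Pos N) : Prop := ∃ k l, c'.a = c.a + k ∧ c'.b = c.b + l ∧
  (∀ i, c'.e (i + k) = c.e i) ∧ ∀ i, c'.E (i + l) = c.E i

def Pos.pushN (c : Pos N) (x : N) : Pos N := ⟨c.a + 1, c.b, scons x c.e, c.E⟩
def Pos.pushS (c : Pos N) (X : Set N) : Pos N := ⟨c.a, c.b + 1, c.e, scons X c.E⟩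

theorem Pos.Le.refl (c : Pos N) : c.Le c := ⟨0, 0, rfl, rfl, fun _ => rfl, fun _ => rfl⟩

theorem Pos.Le.trans {c c' c'' : Pos N} (h : c.Le c') (h' : c'.Le c'') : c.Le c'' := by
  obtain ⟨k, l, h1, h2, h3, h4⟩ := h
  obtain ⟨k', l', h1', h2', h3', h4'⟩ := h'
  refine ⟨k + k', l + l', by omega, by omega, fun i => ?_, fun i => ?_⟩
  · rw [← Nat.add_assoc, h3', h3]
  · rw [← Nat.add_assoc, h4', h4]

theorem Pos.le_pushN (c : Pos N) (x : N) : c.Le (c.pushN x) :=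
  ⟨1, 0, rfl, rfl, fun _ => rfl, fun _ => rfl⟩
theorem Pos.le_pushS (c : Pos N) (X : Set N) : c.Le (c.pushS X) :=
  ⟨0, 1, rfl, rfl, fun _ => rfl, fun _ => rfl⟩

/-- The term `t` has the value `x`. -/
class NV (c : Pos N) (t : Num) (x : outParam N) : Prop where
  out : ∀ c', c.Le c' → (t c'.a).eval c'.e = x

/-- The set variable `X` has the value `A`. -/
class SV (c : Pos N) (X : SetV) (A : outParam (Set N)) : Prop where
  out : ∀ c', c.Le c' → c'.E (X c'.b) = A

/-- The formula `φ` expresses `P`. -/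
class Den (c : Pos N) (φ : Form) (P : outParam Prop) : Prop where
  out : Sat 𝒮 N c.e c.E (φ c.a c.b) ↔ P

variable {c : Pos N}

instance nv_pushN {t : Num} {x y : N} [h : NV c t x] : NV (c.pushN y) t x :=
  ⟨fun c' hc => h.out c' ((c.le_pushN y).trans hc)⟩
instance nv_pushS {t : Num} {x : N} {Y : Set N} [h : NV c t x] : NV (c.pushS Y) t x :=
  ⟨fun c' hc => h.out c' ((c.le_pushS Y).trans hc)⟩
instance sv_pushN {X : SetV} {A : Set N} {y : N} [h : SV c X A] : SV (c.pushN y) X A :=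
  ⟨fun c' hc => h.out c' ((c.le_pushN y).trans hc)⟩
instance sv_pushS {X : SetV} {A : Set N} {Y : Set N} [h : SV c X A] : SV (c.pushS Y) X A :=
  ⟨fun c' hc => h.out c' ((c.le_pushS Y).trans hc)⟩

/-- The variables bound by a quantifier at the position `c`. -/
def Pos.vN (c : Pos N) : Num := fun a' => .var (a' - 1 - c.a)
def Pos.vS (c : Pos N) : SetV := fun b' => b' - 1 - c.b

instance (priority := high) nv_vN {x : N} : NV (c.pushN x) c.vN x := ⟨fun c' hc => by
  obtain ⟨k, l, h1, h2, h3, h4⟩ := hc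
  rw [Pos.vN, h1, show (c.pushN x).a + k - 1 - c.a = 0 + k by simp [Pos.pushN]]
  exact h3 0⟩

instance (priority := high) sv_vS {X : Set N} : SV (c.pushS X) c.vS X := ⟨fun c' hc => by
  obtain ⟨k, l, h1, h2, h3, h4⟩ := hc
  rw [Pos.vS, h2, show (c.pushS X).b + l - 1 - c.b = 0 + l by simp [Pos.pushS]]
  exact h4 0⟩

instance den_allN {f : Num → Form} {P : N → Prop} [h : ∀ x : N, Den (c.pushN x) (f c.vN) (P x)] :
    Den c (allN f) (∀ x, P x) := ⟨forall_congr' fun x => (h x).out⟩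

instance den_exN {f : Num → Form} {P : N → Prop} [h : ∀ x : N, Den (c.pushN x) (f c.vN) (P x)] :
    Den c (exN f) (∃ x, P x) := ⟨exists_congr fun x => (h x).out⟩

instance den_allS {f : SetV → Form} {P : Set N → Prop}
    [h : ∀ (X : Set N) [Fact (X ∈ 𝒮 N)], Den (c.pushS X) (f c.vS) (P X)] :
    Den c (allS f) (∀ X ∈ 𝒮 N, P X) :=
  ⟨forall_congr' fun X => forall_congr' fun hX => (@h X ⟨hX⟩).out⟩

instance den_exS {f : SetV → Form} {P : Set N → Prop}
    [h : ∀ (X : Set N) [Fact (X ∈ 𝒮 N)], Den (c.pushS X) (f c.vS) (P X)] :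
    Den c (exS f) (∃ X ∈ 𝒮 N, P X) :=
  ⟨exists_congr fun X => and_congr_right fun hX => (@h X ⟨hX⟩).out⟩

theorem NV.val {t : Num} {x : N} (h : NV c t x) : (t c.a).eval c.e = x := h.out c (.refl c)
theorem SV.val {X : SetV} {A : Set N} (h : SV c X A) : c.E (X c.b) = A := h.out c (.refl c)

instance den_eq {t u : Num} {x y : N} [h : NV c t x] [h' : NV c u y] : Den c (t ≐ u) (x = y) :=
  ⟨by rw [← h.val, ← h'.val]; rfl⟩

instance den_mem {t : Num} {X : SetV} {x : N} {A : Set N} [h : NV c t x] [h' : SV c X A] :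
    Den c (t ∊ X) (x ∈ A) := ⟨by rw [← h.val, ← h'.val]; rfl⟩

instance den_not {φ : Form} {P : Prop} [h : Den c φ P] : Den c (∼φ) (¬ P) :=
  ⟨(Sat_neg _ _ _ _).trans (not_congr h.out)⟩
instance den_and {φ ψ : Form} {P Q : Prop} [h : Den c φ P] [h' : Den c ψ Q] :
    Den c (φ ⋏ ψ) (P ∧ Q) := ⟨and_congr h.out h'.out⟩
instance den_or {φ ψ : Form} {P Q : Prop} [h : Den c φ P] [h' : Den c ψ Q] :
    Den c (φ ⋎ ψ) (P ∨ Q) := ⟨or_congr h.out h'.out⟩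
theorem Den.congr {φ : Form} {P Q : Prop} [h : Den c φ P] (hPQ : P ↔ Q) : Den c φ Q :=
  ⟨h.out.trans hPQ⟩
instance den_imp {φ ψ : Form} {P Q : Prop} [h : Den c φ P] [h' : Den c ψ Q] :
    Den c (φ ⟶' ψ) (P → Q) := by
  unfold impF; exact Den.congr (imp_iff_not_or).symm
instance den_iff {φ ψ : Form} {P Q : Prop} [h : Den c φ P] [h' : Den c ψ Q] :
    Den c (φ ⟷' ψ) (P ↔ Q) := by
  unfold iffF; exact Den.congr (iff_iff_implies_and_implies).symm

instance nv_bif {b : Bool} {t u : Num} {x y : N} [h : NV c t x] [h' : NV c u y] :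
    NV c (bif b then t else u) (bif b then x else y) := by
  cases b
  · exact h'
  · exact h
instance den_bif {b : Bool} {φ ψ : Form} {P Q : Prop} [h : Den c φ P] [h' : Den c ψ Q] :
    Den c (bif b then φ else ψ) (bif b then P else Q) := by
  cases b
  · exact h'
  · exact h

theorem eval_numeral (e : ℕ → N) (n : ℕ) : (numeral n).eval e = (n : N) := by
  induction n with
  | zero => simp [numeral, Tm.eval]
  | succ n ih => rw [numeral, Tm.eval, ih, succ_eq, Nat.cast_succ]

instance (priority := low) nv_lit {n : ℕ} : NV c (lit n) (n : N) := ⟨fun _ _ => eval_numeral _ n⟩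
instance nv_lit0 : NV c (lit 0) 0 := ⟨fun _ _ => by rw [lit, eval_numeral, Nat.cast_zero]⟩
instance nv_lit1 : NV c (lit 1) 1 := ⟨fun _ _ => by rw [lit, eval_numeral, Nat.cast_one]⟩
instance nv_suc {t : Num} {x : N} [h : NV c t x] : NV c (suc t) (x + 1) :=
  ⟨fun c' hc => by rw [SOA.suc, Tm.eval, h.out c' hc, succ_eq]⟩
instance nv_add {t u : Num} {x y : N} [h : NV c t x] [h' : NV c u y] :
    NV c (fun a => .add (t a) (u a)) (x + y) :=
  ⟨fun c' hc => by rw [Tm.eval, h.out c' hc, h'.out c' hc]⟩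
instance nv_mul {t u : Num} {x y : N} [h : NV c t x] [h' : NV c u y] :
    NV c (fun a => .mul (t a) (u a)) (x * y) :=
  ⟨fun c' hc => by rw [Tm.eval, h.out c' hc, h'.out c' hc]⟩
instance nv_tsucc {t : Num} {x : N} [h : NV c t x] : NV c (fun a => .succ (t a)) (x + 1) := nv_suc
instance nv_pair {t u : Num} {x y : N} [h : NV c t x] [h' : NV c u y] :
    NV c (pair t u) (pp x y) :=
  ⟨fun c' hc => by simp only [SOA.pair, Tm.eval, h.out c' hc, h'.out c' hc, pp]⟩

instance den_lt {t u : Num} {x y : N} [h : NV c t x] [h' : NV c u y] : Den c (ltF t u) (x < y) := by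
  unfold ltF
  refine Den.congr ?_
  rw [ACAM.lt_iff, ACAM.le_def]
  exact exists_congr fun z => by rw [eq_comm, show x + 1 + z = x + (z + 1) by ring]

section
variable {t u s : Num} {x y z : N} [NV c t x] [NV c u y] [NV c s z]
instance nv_cZero : NV c cZero (pp 0 0) := by unfold SOA.cZero; infer_instance
instance nv_cVar : NV c (cVar t) (pp 1 x) := by unfold SOA.cVar; infer_instance
instance nv_cSucc : NV c (cSucc t) (pp 2 x) := by unfold SOA.cSucc; infer_instance
instance nv_cAdd : NV c (cAdd t u) (pp 3 (pp x y)) := by unfold SOA.cAdd; infer_instance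
instance nv_cMul : NV c (cMul t u) (pp 4 (pp x y)) := by unfold SOA.cMul; infer_instance
instance nv_cBound : NV c (cBound t) (pp 0 x) := by unfold SOA.cBound; infer_instance
instance nv_cFree : NV c (cFree t) (pp 1 x) := by unfold SOA.cFree; infer_instance
instance nv_cConst : NV c (cConst t) (pp 2 x) := by unfold SOA.cConst; infer_instance
instance nv_cEq : NV c (cEq t u) (pp 0 (pp x y)) := by unfold SOA.cEq; infer_instance
instance nv_cNeq : NV c (cNeq t u) (pp 1 (pp x y)) := by unfold SOA.cNeq; infer_instance
instance nv_cMem : NV c (cMem t u) (pp 2 (pp x y)) := by unfold SOA.cMem; infer_instance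
instance nv_cNmem : NV c (cNmem t u) (pp 3 (pp x y)) := by unfold SOA.cNmem; infer_instance
instance nv_cAnd : NV c (cAnd t u) (pp 4 (pp x y)) := by unfold SOA.cAnd; infer_instance
instance nv_cOr : NV c (cOr t u) (pp 5 (pp x y)) := by unfold SOA.cOr; infer_instance
instance nv_cAll : NV c (cAll t) (pp 6 x) := by unfold SOA.cAll; infer_instance
instance nv_cEx : NV c (cEx t) (pp 7 x) := by unfold SOA.cEx; infer_instance
instance nv_cAll2 : NV c (cAll2 t) (pp 8 x) := by unfold SOA.cAll2; infer_instance
instance nv_cEx2 : NV c (cEx2 t) (pp 9 x) := by unfold SOA.cEx2; infer_instance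

variable {X Y : SetV} {A B : Set N} [SV c X A] [SV c Y B]
instance den_inDom : Den c (inDom t X) (dom A x) := by unfold SOA.inDom dom; infer_instance
instance den_inSec : Den c (inSec t u X) (sec A y x) := by unfold SOA.inSec sec; infer_instance
/-- `A` is a member of the family `B`. -/
def MemFam (A B : Set N) : Prop := ∃ z, dom B z ∧ ∀ x, x ∈ A ↔ sec B z x
instance den_memFam : Den c (memFam X Y) (MemFam A B) := by
  unfold SOA.memFam MemFam; infer_instance

/-! ### Terms -/

open Classical in
instance den_isTm : Den c (isTm t u) (IsTm y x) := by
  unfold SOA.isTm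
  refine Den.congr ⟨?_, fun h => ⟨{z | IsTm (sndN z) (fstN z)}, setOf_mem inferInstance,
    fun t k => ?_, by simpa using h⟩⟩
  · rintro ⟨R, hR, h, hx⟩
    have : Fact (R ∈ 𝒮 N) := ⟨hR⟩
    refine sind 𝒮 N (P := fun t => ∀ k, pp t k ∈ R → IsTm k t) (fun t ih k hk => ?_) x y hx
    rcases (h t k).1 hk with rfl | ⟨i, rfl, hi⟩ | ⟨u, rfl, hu⟩ | ⟨u, v, rfl | rfl, hu, hv⟩
    · exact isTm_zero k
    · exact (isTm_var k i).2 hi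
    · exact (isTm_succ k u).2 (ih _ (lt_pp_right (by norm_num) _) _ hu)
    · exact (isTm_add k u v).2 ⟨ih _ (lt_of_le_of_lt (le_pp_left _ _) (lt_pp_right (by norm_num) _))
        _ hu, ih _ (lt_of_le_of_lt (le_pp_right _ _) (lt_pp_right (by norm_num) _)) _ hv⟩
    · exact (isTm_mul k u v).2 ⟨ih _ (lt_of_le_of_lt (le_pp_left _ _) (lt_pp_right (by norm_num) _))
        _ hu, ih _ (lt_of_le_of_lt (le_pp_right _ _) (lt_pp_right (by norm_num) _)) _ hv⟩
  · simp only [Set.mem_ofPred_eq, fstN_pp, sndN_pp]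
    constructor
    · intro h
      by_cases hJ : TJunk t
      · exact absurd h (isTm_junk hJ)
      · simp only [TJunk, not_and_or, not_forall, not_not] at hJ
        rcases hJ with rfl | ⟨u, rfl⟩ | ⟨u, rfl⟩ | ⟨u, v, rfl⟩ | ⟨u, v, rfl⟩
        · exact Or.inl rfl
        · exact Or.inr (Or.inl ⟨u, rfl, (isTm_var _ _).1 h⟩)
        · exact Or.inr (Or.inr (Or.inl ⟨u, rfl, (isTm_succ _ _).1 h⟩))
        · exact Or.inr (Or.inr (Or.inr ⟨u, v, Or.inl rfl, (isTm_add _ _ _).1 h⟩))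
        · exact Or.inr (Or.inr (Or.inr ⟨u, v, Or.inr rfl, (isTm_mul _ _ _).1 h⟩))
    · rintro (rfl | ⟨i, rfl, hi⟩ | ⟨u, rfl, hu⟩ | ⟨u, v, rfl | rfl, hu, hv⟩)
      · exact isTm_zero k
      · exact (isTm_var k i).2 hi
      · exact (isTm_succ k u).2 hu
      · exact (isTm_add k u v).2 ⟨hu, hv⟩
      · exact (isTm_mul k u v).2 ⟨hu, hv⟩

end
end

theorem lt_un {j : N} (hj : 1 ≤ j) (g : N) : g < pp j g := lt_pp_right hj g
theorem lt_bin₁ {j : N} (hj : 1 ≤ j) (g h : N) : g < pp j (pp g h) :=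
  lt_of_le_of_lt (le_pp_left _ _) (lt_pp_right hj _)
theorem lt_bin₂ {j : N} (hj : 1 ≤ j) (g h : N) : h < pp j (pp g h) :=
  lt_of_le_of_lt (le_pp_right _ _) (lt_pp_right hj _)

theorem term_cases (t : N) : t = pp 0 0 ∨ (∃ i, t = pp 1 i) ∨ (∃ u, t = pp 2 u) ∨
    (∃ u v, t = pp 3 (pp u v)) ∨ (∃ u v, t = pp 4 (pp u v)) ∨ TJunk t := by
  by_cases hJ : TJunk t
  · simp only [hJ, or_true]
  · simp only [TJunk, not_and_or, not_forall, not_not] at hJ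
    rcases hJ with h | h | h | h | h
    · exact Or.inl h
    · exact Or.inr (Or.inl h)
    · exact Or.inr (Or.inr (Or.inl h))
    · exact Or.inr (Or.inr (Or.inr (Or.inl h)))
    · exact Or.inr (Or.inr (Or.inr (Or.inr (Or.inl h))))

theorem form_cases (x : N) : (∃ j t s, TagL j ∧ x = pp j (pp t s)) ∨
    (∃ j g h, TagB j ∧ x = pp j (pp g h)) ∨ (∃ j g, TagU j ∧ x = pp j g) ∨ FJunk x := by
  by_cases h : FJunk x
  · simp only [h, or_true]
  · simp only [FJunk, not_and_or, not_forall, not_not, exists_prop] at h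
    rcases h with h | h | h
    · exact Or.inl h
    · exact Or.inr (Or.inl h)
    · exact Or.inr (Or.inr (Or.inl h))

/-! ### Least fixed points of recursions on codes -/

theorem fix_iff {Q : N → Prop} [hQ : Def 𝒮 N (fun p : N × N => Q p.2)] {Φ : Set N → N → Prop} {x : N}
    (step : ∀ R f, Φ R f → (∀ g < f, g ∈ R → Q g) → Q f) (inv : ∀ f, Q f → Φ {f | Q f} f) :
    (∃ R ∈ 𝒮 N, (∀ f, f ∈ R ↔ Φ R f) ∧ x ∈ R) ↔ Q x := by
  refine ⟨?_, fun h => ⟨{f | Q f}, setOf_mem hQ,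
    fun f => ⟨inv f, fun h' => step _ f h' fun _ _ h => h⟩, h⟩⟩
  rintro ⟨R, hR, h, hx⟩
  have : Fact (R ∈ 𝒮 N) := ⟨hR⟩
  exact sind 𝒮 N (P := fun f => f ∈ R → Q f) (fun f ih hf => step R f ((h f).1 hf) ih) x hx

theorem fix_iff₂ {Q : N → N → Prop} [hQ : Def 𝒮 N (fun p : N × N => Q p.1 p.2)]
    {Φ : Set N → N → N → Prop} {x y : N}
    (step : ∀ R f a, Φ R f a → (∀ g < f, ∀ b, pp g b ∈ R → Q g b) → Q f a)
    (inv : ∀ R, (∀ f a, pp f a ∈ R ↔ Q f a) → ∀ f a, Q f a → Φ R f a) :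
    (∃ R ∈ 𝒮 N, (∀ f a, pp f a ∈ R ↔ Φ R f a) ∧ pp x y ∈ R) ↔ Q x y := by
  have iQ : ∀ {α : Type} [Ctx N α] (f g : α → N) [DefM 𝒮 N f] [DefM 𝒮 N g],
    Def 𝒮 N (fun a => Q (f a) (g a)) := Def.lift2 hQ
  constructor
  · rintro ⟨R, hR, h, hx⟩
    have : Fact (R ∈ 𝒮 N) := ⟨hR⟩
    exact sind 𝒮 N (P := fun f => ∀ a, pp f a ∈ R → Q f a)
      (fun f ih a hf => step R f a ((h f a).1 hf) ih) x y hx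
  · have hm : ∀ f a, pp f a ∈ {q | Q (fstN q) (sndN q)} ↔ Q f a := fun f a => by simp
    exact fun h => ⟨_, setOf_mem inferInstance, fun f a => ⟨fun h' => inv _ hm f a ((hm f a).1 h'),
      fun h' => (hm f a).2 (step _ f a h' fun g _ b => (hm g b).1)⟩, (hm x y).2 h⟩

theorem fix_iff₃ {Q : N → N → N → Prop} [hQ : Def3 𝒮 N Q] {Φ : Set N → N → N → N → Prop} {x y z : N}
    (step : ∀ R f a a', Φ R f a a' → (∀ g < f, ∀ b b', pp g (pp b b') ∈ R → Q g b b') → Q f a a')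
    (inv : ∀ R, (∀ f a a', pp f (pp a a') ∈ R ↔ Q f a a') → ∀ f a a', Q f a a' → Φ R f a a') :
    (∃ R ∈ 𝒮 N, (∀ f a a', pp f (pp a a') ∈ R ↔ Φ R f a a') ∧ pp x (pp y z) ∈ R) ↔ Q x y z := by
  have iQ : ∀ {α : Type} [Ctx N α] (f g k : α → N) [DefM 𝒮 N f] [DefM 𝒮 N g] [DefM 𝒮 N k],
    Def 𝒮 N (fun a => Q (f a) (g a) (k a)) := Def3.app hQ
  constructor
  · rintro ⟨R, hR, h, hx⟩
    have : Fact (R ∈ 𝒮 N) := ⟨hR⟩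
    exact sind 𝒮 N (P := fun f => ∀ a a', pp f (pp a a') ∈ R → Q f a a')
      (fun f ih a a' hf => step R f a a' ((h f a a').1 hf) ih) x y z hx
  · have hm : ∀ f a a', pp f (pp a a') ∈ {q | Q (fstN q) (fstN (sndN q)) (sndN (sndN q))} ↔
        Q f a a' := fun f a a' => by simp
    exact fun h => ⟨_, setOf_mem inferInstance, fun f a a' =>
      ⟨fun h' => inv _ hm f a a' ((hm f a a').1 h'),
      fun h' => (hm f a a').2 (step _ f a a' h' fun g _ b b' => (hm g b b').1)⟩, (hm x y z).2 h⟩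

section
variable {c : Pos N} {t u s r : Num} {x y z w : N} [NV c t x] [NV c u y] [NV c s z] [NV c r w]
  {X Y : SetV} {A B : Set N} [SV c X A] [SV c Y B]

instance den_val : Den c (val t u) (IsTm 0 x ∧ teval 0 x = y) := by
  unfold SOA.val
  refine Den.congr (fix_iff₂ (Q := fun t n => IsTm 0 t ∧ teval 0 t = n) ?_ ?_)
  · rintro R t n (⟨rfl, rfl⟩ | ⟨u, m, rfl, rfl, hu⟩ | ⟨u, v, m, p, rfl, rfl, hu, hv⟩ |
      ⟨u, v, m, p, rfl, rfl, hu, hv⟩) ih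
    · exact ⟨isTm_zero 0, teval_zero 0⟩
    · obtain ⟨h, rfl⟩ := ih _ (lt_un (by norm_num) _) _ hu
      exact ⟨(isTm_succ _ _).2 h, teval_succ _ _⟩
    all_goals
      obtain ⟨h, rfl⟩ := ih _ (lt_bin₁ (by norm_num) _ _) _ hu
      obtain ⟨h', rfl⟩ := ih _ (lt_bin₂ (by norm_num) _ _) _ hv
    · exact ⟨(isTm_add _ _ _).2 ⟨h, h'⟩, teval_add _ _ _⟩
    · exact ⟨(isTm_mul _ _ _).2 ⟨h, h'⟩, teval_mul _ _ _⟩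
  · rintro R hR t n ⟨h, rfl⟩
    simp only [hR]
    rcases term_cases t with rfl | ⟨i, rfl⟩ | ⟨u, rfl⟩ | ⟨u, v, rfl⟩ | ⟨u, v, rfl⟩ | hJ
    · exact Or.inl ⟨rfl, teval_zero 0⟩
    · exact absurd ((isTm_var _ _).1 h) (not_lt_zero' i)
    · exact Or.inr (Or.inl ⟨u, _, rfl, teval_succ _ _, (isTm_succ _ _).1 h, rfl⟩)
    · have := (isTm_add _ _ _).1 h
      exact Or.inr (Or.inr (Or.inl ⟨u, v, _, _, rfl, teval_add _ _ _, ⟨this.1, rfl⟩, this.2, rfl⟩))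
    · have := (isTm_mul _ _ _).1 h
      exact Or.inr (Or.inr (Or.inr ⟨u, v, _, _, rfl, teval_mul _ _ _, ⟨this.1, rfl⟩, this.2, rfl⟩))
    · exact absurd h (isTm_junk hJ)

/-- The closed terms `x` and `y` have the same value. -/
def SameVal (x y : N) : Prop := IsTm 0 x ∧ IsTm 0 y ∧ teval 0 x = teval 0 y

instance den_sameVal : Den c (sameVal t u) (SameVal x y) := by
  unfold SOA.sameVal
  refine Den.congr ⟨?_, fun h => ⟨_, ⟨h.1, rfl⟩, h.2.1, h.2.2.symm⟩⟩
  rintro ⟨n, ⟨h, rfl⟩, h', e⟩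
  exact ⟨h, h', e.symm⟩

instance den_isNumeral : Den c (isNumeral t u) (y = num x) := by
  unfold SOA.isNumeral
  refine Den.congr (fix_iff₂ (Q := fun t n => n = num t) ?_ ?_)
  · rintro R t n (⟨rfl, rfl⟩ | ⟨m, d, rfl, rfl, h⟩) ih
    · exact num_zero.symm
    · rw [num_succ, ih _ (lt_add_one m) _ h]
  · rintro R hR t n rfl
    simp only [hR]
    rcases eq_zero_or_succ t with rfl | ⟨m, rfl⟩
    · exact Or.inl ⟨rfl, num_zero⟩
    · exact Or.inr ⟨m, _, rfl, num_succ m, rfl⟩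

instance den_tmSub : Den c (tmSub t u s r) (TSh y ∧ w = tsub x z y) := by
  unfold SOA.tmSub
  refine Den.congr (fix_iff₂ (Q := fun t n => TSh t ∧ n = tsub x z t) ?_ ?_)
  · rintro R t n (⟨rfl, rfl⟩ | ⟨rfl, rfl⟩ | ⟨i, hi, rfl, rfl⟩ | ⟨u, u', rfl, rfl, hu⟩ |
      ⟨u, u', v, v', ⟨rfl, rfl⟩ | ⟨rfl, rfl⟩, hu, hv⟩) ih
    · exact ⟨tSh_zero, (tsub_zero _ _).symm⟩
    · exact ⟨tSh_var _, by rw [tsub_var, if_pos rfl]⟩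
    · exact ⟨tSh_var _, by rw [tsub_var, if_neg hi]⟩
    · obtain ⟨h, rfl⟩ := ih _ (lt_un (by norm_num) _) _ hu
      exact ⟨(tSh_succ _).2 h, (tsub_succ _ _ _).symm⟩
    all_goals
      obtain ⟨h, rfl⟩ := ih _ (lt_bin₁ (by norm_num) _ _) _ hu
      obtain ⟨h', rfl⟩ := ih _ (lt_bin₂ (by norm_num) _ _) _ hv
    · exact ⟨(tSh_add _ _).2 ⟨h, h'⟩, (tsub_add _ _ _ _).symm⟩
    · exact ⟨(tSh_mul _ _).2 ⟨h, h'⟩, (tsub_mul _ _ _ _).symm⟩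
  · rintro R hR t n ⟨h, rfl⟩
    simp only [hR]
    rcases term_cases t with rfl | ⟨i, rfl⟩ | ⟨u, rfl⟩ | ⟨u, v, rfl⟩ | ⟨u, v, rfl⟩ | hJ
    · exact Or.inl ⟨rfl, tsub_zero _ _⟩
    · by_cases hi : i = z
      · exact Or.inr (Or.inl ⟨by rw [hi], by rw [tsub_var, if_pos hi]⟩)
      · exact Or.inr (Or.inr (Or.inl ⟨i, hi, rfl, by rw [tsub_var, if_neg hi]⟩))
    · exact Or.inr (Or.inr (Or.inr (Or.inl ⟨u, _, rfl, tsub_succ _ _ _, (tSh_succ _).1 h, rfl⟩)))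
    · have := (tSh_add _ _).1 h
      exact Or.inr (Or.inr (Or.inr (Or.inr ⟨u, _, v, _, Or.inl ⟨rfl, tsub_add _ _ _ _⟩,
        ⟨this.1, rfl⟩, this.2, rfl⟩)))
    · have := (tSh_mul _ _).1 h
      exact Or.inr (Or.inr (Or.inr (Or.inr ⟨u, _, v, _, Or.inr ⟨rfl, tsub_mul _ _ _ _⟩,
        ⟨this.1, rfl⟩, this.2, rfl⟩)))
    · exact absurd h (tSh_junk hJ)

/-! ### Formulas -/

theorem tagL_of {j : N} (h : TagL j) : TagE j ∨ (j = 2 ∨ j = 3) := by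
  unfold TagL at h; unfold TagE; tauto
theorem not_tagE {j : N} (h : j = 2 ∨ j = 3) : ¬ TagE j := by
  rcases h with rfl | rfl <;> simp [TagE]
theorem TagE.tagL {j : N} (h : TagE j) : TagL j := by unfold TagE at h; unfold TagL; tauto
theorem tagL_mem {j : N} (h : j = 2 ∨ j = 3) : TagL j := by unfold TagL; tauto

/-- Formulas with a given tag, written as a disjunction. -/
theorem pp_or {f j k a : N} : f = pp j a ∨ f = pp k a ↔ ∃ i, (i = j ∨ i = k) ∧ f = pp i a :=
  ⟨fun h => h.elim (fun h => ⟨j, Or.inl rfl, h⟩) fun h => ⟨k, Or.inr rfl, h⟩, by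
    rintro ⟨i, rfl | rfl, h⟩
    · exact Or.inl h
    · exact Or.inr h⟩

instance den_isFm [hB : Fact (B ∈ 𝒮 N)] : Den c (isFm t Y) (IsFm B x) := by
  unfold SOA.isFm
  refine Den.congr (fix_iff₃ (Q := FmK True B) ?_ ?_)
  · simp only [pp_or]
    rintro R f k l (⟨t, u, ⟨j, hj, rfl⟩, h1, h2⟩ | ⟨t, s, ⟨j, hj, rfl⟩, h1, i, h2⟩ |
      ⟨g, h, ⟨j, hj, rfl⟩, h1, h2⟩ | ⟨g, ⟨j, hj, rfl⟩, h1⟩ | ⟨g, ⟨j, hj, rfl⟩, h1⟩) ih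
    · exact (fmK_lit (TagE.tagL hj)).2 ⟨h1, fun _ => h2, fun h => absurd hj h⟩
    · refine (fmK_lit (tagL_mem hj)).2 ⟨h1, fun h => absurd h (not_tagE hj), fun _ => ?_⟩
      rcases h2 with ⟨rfl, h2⟩ | rfl | ⟨rfl, h2⟩
      · exact Or.inl ⟨i, h2, rfl⟩
      · exact Or.inr (Or.inl ⟨trivial, i, rfl⟩)
      · exact Or.inr (Or.inr ⟨i, rfl, h2⟩)
    · exact (fmK_bin hj).2 ⟨ih _ (lt_bin₁ (TagB.pos hj) _ _) _ _ h1,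
        ih _ (lt_bin₂ (TagB.pos hj) _ _) _ _ h2⟩
    · exact (fmK_num hj).2 (ih _ (lt_un (tagU_num hj).pos _) _ _ h1)
    · exact (fmK_set hj).2 (ih _ (lt_un (tagU_set hj).pos _) _ _ h1)
  · intro R hR f k l h
    simp only [hR, pp_or]
    rcases form_cases f with ⟨j, t, s, hj, rfl⟩ | ⟨j, g, g', hj, rfl⟩ | ⟨j, g, hj, rfl⟩ | hJ
    · obtain ⟨h1, h2, h3⟩ := (fmK_lit hj).1 h
      rcases tagL_of hj with hE | hE
      · exact Or.inl ⟨t, s, ⟨j, hE, rfl⟩, h1, h2 hE⟩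
      · refine Or.inr (Or.inl ⟨t, s, ⟨j, hE, rfl⟩, h1, ?_⟩)
        rcases h3 (not_tagE hE) with ⟨i, hi, rfl⟩ | ⟨-, i, rfl⟩ | ⟨i, rfl, hi⟩
        · exact ⟨i, Or.inl ⟨rfl, hi⟩⟩
        · exact ⟨i, Or.inr (Or.inl rfl)⟩
        · exact ⟨i, Or.inr (Or.inr ⟨rfl, hi⟩)⟩
    · exact Or.inr (Or.inr (Or.inl ⟨g, g', ⟨j, hj, rfl⟩, (fmK_bin hj).1 h⟩))
    · rcases tagU_cases hj with hq | hq
      · exact Or.inr (Or.inr (Or.inr (Or.inl ⟨g, ⟨j, hq, rfl⟩, (fmK_num hq).1 h⟩)))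
      · exact Or.inr (Or.inr (Or.inr (Or.inr ⟨g, ⟨j, hq, rfl⟩, (fmK_set hq).1 h⟩)))
    · exact absurd h (wf_junk _ _ _ _ _ hJ)

instance den_occurs : Den c (occurs t u) (Occ x y) := by
  unfold SOA.occurs
  refine Den.congr (fix_iff (Q := Occ x) ?_ ?_)
  · rintro R f (⟨t, h1⟩ | ⟨g, h, h1, h2⟩ | ⟨g, h1, h2⟩) ih
    · obtain ⟨j, hj, rfl⟩ := pp_or.1 h1
      exact (occ_lit (tagL_mem hj)).2 ⟨not_tagE hj, rfl⟩
    · obtain ⟨j, hj, rfl⟩ := pp_or.1 h1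
      exact (occ_bin hj).2 (h2.imp (ih _ (lt_bin₁ (TagB.pos hj) _ _))
        (ih _ (lt_bin₂ (TagB.pos hj) _ _)))
    · obtain ⟨j, hj, rfl⟩ : ∃ j, TagU j ∧ f = pp j g := by
        rcases h1 with rfl | rfl | rfl | rfl <;> exact ⟨_, by simp [TagU], rfl⟩
      exact (occ_un hj).2 (ih _ (lt_un hj.pos _) h2)
  · intro f h
    rcases form_cases f with ⟨j, t, s, hj, rfl⟩ | ⟨j, g, g', hj, rfl⟩ | ⟨j, g, hj, rfl⟩ | hJ
    · obtain ⟨h1, rfl⟩ := (occ_lit hj).1 h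
      exact Or.inl ⟨t, pp_or.2 ⟨j, (tagL_of hj).resolve_left h1, rfl⟩⟩
    · exact Or.inr (Or.inl ⟨g, g', pp_or.2 ⟨j, hj, rfl⟩, (occ_bin hj).1 h⟩)
    · refine Or.inr (Or.inr ⟨g, ?_, (occ_un hj).1 h⟩)
      rcases hj with rfl | rfl | rfl | rfl <;> tauto
    · exact absurd h (occ_junk hJ)

instance den_isSent [hB : Fact (B ∈ 𝒮 N)] : Den c (isSent t Y) (Sent B x) := by
  unfold SOA.isSent
  exact Den.congr sent_iff.symm

instance den_isArith : Den c (isArith t) (IsAr x) := by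
  unfold SOA.isArith
  refine Den.congr (fix_iff (Q := IsAr) ?_ ?_)
  · rintro R f (⟨t, s, h1⟩ | ⟨g, h, h1, h2⟩ | ⟨g, h1, h2⟩) ih
    · rcases h1 with rfl | rfl | rfl | rfl <;> exact isAr_lit (by simp [TagL])
    · obtain ⟨j, hj, rfl⟩ := pp_or.1 h1
      exact (isAr_bin hj).2 (h2.imp (ih _ (lt_bin₁ (TagB.pos hj) _ _))
        (ih _ (lt_bin₂ (TagB.pos hj) _ _)))
    · obtain ⟨j, hj, rfl⟩ := pp_or.1 h1
      exact (isAr_un (tagU_num hj)).2 ⟨hj, ih _ (lt_un (tagU_num hj).pos _) h2⟩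
  · intro f h
    rcases form_cases f with ⟨j, t, s, hj, rfl⟩ | ⟨j, g, g', hj, rfl⟩ | ⟨j, g, hj, rfl⟩ | hJ
    · refine Or.inl ⟨t, s, ?_⟩
      rcases hj with rfl | rfl | rfl | rfl <;> tauto
    · exact Or.inr (Or.inl ⟨g, g', pp_or.2 ⟨j, hj, rfl⟩, (isAr_bin hj).1 h⟩)
    · have := (isAr_un hj).1 h
      exact Or.inr (Or.inr ⟨g, pp_or.2 ⟨j, this.1, rfl⟩, this.2⟩)
    · exact absurd h (isAr_junk hJ)

theorem den_isClass (n : ℕ) : ∀ (c : Pos N) (t : Num) (x : N) [NV c t x] (pol : Bool),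
    Den c (isClass pol n t) (Cls pol n x) := by
  induction n with
  | zero => intro c t x _ pol; rw [isClass, cls_zero]; infer_instance
  | succ n ih =>
    intro c t x _ pol
    rw [isClass]
    refine Den.congr (fix_iff (Q := Cls pol (n + 1)) ?_ ?_)
    · intro R f h ih
      rw [cls_succ]
      refine h.imp id ?_
      rintro ⟨g, h1, h2⟩
      cases pol <;> refine ⟨g, h1, ih _ ?_ h2⟩ <;> rcases h1 with rfl | rfl <;>
        exact lt_un (by norm_num) _
    · intro f h
      rw [cls_succ] at h
      cases pol <;> exact h

instance den_isClass' {pol : Bool} {n : ℕ} : Den c (isClass pol n t) (Cls pol n x) :=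
  den_isClass n c t x pol

end

/-! ### Operations on formulas, as relations -/

/-- The clauses of `mapFm`. -/
def MapC (d : Bool) (LIT : N → N → N → Prop) (gn gs : N → N) (Q : N → N → N → Prop)
    (f k f' : N) : Prop :=
  LIT f k f' ∨
  (∃ j g h g' h', TagB j ∧ f = pp j (pp g h) ∧ f' = pp (dl d j) (pp g' h') ∧ Q g k g' ∧ Q h k h') ∨
  (∃ j g g', (j = 6 ∨ j = 7) ∧ f = pp j g ∧ f' = pp (dl d j) g' ∧ Q g (gn k) g') ∨
  (∃ j g g', (j = 8 ∨ j = 9) ∧ f = pp j g ∧ f' = pp (dl d j) g' ∧ Q g (gs k) g')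

theorem NV.mono {c c' : Pos N} {t : Num} {x : N} (h : NV c t x) (hc : c.Le c') : NV c' t x :=
  ⟨fun _ h' => h.out _ (hc.trans h')⟩
theorem SV.mono {c c' : Pos N} {X : SetV} {A : Set N} (h : SV c X A) (hc : c.Le c') : SV c' X A :=
  ⟨fun _ h' => h.out _ (hc.trans h')⟩

theorem den_mapFm {dual : Bool} {lit : Num → Num → Num → Form} {goN goS : Num → Num}
    {LIT : N → N → N → Prop} {gn gs : N → N} {Q : N → N → N → Prop} [hQd : Def3 𝒮 N Q]
    {c : Pos N} {t u : Num} {x y : N} [NV c t x] [NV c u y]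
    (hlit : ∀ (c' : Pos N) [Fact (c.Le c')] (t u s : Num) (x y z : N)
      [NV c' t x] [NV c' u y] [NV c' s z], Den c' (lit t u s) (LIT x y z))
    (hgn : ∀ (c : Pos N) (t : Num) (x : N) [NV c t x], NV c (goN t) (gn x))
    (hgs : ∀ (c : Pos N) (t : Num) (x : N) [NV c t x], NV c (goS t) (gs x))
    (hQ : ∀ f k f', Q f k f' ↔ MapC dual LIT gn gs Q f k f') :
    Den c (mapFm dual lit goN goS t u) (Q x 0 y) := by
  have key : ∀ Q' : N → N → N → Prop, ∀ f k f', MapC dual LIT gn gs Q' f k f' ↔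
      (LIT f k f' ∨
      (∃ g h g' h', ((f = pp 4 (pp g h) ∧ f' = bif dual then pp 5 (pp g' h') else pp 4 (pp g' h')) ∨
        (f = pp 5 (pp g h) ∧ f' = bif dual then pp 4 (pp g' h') else pp 5 (pp g' h'))) ∧
        Q' g k g' ∧ Q' h k h') ∨
      (∃ g g', ((f = pp 6 g ∧ f' = bif dual then pp 7 g' else pp 6 g') ∨
        (f = pp 7 g ∧ f' = bif dual then pp 6 g' else pp 7 g')) ∧ Q' g (gn k) g') ∨
      (∃ g g', ((f = pp 8 g ∧ f' = bif dual then pp 9 g' else pp 8 g') ∨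
        (f = pp 9 g ∧ f' = bif dual then pp 8 g' else pp 9 g')) ∧ Q' g (gs k) g')) := by
    intro Q' f k f'
    simp only [MapC, TagB, or_and_right, exists_or]
    cases dual <;> simp [dl, and_assoc]
  have i0 : Fact (c.Le c) := ⟨.refl c⟩
  have i1 : ∀ (c' : Pos N) [h : Fact (c.Le c')] (x : N), Fact (c.Le (c'.pushN x)) :=
    fun c' h x => ⟨h.out.trans (c'.le_pushN x)⟩
  have i2 : ∀ (c' : Pos N) [h : Fact (c.Le c')] (X : Set N), Fact (c.Le (c'.pushS X)) :=
    fun c' h x => ⟨h.out.trans (c'.le_pushS x)⟩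
  unfold mapFm
  refine Den.congr (fix_iff₃ ?_ fun R hR f k f' h => ?_)
  · intro R f k f' hk ih
    rw [hQ]
    rcases (key (fun f k f' => pp f (pp k f') ∈ R) f k f').2 hk with
      h1 | ⟨j, g, h, g', h', hj, rfl, h2, h3, h4⟩ | ⟨j, g, g', hj, rfl, h2, h3⟩ |
      ⟨j, g, g', hj, rfl, h2, h3⟩
    · exact Or.inl h1
    · exact Or.inr (Or.inl ⟨j, g, h, g', h', hj, rfl, h2, ih _ (lt_bin₁ hj.pos _ _) _ _ h3,
        ih _ (lt_bin₂ hj.pos _ _) _ _ h4⟩)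
    · exact Or.inr (Or.inr (Or.inl ⟨j, g, g', hj, rfl, h2,
        ih _ (lt_un (tagU_num hj).pos _) _ _ h3⟩))
    · exact Or.inr (Or.inr (Or.inr ⟨j, g, g', hj, rfl, h2,
        ih _ (lt_un (tagU_set hj).pos _) _ _ h3⟩))
  · simp only [hR]
    exact (key Q f k f').1 ((hQ f k f').1 h)

theorem mapC_fun {d : Bool} {T S : N → N → N → N} [DefM3 𝒮 N T] [DefM3 𝒮 N S]
    {TD SD : N → N → N → Prop} [Def3 𝒮 N TD] [Def3 𝒮 N SD] {p q : N} (α β : N → N)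
    {gn gs : N → N} {LIT : N → N → N → Prop}
    (hlit : ∀ f k f', LIT f k f' ↔ ∃ j t s, TagL j ∧ f = pp j (pp t s) ∧
      Wf TD SD p f (α k) (β k) ∧ f' = fmap d T S q f (α k) (β k))
    (hN : ∀ g k, Shape g → (Wf TD SD p g (α k + 1) (β k) ↔ Wf TD SD p g (α (gn k)) (β (gn k))) ∧
      fmap d T S q g (α k + 1) (β k) = fmap d T S q g (α (gn k)) (β (gn k)))
    (hS : ∀ g k, Shape g → (Wf TD SD p g (α k) (β k + 1) ↔ Wf TD SD p g (α (gs k)) (β (gs k))) ∧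
      fmap d T S q g (α k) (β k + 1) = fmap d T S q g (α (gs k)) (β (gs k))) (f k f' : N) :
    (Wf TD SD p f (α k) (β k) ∧ f' = fmap d T S q f (α k) (β k)) ↔
      MapC d LIT gn gs (fun f k f' => Wf TD SD p f (α k) (β k) ∧ f' = fmap d T S q f (α k) (β k))
        f k f' := by
  unfold MapC
  constructor
  · rintro ⟨hf, rfl⟩
    rcases hf.cases with ⟨j, t, s, hj, rfl, -⟩ | ⟨j, g, h, hj, rfl, h1, h2⟩ | ⟨j, g, hj, rfl, h1⟩
    · exact Or.inl ((hlit _ _ _).2 ⟨j, t, s, hj, rfl, hf, rfl⟩)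
    · exact Or.inr (Or.inl ⟨j, g, h, _, _, hj, rfl, fmap_bin _ _ _ _ _ _ hj _ _,
        ⟨h1, rfl⟩, h2, rfl⟩)
    · rcases tagU_cases hj with hq | hq
      · refine Or.inr (Or.inr (Or.inl ⟨j, g, _, hq, rfl, fmap_un _ _ _ _ _ _ hj _, ?_⟩))
        rw [kk_num hq, ll_num hq] at h1 ⊢
        exact ⟨(hN g k h1.shape).1.1 h1, (hN g k h1.shape).2⟩
      · refine Or.inr (Or.inr (Or.inr ⟨j, g, _, hq, rfl, fmap_un _ _ _ _ _ _ hj _, ?_⟩))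
        rw [kk_set hq, ll_set hq] at h1 ⊢
        exact ⟨(hS g k h1.shape).1.1 h1, (hS g k h1.shape).2⟩
  · rintro (h | ⟨j, g, h, _, _, hj, rfl, rfl, ⟨h1, rfl⟩, h2, rfl⟩ | ⟨j, g, _, hq, rfl, rfl, h1, rfl⟩ |
      ⟨j, g, _, hq, rfl, rfl, h1, rfl⟩)
    · obtain ⟨j, t, s, hj, rfl, h1, h2⟩ := (hlit _ _ _).1 h
      exact ⟨h1, h2⟩
    · exact ⟨(wf_bin _ _ _ _ _ hj _ _).2 ⟨h1, h2⟩, (fmap_bin _ _ _ _ _ _ hj _ _).symm⟩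
    · rw [wf_un _ _ _ _ _ (tagU_num hq), fmap_un _ _ _ _ _ _ (tagU_num hq), kk_num hq, ll_num hq]
      exact ⟨(hN g k h1.shape).1.2 h1, by rw [(hN g k h1.shape).2]⟩
    · rw [wf_un _ _ _ _ _ (tagU_set hq), fmap_un _ _ _ _ _ _ (tagU_set hq), kk_set hq, ll_set hq]
      exact ⟨(hS g k h1.shape).1.2 h1, by rw [(hS g k h1.shape).2]⟩

def tshT (_ _ t : N) : Prop := TSh t
instance def3_tshT {F : Set (Set N)} [Closed F] : Def3 F (tshT : N → N → N → Prop) := by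
  unfold tshT; infer_instance

/-- `f` is well-formed, apart from its variables. -/
def InstOK (f : N) : Prop := Wf tshT topT 0 f 0 0

theorem FmK.instOK {fr : Prop} {Y : Set N} [Fact (Y ∈ 𝒮 N)] {f k l : N}
    (h : FmK fr Y f k l) : InstOK f :=
  Wf.imp h (fun _ _ h => IsTm.tSh h) fun _ _ _ => trivial

section
variable {c : Pos N} {t u s r : Num} {x y z w : N} [NV c t x] [NV c u y] [NV c s z] [NV c r w]
  {X Y Z V : SetV} {A B C E : Set N} [SV c X A] [SV c Y B] [SV c Z C] [SV c V E]

instance den_isNeg : Den c (isNeg t u) (Shape x ∧ y = neg x) := by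
  refine den_mapFm (Q := fun f _ f' => Wf topT topT 0 f 0 0 ∧ f' = fmap true idT idT 0 f 0 0)
    (LIT := fun f _ f' => ∃ t s, (f = pp 0 (pp t s) ∧ f' = pp 1 (pp t s)) ∨
      (f = pp 1 (pp t s) ∧ f' = pp 0 (pp t s)) ∨ (f = pp 2 (pp t s) ∧ f' = pp 3 (pp t s)) ∨
      (f = pp 3 (pp t s) ∧ f' = pp 2 (pp t s))) (gn := id) (gs := id)
    (hQd := by unfold Def3; infer_instance)
    (fun _ _ _ _ _ _ _ _ _ _ _ => inferInstance) (fun _ _ _ h => h) (fun _ _ _ h => h)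
    (mapC_fun (fun _ => 0) (fun _ => 0) ?_ ?_ ?_)
  · intro f k f'
    constructor
    · rintro ⟨t, s, h⟩
      have : ∃ j, TagL j ∧ f = pp j (pp t s) ∧ f' = pp (dl true j) (pp t s) := by
        rcases h with ⟨rfl, rfl⟩ | ⟨rfl, rfl⟩ | ⟨rfl, rfl⟩ | ⟨rfl, rfl⟩ <;>
          exact ⟨_, by simp [TagL], rfl, by simp [dl]⟩
      obtain ⟨j, hj, rfl, rfl⟩ := this
      exact ⟨j, t, s, hj, rfl, shape_lit hj, (neg_lit hj t s).symm⟩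
    · rintro ⟨j, t, s, hj, rfl, -, h⟩
      refine ⟨t, s, ?_⟩
      rw [show f' = _ from h.trans (neg_lit hj t s)]
      rcases hj with rfl | rfl | rfl | rfl <;> simp [dl]
  · exact fun g k hg => ⟨⟨fun _ => hg.wf, fun _ => hg.wf⟩, fmap_idT_counters _ hg _ _ _ _ _ _⟩
  · exact fun g k hg => ⟨⟨fun _ => hg.wf, fun _ => hg.wf⟩, fmap_idT_counters _ hg _ _ _ _ _ _⟩

instance den_instTm : Den c (instTm t u s) (InstOK x ∧ z = inst y x) := by
  refine den_mapFm (Q := fun f k f' => Wf tshT topT 0 f k 0 ∧ f' = fmap false tsub idT y f k 0)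
    (LIT := fun f k f' => ∃ t t', (TSh t ∧ t' = tsub y k t) ∧
      ((∃ u u', (TSh u ∧ u' = tsub y k u) ∧
        ((f = pp 0 (pp t u) ∧ f' = pp 0 (pp t' u')) ∨ (f = pp 1 (pp t u) ∧ f' = pp 1 (pp t' u')))) ∨
       (∃ s, (f = pp 2 (pp t s) ∧ f' = pp 2 (pp t' s)) ∨ (f = pp 3 (pp t s) ∧ f' = pp 3 (pp t' s)))))
    (gn := fun k => k + 1) (gs := id) (hQd := by unfold Def3; infer_instance)
    ?_ (fun _ _ _ _ => inferInstance) (fun _ _ _ h => h)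
    (mapC_fun (fun k => k) (fun _ => 0) ?_ ?_ ?_)
  · intro c' hc t s r x z w _ _ _
    have : NV c' u y := NV.mono ‹_› hc.out
    infer_instance
  · intro f k f'
    constructor
    · rintro ⟨t, t', ⟨h1, rfl⟩, h⟩
      rcases h with ⟨u, u', ⟨h2, rfl⟩, h⟩ | ⟨s, h⟩
      · have : ∃ j, TagE j ∧ f = pp j (pp t u) ∧ f' = pp j (pp (tsub y k t) (tsub y k u)) :=
          h.elim (fun h => ⟨0, Or.inl rfl, h⟩) fun h => ⟨1, Or.inr rfl, h⟩
        obtain ⟨j, hj, rfl, rfl⟩ := this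
        refine ⟨j, t, u, hj.tagL, rfl, (wf_lit _ _ _ _ _ hj.tagL _ _).2
          ⟨h1, fun _ => h2, fun h => absurd hj h⟩, ?_⟩
        rw [fmap_lit _ _ _ _ _ _ hj.tagL, if_pos hj, dl_false]
      · have : ∃ j, (j = 2 ∨ j = 3) ∧ f = pp j (pp t s) ∧ f' = pp j (pp (tsub y k t) s) :=
          h.elim (fun h => ⟨2, Or.inl rfl, h⟩) fun h => ⟨3, Or.inr rfl, h⟩
        obtain ⟨j, hj, rfl, rfl⟩ := this
        refine ⟨j, t, s, tagL_mem hj, rfl, (wf_lit _ _ _ _ _ (tagL_mem hj) _ _).2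
          ⟨h1, fun h => absurd h (not_tagE hj), fun _ => trivial⟩, ?_⟩
        rw [fmap_lit _ _ _ _ _ _ (tagL_mem hj), if_neg (not_tagE hj), dl_false]; rfl
    · rintro ⟨j, t, s, hj, rfl, h, rfl⟩
      obtain ⟨h1, h2, h3⟩ := (wf_lit _ _ _ _ _ hj _ _).1 h
      refine ⟨t, _, ⟨h1, rfl⟩, ?_⟩
      rw [fmap_lit _ _ _ _ _ _ hj]
      rcases tagL_of hj with hE | hE
      · rw [if_pos hE]
        refine Or.inl ⟨s, _, ⟨h2 hE, rfl⟩, ?_⟩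
        rcases hE with rfl | rfl
        · exact Or.inl ⟨rfl, rfl⟩
        · exact Or.inr ⟨rfl, rfl⟩
      · rw [if_neg (not_tagE hE)]
        refine Or.inr ⟨s, ?_⟩
        rcases hE with rfl | rfl
        · exact Or.inl ⟨rfl, rfl⟩
        · exact Or.inr ⟨rfl, rfl⟩
  · exact fun g k hg => ⟨Iff.rfl, rfl⟩
  · exact fun g k hg => ⟨⟨fun h => h.imp (fun _ _ h => h) (fun _ _ h => h),
      fun h => h.imp (fun _ _ h => h) (fun _ _ h => h)⟩, fmap_congr (fun _ _ _ => rfl)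
        (fun _ _ _ => rfl) (hg.wf (p := 0) (k := 0) (l := 0))⟩

instance den_instNum : Den c (instNum t u s) (InstOK x ∧ z = inst (num y) x) := by
  unfold SOA.instNum
  exact Den.congr ⟨fun ⟨_, h, h'⟩ => h ▸ h', fun h => ⟨_, rfl, h⟩⟩

instance den_instSet : Den c (instSet t u s) (Shape x ∧ z = inst2 y x) := by
  refine den_mapFm (Q := fun f k f' => Wf topT topT 0 f 0 k ∧ f' = fmap false idT setS y f 0 k)
    (LIT := fun f k f' => ∃ t,
      (∃ u, (f = pp 0 (pp t u) ∧ f' = pp 0 (pp t u)) ∨ (f = pp 1 (pp t u) ∧ f' = pp 1 (pp t u))) ∨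
      (∃ s s', ((s = pp 0 k ∧ s' = y) ∨ (¬ s = pp 0 k ∧ s' = s)) ∧
       ((f = pp 2 (pp t s) ∧ f' = pp 2 (pp t s')) ∨ (f = pp 3 (pp t s) ∧ f' = pp 3 (pp t s')))))
    (gn := id) (gs := fun k => k + 1) (hQd := by unfold Def3; infer_instance)
    ?_ (fun _ _ _ h => h) (fun _ _ _ _ => inferInstance)
    (mapC_fun (fun _ => 0) (fun k => k) ?_ ?_ ?_)
  · intro c' hc t s r x z w _ _ _
    have : NV c' u y := NV.mono ‹_› hc.out
    infer_instance
  · intro f k f'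
    constructor
    · rintro ⟨t, ⟨u, h⟩ | ⟨s, s', h1, h⟩⟩
      · have : ∃ j, TagE j ∧ f = pp j (pp t u) ∧ f' = pp j (pp t u) :=
          h.elim (fun h => ⟨0, Or.inl rfl, h⟩) fun h => ⟨1, Or.inr rfl, h⟩
        obtain ⟨j, hj, rfl, rfl⟩ := this
        refine ⟨j, t, u, hj.tagL, rfl, (shape_lit hj.tagL).wf, ?_⟩
        rw [fmap_lit _ _ _ _ _ _ hj.tagL, if_pos hj, dl_false]; rfl
      · have : ∃ j, (j = 2 ∨ j = 3) ∧ f = pp j (pp t s) ∧ f' = pp j (pp t s') :=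
          h.elim (fun h => ⟨2, Or.inl rfl, h⟩) fun h => ⟨3, Or.inr rfl, h⟩
        obtain ⟨j, hj, rfl, rfl⟩ := this
        refine ⟨j, t, s, tagL_mem hj, rfl, (shape_lit (tagL_mem hj)).wf, ?_⟩
        rw [fmap_lit _ _ _ _ _ _ (tagL_mem hj), if_neg (not_tagE hj), dl_false]
        rcases h1 with ⟨h1, rfl⟩ | ⟨h1, rfl⟩
        · rw [setS, if_pos h1]; rfl
        · rw [setS, if_neg h1]; rfl
    · rintro ⟨j, t, s, hj, rfl, h, rfl⟩
      rw [fmap_lit _ _ _ _ _ _ hj]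
      refine ⟨t, ?_⟩
      rcases tagL_of hj with hE | hE
      · rw [if_pos hE]
        refine Or.inl ⟨s, ?_⟩
        rcases hE with rfl | rfl
        · exact Or.inl ⟨rfl, rfl⟩
        · exact Or.inr ⟨rfl, rfl⟩
      · rw [if_neg (not_tagE hE)]
        refine Or.inr ⟨s, setS y k s, ?_, ?_⟩
        · by_cases hs : s = pp 0 k
          · exact Or.inl ⟨hs, by rw [setS, if_pos hs]⟩
          · exact Or.inr ⟨hs, by rw [setS, if_neg hs]⟩
        · rcases hE with rfl | rfl
          · exact Or.inl ⟨rfl, rfl⟩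
          · exact Or.inr ⟨rfl, rfl⟩
  · exact fun g k hg => ⟨⟨fun _ => hg.wf, fun _ => hg.wf⟩, fmap_congr (fun _ _ _ => rfl)
        (fun _ _ _ => rfl) (hg.wf (p := 0) (k := 0) (l := 0))⟩
  · exact fun g k hg => ⟨⟨fun _ => hg.wf, fun _ => hg.wf⟩, rfl⟩

end

section
variable {Y W : Set N} [hY : Fact (Y ∈ 𝒮 N)] [hW : Fact (W ∈ 𝒮 N)]

/-- The symbols `s`, for `Y`, and `s'`, for `W`, have the same meaning. -/
def SymEq (Y W : Set N) (s s' : N) : Prop :=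
  (∃ i, (s = pp 0 i ∨ s = pp 1 i) ∧ s' = s) ∨
    ∃ i j, s = pp 2 i ∧ s' = pp 2 j ∧ dom Y i ∧ dom W j ∧ ∀ x, sec Y i x ↔ sec W j x

theorem canS_symM_eq {k l k' l' s s' : N} (h : symM W W k l s) (h' : symM W W k' l' s')
    (i : N) (hi : s = pp 0 i ∨ s = pp 1 i) (e : s = canS W W k' l' s') : s' = s := by
  rcases h' with ⟨i', rfl⟩ | ⟨i', rfl⟩ | ⟨i', rfl, hi', j, hj⟩
  · rw [e, canS_other fun i => by simp]
  · rw [e, canS_other fun i => by simp]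
  · obtain ⟨m, hm, -⟩ := canS_const_match (p := k') (l := l') hj
    rw [hm] at e
    rcases hi with rfl | rfl <;> simp at e

theorem symEq_iff {k l k' l' s s' : N} : SymEq Y W s s' ↔
    symM Y W k l s ∧ symM W Y k l s' ∧ canS Y W k' l' s = canS W W k' l' s' := by
  constructor
  · rintro (⟨i, rfl | rfl, rfl⟩ | ⟨i, j, rfl, rfl, hi, hj, h⟩)
    · refine ⟨Or.inl ⟨i, rfl⟩, Or.inl ⟨i, rfl⟩, ?_⟩
      rw [canS_other fun i => by simp,
        canS_other fun i => by simp]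
    · refine ⟨Or.inr (Or.inl ⟨i, rfl⟩), Or.inr (Or.inl ⟨i, rfl⟩), ?_⟩
      rw [canS_other fun i => by simp,
        canS_other fun i => by simp]
    · have hm : matchI Y W i j := ⟨hj, h⟩
      exact ⟨Or.inr (Or.inr ⟨i, rfl, hi, j, hm⟩), Or.inr (Or.inr ⟨j, rfl, hj, i, hm.symm hi⟩),
        canS_congr h ⟨j, hm⟩⟩
  · rintro ⟨⟨i, rfl⟩ | ⟨i, rfl⟩ | ⟨i, rfl, hi, hj⟩, h2, h3⟩
    · rw [canS_other fun i => by simp] at h3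
      exact Or.inl ⟨i, Or.inl rfl, canS_symM_eq (k := k) (l := l) (Or.inl ⟨i, rfl⟩) (symM_self h2) i
        (Or.inl rfl) h3⟩
    · rw [canS_other fun i => by simp] at h3
      exact Or.inl ⟨i, Or.inr rfl, canS_symM_eq (k := k) (l := l) (Or.inr (Or.inl ⟨i, rfl⟩))
        (symM_self h2) i (Or.inr rfl) h3⟩
    · obtain ⟨j, hj⟩ := hj
      obtain ⟨m, hm, hm'⟩ := canS_const_match (p := k') (l := l') hj
      rcases h2 with ⟨i', rfl⟩ | ⟨i', rfl⟩ | ⟨i', rfl, hi', -⟩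
      · rw [hm, canS_other fun i => by simp] at h3
        simp at h3
      · rw [hm, canS_other fun i => by simp] at h3
        simp at h3
      · exact Or.inr ⟨i, i', rfl, rfl, hi, hi', (canS_eq hi' h3).2⟩

theorem sm_lit {V : Set N} [Fact (V ∈ 𝒮 N)] {j t s : N} (hj : TagL j) :
    sm V W (pp j (pp t s)) = pp j (pp t (if TagE j then s else canS V W 0 0 s)) :=
  rn_lit hj

theorem sm_bin {V : Set N} [Fact (V ∈ 𝒮 N)] {j g h : N} (hj : TagB j) :
    sm V W (pp j (pp g h)) = pp j (pp (sm V W g) (sm V W h)) :=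
  rn_bin hj

theorem sm_un {V : Set N} [Fact (V ∈ 𝒮 N)] {j g : N} (hj : TagU j)
    (hg : Shape g) : sm V W (pp j g) = pp j (sm V W g) :=
  rn_un hj hg

theorem wf_counters {V : Set N} [Fact (V ∈ 𝒮 N)] {g k l : N} :
    Wf topT (symM V W) 0 g k l ↔ Wf topT (symM V W) 0 g 0 0 :=
  ⟨fun h => h.imp (fun _ _ h => h) fun _ _ h => h, fun h => h.imp (fun _ _ h => h) fun _ _ h => h⟩

theorem same_lit {j t s f' : N} (hj : TagL j) : Same (pp j (pp t s)) Y f' W ↔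
    ∃ s', f' = pp j (pp t s') ∧ (TagE j → s' = s) ∧ (¬ TagE j → SymEq Y W s s') := by
  constructor
  · rintro ⟨h1, h2, h3⟩
    rw [sm_lit hj] at h3
    have h1' := (wf_lit _ _ _ _ _ hj _ _).1 h1
    rcases h2.shape.cases with ⟨j', t', s', hj', rfl⟩ | ⟨j', g, g', hj', rfl, -, -⟩ |
      ⟨j', g, hj', rfl, hg⟩
    · rw [sm_lit hj', pp_inj, pp_inj] at h3
      obtain ⟨rfl, rfl, h3⟩ := h3
      have h2' := (wf_lit _ _ _ _ _ hj _ _).1 h2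
      refine ⟨s', rfl, fun hE => ?_, fun hE => ?_⟩
      · rw [if_pos hE, if_pos hE] at h3; exact h3.symm
      · rw [if_neg hE, if_neg hE] at h3
        exact symEq_iff.2 ⟨h1'.2.2 hE, h2'.2.2 hE, h3⟩
    · rw [sm_bin hj', pp_inj] at h3
      exact absurd h3.1 (hj.ne_tagB hj')
    · rw [sm_un hj' hg, pp_inj] at h3
      exact absurd h3.1 (hj.ne_tagU hj')
  · rintro ⟨s', rfl, h1, h2⟩
    refine ⟨(wf_lit _ _ _ _ _ hj _ _).2 ⟨trivial, fun _ => trivial, fun hE => ?_⟩,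
      (wf_lit _ _ _ _ _ hj _ _).2 ⟨trivial, fun _ => trivial, fun hE => ?_⟩, ?_⟩
    · exact (symEq_iff (k' := 0) (l' := 0).1 (h2 hE)).1
    · exact (symEq_iff (k' := 0) (l' := 0).1 (h2 hE)).2.1
    · rw [sm_lit hj, sm_lit hj]
      by_cases hE : TagE j
      · rw [if_pos hE, if_pos hE, h1 hE]
      · rw [if_neg hE, if_neg hE, (symEq_iff (k := 0) (l := 0).1 (h2 hE)).2.2]

theorem same_bin {j g h f' : N} (hj : TagB j) : Same (pp j (pp g h)) Y f' W ↔
    ∃ g' h', f' = pp j (pp g' h') ∧ Same g Y g' W ∧ Same h Y h' W := by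
  constructor
  · rintro ⟨h1, h2, h3⟩
    rw [sm_bin hj] at h3
    have h1' := (wf_bin _ _ _ _ _ hj _ _).1 h1
    rcases h2.shape.cases with ⟨j', t', s', hj', rfl⟩ | ⟨j', g', h', hj', rfl, -, -⟩ |
      ⟨j', g', hj', rfl, hg⟩
    · rw [sm_lit hj', pp_inj] at h3
      exact absurd h3.1.symm (hj'.ne_tagB hj)
    · rw [sm_bin hj', pp_inj, pp_inj] at h3
      obtain ⟨rfl, h4, h5⟩ := h3
      have h2' := (wf_bin _ _ _ _ _ hj _ _).1 h2
      exact ⟨g', h', rfl, ⟨h1'.1, h2'.1, h4⟩, h1'.2, h2'.2, h5⟩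
    · rw [sm_un hj' hg, pp_inj] at h3
      exact absurd h3.1 (hj.ne_tagU hj')
  · rintro ⟨g', h', rfl, h1, h2⟩
    exact ⟨(wf_bin _ _ _ _ _ hj _ _).2 ⟨h1.1, h2.1⟩, (wf_bin _ _ _ _ _ hj _ _).2 ⟨h1.2.1, h2.2.1⟩,
      by rw [sm_bin hj, sm_bin hj, h1.2.2, h2.2.2]⟩

theorem same_un {j g f' : N} (hj : TagU j) : Same (pp j g) Y f' W ↔
    ∃ g', f' = pp j g' ∧ Same g Y g' W := by
  constructor
  · rintro ⟨h1, h2, h3⟩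
    have h1' := wf_counters.1 ((wf_un _ _ _ _ _ hj _).1 h1)
    rw [sm_un hj h1'.shape] at h3
    rcases h2.shape.cases with ⟨j', t', s', hj', rfl⟩ | ⟨j', g', h', hj', rfl, -, -⟩ |
      ⟨j', g', hj', rfl, hg⟩
    · rw [sm_lit hj', pp_inj] at h3
      exact absurd h3.1.symm (hj'.ne_tagU hj)
    · rw [sm_bin hj', pp_inj] at h3
      exact absurd h3.1.symm (hj'.ne_tagU hj)
    · rw [sm_un hj' hg, pp_inj] at h3
      obtain ⟨rfl, h4⟩ := h3
      have h2' := wf_counters.1 ((wf_un _ _ _ _ _ hj _).1 h2)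
      exact ⟨g', rfl, h1', h2', h4⟩
  · rintro ⟨g', rfl, h1⟩
    exact ⟨(wf_un _ _ _ _ _ hj _).2 (wf_counters.2 h1.1),
      (wf_un _ _ _ _ _ hj _).2 (wf_counters.2 h1.2.1),
      by rw [sm_un hj h1.1.shape, sm_un hj h1.2.1.shape, h1.2.2]⟩

theorem not_same_junk {f f' : N} (hf : FJunk f) : ¬ Same f Y f' W := fun h =>
  wf_junk _ _ _ _ _ hf h.1
end

section
variable {c : Pos N} {t u s r : Num} {x y z w : N} [NV c t x] [NV c u y] [NV c s z] [NV c r w]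
  {X Y Z V : SetV} {A B C E : Set N} [SV c X A] [SV c Y B] [SV c Z C] [SV c V E]

instance den_same [Fact (A ∈ 𝒮 N)] [Fact (B ∈ 𝒮 N)] :
    Den c (same t X u Y) (Same x A y B) := by
  refine den_mapFm (Q := fun f _ f' => Same f A f' B)
    (LIT := fun f _ f' => ∃ t,
      (∃ u, (f = pp 0 (pp t u) ∧ f' = pp 0 (pp t u)) ∨ (f = pp 1 (pp t u) ∧ f' = pp 1 (pp t u))) ∨
      (∃ s s', SymEq A B s s' ∧
       ((f = pp 2 (pp t s) ∧ f' = pp 2 (pp t s')) ∨ (f = pp 3 (pp t s) ∧ f' = pp 3 (pp t s')))))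
    (gn := id) (gs := id) (hQd := by unfold Def3; infer_instance)
    ?_ (fun _ _ _ h => h) (fun _ _ _ h => h) (fun f k f' => ?_)
  · intro c' hc t s r x z w _ _ _
    have : SV c' X A := SV.mono ‹_› hc.out
    have : SV c' Y B := SV.mono ‹_› hc.out
    unfold SymEq
    infer_instance
  · unfold MapC
    constructor
    · intro h
      rcases form_cases f with ⟨j, t, s, hj, rfl⟩ | ⟨j, g, g', hj, rfl⟩ | ⟨j, g, hj, rfl⟩ | hJ
      · obtain ⟨s', rfl, h1, h2⟩ := (same_lit hj).1 h
        refine Or.inl ⟨t, ?_⟩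
        rcases tagL_of hj with hE | hE
        · obtain rfl := h1 hE
          refine Or.inl ⟨s', ?_⟩
          rcases hE with rfl | rfl
          · exact Or.inl ⟨rfl, rfl⟩
          · exact Or.inr ⟨rfl, rfl⟩
        · refine Or.inr ⟨s, s', h2 (not_tagE hE), ?_⟩
          rcases hE with rfl | rfl
          · exact Or.inl ⟨rfl, rfl⟩
          · exact Or.inr ⟨rfl, rfl⟩
      · obtain ⟨k, k', rfl, h1, h2⟩ := (same_bin hj).1 h
        exact Or.inr (Or.inl ⟨j, g, g', k, k', hj, rfl, by rw [dl_false], h1, h2⟩)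
      · obtain ⟨k, rfl, h1⟩ := (same_un hj).1 h
        rcases tagU_cases hj with hq | hq
        · exact Or.inr (Or.inr (Or.inl ⟨j, g, k, hq, rfl, by rw [dl_false], h1⟩))
        · exact Or.inr (Or.inr (Or.inr ⟨j, g, k, hq, rfl, by rw [dl_false], h1⟩))
      · exact absurd h (not_same_junk hJ)
    · rintro (⟨t, ⟨u, h⟩ | ⟨s, s', h1, h⟩⟩ | ⟨j, g, h, g', h', hj, rfl, rfl, h1, h2⟩ |
        ⟨j, g, g', hj, rfl, rfl, h1⟩ | ⟨j, g, g', hj, rfl, rfl, h1⟩)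
      · have : ∃ j, TagE j ∧ f = pp j (pp t u) ∧ f' = pp j (pp t u) :=
          h.elim (fun h => ⟨0, Or.inl rfl, h⟩) fun h => ⟨1, Or.inr rfl, h⟩
        obtain ⟨j, hj, rfl, rfl⟩ := this
        exact (same_lit hj.tagL).2 ⟨u, rfl, fun _ => rfl, fun h => absurd hj h⟩
      · have : ∃ j, (j = 2 ∨ j = 3) ∧ f = pp j (pp t s) ∧ f' = pp j (pp t s') :=
          h.elim (fun h => ⟨2, Or.inl rfl, h⟩) fun h => ⟨3, Or.inr rfl, h⟩
        obtain ⟨j, hj, rfl, rfl⟩ := this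
        exact (same_lit (tagL_mem hj)).2 ⟨s', rfl, fun h => absurd h (not_tagE hj), fun _ => h1⟩
      · rw [dl_false]; exact (same_bin hj).2 ⟨g', h', rfl, h1, h2⟩
      · rw [dl_false]; exact (same_un (tagU_num hj)).2 ⟨g', rfl, h1⟩
      · rw [dl_false]; exact (same_un (tagU_set hj)).2 ⟨g', rfl, h1⟩

/-- Tarski's clauses. -/
def Tarski (M D S : Set N) : Prop := ∀ f, f ∈ D →
  (∀ t u, f = pp 0 (pp t u) → (f ∈ S ↔ SameVal t u)) ∧
  (∀ t u, f = pp 1 (pp t u) → (f ∈ S ↔ ¬ SameVal t u)) ∧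
  (∀ t i, f = pp 2 (pp t (pp 2 i)) → (f ∈ S ↔ ∃ n, (IsTm 0 t ∧ teval 0 t = n) ∧ sec M i n)) ∧
  (∀ t i, f = pp 3 (pp t (pp 2 i)) → (f ∈ S ↔ ¬ ∃ n, (IsTm 0 t ∧ teval 0 t = n) ∧ sec M i n)) ∧
  (∀ g h, f = pp 4 (pp g h) → g ∈ D ∧ h ∈ D ∧ (f ∈ S ↔ g ∈ S ∧ h ∈ S)) ∧
  (∀ g h, f = pp 5 (pp g h) → g ∈ D ∧ h ∈ D ∧ (f ∈ S ↔ g ∈ S ∨ h ∈ S)) ∧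
  (∀ g, f = pp 6 g → (∀ n g', InstOK g ∧ g' = inst (num n) g → g' ∈ D) ∧
    (f ∈ S ↔ ∀ n g', InstOK g ∧ g' = inst (num n) g → g' ∈ S)) ∧
  (∀ g, f = pp 7 g → (∀ n g', InstOK g ∧ g' = inst (num n) g → g' ∈ D) ∧
    (f ∈ S ↔ ∃ n g', (InstOK g ∧ g' = inst (num n) g) ∧ g' ∈ S)) ∧
  (∀ g, f = pp 8 g → (∀ i g', dom M i ∧ Shape g ∧ g' = inst2 (pp 2 i) g → g' ∈ D) ∧
    (f ∈ S ↔ ∀ i g', dom M i ∧ Shape g ∧ g' = inst2 (pp 2 i) g → g' ∈ S)) ∧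
  (∀ g, f = pp 9 g → (∀ i g', dom M i ∧ Shape g ∧ g' = inst2 (pp 2 i) g → g' ∈ D) ∧
    (f ∈ S ↔ ∃ i g', dom M i ∧ (Shape g ∧ g' = inst2 (pp 2 i) g) ∧ g' ∈ S))

instance den_tarski : Den c (tarski X Y Z) (Tarski A B C) := by
  unfold SOA.tarski Tarski; infer_instance

end

section
variable {M D S : Set N} [hM : Fact (M ∈ 𝒮 N)]

theorem sent_num {j g : N} (hj : j = 6 ∨ j = 7) (h : Sent M (pp j g)) : InstOK g :=
  FmK.instOK ((fmK_num hj).1 h)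
theorem sent_set {j g : N} (hj : j = 8 ∨ j = 9) (h : Sent M (pp j g)) : Shape g :=
  FmK.shape ((fmK_set hj).1 h)

theorem TC.tarski (h : TC M D S) : Tarski M D S := by
  intro f hf
  have hs := h.sent f hf
  refine ⟨?_, ?_, ?_, ?_, ?_, ?_, ?_, ?_, ?_, ?_⟩
  · rintro t u rfl
    have := Sent.lit_sym (by simp [TagL]) hs
    rw [h.lit _ _ _ (by simp [TagL]) hf]
    simp [LitV, SameVal, this.1, this.2.1 (by simp [TagE])]
  · rintro t u rfl
    have := Sent.lit_sym (by simp [TagL]) hs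
    rw [h.lit _ _ _ (by simp [TagL]) hf]
    simp [LitV, SameVal, this.1, this.2.1 (by simp [TagE])]
  · rintro t u rfl
    have := Sent.lit_sym (by simp [TagL]) hs
    rw [h.lit _ _ _ (by simp [TagL]) hf]
    simp [LitV, this.1]
  · rintro t u rfl
    have := Sent.lit_sym (by simp [TagL]) hs
    rw [h.lit _ _ _ (by simp [TagL]) hf]
    simp [LitV, this.1]
  · rintro g k rfl
    have := h.bin _ _ _ (by simp [TagB]) hf
    simpa [and_assoc] using this
  · rintro g k rfl
    have := h.bin _ _ _ (by simp [TagB]) hf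
    simpa [and_assoc] using this
  · rintro g rfl
    have h1 := h.num _ _ (by simp) hf
    have h2 := sent_num (by simp) hs
    simpa [h2] using h1
  · rintro g rfl
    have h1 := h.num _ _ (by simp) hf
    have h2 := sent_num (by simp) hs
    simpa [h2] using h1
  · rintro g rfl
    have h1 := h.set _ _ (by simp) hf
    have h2 := sent_set (by simp) hs
    simpa [h2] using h1
  · rintro g rfl
    have h1 := h.set _ _ (by simp) hf
    have h2 := sent_set (by simp) hs
    simpa [h2] using h1

theorem Tarski.tc (h : Tarski M D S) : TC M {f | f ∈ D ∧ Sent M f} S where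
  sent f hf := hf.2
  lit j t s hj hf := by
    obtain ⟨h1, h2⟩ := hf
    have h3 := h _ h1
    have h4 := Sent.lit_sym hj h2
    rcases tagL_of hj with hE | hE
    · have := h4.2.1 hE
      rcases hE with rfl | rfl
      · rw [h3.1 _ _ rfl]; simp [LitV, SameVal, h4.1, this]
      · rw [h3.2.1 _ _ rfl]; simp [LitV, SameVal, h4.1, this]
    · obtain ⟨i, rfl, hi⟩ := h4.2.2 (not_tagE hE)
      rcases hE with rfl | rfl
      · rw [h3.2.2.1 _ _ rfl]; simp [LitV, h4.1]
      · rw [h3.2.2.2.1 _ _ rfl]; simp [LitV, h4.1]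
  bin j g k hj hf := by
    obtain ⟨h1, h2⟩ := hf
    obtain ⟨-, -, -, -, h5, h6, -⟩ := h _ h1
    have h4 := (fmK_bin hj).1 h2
    rcases hj with rfl | rfl
    · obtain ⟨a, b, e⟩ := h5 _ _ rfl
      exact ⟨⟨⟨a, h4.1⟩, b, h4.2⟩, by rw [e, if_pos rfl]⟩
    · obtain ⟨a, b, e⟩ := h6 _ _ rfl
      exact ⟨⟨⟨a, h4.1⟩, b, h4.2⟩, by rw [e, if_neg (by norm_num)]⟩
  num j g hj hf := by
    obtain ⟨h1, h2⟩ := hf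
    obtain ⟨-, -, -, -, -, -, h5, h6, -⟩ := h _ h1
    have h4 := sent_num hj h2
    have h7 := fun n => fmK_inst_body hj (isTm_num 0 n) h2
    rcases hj with rfl | rfl
    · obtain ⟨a, e⟩ := h5 _ rfl
      exact ⟨fun n => ⟨a n _ ⟨h4, rfl⟩, h7 n⟩, by rw [e, if_pos rfl]; simp [h4]⟩
    · obtain ⟨a, e⟩ := h6 _ rfl
      exact ⟨fun n => ⟨a n _ ⟨h4, rfl⟩, h7 n⟩, by rw [e, if_neg (by norm_num)]; simp [h4]⟩
  set j g hj hf := by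
    obtain ⟨h1, h2⟩ := hf
    obtain ⟨-, -, -, -, -, -, -, -, h5, h6⟩ := h _ h1
    have h4 := sent_set hj h2
    have h7 := fun i (hi : dom M i) => fmK_inst2_body hj (symT_const hi) h2
    rcases hj with rfl | rfl
    · obtain ⟨a, e⟩ := h5 _ rfl
      exact ⟨fun n hn => ⟨a n _ ⟨hn, h4, rfl⟩, h7 n hn⟩, by rw [e, if_pos rfl]; simp [h4]⟩
    · obtain ⟨a, e⟩ := h6 _ rfl
      exact ⟨fun n hn => ⟨a n _ ⟨hn, h4, rfl⟩, h7 n hn⟩, by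
        rw [e, if_neg (by norm_num)]; simp [h4]⟩

end

/-! ### Models, theories, and proofs -/

def IsModel (M : Set N) : Prop := ∃ i, dom M i

def InLang (f : N) (Y M : Set N) : Prop := ∃ f', Sent M f' ∧ Same f Y f' M

def Models (M : Set N) (f : N) (Y : Set N) : Prop :=
  ∃ D ∈ 𝒮 N, ∃ S ∈ 𝒮 N, (∀ g, g ∈ D ↔ Sent M g) ∧
    Tarski M D S ∧ ∃ f', Same f Y f' M ∧ f' ∈ D ∧ f' ∈ S

def TrArith (f : N) (Y : Set N) : Prop :=
  ∃ D ∈ 𝒮 N, ∃ S ∈ 𝒮 N, Tarski Y D S ∧ f ∈ D ∧ f ∈ S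

def InstEx (W : Set N) (f g : N) : Prop := ∀ S ∈ 𝒮 N,
  f ∈ S ∧ (∀ h b h', h ∈ S ∧
    ((h = pp 7 b ∧ ∃ n, InstOK b ∧ h' = inst (num n) b) ∨
      (h = pp 9 b ∧ ∃ i, dom W i ∧ Shape b ∧ h' = inst2 (pp 2 i) b)) → h' ∈ S) → g ∈ S

def TrPi : ℕ → N → Set N → Prop
  | 0, f, Y => TrArith f Y
  | n + 1, f, Y => ∃ f', (Shape f ∧ f' = neg f) ∧ ¬ ∃ W ∈ 𝒮 N, ∃ h g,
      Same f' Y h W ∧ InstEx W h g ∧ Cls true n g ∧ TrPi n g W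

def IsTheory (F Y : Set N) : Prop := ∀ f, f ∈ F → Sent Y f

def ModelsTh (M F Y : Set N) : Prop := IsModel M ∧ ∀ f, f ∈ F → Models M f Y

def OmegaRFN (n : ℕ) (F Y : Set N) : Prop := ∀ f, ∀ Z ∈ 𝒮 N,
  Sent Z f ∧ Cls true n f ∧
    (∀ M ∈ 𝒮 N, ModelsTh M F Y ∧ InLang f Z M → Models M f Z) → TrPi n f Z

def Prem (E : Set N) (i n j : N) : Prop := pp (pp i n) j ∈ E

def IsTree (I E : Set N) (r : N) : Prop :=
  r ∈ I ∧
  (∀ i n j, Prem E i n j → i ∈ I ∧ j ∈ I ∧ ¬ j = r) ∧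
  (∀ i n j k, Prem E i n j ∧ Prem E i n k → j = k) ∧
  (∀ j, j ∈ I ∧ ¬ j = r → ∃ i n, Prem E i n j) ∧
  (∀ i n k m j, Prem E i n j ∧ Prem E k m j → i = k ∧ n = m) ∧
  (∀ X ∈ 𝒮 N, r ∈ X ∧ (∀ i n j, i ∈ X ∧ Prem E i n j → j ∈ X) →
    ∀ i, i ∈ I → i ∈ X)

def IsWF (I E : Set N) : Prop := ∀ X ∈ 𝒮 N,
  (∃ i, i ∈ I ∧ i ∈ X) → ∃ i, i ∈ I ∧ i ∈ X ∧ ∀ n j, Prem E i n j → ¬ j ∈ X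

def ConclIs (D G : Set N) (i f : N) : Prop := ∀ h, pp i h ∈ D ↔ pp i h ∈ G ∨ h = f

def PremIs (E D G : Set N) (i n f : N) : Prop :=
  ∃ j, Prem E i n j ∧ ∀ h, pp j h ∈ D ↔ pp i h ∈ G ∨ h = f

def Prem0 (E : Set N) (i : N) : Prop := ∀ n j, ¬ Prem E i n j
def Prem1 (E : Set N) (i : N) : Prop := ∀ n j, Prem E i n j → n = 0
def Prem2 (E : Set N) (i : N) : Prop := ∀ n j, Prem E i n j → n = 0 ∨ n = 1

def AxiomAt (D W : Set N) (i : N) : Prop := ∃ t u,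
  (pp i (pp 0 (pp t u)) ∈ D ∧ SameVal t u) ∨
  (pp i (pp 1 (pp t u)) ∈ D ∧ ¬ SameVal t u) ∨
  (∃ k, pp i (pp 2 (pp t (pp 2 k))) ∈ D ∧ ∃ n, (IsTm 0 t ∧ teval 0 t = n) ∧ sec W k n) ∨
  (∃ k, pp i (pp 3 (pp t (pp 2 k))) ∈ D ∧ ∃ n, (IsTm 0 t ∧ teval 0 t = n) ∧ ¬ sec W k n) ∨
  (∃ k, pp i (pp 2 (pp t (pp 1 k))) ∈ D ∧ pp i (pp 3 (pp u (pp 1 k))) ∈ D ∧ SameVal t u)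

def RuleAt (E D G W : Set N) (i : N) : Prop :=
  (∃ f g, ConclIs D G i (pp 4 (pp f g)) ∧ Prem2 E i ∧ PremIs E D G i 0 f ∧ PremIs E D G i 1 g) ∨
  (∃ f g, ConclIs D G i (pp 5 (pp f g)) ∧ Prem1 E i ∧
    ∃ j, Prem E i 0 j ∧ ∀ h, pp j h ∈ D ↔ pp i h ∈ G ∨ h = f ∨ h = g) ∨
  (∃ f, ConclIs D G i (pp 6 f) ∧
    ∀ n, ∃ f', (InstOK f ∧ f' = inst (num n) f) ∧ PremIs E D G i n f') ∨
  (∃ f t f', ConclIs D G i (pp 7 f) ∧ Prem1 E i ∧ IsTm 0 t ∧ (InstOK f ∧ f' = inst t f) ∧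
    PremIs E D G i 0 f') ∨
  (∃ f u f', ConclIs D G i (pp 8 f) ∧ Prem1 E i ∧ (∀ h, pp i h ∈ D → ¬ Occ u h) ∧
    (Shape f ∧ f' = inst2 (pp 1 u) f) ∧ PremIs E D G i 0 f') ∨
  (∃ f c f', ConclIs D G i (pp 9 f) ∧ Prem1 E i ∧ dom W c ∧
    (Shape f ∧ f' = inst2 (pp 2 c) f) ∧ PremIs E D G i 0 f') ∨
  (∃ f u f', ConclIs D G i (pp 9 f) ∧ Prem1 E i ∧
    (Shape f ∧ f' = inst2 (pp 1 u) f) ∧ PremIs E D G i 0 f') ∨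
  ((∀ h, pp i h ∈ D ↔ pp i h ∈ G) ∧ Prem1 E i ∧
    ∃ j, Prem E i 0 j ∧ ∀ h, pp j h ∈ D ↔ pp i h ∈ G)

def CutAt (E D G : Set N) (i : N) : Prop := ∃ f f', (Shape f ∧ f' = neg f) ∧
  (∀ h, pp i h ∈ D ↔ pp i h ∈ G) ∧ Prem2 E i ∧ PremIs E D G i 0 f ∧ PremIs E D G i 1 f'

def IsProof (cut : Bool) (I E D G W : Set N) (r : N) : Prop :=
  IsTree I E r ∧ IsWF I E ∧
  ∀ i, i ∈ I → (∀ h, pp i h ∈ D → IsFm W h) ∧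
    ((AxiomAt D W i ∧ Prem0 E i) ∨
      bif cut then RuleAt E D G W i ∨ CutAt E D G i else RuleAt E D G W i)

def IsNegAx (F Y : Set N) (f h : N) (W : Set N) : Prop :=
  f ∈ F ∧ ∃ f', (Shape f ∧ f' = neg f) ∧ Same f' Y h W

def ProvesNeg (cut : Bool) (F Y : Set N) : Prop :=
  ∃ I ∈ 𝒮 N, ∃ E ∈ 𝒮 N, ∃ D ∈ 𝒮 N,
  ∃ G ∈ 𝒮 N, ∃ W ∈ 𝒮 N, ∃ r,
    IsProof cut I E D G W r ∧
    (∀ h, pp r h ∈ D → ∃ f, IsNegAx F Y f h W) ∧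
    (∀ f, f ∈ F → ∃ h, IsNegAx F Y f h W ∧ pp r h ∈ D)

def ProvesNegOr (cut : Bool) (F Y : Set N) (g : N) (Z : Set N) : Prop :=
  ∃ I ∈ 𝒮 N, ∃ E ∈ 𝒮 N, ∃ D ∈ 𝒮 N,
  ∃ G ∈ 𝒮 N, ∃ W ∈ 𝒮 N, ∃ r,
    IsProof cut I E D G W r ∧
    (∀ h, pp r h ∈ D → (∃ f, IsNegAx F Y f h W) ∨ Same g Z h W) ∧
    (∀ f, f ∈ F → ∃ h, IsNegAx F Y f h W ∧ pp r h ∈ D) ∧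
    ∃ h, Same g Z h W ∧ pp r h ∈ D

def ProvSound (n : ℕ) (cut : Bool) (F Y : Set N) : Prop := ∀ g, ∀ Z ∈ 𝒮 N,
  Sent Z g ∧ Cls true n g ∧ ProvesNegOr cut F Y g Z → TrPi n g Z

def EverySetInModel (F Y : Set N) : Prop := ∀ X ∈ 𝒮 N,
  ∃ M ∈ 𝒮 N, MemFam X M ∧ ModelsTh M F Y

section
variable {c : Pos N} {t u s r : Num} {x y z w : N} [NV c t x] [NV c u y] [NV c s z] [NV c r w]
  {X Y Z V U : SetV} {A B C D E : Set N} [SV c X A] [SV c Y B] [SV c Z C] [SV c V D] [SV c U E]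

instance den_isModel : Den c (isModel X) (IsModel A) := by
  unfold SOA.isModel IsModel; infer_instance

section
variable [Fact (A ∈ 𝒮 N)] [Fact (B ∈ 𝒮 N)]
instance den_inLang : Den c (inLang t X Y) (InLang x A B) := by
  unfold SOA.inLang InLang; infer_instance
instance den_models : Den c (models X t Y) (Models A x B) := by
  unfold SOA.models Models; infer_instance
end

instance den_trArith : Den c (trArith t X) (TrArith x A) := by
  unfold SOA.trArith TrArith; infer_instance
instance den_instEx : Den c (instEx X t u) (InstEx A x y) := by
  unfold SOA.instEx InstEx; infer_instance

theorem den_trPi' (n : ℕ) : ∀ (c : Pos N) (t : Num) (x : N) [NV c t x] (X : SetV) (A : Set N)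
    [SV c X A] [Fact (A ∈ 𝒮 N)], Den c (trPi n t X) (TrPi n x A) := by
  induction n with
  | zero => intro c t x _ X A _ _; unfold SOA.trPi TrPi; infer_instance
  | succ n ih =>
    intro c t x _ X A _ _; unfold SOA.trPi TrPi
    exact den_exN (h := fun f' => den_and (h' := den_not (h := den_exS (h := fun W _ => by
      infer_instance))))

instance den_trPi [Fact (A ∈ 𝒮 N)] {n : ℕ} :
    Den c (trPi n t X) (TrPi n x A) := den_trPi' n c t x X A

instance den_isTheory [Fact (B ∈ 𝒮 N)] :
    Den c (isTheory X Y) (IsTheory A B) := by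
  unfold SOA.isTheory IsTheory; infer_instance

instance den_contains {L : List Fm} :
    Den c (contains L X) (∀ σ ∈ L, ((σ.code : ℕ) : N) ∈ A) := by
  unfold SOA.contains
  induction L with
  | nil => exact Den.congr (h := den_eq (h := nv_lit0) (h' := nv_lit0)) (by simp)
  | cons σ L ih =>
    rw [List.foldr_cons]
    exact Den.congr (h := den_and (h := den_mem (h := nv_lit)) (h' := ih)) (by simp)

section
variable [Fact (A ∈ 𝒮 N)] [Fact (B ∈ 𝒮 N)] [Fact (C ∈ 𝒮 N)]
instance den_modelsTh : Den c (modelsTh X Y Z) (ModelsTh A B C) := by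
  unfold SOA.modelsTh ModelsTh; infer_instance
end
instance den_omegaRFN [Fact (A ∈ 𝒮 N)] [Fact (B ∈ 𝒮 N)]
    {n : ℕ} : Den c (omegaRFN n X Y) (OmegaRFN n A B) := by
  unfold SOA.omegaRFN OmegaRFN
  exact den_allN (h := fun f => den_allS (h := fun Z _ => den_imp (h := den_and (h' := den_and
    (h' := den_allS (h := fun M _ => by infer_instance))))))

instance den_prem : Den c (prem X t u s) (Prem A x y z) := by
  unfold SOA.prem Prem; infer_instance
instance den_isTree : Den c (isTree X Y t) (IsTree A B x) := by
  unfold SOA.isTree IsTree; infer_instance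
instance den_isWF : Den c (isWF X Y) (IsWF A B) := by
  unfold SOA.isWF IsWF; infer_instance
instance den_conclIs : Den c (conclIs X Y t u) (ConclIs A B x y) := by
  unfold SOA.conclIs ConclIs; infer_instance
instance den_premIs : Den c (premIs X Y Z t u s) (PremIs A B C x y z) := by
  unfold SOA.premIs PremIs; infer_instance
instance den_prem0 : Den c (prem0 X t) (Prem0 A x) := by
  unfold SOA.prem0 Prem0; infer_instance
instance den_prem1 : Den c (prem1 X t) (Prem1 A x) := by
  unfold SOA.prem1 Prem1; infer_instance
instance den_prem2 : Den c (prem2 X t) (Prem2 A x) := by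
  unfold SOA.prem2 Prem2; infer_instance
instance den_axiomAt : Den c (axiomAt X Y t) (AxiomAt A B x) := by
  unfold SOA.axiomAt AxiomAt; infer_instance
instance den_ruleAt : Den c (ruleAt X Y Z V t) (RuleAt A B C D x) := by
  unfold SOA.ruleAt RuleAt; infer_instance
instance den_cutAt : Den c (cutAt X Y Z t) (CutAt A B C x) := by
  unfold SOA.cutAt CutAt; infer_instance
instance den_isProof [Fact (E ∈ 𝒮 N)] {cut : Bool} :
    Den c (isProof cut X Y Z V U t) (IsProof cut A B C D E x) := by
  unfold SOA.isProof IsProof; infer_instance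
instance den_isNegAx [Fact (B ∈ 𝒮 N)] [Fact (C ∈ 𝒮 N)] :
    Den c (isNegAx X Y t u Z) (IsNegAx A B x y C) := by
  unfold SOA.isNegAx IsNegAx; infer_instance
section
variable [Fact (A ∈ 𝒮 N)] [Fact (B ∈ 𝒮 N)] {cut : Bool}
instance den_provesNeg : Den c (provesNeg cut X Y) (ProvesNeg cut A B) := by
  unfold SOA.provesNeg ProvesNeg
  exact den_exS (h := fun I _ => den_exS (h := fun E _ => den_exS (h := fun D _ =>
    den_exS (h := fun G _ => den_exS (h := fun W _ => by infer_instance)))))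
instance den_provesNegOr [Fact (C ∈ 𝒮 N)] :
    Den c (provesNegOr cut X Y t Z) (ProvesNegOr cut A B x C) := by
  unfold SOA.provesNegOr ProvesNegOr
  exact den_exS (h := fun I _ => den_exS (h := fun E _ => den_exS (h := fun D _ =>
    den_exS (h := fun G _ => den_exS (h := fun W _ => by infer_instance)))))
instance den_provSound {n : ℕ} : Den c (provSound n cut X Y) (ProvSound n cut A B) := by
  unfold SOA.provSound ProvSound
  exact den_allN (h := fun f => den_allS (h := fun Z _ => by infer_instance))
instance den_everySetInModel : Den c (everySetInModel X Y) (EverySetInModel A B) := by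
  unfold SOA.everySetInModel EverySetInModel
  exact den_allS (h := fun X _ => den_exS (h := fun M _ => by infer_instance))
end
end

/-! ### Satisfaction classes -/

section
variable {M D S W Y : Set N} [hM : Fact (M ∈ 𝒮 N)] [hD : Fact (D ∈ 𝒮 N)] [hS : Fact (S ∈ 𝒮 N)]
  [hW : Fact (W ∈ 𝒮 N)] [hY : Fact (Y ∈ 𝒮 N)]

/-- The set of all sentences with constants in `M`. -/
def sents (M : Set N) : Set N := {f | Sent M f}

instance fact_sents : Fact (sents M ∈ 𝒮 N) := ⟨setOf_mem inferInstance⟩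

theorem TC.neg_mem {f : N} (h : TC M D S) (hf : f ∈ D) (hn : SOA.neg f ∈ D) :
    SOA.neg f ∈ S ↔ f ∉ S := by
  have := h.nr h true hn hf (Or.inl rfl) (NR.neg (h.sent f hf).shape)
  simp only [cond_true] at this
  rw [this, not_not]

theorem TC.agree {D' S' : Set N} [Fact (D' ∈ 𝒮 N)]
    [Fact (S' ∈ 𝒮 N)] {f : N} (h : TC M D S) (h' : TC M D' S') (hf : f ∈ D)
    (hf' : f ∈ D') : f ∈ S' ↔ f ∈ S :=
  h.nr h' false hf hf' (Or.inl rfl) rfl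

theorem trArith_iff {f : N} (hf : Sent Y f) : TrArith f Y ↔
    ∃ D ∈ 𝒮 N, ∃ S ∈ 𝒮 N, TC Y D S ∧ f ∈ D ∧ f ∈ S := by
  constructor
  · rintro ⟨D, hD, S, hS, h, h1, h2⟩
    have : Fact (D ∈ 𝒮 N) := ⟨hD⟩
    exact ⟨{f | f ∈ D ∧ Sent Y f}, setOf_mem inferInstance, S, hS, h.tc, ⟨h1, hf⟩, h2⟩
  · rintro ⟨D, hD, S, hS, h, h1, h2⟩
    exact ⟨D, hD, S, hS, h.tarski, h1, h2⟩

theorem models_iff {f : N} : Models M f Y ↔ ∃ S ∈ 𝒮 N, TC M (sents M) S ∧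
    ∃ f', Same f Y f' M ∧ Sent M f' ∧ f' ∈ S := by
  constructor
  · rintro ⟨D, hD, S, hS, h, h1, f', h2, h3, h4⟩
    have e : D = sents M := Set.ext h
    subst e
    have : {f | f ∈ sents M ∧ Sent M f} = sents M := Set.ext fun f => and_self_iff
    exact ⟨S, hS, this ▸ h1.tc, f', h2, h3, h4⟩
  · rintro ⟨S, hS, h, f', h1, h2, h3⟩
    exact ⟨sents M, fact_sents.out, S, hS, fun g => Iff.rfl, h.tarski, f', h1, h2, h3⟩

theorem TC.same {f f' f'' : N} (h : TC M (sents M) S) (h1 : Same f Y f' M) (h2 : Same f Y f'' M)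
    (hf : Sent M f') : f'' ∈ S ↔ f' ∈ S := by
  have h3 := h1.symm.trans h2
  exact h.nr h false hf (h3.sent hf) (Or.inl rfl) h3.nr

theorem TC.models_iff {f : N} (h : TC M (sents M) S) (hf : Sent Y f) :
    Models M f Y ↔ ∃ f', Same f Y f' M ∧ f' ∈ S := by
  rw [SOA.models_iff]
  constructor
  · rintro ⟨S', hS', h', f', h1, h2, h3⟩
    have : Fact (S' ∈ 𝒮 N) := ⟨hS'⟩
    exact ⟨f', h1, (h'.agree h h2 h2).2 h3⟩
  · rintro ⟨f', h1, h2⟩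
    exact ⟨S, hS.out, h, f', h1, h1.sent hf, h2⟩

/-- `P` is closed under downward steps in the search for a counterexample. -/
structure Refuting (M : Set N) (P : N → Prop) : Prop where
  lit : ∀ j t s, TagL j → P (pp j (pp t s)) → ¬ LitV M j t s
  bin : ∀ j g h, TagB j → P (pp j (pp g h)) → if j = 4 then P g ∨ P h else P g ∧ P h
  num : ∀ j g, j = 6 ∨ j = 7 → P (pp j g) →
    if j = 6 then ∃ n, P (inst (num n) g) else ∀ n, P (inst (num n) g)
  set : ∀ j g, j = 8 ∨ j = 9 → P (pp j g) →
    if j = 8 then ∃ i, dom M i ∧ P (inst2 (pp 2 i) g) else ∀ i, dom M i → P (inst2 (pp 2 i) g)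

theorem TC.refuting (h : TC M D S) : Refuting M (fun f => f ∈ D ∧ f ∉ S) where
  lit j t s hj hf := by rw [← h.lit _ _ _ hj hf.1]; exact hf.2
  bin j g k hj hf := by
    obtain ⟨⟨h1, h2⟩, h3⟩ := h.bin _ _ _ hj hf.1
    have := hf.2
    rw [h3] at this
    split_ifs at this ⊢ with e
    · rw [not_and_or] at this
      exact this.imp (fun h => ⟨h1, h⟩) fun h => ⟨h2, h⟩
    · rw [not_or] at this
      exact ⟨⟨h1, this.1⟩, h2, this.2⟩
  num j g hj hf := by
    obtain ⟨h1, h3⟩ := h.num _ _ hj hf.1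
    have := hf.2
    rw [h3] at this
    split_ifs at this ⊢ with e
    · rw [not_forall] at this
      exact this.imp fun n h => ⟨h1 n, h⟩
    · rw [not_exists] at this
      exact fun n => ⟨h1 n, this n⟩
  set j g hj hf := by
    obtain ⟨h1, h3⟩ := h.set _ _ hj hf.1
    have := hf.2
    rw [h3] at this
    split_ifs at this ⊢ with e
    · push Not at this
      exact this.imp fun n h => ⟨h.1, h1 n h.1, h.2⟩
    · push Not at this
      exact fun n hn => ⟨h1 n hn, this n hn⟩

set_option maxHeartbeats 400000 in
theorem Refuting.not_mem {P : N → Prop} (h : Refuting M P) (h' : TC M D S)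
    (hP : Def 𝒮 N (fun p : N × N => P p.2)) {f : N} (hf : f ∈ D) (hp : P f) :
    f ∉ S := by
  have hP' : ∀ {α : Type} [Ctx N α] (f : α → N) [DefM 𝒮 N f],
      Def 𝒮 N (fun a => P (f a)) := fun f => Def.lift hP f
  suffices H : ∀ n f : N, dp f = n → f ∈ D → P f → f ∉ S from H _ f rfl hf hp
  have lt1 : ∀ a : N, a < a + 1 := fun a => ACAM.lt_add_one_iff.2 le_rfl
  refine sind 𝒮 N (P := fun n => ∀ f : N, dp f = n → f ∈ D → P f → f ∉ S)
    fun n ih f hn hf hp => ?_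
  rcases (h'.sent f hf).shape.cases with ⟨j, t, s, hj, rfl⟩ | ⟨j, g, k, hj, rfl, hg, hk⟩ |
    ⟨j, g, hj, rfl, hg⟩
  · rw [h'.lit _ _ _ hj hf]
    exact h.lit _ _ _ hj hp
  · obtain ⟨⟨hg1, hk1⟩, e1⟩ := h'.bin _ _ _ hj hf
    rw [dp_bin hj] at hn
    have l1 : dp g < n := hn ▸ ACAM.lt_add_one_iff.2 le_self_add
    have l2 : dp k < n := by
      have : dp k ≤ dp k + dp g := le_self_add
      rw [add_comm] at this
      exact hn ▸ ACAM.lt_add_one_iff.2 this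
    have h3 := h.bin _ _ _ hj hp
    rw [e1]
    split_ifs at h3 ⊢ with e
    · rw [not_and_or]
      exact h3.imp (ih _ l1 g rfl hg1) (ih _ l2 k rfl hk1)
    · rw [not_or]
      exact ⟨ih _ l1 g rfl hg1 h3.1, ih _ l2 k rfl hk1 h3.2⟩
  · have hdn : dp g + 1 = n := by rw [← hn, dp_un hj]
    rcases tagU_cases hj with hq | hq
    · obtain ⟨m1, e1⟩ := h'.num _ _ hq hf
      have i1 := fun m : N => ih (dp g) (hdn ▸ lt1 _) (SOA.inst (SOA.num m) g) (dp_inst hg) (m1 m)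
      have h3 := h.num _ _ hq hp
      rw [e1]
      split_ifs at h3 ⊢ with e
      · rw [not_forall]
        exact h3.imp fun m hm => i1 m hm
      · rw [not_exists]
        exact fun m => i1 m (h3 m)
    · obtain ⟨m1, e1⟩ := h'.set _ _ hq hf
      have i1 := fun (m : N) hm => ih (dp g) (hdn ▸ lt1 _) (inst2 (pp 2 m) g) (dp_inst2 hg) (m1 m hm)
      have h3 := h.set _ _ hq hp
      rw [e1]
      split_ifs at h3 ⊢ with e
      · push Not
        exact h3.imp fun m hm => ⟨hm.1, i1 m hm.1 hm.2⟩
      · push Not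
        exact fun m hm => i1 m hm (h3 m hm)

end

/-! ### Standard formulas -/

/-- The family of sets coded by `M`. -/
def fam (M : Set N) : Set (Set N) := {A | ∃ i, dom M i ∧ A = {x | sec M i x}}

theorem memFam_iff {A M : Set N} : MemFam A M ↔ A ∈ fam M :=
  exists_congr fun _ => and_congr_right fun _ => Set.ext_iff.symm

theorem fam_sub {M : Set N} [Fact (M ∈ 𝒮 N)] :
    fam M ⊆ 𝒮 N := by
  rintro _ ⟨i, -, rfl⟩
  exact setOf_mem inferInstance

/-- The code of a term with numerals substituted for its free variables. -/
noncomputable def icT (k : ℕ) (e : ℕ → N) : Tm → N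
  | .zero => pp 0 0
  | .var i => if i < k then pp 1 (i : N) else num (e (i - k))
  | .succ t => pp 2 (icT k e t)
  | .add t u => pp 3 (pp (icT k e t) (icT k e u))
  | .mul t u => pp 4 (pp (icT k e t) (icT k e u))

/-- The code of a set variable with a constant substituted for it if it is free. -/
noncomputable def icS (l : ℕ) (I : ℕ → N) (X : ℕ) : N :=
  if X < l then pp 0 (X : N) else pp 2 (I (X - l))

/-- The code of a formula with numerals and constants substituted for its free variables. -/
noncomputable def icF : ℕ → ℕ → (ℕ → N) → (ℕ → N) → Fm → N
  | k, _, e, _, .eq t u => pp 0 (pp (icT k e t) (icT k e u))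
  | k, _, e, _, .neq t u => pp 1 (pp (icT k e t) (icT k e u))
  | k, l, e, I, .mem t X => pp 2 (pp (icT k e t) (icS l I X))
  | k, l, e, I, .nmem t X => pp 3 (pp (icT k e t) (icS l I X))
  | k, l, e, I, .and φ ψ => pp 4 (pp (icF k l e I φ) (icF k l e I ψ))
  | k, l, e, I, .or φ ψ => pp 5 (pp (icF k l e I φ) (icF k l e I ψ))
  | k, l, e, I, .all φ => pp 6 (icF (k + 1) l e I φ)
  | k, l, e, I, .ex φ => pp 7 (icF (k + 1) l e I φ)
  | k, l, e, I, .all2 φ => pp 8 (icF k (l + 1) e I φ)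
  | k, l, e, I, .ex2 φ => pp 9 (icF k (l + 1) e I φ)

theorem teval_icT (e : ℕ → N) (p : N) (t : Tm) : teval p (icT 0 e t) = t.eval e := by
  induction t with
  | zero => exact teval_zero p
  | var i => simp [icT, Tm.eval, teval_num]
  | succ t ih => rw [icT, teval_succ, ih, Tm.eval, succ_eq]
  | add t u ih ih' => rw [icT, teval_add, ih, ih', Tm.eval]
  | mul t u ih ih' => rw [icT, teval_mul, ih, ih', Tm.eval]

theorem tsub_closed {c k t : N} : IsTm 0 t → tsub c k t = t := by
  refine term_ind 𝒮 N (P := fun t => IsTm 0 t → tsub c k t = t) ?_ ?_ ?_ ?_ ?_ ?_ t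
  · exact fun _ => tsub_zero _ _
  · exact fun i h => absurd ((isTm_var _ _).1 h) (not_lt_zero' i)
  · intro t ih h
    rw [tsub_succ, ih ((isTm_succ _ _).1 h)]
  · intro t u ih ih' h
    rw [tsub_add, ih ((isTm_add _ _ _).1 h).1, ih' ((isTm_add _ _ _).1 h).2]
  · intro t u ih ih' h
    rw [tsub_mul, ih ((isTm_mul _ _ _).1 h).1, ih' ((isTm_mul _ _ _).1 h).2]
  · exact fun t hJ h => absurd h (isTm_junk hJ)

theorem tsub_icT (n : N) (k : ℕ) (e : ℕ → N) (t : Tm) :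
    tsub (num n) (k : N) (icT (k + 1) e t) = icT k (scons n e) t := by
  induction t with
  | zero => rw [icT, icT, tsub_zero]
  | var i =>
    rw [icT, icT]
    rcases lt_trichotomy i k with h | rfl | h
    · rw [if_pos (by omega), if_pos h, tsub_var, if_neg]
      exact fun e => absurd (Nat.cast_injective e) (by omega)
    · rw [if_pos (by omega), if_neg (by omega), tsub_var, if_pos rfl, Nat.sub_self]; rfl
    · rw [if_neg (by omega), if_neg (by omega), tsub_closed (isTm_num 0 _)]
      obtain ⟨m, rfl⟩ : ∃ m, i = k + 1 + m := ⟨i - (k + 1), by omega⟩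
      rw [show k + 1 + m - (k + 1) = m by omega, show k + 1 + m - k = m + 1 by omega]; rfl
  | succ t ih => rw [icT, icT, tsub_succ, ih]
  | add t u ih ih' => rw [icT, icT, tsub_add, ih, ih']
  | mul t u ih ih' => rw [icT, icT, tsub_mul, ih, ih']

theorem setS_icS (i : N) (l : ℕ) (I : ℕ → N) (X : ℕ) :
    setS (pp 2 i) (l : N) (icS (l + 1) I X) = icS l (scons i I) X := by
  unfold icS setS
  rcases lt_trichotomy X l with h | rfl | h
  · rw [if_pos (show X < l + 1 by omega), if_pos h, if_neg]
    rw [pp_inj]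
    exact fun e => absurd (Nat.cast_injective e.2) (by omega)
  · rw [if_pos (show X < X + 1 by omega), if_neg (lt_irrefl X), if_pos rfl, Nat.sub_self]; rfl
  · rw [if_neg (show ¬ X < l + 1 by omega), if_neg (show ¬ X < l by omega),
      if_neg (by simp)]
    obtain ⟨m, rfl⟩ : ∃ m, X = l + 1 + m := ⟨X - (l + 1), by omega⟩
    rw [show l + 1 + m - (l + 1) = m by omega, show l + 1 + m - l = m + 1 by omega]; rfl

theorem fmap_icF (n : N) (φ : Fm) : ∀ (k l : ℕ) (e I : ℕ → N) (m : N),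
    fmap false tsub idT (num n) (icF (k + 1) l e I φ) (k : N) m = icF k l (scons n e) I φ := by
  induction φ <;> intro k l e I m <;> unfold icF
  case eq | neq =>
    rw [fmap_lit _ _ _ _ _ _ (by simp [TagL]), if_pos (by simp [TagE]), tsub_icT, tsub_icT,
      dl_false]
  case mem | nmem =>
    rw [fmap_lit _ _ _ _ _ _ (by simp [TagL]), if_neg (by simp [TagE]), tsub_icT, dl_false]; rfl
  case and ih ih' | or ih ih' =>
    rw [fmap_bin _ _ _ _ _ _ (by simp [TagB]), ih, ih', dl_false]
  case all ih | ex ih =>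
    rw [fmap_un _ _ _ _ _ _ (by simp [TagU]), kk_num (by simp), ← Nat.cast_succ, ih, dl_false]
  case all2 ih | ex2 ih =>
    rw [fmap_un _ _ _ _ _ _ (by simp [TagU]), kk_set (by simp), ih, dl_false]

theorem fmap_icF_set (i : N) (φ : Fm) : ∀ (k l : ℕ) (e I : ℕ → N) (m : N),
    fmap false idT setS (pp 2 i) (icF k (l + 1) e I φ) m (l : N) = icF k l e (scons i I) φ := by
  induction φ <;> intro k l e I m <;> unfold icF
  case eq | neq =>
    rw [fmap_lit _ _ _ _ _ _ (by simp [TagL]), if_pos (by simp [TagE]), dl_false]; rfl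
  case mem | nmem =>
    rw [fmap_lit _ _ _ _ _ _ (by simp [TagL]), if_neg (by simp [TagE]), setS_icS, dl_false]; rfl
  case and ih ih' | or ih ih' =>
    rw [fmap_bin _ _ _ _ _ _ (by simp [TagB]), ih, ih', dl_false]
  case all ih | ex ih =>
    rw [fmap_un _ _ _ _ _ _ (by simp [TagU]), ll_num (by simp), ih, dl_false]
  case all2 ih | ex2 ih =>
    rw [fmap_un _ _ _ _ _ _ (by simp [TagU]), ll_set (by simp), ← Nat.cast_succ, ih, dl_false]

theorem inst_icF (n : N) (φ : Fm) (l : ℕ) (e I : ℕ → N) :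
    inst (num n) (icF 1 l e I φ) = icF 0 l (scons n e) I φ := by
  have := fmap_icF n φ 0 l e I 0
  rw [Nat.cast_zero] at this
  exact this

theorem inst2_icF (i : N) (φ : Fm) (k : ℕ) (e I : ℕ → N) :
    inst2 (pp 2 i) (icF k 1 e I φ) = icF k 0 e (scons i I) φ := by
  have := fmap_icF_set i φ k 0 e I 0
  rw [Nat.cast_zero] at this
  exact this

theorem cast_pr (x y : ℕ) : ((pr x y : ℕ) : N) = pp (x : N) (y : N) := by
  unfold pr pp; push_cast; rfl

theorem icT_closed {k : ℕ} (e : ℕ → N) (t : Tm) (h : t.Closed k) :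
    icT k e t = ((t.code : ℕ) : N) := by
  induction t <;> simp_all [Tm.Closed, icT, Tm.code, cast_pr]

theorem icF_closed (φ : Fm) : ∀ {k l : ℕ} (e I : ℕ → N), φ.Closed k l →
    icF k l e I φ = ((φ.code : ℕ) : N) := by
  induction φ <;> intro k l e I h <;>
    simp_all [Fm.Closed, icF, Fm.code, cast_pr, icT_closed, icS]

theorem neg_closed (φ : Fm) : ∀ {k l : ℕ}, φ.Closed k l → φ.neg.Closed k l := by
  induction φ <;> intro k l h <;> simp_all [Fm.Closed, Fm.neg]

theorem shape_code (φ : Fm) : Shape ((φ.code : ℕ) : N) ∧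
    neg ((φ.code : ℕ) : N) = ((φ.neg.code : ℕ) : N) := by
  induction φ <;> simp only [Fm.code, Fm.neg, cast_pr]
  case eq | neq | mem | nmem =>
    refine ⟨shape_lit (by simp [TagL]), ?_⟩
    rw [neg_lit (by simp [TagL])]; simp [dl]
  case and ih ih' | or ih ih' =>
    refine ⟨(shape_bin (by simp [TagB])).2 ⟨ih.1, ih'.1⟩, ?_⟩
    rw [neg_bin (by simp [TagB]), ih.2, ih'.2]; simp [dl]
  case all ih | ex ih | all2 ih | ex2 ih =>
    refine ⟨(shape_un (by simp [TagU])).2 ih.1, ?_⟩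
    rw [neg_un (by simp [TagU]) ih.1, ih.2]; simp [dl]

section
variable {M : Set N} [hM : Fact (M ∈ 𝒮 N)]

theorem Refuting.not_sat {P : N → Prop} (h : Refuting M P) (φ : Fm) : ∀ e I : ℕ → N,
    (∀ i, dom M (I i)) → P (icF 0 0 e I φ) →
      ¬ Sat (fam M) e (fun i => {x | sec M (I i) x}) φ := by
  have hsc : ∀ (n : N) (I : ℕ → N), (fun i => {x | sec M (scons n I i) x}) =
      scons {x | sec M n x} (fun i => {x | sec M (I i) x}) := by
    intro n I; funext i; cases i <;> rfl
  have hdom : ∀ {n : N} {I : ℕ → N}, dom M n → (∀ i, dom M (I i)) →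
      ∀ i, dom M (scons n I i) := by
    intro n I hn hI i
    cases i
    · exact hn
    · exact hI _
  induction φ <;> intro e I hI hp <;> unfold icF at hp <;> simp only [Sat]
  case eq | neq | mem | nmem =>
    have := h.lit _ _ _ (by simp [TagL]) hp
    simpa [LitV, teval_icT, icS] using this
  case and ih ih' =>
    have := h.bin _ _ _ (by simp [TagB]) hp
    rw [if_pos rfl] at this
    rw [not_and_or]
    exact this.imp (ih e I hI) (ih' e I hI)
  case or ih ih' =>
    have := h.bin _ _ _ (by simp [TagB]) hp
    rw [if_neg (by norm_num)] at this
    rw [not_or]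
    exact this.imp (ih e I hI) (ih' e I hI)
  case all ih =>
    have := h.num _ _ (by simp) hp
    rw [if_pos rfl] at this
    obtain ⟨n, hn⟩ := this
    rw [inst_icF] at hn
    exact fun h => ih _ _ hI hn (h n)
  case ex ih =>
    have := h.num _ _ (by simp) hp
    rw [if_neg (by norm_num)] at this
    rintro ⟨n, hn⟩
    have h1 := this n
    rw [inst_icF] at h1
    exact ih _ _ hI h1 hn
  case all2 ih =>
    have := h.set _ _ (by simp) hp
    rw [if_pos rfl] at this
    obtain ⟨n, hd, hn⟩ := this
    rw [inst2_icF] at hn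
    intro h
    have h1 := ih _ _ (hdom hd hI) hn
    rw [hsc] at h1
    exact h1 (h _ ⟨n, hd, rfl⟩)
  case ex2 ih =>
    have := h.set _ _ (by simp) hp
    rw [if_neg (by norm_num)] at this
    rintro ⟨_, ⟨n, hd, rfl⟩, hn⟩
    have h1 := this n hd
    rw [inst2_icF] at h1
    have h2 := ih _ _ (hdom hd hI) h1
    rw [hsc] at h2
    exact h2 hn

/-- A family in which the negations of the axioms `A` are refuted is closed under arithmetical
comprehension. -/
theorem closed_fam {A : List Fm} (hA : ∀ σ ∈ A, σ.IsSentence)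
    (hACA : ∀ α ∈ ACA0, Proves {σ | σ ∈ A} α) (hm : IsModel M)
    (h : ∀ σ ∈ A, ∃ P, Refuting M P ∧ P ((σ.neg.code : ℕ) : N)) : Closed (fam M) where
  sub := fam_sub
  nonempty := ⟨_, hm.choose, hm.choose_spec, rfl⟩
  compr := by
    obtain ⟨i, hi⟩ := hm
    refine hasCompr_of_sat fun α hα e E hE => Proves.sound (fam M) (fun σ hσ e E hE => ?_)
      (hACA α hα) e E hE
    obtain ⟨P, hP, hp⟩ := h σ hσ
    rw [← icF_closed (k := 0) (l := 0) σ.neg e (fun _ => i) (neg_closed σ (hA σ hσ))] at hp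
    have := hP.not_sat σ.neg e _ (fun _ => hi) hp
    rw [Sat_neg, not_not] at this
    exact (Sat_congr _ σ (k := 0) (l := 0) (by simp) (by simp) (hA σ hσ)).1 this

theorem exists_of_aca {A : List Fm} (hACA : ∀ α ∈ ACA0, Proves {σ | σ ∈ A} α) : ∃ σ, σ ∈ A := by
  by_contra! h
  let _ : PreMod Unit := { zero := (), add := fun _ _ => (), mul := fun _ _ => (), succ := id }
  have := Proves.sound (N := Unit) {∅} (fun σ hσ => absurd hσ (h σ)) (hACA _ .succ_ne_zero)
    (fun _ => ()) (fun _ => ∅) (fun _ => rfl)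
  exact this () rfl

end

def symB (_ l s : N) : Prop := ∃ i, i < l ∧ s = pp 0 i
instance def3_symB {F : Set (Set N)} [Closed F] : Def3 F (symB : N → N → N → Prop) := by
  unfold symB; infer_instance

theorem isTm_code {k : ℕ} (t : Tm) (h : t.Closed k) : IsTm (k : N) ((t.code : ℕ) : N) := by
  induction t <;> simp only [Tm.code, cast_pr, Nat.cast_zero, Nat.cast_one, Nat.cast_ofNat]
  case zero => exact isTm_zero (k : N)
  case var => exact (isTm_var (k : N) _).2 (Nat.cast_lt.2 h)
  case succ ih => exact (isTm_succ _ _).2 (ih h)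
  case add ih ih' => exact (isTm_add _ _ _).2 ⟨ih h.1, ih' h.2⟩
  case mul ih ih' => exact (isTm_mul _ _ _).2 ⟨ih h.1, ih' h.2⟩

theorem wf_code (φ : Fm) : ∀ {k l : ℕ}, φ.Closed k l →
    Wf tmT symB 0 ((φ.code : ℕ) : N) (k : N) (l : N) := by
  induction φ <;> intro k l h <;> simp only [Fm.code, cast_pr]
  case eq | neq =>
    refine (wf_lit _ _ _ _ _ (by simp [TagL]) _ _).2 ⟨isTm_code _ h.1,
      fun _ => isTm_code _ h.2, fun hE => absurd ?_ hE⟩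
    simp [TagE]
  case mem | nmem =>
    exact (wf_lit _ _ _ _ _ (by simp [TagL]) _ _).2 ⟨isTm_code _ h.1,
      fun hE => absurd hE (by simp [TagE]), fun _ => ⟨_, Nat.cast_lt.2 h.2, by simp⟩⟩
  case and ih ih' | or ih ih' =>
    exact (wf_bin _ _ _ _ _ (by simp [TagB]) _ _).2 ⟨ih h.1, ih' h.2⟩
  case all ih | ex ih =>
    refine (wf_un _ _ _ _ _ (by simp [TagU]) _).2 ?_
    rw [kk_num (by simp), ll_num (by simp), ← Nat.cast_succ]
    exact ih h
  case all2 ih | ex2 ih =>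
    refine (wf_un _ _ _ _ _ (by simp [TagU]) _).2 ?_
    rw [kk_set (by simp), ll_set (by simp), ← Nat.cast_succ]
    exact ih h

section
variable {M D S W Y F : Set N} [hM : Fact (M ∈ 𝒮 N)] [hD : Fact (D ∈ 𝒮 N)] [hS : Fact (S ∈ 𝒮 N)]
  [hW : Fact (W ∈ 𝒮 N)] [hY : Fact (Y ∈ 𝒮 N)]

theorem same_code {σ : Fm} (h : σ.IsSentence) :
    Same ((σ.code : ℕ) : N) Y ((σ.code : ℕ) : N) W := by
  have h1 : Wf tmT symB 0 ((σ.code : ℕ) : N) 0 0 := by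
    have := wf_code (N := N) σ h
    rwa [Nat.cast_zero] at this
  refine ⟨h1.imp (fun _ _ _ => trivial) fun _ _ h => Or.inl ⟨_, h.choose_spec.2⟩,
    h1.imp (fun _ _ _ => trivial) fun _ _ h => Or.inl ⟨_, h.choose_spec.2⟩,
    fmap_congr (fun _ _ _ => rfl) (fun b s h => ?_) h1⟩
  obtain ⟨i, -, rfl⟩ := h
  rw [canS_other fun i => by simp,
    canS_other fun i => by simp]

/-- A model of a theory that contains `ACA₀` has a satisfaction class, and is closed under
arithmetical comprehension. -/
theorem ModelsTh.closed {A : List Fm} (hA : ∀ σ ∈ A, σ.IsSentence)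
    (hACA : ∀ α ∈ ACA0, Proves {σ | σ ∈ A} α) (hT : IsTheory F Y)
    (hc : ∀ σ ∈ A, ((σ.code : ℕ) : N) ∈ F) (h : ModelsTh M F Y) : Closed (fam M) ∧
      ∃ S ∈ 𝒮 N, TC M (sents M) S ∧
        ∀ f ∈ F, ∃ f', Same f Y f' M ∧ Sent M f' ∧ f' ∈ S := by
  have key : ∀ σ ∈ A, ∃ S ∈ 𝒮 N, TC M (sents M) S ∧
      ((σ.neg.code : ℕ) : N) ∈ sents M ∧ ((σ.neg.code : ℕ) : N) ∉ S := by
    intro σ hσ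
    obtain ⟨S, hS, h1, f', h2, h3, h4⟩ := models_iff.1 (h.2 _ (hc σ hσ))
    have : Fact (S ∈ 𝒮 N) := ⟨hS⟩
    have h5 : Sent M ((σ.code : ℕ) : N) := (same_code (hA σ hσ)).sent (hT _ (hc σ hσ))
    have h7 := (h1.same h2 (same_code (hA σ hσ)) h3).2 h4
    have h6 : Sent M ((σ.neg.code : ℕ) : N) := by
      rw [← (shape_code σ).2]
      exact fmK_neg h5
    refine ⟨S, hS, h1, h6, ?_⟩
    rw [← (shape_code σ).2] at h6 ⊢
    rw [h1.neg_mem h5 h6, not_not]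
    exact h7
  refine ⟨closed_fam hA hACA h.1 fun σ hσ => ?_, ?_⟩
  · obtain ⟨S, hS, h1, h2⟩ := key σ hσ
    have : Fact (S ∈ 𝒮 N) := ⟨hS⟩
    exact ⟨_, h1.refuting, h2⟩
  · obtain ⟨σ, hσ⟩ := exists_of_aca hACA
    obtain ⟨S, hS, h1, h2⟩ := key σ hσ
    have : Fact (S ∈ 𝒮 N) := ⟨hS⟩
    refine ⟨S, hS, h1, fun f hf => ?_⟩
    obtain ⟨f', h3, h4⟩ := (h1.models_iff (hT f hf)).1 (h.2 f hf)
    exact ⟨f', h3, h3.sent (hT f hf), h4⟩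

/-! ### `Π¹₁`-reflection gives models -/

theorem InstEx.refl (W : Set N) (f : N) : InstEx W f f := fun _ _ h => h.1

theorem InstEx.sent {f g : N} (h : InstEx W f g) (hf : Sent W f) : Sent W g := by
  refine h (sents W) fact_sents.out ⟨hf, fun x b x' h => ?_⟩
  obtain ⟨h1, ⟨rfl, n, -, rfl⟩ | ⟨rfl, i, hi, -, rfl⟩⟩ := h
  · exact fmK_inst_body (by simp) (isTm_num 0 n) h1
  · exact fmK_inst2_body (by simp) (symT_const hi) h1

theorem EverySetInModel.of_omegaRFN (h : OmegaRFN 1 F Y) : EverySetInModel F Y := by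
  intro X hX
  by_contra hn
  push Not at hn
  have hX' : Fact (X ∈ 𝒮 N) := ⟨hX⟩
  let Z : Set N := {z | z = pp 0 0 ∨ ∃ x, x ∈ X ∧ z = pp 0 (x + 1)}
  have hZ : Fact (Z ∈ 𝒮 N) := ⟨setOf_mem inferInstance⟩
  have hd : dom Z 0 := Or.inl rfl
  have hs : ∀ x, sec Z 0 x ↔ x ∈ X := fun x => by
    constructor
    · rintro (h | ⟨y, hy, e⟩)
      · exact absurd (pp_inj.1 h).2 (by simp)
      · rwa [add_right_cancel (pp_inj.1 e).2]
    · exact fun h => Or.inr ⟨x, h, rfl⟩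
  obtain ⟨j, hj, hj'⟩ : ∃ j : N, (j = 2 ∨ j = 3) ∧ ¬ LitV Z j (pp 0 0) (pp 2 0) := by
    by_cases h0 : (0 : N) ∈ X
    · exact ⟨3, Or.inr rfl, by simp [LitV, teval_zero, hs, h0]⟩
    · exact ⟨2, Or.inl rfl, by simp [LitV, teval_zero, hs, h0]⟩
  have hsent : ∀ j : N, (j = 2 ∨ j = 3) → Sent Z (pp j (pp (pp 0 0) (pp 2 0))) := fun j hj =>
    (fmK_lit (tagL_mem hj)).2 ⟨isTm_zero 0, fun h => absurd h (not_tagE hj),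
      fun _ => symT_const hd _⟩
  have h0 : ∀ M ∈ 𝒮 N, ModelsTh M F Y ∧
      InLang (pp j (pp (pp 0 0) (pp 2 0))) Z M → Models M (pp j (pp (pp 0 0) (pp 2 0))) Z := by
    rintro M hM ⟨h1, f', h2, h3⟩
    have : Fact (M ∈ 𝒮 N) := ⟨hM⟩
    refine absurd h1 (hn M hM ?_)
    obtain ⟨s', rfl, -, h4⟩ := (same_lit (tagL_mem hj)).1 h3
    rcases h4 (not_tagE hj) with ⟨i, h5, -⟩ | ⟨i, k, h5, rfl, -, h6, h7⟩
    · rcases h5 with h5 | h5 <;> simp at h5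
    · obtain rfl := (pp_inj.1 h5).2
      exact ⟨k, h6, fun x => (hs x).symm.trans (h7 x)⟩
  obtain ⟨_, ⟨-, rfl⟩, h1⟩ := h _ Z hZ.out ⟨hsent j hj, cls_lit _ _ (tagL_mem hj), h0⟩
  · have hj2 : dl true j = 2 ∨ dl true j = 3 := by rcases hj with rfl | rfl <;> simp [dl]
    rw [neg_lit (tagL_mem hj)] at h1
    refine h1 ⟨Z, hZ.out, _, _, Same.refl (hsent _ hj2), InstEx.refl _ _, cls_lit _ _
      (tagL_mem hj2), (trArith_iff (hsent _ hj2)).2 ⟨{f | f = pp (dl true j) (pp (pp 0 0) (pp 2 0))},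
        setOf_mem inferInstance, {f | f = pp (dl true j) (pp (pp 0 0) (pp 2 0))},
        setOf_mem inferInstance, ?_, rfl, rfl⟩⟩
    constructor
    · rintro f rfl
      exact hsent _ hj2
    · intro j' t s hq e
      refine iff_of_true e ?_
      simp only [Set.mem_ofPred_eq, pp_inj] at e
      obtain ⟨rfl, rfl, rfl⟩ := e
      have := LitV.dual (W := Z) (W' := Z) (t := pp 0 0) (s := pp 2 0) (tagL_mem hj) rfl
        (fun _ => rfl) (fun _ _ => Iff.rfl) true
      simp only [cond_true] at this
      exact this.2 hj'
    · intro j' g k hj' e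
      exact absurd (pp_inj.1 e).1.symm ((tagL_mem hj2).ne_tagB hj')
    · intro j' g hj' e
      exact absurd (pp_inj.1 e).1.symm ((tagL_mem hj2).ne_tagU (tagU_num hj'))
    · intro j' g hj' e
      exact absurd (pp_inj.1 e).1.symm ((tagL_mem hj2).ne_tagU (tagU_set hj'))

/-! ### `Π¹₂`-reflection gives `Π¹₁`-reflection -/

theorem cls_one {pol : Bool} {x : N} (h : IsAr x) : Cls pol 1 x :=
  (cls_succ _ _ _).2 (Or.inl ((cls_zero _ _).2 h))

theorem Cls.mono {x : N} : Cls true 1 x → Cls true 2 x := by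
  refine sind 𝒮 N (P := fun x => Cls true 1 x → Cls true 2 x) (fun x ih h => ?_) x
  rw [cls_succ] at h ⊢
  refine h.imp (fun h => cls_one ((cls_zero _ _).1 h)) ?_
  rintro ⟨g, h1, h2⟩
  refine ⟨g, h1, ih g ?_ h2⟩
  rcases h1 with rfl | rfl <;> exact lt_un (by norm_num) g

theorem nf_neg {d : Bool} {f : N} (hf : Shape f) : nf d W Y (neg f) = nf (!d) W Y f := by
  unfold nf SOA.neg
  rw [fmap_fmap_shape canT (canS W Y) 0 (fun _ _ => rfl) (fun _ _ => rfl) hf]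
  cases d <;> rfl

theorem NR.isAr {d : Bool} {f g : N} (hf : Shape f) (hg : Shape g) (h : NR d W Y f g) :
    IsAr f ↔ IsAr g := by
  unfold NR at h
  have h1 := isAr_fmap (d := d) (T1 := canT) (S1 := canS W Y) (q := 0) (k := 0) (l := 0) hf
  have h2 := isAr_fmap (d := false) (T1 := canT) (S1 := canS Y Y) (q := 0) (k := 0) (l := 0) hg
  exact h1.symm.trans ((iff_of_eq (congrArg IsAr h)).trans h2)

theorem dl_inj {j k : N} (hj : TagU j) (h : dl true j = k) : j = dl true k := by
  rw [← h, dl_dl (Or.inr (Or.inr hj))]; simp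

set_option maxHeartbeats 400000 in
/-- The partial truth definitions agree on arithmetical sentences. -/
theorem TrArith.trPi_one {g : N} (hg : Sent W g) (ha : IsAr g) (h : TrArith g W) : TrPi 1 g W := by
  refine ⟨_, ⟨hg.shape, rfl⟩, ?_⟩
  rintro ⟨V, hV, h', g', h1, h2, h3, h4⟩
  have : Fact (V ∈ 𝒮 N) := ⟨hV⟩
  have hs' := h1.sent (fmK_neg hg)
  obtain ⟨D, hD, S, hS, t1, t2, t3⟩ := (trArith_iff hg).1 h
  obtain ⟨D', hD', S', hS', t1', t2', t3'⟩ := (trArith_iff (h2.sent hs')).1 h4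
  have : Fact (D ∈ 𝒮 N) := ⟨hD⟩
  have : Fact (S ∈ 𝒮 N) := ⟨hS⟩
  have : Fact (D' ∈ 𝒮 N) := ⟨hD'⟩
  have : Fact (S' ∈ 𝒮 N) := ⟨hS'⟩
  suffices H : g' ∈ {x | Sent V x ∧ IsAr x ∧ ∃ y, y ∈ D ∧ y ∈ S ∧ NR true W V y x} by
    obtain ⟨-, -, y, y1, y2, y3⟩ := H
    have hg' := h2.sent hs'
    have hy := (NR.isAr (t1.sent y y1).shape hg'.shape y3).2 ((cls_zero _ _).1 h3)
    exact (t1.nr t1' true y1 t2' (Or.inr hy) y3).1 t3' y2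
  refine h2 _ (setOf_mem inferInstance) ⟨⟨hs', ?_, g, t2, t3, ?_⟩, ?_⟩
  · rw [← h1.isAr]
    have hn : Sent W (neg g) := fmK_neg hg
    exact (NR.isAr hn.shape hg.shape (NR.neg (W := W) hg.shape)).2 ha
  · have := h1.nr
    unfold NR at this ⊢
    rwa [nf_neg hg.shape] at this
  · rintro x b x' ⟨⟨h5, h6, y, y1, y2, y3⟩, h7⟩
    rcases h7 with ⟨rfl, n, -, rfl⟩ | ⟨rfl, i, hi, -, rfl⟩
    · refine ⟨fmK_inst_body (by simp) (isTm_num 0 n) h5,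
        (isAr_inst ((shape_un (by simp [TagU])).1 h5.shape)).2 ((isAr_un (by simp [TagU])).1 h6).2, ?_⟩
      rcases (t1.sent y y1).shape.cases with ⟨j, t, s, hj, rfl⟩ | ⟨j, g, k, hj, rfl, -, -⟩ |
        ⟨j, k, hj, rfl, hk⟩
      · obtain ⟨_, _, e, -⟩ := y3.lit h5.shape hj
        exact absurd (pp_inj.1 e).1.symm ((hj.dl true).ne_tagU (by simp [TagU]))
      · obtain ⟨_, _, e, -⟩ := y3.bin h5.shape hj
        exact absurd (pp_inj.1 e).1.symm ((hj.dl true).ne_tagU (by simp [TagU]))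
      · obtain ⟨b', e, h8, h9⟩ := y3.un h5.shape hk hj
        obtain ⟨e1, rfl⟩ := pp_inj.1 e
        have hj6 : j = 6 := by rw [dl_inj hj e1.symm]; simp [dl]
        subst hj6
        obtain ⟨a1, a2⟩ := t1.num _ _ (by simp) y1
        rw [if_pos rfl] at a2
        exact ⟨_, a1 n, a2.1 y2 n, h9.inst hk h8 rfl⟩
    · have := ((isAr_un (by simp [TagU])).1 h6).1
      simp at this

theorem OmegaRFN.one_of_two (h : OmegaRFN 2 F Y) : OmegaRFN 1 F Y := by
  rintro f Z hZ ⟨h1, h2, h3⟩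
  have : Fact (Z ∈ 𝒮 N) := ⟨hZ⟩
  obtain ⟨f', hf', h4⟩ := h f Z hZ ⟨h1, h2.mono, h3⟩
  refine ⟨f', hf', ?_⟩
  rintro ⟨W, hW, x, g, h5, h6, h7, h8⟩
  have : Fact (W ∈ 𝒮 N) := ⟨hW⟩
  rw [cls_zero] at h7
  have hx : Sent W g := h6.sent (h5.sent (hf'.2 ▸ fmK_neg h1))
  exact h4 ⟨W, hW, x, g, h5, h6, cls_one h7, TrArith.trPi_one hx h7 h8⟩

end

/-! ### Iteration -/

section
variable {F : Set (Set N)} [hF : Closed F]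

noncomputable def iterStep (st : N → N → N) (x₀ n : N) (f : N → N) : N :=
  if n = predN n + 1 then st (predN n) (f (predN n)) else x₀

theorem iterStep_local (st : N → N → N) : Local (iterStep st) := by
  intro x n f g h
  unfold iterStep
  split_ifs with hn
  · rw [h]
    rw [ACAM.lt_iff, ← hn]
  · rfl

theorem iterStep_def {st : N → N → N} (hst : DefM F (fun q : N × N => st q.1 q.2)) :
    DefM F (fun q : (N × N) × N => iterStep st q.1.1 q.1.2 (ap q.2)) := by
  have hst' : ∀ {α : Type} [Ctx N α] (f g : α → N) [DefM F f] [DefM F g],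
      DefM F (fun a => st (f a) (g a)) := fun f g => DefM.lift2 (P := st) hst f g
  unfold iterStep; infer_instance

/-- The sequence `x₀, st 0 x₀, st 1 (st 0 x₀), …`. -/
noncomputable def iterN (st : N → N → N) (x₀ n : N) : N := recN (iterStep st) x₀ n

theorem defM_iterN {st : N → N → N} (hst : DefM F (fun q : N × N => st q.1 q.2)) :
    DefM F (fun q : N × N => iterN st q.1 q.2) :=
  defM_recN (iterStep_local st) (iterStep_def hst)

theorem iterN_zero {st : N → N → N} (hst : DefM 𝒮 N (fun q : N × N => st q.1 q.2))
    (x₀ : N) : iterN st x₀ 0 = x₀ := by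
  rw [iterN, recN_eq 𝒮 N (iterStep_local st) (iterStep_def hst), iterStep,
    if_neg (fun h : (0 : N) = predN 0 + 1 => absurd h.symm (by simp))]

theorem iterN_succ {st : N → N → N} (hst : DefM 𝒮 N (fun q : N × N => st q.1 q.2))
    (x₀ n : N) : iterN st x₀ (n + 1) = st n (iterN st x₀ n) := by
  rw [iterN, recN_eq 𝒮 N (iterStep_local st) (iterStep_def hst), iterStep]
  simp [iterN]

end

section
variable {M S W Y Z F : Set N} [hM : Fact (M ∈ 𝒮 N)] [hS : Fact (S ∈ 𝒮 N)]
  [hW : Fact (W ∈ 𝒮 N)] [hY : Fact (Y ∈ 𝒮 N)] [hZ : Fact (Z ∈ 𝒮 N)]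

theorem cls_inst {pol : Bool} {n : ℕ} {c b : N} (hb : Shape b) :
    Cls pol n (inst c b) ↔ Cls pol n b := by
  have := cls_fmap (d := false) (pol := pol) (n := n) (T1 := tsub) (S1 := idT) (q := c) (k := 0)
    (l := 0) hb
  rwa [Bool.xor_false] at this

theorem cls_inst2 {pol : Bool} {n : ℕ} {c b : N} (hb : Shape b) :
    Cls pol n (inst2 c b) ↔ Cls pol n b := by
  have := cls_fmap (d := false) (pol := pol) (n := n) (T1 := idT) (S1 := setS) (q := c) (k := 0)
    (l := 0) hb
  rwa [Bool.xor_false] at this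

theorem cls_neg {pol : Bool} {n : ℕ} {b : N} (hb : Shape b) :
    Cls (!pol) n (neg b) ↔ Cls pol n b := by
  have := cls_fmap (d := true) (pol := pol) (n := n) (T1 := idT) (S1 := idT) (q := 0) (k := 0)
    (l := 0) hb
  rwa [Bool.xor_true] at this

/-- A true instance of an existential sentence. -/
noncomputable def witStep (M S : Set N) (x : N) : N :=
  if x = pp 7 (sndN x) then inst (num (leastN fun n => inst (num n) (sndN x) ∈ S)) (sndN x)
  else if x = pp 9 (sndN x) then
    inst2 (pp 2 (leastN fun i => dom M i ∧ inst2 (pp 2 i) (sndN x) ∈ S)) (sndN x)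
  else x

instance defM_witStep {α : Type} [Ctx N α] {f : α → N} [DefM 𝒮 N f] :
    DefM 𝒮 N (fun a => witStep M S (f a)) :=
  DefM.lift (P := witStep M S) (by unfold witStep; infer_instance) f

theorem witStep_spec (h : TC M (sents M) S) {x : N} (hx : Sent M x) (hxS : x ∈ S)
    (hc : Cls false 1 x) : Sent M (witStep M S x) ∧ witStep M S x ∈ S ∧
      Cls false 1 (witStep M S x) ∧ (IsAr x → IsAr (witStep M S x)) ∧
      (IsAr x ∨ dp (witStep M S x) + 1 = dp x) ∧
      ∀ U ∈ 𝒮 N, (∀ h b h', h ∈ U ∧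
        ((h = pp 7 b ∧ ∃ n, InstOK b ∧ h' = inst (num n) b) ∨
        (h = pp 9 b ∧ ∃ i, dom M i ∧ Shape b ∧ h' = inst2 (pp 2 i) b)) → h' ∈ U) →
        x ∈ U → witStep M S x ∈ U := by
  have key : IsAr x ∨ ∃ g, (x = pp 7 g ∨ x = pp 9 g) ∧ Cls false 1 g :=
    ((cls_succ _ _ _).1 hc).imp (cls_zero _ _).1 id
  by_cases h7 : x = pp 7 (sndN x)
  · obtain ⟨b, rfl⟩ : ∃ b, x = pp 7 b := ⟨_, h7⟩
    have e : witStep M S (pp 7 b) = inst (num (leastN fun n => inst (num n) b ∈ S)) b := by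
      unfold witStep; rw [sndN_pp, if_pos rfl]
    have hb : Shape b := (shape_un (by simp [TagU])).1 hx.shape
    have hex := (h.num _ _ (by simp) hx).2.1 hxS
    rw [if_neg (by norm_num)] at hex
    have hl := leastN_spec 𝒮 N (P := fun n => inst (num n) b ∈ S) hex
    rw [e]
    refine ⟨fmK_inst_body (by simp) (isTm_num 0 _) hx, hl, ?_, ?_, ?_, ?_⟩
    · refine (cls_inst hb).2 ?_
      rcases key with h1 | ⟨g, h1, h2⟩
      · exact cls_one ((isAr_un (by simp [TagU])).1 h1).2
      · rcases h1 with h1 | h1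
        · rw [(pp_inj.1 h1).2]; exact h2
        · exact absurd (pp_inj.1 h1).1 (by norm_num)
    · exact fun h1 => (isAr_inst hb).2 ((isAr_un (by simp [TagU])).1 h1).2
    · right; rw [dp_inst hb, dp_un (by simp [TagU])]
    · intro U hU hc hxU
      exact hc _ b _ ⟨hxU, Or.inl ⟨rfl, _, sent_num (by simp) hx, rfl⟩⟩
  by_cases h9 : x = pp 9 (sndN x)
  · obtain ⟨b, rfl⟩ : ∃ b, x = pp 9 b := ⟨_, h9⟩
    have e : witStep M S (pp 9 b) =
        inst2 (pp 2 (leastN fun i => dom M i ∧ inst2 (pp 2 i) b ∈ S)) b := by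
      unfold witStep; rw [if_neg h7, sndN_pp, if_pos rfl]
    have hb : Shape b := (shape_un (by simp [TagU])).1 hx.shape
    have hex := (h.set _ _ (by simp) hx).2.1 hxS
    rw [if_neg (by norm_num)] at hex
    have hl := leastN_spec 𝒮 N (P := fun i => dom M i ∧ inst2 (pp 2 i) b ∈ S) hex
    rw [e]
    refine ⟨fmK_inst2_body (by simp) (symT_const hl.1) hx, hl.2, ?_, ?_, ?_, ?_⟩
    · refine (cls_inst2 hb).2 ?_
      rcases key with h1 | ⟨g, h1, h2⟩
      · exact cls_one ((isAr_un (by simp [TagU])).1 h1).2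
      · rcases h1 with h1 | h1
        · exact absurd (pp_inj.1 h1).1 (by norm_num)
        · rw [(pp_inj.1 h1).2]; exact h2
    · intro h1
      have := ((isAr_un (by simp [TagU])).1 h1).1
      simp at this
    · right; rw [dp_inst2 hb, dp_un (by simp [TagU])]
    · intro U hU hc hxU
      exact hc _ b _ ⟨hxU, Or.inr ⟨rfl, _, hl.1, hb, rfl⟩⟩
  have e : witStep M S x = x := by unfold witStep; rw [if_neg h7, if_neg h9]
  rw [e]
  refine ⟨hx, hxS, hc, id, ?_, fun U _ _ h => h⟩
  refine key.imp id ?_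
  rintro ⟨g, rfl | rfl, -⟩
  · exact absurd (by rw [sndN_pp]) h7
  · exact absurd (by rw [sndN_pp]) h9

/-- A true `Σ¹₁`-sentence has a true arithmetical instance. -/
theorem TC.exists_instEx (h : TC M (sents M) S) {x : N} (hx : Sent M x) (hxS : x ∈ S)
    (hc : Cls false 1 x) : ∃ g, InstEx M x g ∧ IsAr g ∧ Sent M g ∧ g ∈ S := by
  have hst : DefM 𝒮 N (fun q : N × N => witStep M S q.2) := inferInstance
  have hit : DefM 𝒮 N (fun q : N × N => iterN (fun _ => witStep M S) x q.2) :=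
    DefM.lift2 (P := iterN (fun _ => witStep M S)) (defM_iterN hst) (fun _ => x) (fun q : N × N => q.2)
  have hit' : ∀ {α : Type} [Ctx N α] (f : α → N) [DefM 𝒮 N f],
      DefM 𝒮 N (fun a => iterN (fun _ => witStep M S) x (f a)) :=
    fun f => DefM.lift hit f
  have inv : ∀ n : N, (Sent M (iterN (fun _ => witStep M S) x n) ∧
      iterN (fun _ => witStep M S) x n ∈ S ∧ Cls false 1 (iterN (fun _ => witStep M S) x n)) ∧
      (IsAr (iterN (fun _ => witStep M S) x n) ∨
        dp (iterN (fun _ => witStep M S) x n) + n = dp x) := by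
    refine ind 𝒮 N ?_ fun n ih => ?_
    · rw [iterN_zero hst, add_zero]
      exact ⟨⟨hx, hxS, hc⟩, Or.inr rfl⟩
    · rw [iterN_succ hst]
      obtain ⟨⟨h1, h2, h3⟩, h4⟩ := ih
      obtain ⟨i1, i2, i3, i4, i5, -⟩ := witStep_spec h h1 h2 h3
      refine ⟨⟨i1, i2, i3⟩, ?_⟩
      by_cases ha : IsAr (iterN (fun _ => witStep M S) x n)
      · exact Or.inl (i4 ha)
      · right
        rw [← h4.resolve_left ha, ← i5.resolve_left ha]; ring
  obtain ⟨⟨h1, h2, h3⟩, h4⟩ := inv (dp x + 1)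
  refine ⟨_, ?_, h4.resolve_right fun e => ?_, h1, h2⟩
  · rintro U hU ⟨hxU, hcl⟩
    have : Fact (U ∈ 𝒮 N) := ⟨hU⟩
    refine ind 𝒮 N (P := fun n => iterN (fun _ => witStep M S) x n ∈ U) ?_ (fun n ih => ?_) _
    · rw [iterN_zero hst]; exact hxU
    · rw [iterN_succ hst]
      obtain ⟨⟨h1, h2, h3⟩, -⟩ := inv n
      exact (witStep_spec h h1 h2 h3).2.2.2.2.2 U hU hcl ih
  · have : dp x < dp x := by
      calc dp x < dp x + 1 := ACAM.lt_add_one_iff.2 le_rfl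
        _ ≤ (dp x + 1) + dp (iterN (fun _ => witStep M S) x (dp x + 1)) := le_self_add
        _ = dp x := by rw [add_comm, e]
    exact lt_irrefl _ this

/-! ### Satisfaction and changes of the constant symbols -/

theorem sm_inst {c g : N} (hg : Shape g) : sm W M (inst c g) = inst c (sm W M g) := rn_inst hg

theorem sm_inst2 {r g : N} (hg : Shape g) :
    sm W M (inst2 r g) = inst2 (canS W M 0 0 r) (sm W M g) := rn_inst2 hg

/-- A false `Π¹₂`-sentence fails in all models that contain certain sets. -/
theorem exists_of_not_trPi {f : N} (hf : Sent Z f) (hn : ¬ TrPi 2 f Z) :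
    ∃ W ∈ 𝒮 N, ∀ M ∈ 𝒮 N,
      (∀ i, dom W i → ∃ j, matchI W M i j) → ∀ S ∈ 𝒮 N, TC M (sents M) S →
        ∃ f', Same f Z f' M ∧ Sent M f' ∧ f' ∉ S := by
  have : ∃ W ∈ 𝒮 N, ∃ h g, Same (neg f) Z h W ∧ InstEx W h g ∧ Cls true 1 g ∧
      TrPi 1 g W := by
    by_contra h
    exact hn ⟨_, ⟨hf.shape, rfl⟩, h⟩
  obtain ⟨W, hW, x, g, h1, h2, h3, h4⟩ := this
  refine ⟨W, hW, fun M hM hm S hS h => ?_⟩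
  have : Fact (W ∈ 𝒮 N) := ⟨hW⟩
  have : Fact (M ∈ 𝒮 N) := ⟨hM⟩
  have : Fact (S ∈ 𝒮 N) := ⟨hS⟩
  have hx : Sent W x := h1.sent (fmK_neg hf)
  have hsm : ∀ {y : N}, Sent W y → Sent M (sm W M y) := fun hy => (Same.exists hy hm).sent hy
  have h5 : Same f Z (neg (sm W M x)) M := by
    have := (h1.trans (Same.exists hx hm)).neg
    rwa [neg_neg' hf.shape] at this
  refine ⟨_, h5, h5.sent hf, fun h6 => ?_⟩
  have hxM := hsm hx
  rw [h.neg_mem hxM (fmK_neg hxM)] at h6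
  have h7 : Sent W g ∧ sm W M g ∉ S := by
    refine h2 {y | Sent W y ∧ sm W M y ∉ S} (setOf_mem inferInstance) ⟨⟨hx, h6⟩, ?_⟩
    rintro y b y' ⟨⟨i1, i2⟩, ⟨rfl, n, -, rfl⟩ | ⟨rfl, i, hi, -, rfl⟩⟩
    · have hb := (shape_un (by simp [TagU])).1 i1.shape
      refine ⟨fmK_inst_body (by simp) (isTm_num 0 n) i1, fun hmem => i2 ?_⟩
      rw [sm_inst hb] at hmem
      have := h.num 7 (sm W M b) (by simp) (by rw [← sm_un (by simp [TagU]) hb]; exact hsm i1)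
      rw [sm_un (by simp [TagU]) hb, this.2, if_neg (by norm_num)]
      exact ⟨n, hmem⟩
    · have hb := (shape_un (by simp [TagU])).1 i1.shape
      refine ⟨fmK_inst2_body (by simp) (symT_const hi) i1, fun hmem => i2 ?_⟩
      obtain ⟨j, hj⟩ := hm i hi
      obtain ⟨m, e, hm'⟩ := canS_const_match (p := 0) (l := 0) hj
      rw [sm_inst2 hb, e] at hmem
      have := h.set 9 (sm W M b) (by simp) (by rw [← sm_un (by simp [TagU]) hb]; exact hsm i1)
      rw [sm_un (by simp [TagU]) hb, this.2, if_neg (by norm_num)]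
      exact ⟨m, hm'.1, hmem⟩
  obtain ⟨hg, hg'⟩ := h7
  have hgM := hsm hg
  have hnM : Sent M (neg (sm W M g)) := fmK_neg hgM
  have h8 : Same (neg g) W (neg (sm W M g)) M := (Same.exists hg hm).neg
  obtain ⟨k, k1, k2, k3, k4⟩ := h.exists_instEx hnM ((h.neg_mem hgM hnM).2 hg') (by
    refine (cls_neg (pol := true) hgM.shape).2 ?_
    exact ((Same.exists hg hm).cls true 1).1 h3)
  obtain ⟨f', ⟨-, rfl⟩, h9⟩ := h4
  exact h9 ⟨M, hM, _, k, h8, k1, (cls_zero _ _).2 k2,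
    (trArith_iff k3).2 ⟨sents M, fact_sents.out, S, hS, h, k3, k4⟩⟩

theorem matchI_of_closed (hc : Closed (fam M)) (h : W ∈ fam M) {i : N} (_ : dom W i) :
    ∃ j, matchI W M i j := by
  have : Fact (W ∈ fam M) := ⟨h⟩
  obtain ⟨j, h1, h2⟩ : {x | sec W i x} ∈ fam M := setOf_mem inferInstance
  exact ⟨j, h1, fun x => (Set.ext_iff.1 h2 x)⟩

/-- `F` is a theory all of whose models are closed under arithmetical comprehension and have a
satisfaction class. -/
def Strong (F Y : Set N) : Prop := ∀ M ∈ 𝒮 N, ModelsTh M F Y → Closed (fam M) ∧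
  ∃ S ∈ 𝒮 N, TC M (sents M) S ∧
    ∀ f ∈ F, ∃ f', Same f Y f' M ∧ Sent M f' ∧ f' ∈ S

theorem EverySetInModel.two (hF : Strong F Y) (h : EverySetInModel F Y) :
    ∃ M ∈ 𝒮 N, ModelsTh M F Y ∧
      (∀ i, dom W i → ∃ j, matchI W M i j) ∧ (∀ i, dom Z i → ∃ j, matchI Z M i j) ∧
      ∃ S ∈ 𝒮 N, TC M (sents M) S ∧
        ∀ f ∈ F, ∃ f', Same f Y f' M ∧ Sent M f' ∧ f' ∈ S := by
  obtain ⟨M, hM, h1, h2⟩ := h {z | (∃ x, x ∈ W ∧ z = pp 0 x) ∨ ∃ x, x ∈ Z ∧ z = pp 1 x}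
    (setOf_mem inferInstance)
  obtain ⟨h3, h4⟩ := hF M hM h2
  rw [memFam_iff] at h1
  have : Fact (M ∈ 𝒮 N) := ⟨hM⟩
  have : Fact ({z | (∃ x, x ∈ W ∧ z = pp 0 x) ∨ ∃ x, x ∈ Z ∧ z = pp 1 x} ∈ fam M) := ⟨h1⟩
  have h5 : {x | pp 0 x ∈ {z : N | (∃ x, x ∈ W ∧ z = pp 0 x) ∨ ∃ x, x ∈ Z ∧ z = pp 1 x}} ∈ fam M :=
    setOf_mem inferInstance
  have h6 : {x | pp 1 x ∈ {z : N | (∃ x, x ∈ W ∧ z = pp 0 x) ∨ ∃ x, x ∈ Z ∧ z = pp 1 x}} ∈ fam M :=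
    setOf_mem inferInstance
  have e5 : {x | pp 0 x ∈ {z : N | (∃ x, x ∈ W ∧ z = pp 0 x) ∨ ∃ x, x ∈ Z ∧ z = pp 1 x}} = W := by
    ext x; simp
  have e6 : {x | pp 1 x ∈ {z : N | (∃ x, x ∈ W ∧ z = pp 0 x) ∨ ∃ x, x ∈ Z ∧ z = pp 1 x}} = Z := by
    ext x; simp
  rw [e5] at h5
  rw [e6] at h6
  exact ⟨M, hM, h2, fun i => matchI_of_closed h3 h5, fun i => matchI_of_closed h3 h6, h4⟩

theorem OmegaRFN.two_of_models (hF : Strong F Y) (h : EverySetInModel F Y) : OmegaRFN 2 F Y := by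
  rintro f Z hZ ⟨h1, h2, h3⟩
  have : Fact (Z ∈ 𝒮 N) := ⟨hZ⟩
  by_contra hn
  obtain ⟨W, hW, h4⟩ := exists_of_not_trPi h1 hn
  obtain ⟨M, hM, h5, h6, -, S, hS, h7, -⟩ := (have : Fact (W ∈ 𝒮 N) := ⟨hW⟩; h.two (W := W) (Z := W) hF)
  have : Fact (M ∈ 𝒮 N) := ⟨hM⟩
  have : Fact (S ∈ 𝒮 N) := ⟨hS⟩
  obtain ⟨f', h8, h9, h10⟩ := h4 M hM h6 S hS h7
  obtain ⟨f'', h11, h12⟩ := (h7.models_iff h1).1 (h3 M hM ⟨h5, f', h9, h8⟩)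
  exact h10 ((h7.same h11 h8 (h11.sent h1)).2 h12)

end

/-! ### Soundness of `ω`-proofs -/

/-- The symbols for free variables are interpreted by `ν`, the constants of `W` by those of
`M`. -/
noncomputable def asg (W M : Set N) (i ν _ s : N) : N :=
  if s = pp 2 (sndN s) then pp 2 (leastN (matchI W M (sndN s)))
  else if s = pp 1 (sndN s) then
    if dom M (lk ν (sndN s)) then pp 2 (lk ν (sndN s)) else pp 2 i
  else s

section
variable {M S W I E D G : Set N} [hM : Fact (M ∈ 𝒮 N)] [hS : Fact (S ∈ 𝒮 N)] [hW : Fact (W ∈ 𝒮 N)]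
  [hI : Fact (I ∈ 𝒮 N)] [hE : Fact (E ∈ 𝒮 N)] [hD : Fact (D ∈ 𝒮 N)] [hG : Fact (G ∈ 𝒮 N)]
  {i0 ν : N}

instance ren_asg : Ren (asg W M i0) where
  defM := by unfold asg; infer_instance
  const _ _ _ := rfl
  bound p l s k := by
    unfold asg
    split_ifs with h1 h2
    · rw [h1]; simp
    · rw [h2]; simp
    · rw [h2]; simp
    · rfl

theorem asg_const (hm : ∀ i, dom W i → ∃ j, matchI W M i j) {k : N} (hk : dom W k) :
    ∃ m, asg W M i0 ν 0 (pp 2 k) = pp 2 m ∧ matchI W M k m := by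
  refine ⟨_, ?_, leastN_spec 𝒮 N (P := matchI W M k) (hm k hk)⟩
  rw [asg, sndN_pp, if_pos rfl]

omit hM hW in
theorem asg_free (hi : dom M i0) (u : N) : ∃ m, asg W M i0 ν 0 (pp 1 u) = pp 2 m ∧ dom M m := by
  rw [asg, sndN_pp, if_neg (by simp), if_pos rfl]
  split_ifs with h
  · exact ⟨_, rfl, h⟩
  · exact ⟨_, rfl, hi⟩

omit hM hW in
theorem asg_upd_self {u k : N} (hk : dom M k) :
    asg W M i0 (upd ν u k) 0 (pp 1 u) = pp 2 k := by
  rw [asg, sndN_pp, if_neg (by simp), if_pos rfl, lk_upd, if_pos rfl, if_pos hk]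

theorem rn_asg_upd {u k f : N} (hf : IsFm W f) (hu : ¬ Occ u f) :
    rn (asg W M i0) (upd ν u k) f = rn (asg W M i0) ν f := by
  have hd : Def3 𝒮 N (fun _ _ s => s ≠ pp 1 u) := by infer_instance
  have h : Wf tmT (fun _ _ s => s ≠ pp 1 u) 0 f 0 0 := Wf.not_occ hf (fun _ _ _ h => h) hu
  refine fmap_congr (fun _ _ _ => rfl) (fun b s hs => ?_) h
  unfold asg
  split_ifs with h1 h2 h3 h4 h4 <;> try rfl
  all_goals
    have : u ≠ sndN s := fun e => hs (by rw [e]; exact h2)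
    rw [lk_upd, if_neg this] at *
  · contradiction
  · contradiction

theorem sent_asg (hm : ∀ i, dom W i → ∃ j, matchI W M i j) (hi : dom M i0) {f : N}
    (hf : IsFm W f) : Sent M (rn (asg W M i0) ν f) := by
  refine rn_sent (fun b s hs => ?_) hf
  rcases hs with ⟨i, hi', rfl⟩ | ⟨-, u, rfl⟩ | ⟨k, rfl, hk⟩
  · rw [(ren_asg.bound _ _ _ _).2 rfl]; exact Or.inl ⟨i, hi', rfl⟩
  · obtain ⟨m, e, hm'⟩ := asg_free (W := W) (ν := ν) hi u
    rw [e]; exact symT_const hm' _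
  · obtain ⟨m, e, hm'⟩ := asg_const (i0 := i0) (ν := ν) hm hk
    rw [e]; exact symT_const hm'.1 _

theorem TC.inst_num (h : TC M (sents M) S) {j g t : N} (hj : j = 6 ∨ j = 7) (ht : IsTm 0 t)
    (hf : Sent M (pp j g)) : SOA.inst t g ∈ S ↔ SOA.inst (SOA.num (teval 0 t)) g ∈ S := by
  have hg : Shape g := (shape_un (tagU_num hj)).1 hf.shape
  refine h.nr h false (y := SOA.inst (SOA.num (teval 0 t)) g) (fmK_inst_body hj (isTm_num 0 _) hf)
    (fmK_inst_body hj ht hf) (Or.inl rfl) (NR.inst hg hg ?_ rfl)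
  rw [can_eq_iff]
  intro p; rw [teval_num, teval_closed ht]

theorem not_refuted_axiom (h : TC M (sents M) S) (hm : ∀ i, dom W i → ∃ j, matchI W M i j)
    (hi : dom M i0) {i : N} (hfm : ∀ h, pp i h ∈ D → IsFm W h) (hax : AxiomAt D W i)
    (hfal : ∀ x, pp i x ∈ D → rn (asg W M i0) ν x ∉ S) : False := by
  have key : ∀ j t s, TagL j → pp i (pp j (pp t s)) ∈ D →
      ¬ LitV M j t (if TagE j then s else asg W M i0 ν 0 s) := by
    intro j t s hj hD hl
    have h1 := sent_asg (ν := ν) hm hi (hfm _ hD)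
    rw [rn_lit hj] at h1
    have h2 := hfal _ hD
    rw [rn_lit hj, h.lit _ _ _ hj h1] at h2
    exact h2 hl
  have const : ∀ {j t k : N}, (j = 2 ∨ j = 3) → pp i (pp j (pp t (pp 2 k))) ∈ D → dom W k := by
    intro j t k hj h
    rcases ((fmK_lit (tagL_mem hj)).1 (hfm _ h)).2.2 (not_tagE hj) with
      ⟨_, _, e⟩ | ⟨_, _, e⟩ | ⟨_, e, hk⟩
    · simp at e
    · simp at e
    · rwa [(pp_inj.1 e).2]
  obtain ⟨t, u, ⟨h1, h2, h3, h4⟩ | ⟨h1, h2⟩ | ⟨k, h1, n, ⟨h2, rfl⟩, h3⟩ |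
    ⟨k, h1, n, ⟨h2, rfl⟩, h3⟩ | ⟨k, h1, h2, h3, h4, h5⟩⟩ := hax
  · refine key 0 t u (by simp [TagL]) h1 ?_
    rw [if_pos (by simp [TagE])]
    simp [LitV, h4]
  · refine key 1 t u (by simp [TagL]) h1 ?_
    rw [if_pos (by simp [TagE])]
    obtain ⟨i1, i2, -⟩ := (fmK_lit (by simp [TagL])).1 (hfm _ h1)
    have : teval 0 t ≠ teval 0 u := fun e => h2 ⟨i1, i2 (by simp [TagE]), e⟩
    simp [LitV, this]
  · obtain ⟨m, e, hm'⟩ := asg_const (i0 := i0) (ν := ν) hm (const (by simp) h1)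
    refine key 2 t _ (by simp [TagL]) h1 ?_
    rw [if_neg (by simp [TagE]), e]
    have := (hm'.2 _).1 h3
    simp [LitV, this]
  · obtain ⟨m, e, hm'⟩ := asg_const (i0 := i0) (ν := ν) hm (const (by simp) h1)
    refine key 3 t _ (by simp [TagL]) h1 ?_
    rw [if_neg (by simp [TagE]), e]
    have := mt (hm'.2 _).2 h3
    simp [LitV, this]
  · obtain ⟨m, e, hm'⟩ := asg_free (W := W) (ν := ν) hi k
    have k1 := key 2 t _ (by simp [TagL]) h1
    have k2 := key 3 u _ (by simp [TagL]) h2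
    rw [if_neg (by simp [TagE]), e] at k1 k2
    simp [LitV, h5] at k1 k2
    exact k1 k2

/-- In an `ω`-proof, no sequent is refuted by an assignment of sets of a model that contains all
sets named in the proof. -/
theorem IsProof.sound {r : N} (hp : IsProof true I E D G W r) (h : TC M (sents M) S)
    (hm : ∀ i, dom W i → ∃ j, matchI W M i j) (hi : dom M i0) (ν : N) :
    ¬ ∀ x, pp r x ∈ D → rn (asg W M i0) ν x ∉ S := by
  intro hr
  obtain ⟨⟨hrI, htree, -⟩, hwf, hall⟩ := hp
  obtain ⟨i, hiI, ⟨ν, hfal⟩, hmin⟩ := hwf {i | ∃ ν, ∀ x, pp i x ∈ D → rn (asg W M i0) ν x ∉ S}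
    (setOf_mem inferInstance) ⟨r, hrI, ν, hr⟩
  obtain ⟨hfm, hrule⟩ := hall i hiI
  have hmin' : ∀ n j, Prem E i n j → ∀ ν, ∃ x, pp j x ∈ D ∧ rn (asg W M i0) ν x ∈ S := by
    intro n j hj ν
    by_contra hc
    push Not at hc
    exact hmin n j hj ⟨ν, hc⟩
  have hsent : ∀ {x}, pp i x ∈ D → Sent M (rn (asg W M i0) ν x) := fun hx =>
    sent_asg hm hi (hfm _ hx)
  have prem : ∀ n f, (∀ x, pp i x ∈ G → pp i x ∈ D) → PremIs E D G i n f →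
      rn (asg W M i0) ν f ∈ S := by
    rintro n f hGD ⟨j, hj, hjD⟩
    obtain ⟨x, hx, hxS⟩ := hmin' n j hj ν
    rcases (hjD x).1 hx with hx | rfl
    · exact absurd hxS (hfal _ (hGD _ hx))
    · exact hxS
  have concl : ∀ {f}, ConclIs D G i f → (∀ x, pp i x ∈ G → pp i x ∈ D) ∧ pp i f ∈ D := fun hc =>
    ⟨fun x hx => (hc x).2 (Or.inl hx), (hc _).2 (Or.inr rfl)⟩
  have cun : ∀ {j f}, TagU j → ConclIs D G i (pp j f) → (∀ x, pp i x ∈ G → pp i x ∈ D) ∧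
      pp i (pp j f) ∈ D ∧ Shape f ∧ Sent M (pp j (rn (asg W M i0) ν f)) ∧
      pp j (rn (asg W M i0) ν f) ∉ S := by
    intro j f hj hc
    obtain ⟨c1, c2⟩ := concl hc
    have hf : Shape f := (shape_un hj).1 (hfm _ c2).shape
    rw [← rn_un hj hf]
    exact ⟨c1, c2, hf, hsent c2, hfal _ c2⟩
  rcases hrule with ⟨hax, -⟩ | hrule | ⟨f, f', ⟨hf, rfl⟩, hc, -, p0, p1⟩
  · exact not_refuted_axiom h hm hi hfm hax hfal
  · rcases hrule with ⟨f, g, hc, -, p0, p1⟩ | ⟨f, g, hc, -, j, hj, hjD⟩ | ⟨f, hc, hp⟩ |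
      ⟨f, t, f', hc, -, ht, ⟨-, rfl⟩, p0⟩ | ⟨f, u, f', hc, -, hu, ⟨-, rfl⟩, p0⟩ |
      ⟨f, c, f', hc, -, hdc, ⟨-, rfl⟩, p0⟩ | ⟨f, u, f', hc, -, ⟨-, rfl⟩, p0⟩ | ⟨hc, -, j, hj, hjD⟩
    · obtain ⟨c1, c2⟩ := concl hc
      have hs := hsent c2
      refine hfal _ c2 ?_
      rw [rn_bin (by simp [TagB])] at hs ⊢
      rw [(h.bin _ _ _ (by simp [TagB]) hs).2, if_pos rfl]
      exact ⟨prem _ _ c1 p0, prem _ _ c1 p1⟩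
    · obtain ⟨c1, c2⟩ := concl hc
      have hs := hsent c2
      refine hfal _ c2 ?_
      rw [rn_bin (by simp [TagB])] at hs ⊢
      rw [(h.bin _ _ _ (by simp [TagB]) hs).2, if_neg (by norm_num)]
      obtain ⟨x, hx, hxS⟩ := hmin' _ j hj ν
      rcases (hjD x).1 hx with hx | rfl | rfl
      · exact absurd hxS (hfal _ (c1 _ hx))
      · exact Or.inl hxS
      · exact Or.inr hxS
    · obtain ⟨c1, c2, hf, hs, hn⟩ := cun (by simp [TagU]) hc
      rw [(h.num _ _ (by simp) hs).2, if_pos rfl] at hn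
      refine hn fun n => ?_
      obtain ⟨f', ⟨-, rfl⟩, hpn⟩ := hp n
      rw [← rn_inst hf]
      exact prem _ _ c1 hpn
    · obtain ⟨c1, c2, hf, hs, hn⟩ := cun (by simp [TagU]) hc
      rw [(h.num _ _ (by simp) hs).2, if_neg (by norm_num)] at hn
      refine hn ⟨teval 0 t, ?_⟩
      rw [← h.inst_num (by simp) ht hs, ← rn_inst hf]
      exact prem _ _ c1 p0
    · obtain ⟨c1, c2, hf, hs, hn⟩ := cun (by simp [TagU]) hc
      rw [(h.set _ _ (by simp) hs).2, if_pos rfl] at hn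
      refine hn fun k hk => ?_
      obtain ⟨j, hj, hjD⟩ := p0
      obtain ⟨x, hx, hxS⟩ := hmin' _ j hj (upd ν u k)
      rcases (hjD x).1 hx with hx | rfl
      · rw [rn_asg_upd (hfm _ (c1 _ hx)) (hu _ (c1 _ hx))] at hxS
        exact absurd hxS (hfal _ (c1 _ hx))
      · rw [rn_inst2 hf, asg_upd_self hk] at hxS
        have e : rn (asg W M i0) (upd ν u k) f = rn (asg W M i0) ν f := by
          have := rn_asg_upd (M := M) (i0 := i0) (ν := ν) (k := k) (hfm _ c2) (hu _ c2)
          rw [rn_un (by simp [TagU]) hf, rn_un (by simp [TagU]) hf] at this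
          exact (pp_inj.1 this).2
        rwa [e] at hxS
    · obtain ⟨c1, c2, hf, hs, hn⟩ := cun (by simp [TagU]) hc
      rw [(h.set _ _ (by simp) hs).2, if_neg (by norm_num)] at hn
      obtain ⟨m, e, hm'⟩ := asg_const (i0 := i0) (ν := ν) hm hdc
      refine hn ⟨m, hm'.1, ?_⟩
      rw [← e, ← rn_inst2 hf]
      exact prem _ _ c1 p0
    · obtain ⟨c1, c2, hf, hs, hn⟩ := cun (by simp [TagU]) hc
      rw [(h.set _ _ (by simp) hs).2, if_neg (by norm_num)] at hn
      obtain ⟨m, e, hm'⟩ := asg_free (W := W) (ν := ν) hi u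
      refine hn ⟨m, hm', ?_⟩
      rw [← e, ← rn_inst2 hf]
      exact prem _ _ c1 p0
    · obtain ⟨x, hx, hxS⟩ := hmin' _ j hj ν
      exact hfal x ((hc x).2 ((hjD x).1 hx)) hxS
  · have c1 : ∀ x, pp i x ∈ G → pp i x ∈ D := fun x hx => (hc x).2 hx
    have h0 := prem _ _ c1 p0
    have h1 := prem _ _ c1 p1
    obtain ⟨j, hj, hjD⟩ := p0
    have hfj : IsFm W f := (hall j (htree i 0 j hj).2.1).1 f ((hjD f).2 (Or.inr rfl))
    have hs : Sent M (rn (asg W M i0) ν f) := sent_asg hm hi hfj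
    rw [rn_neg hf] at h1
    have hn : Sent M (neg (rn (asg W M i0) ν f)) := fmK_neg hs
    exact (h.neg_mem hs hn).1 h1 h0

end

section
variable {M S W Y Z F I E D G : Set N} [hM : Fact (M ∈ 𝒮 N)]
  [hS : Fact (S ∈ 𝒮 N)] [hW : Fact (W ∈ 𝒮 N)] [hY : Fact (Y ∈ 𝒮 N)] [hZ : Fact (Z ∈ 𝒮 N)]
  [hF : Fact (F ∈ 𝒮 N)]
  {i0 ν : N}

theorem rn_asg_sent (hm : ∀ i, dom W i → ∃ j, matchI W M i j) {f : N} (hf : Sent W f) :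
    rn (asg W M i0) ν f = sm W M f := by
  refine fmap_congr (fun _ _ _ => rfl) (fun b s hs => ?_) hf
  rcases hs with ⟨i, -, rfl⟩ | hs | ⟨i, rfl, hi⟩
  · rw [(ren_asg.bound _ _ _ _).2 rfl, canS_eq_bound.2 rfl]
  · exact absurd hs.1 id
  · rw [asg, canS, sndN_pp, if_pos rfl, if_pos rfl, if_pos (hm i hi)]

/-- Some sentence in the end sequent of a proof is true in every model that contains all sets
named in the proof. -/
theorem ProvesNeg.exists_mem [Fact (I ∈ 𝒮 N)] [Fact (E ∈ 𝒮 N)] [Fact (D ∈ 𝒮 N)]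
    [Fact (G ∈ 𝒮 N)] {r : N} (hp : IsProof true I E D G W r)
    (h : TC M (sents M) S) (hm : ∀ i, dom W i → ∃ j, matchI W M i j) (hi : dom M i0)
    (hs : ∀ x, pp r x ∈ D → Sent W x) :
    ∃ x, pp r x ∈ D ∧ ∃ x', Same x W x' M ∧ Sent M x' ∧ x' ∈ S := by
  have := hp.sound h hm hi 0
  push Not at this
  obtain ⟨x, hx, hxS⟩ := this
  rw [rn_asg_sent hm (hs x hx)] at hxS
  have h1 := Same.exists (hs x hx) hm
  exact ⟨x, hx, _, h1, h1.sent (hs x hx), hxS⟩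

theorem IsNegAx.sent (hT : IsTheory F Y) {f x : N} (h : IsNegAx F Y f x W) : Sent W x := by
  obtain ⟨hf, f', ⟨-, rfl⟩, h⟩ := h
  exact h.sent (fmK_neg (hT f hf))

theorem IsNegAx.not_mem (hT : IsTheory F Y) {f x x' f' : N} (h : IsNegAx F Y f x W)
    (hS : TC M (sents M) S) (hx : Same x W x' M) (hf : Same f Y f' M) (hfS : f' ∈ S) :
    x' ∉ S := by
  obtain ⟨hfF, _, ⟨-, rfl⟩, h⟩ := h
  have h1 := hf.sent (hT f hfF)
  have h2 : Sent M (neg f') := fmK_neg h1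
  rw [hS.same hf.neg (h.trans hx) h2, hS.neg_mem h1 h2, not_not]
  exact hfS

theorem EverySetInModel.not_provesNeg (hT : IsTheory F Y) (hF : Strong F Y)
    (h : EverySetInModel F Y) : ¬ ProvesNeg true F Y := by
  rintro ⟨I, hI, E, hE, D, hD, G, hG, W, hW, r, hp, h1, -⟩
  have : Fact (I ∈ 𝒮 N) := ⟨hI⟩
  have : Fact (E ∈ 𝒮 N) := ⟨hE⟩
  have : Fact (D ∈ 𝒮 N) := ⟨hD⟩
  have : Fact (G ∈ 𝒮 N) := ⟨hG⟩
  have : Fact (W ∈ 𝒮 N) := ⟨hW⟩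
  obtain ⟨M, hM, ⟨⟨i, hi⟩, -⟩, h2, -, S, hS, h3, h4⟩ := h.two (W := W) (Z := W) hF
  have : Fact (M ∈ 𝒮 N) := ⟨hM⟩
  have : Fact (S ∈ 𝒮 N) := ⟨hS⟩
  obtain ⟨x, hx, x', hx1, hx2, hx3⟩ := ProvesNeg.exists_mem hp h3 h2 hi fun x hx => by
    obtain ⟨f, hf⟩ := h1 x hx
    exact hf.sent hT
  obtain ⟨f, hf⟩ := h1 x hx
  obtain ⟨f', h5, -, h6⟩ := h4 f hf.1
  exact hf.not_mem hT h3 hx1 h5 h6 hx3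

theorem EverySetInModel.provSound (hT : IsTheory F Y) (hF : Strong F Y)
    (h : EverySetInModel F Y) : ProvSound 2 true F Y := by
  rintro g Z hZ ⟨hg, -, I, hI, E, hE, D, hD, G, hG, W, hW, r, hp, h1, -⟩
  have : Fact (Z ∈ 𝒮 N) := ⟨hZ⟩
  have : Fact (I ∈ 𝒮 N) := ⟨hI⟩
  have : Fact (E ∈ 𝒮 N) := ⟨hE⟩
  have : Fact (D ∈ 𝒮 N) := ⟨hD⟩
  have : Fact (G ∈ 𝒮 N) := ⟨hG⟩
  have : Fact (W ∈ 𝒮 N) := ⟨hW⟩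
  by_contra hn
  obtain ⟨U, hU, h5⟩ := exists_of_not_trPi hg hn
  have : Fact (U ∈ 𝒮 N) := ⟨hU⟩
  obtain ⟨M, hM, ⟨⟨i, hi⟩, -⟩, h2, h2', S, hS, h3, h4⟩ := h.two (W := W) (Z := U) hF
  have : Fact (M ∈ 𝒮 N) := ⟨hM⟩
  have : Fact (S ∈ 𝒮 N) := ⟨hS⟩
  obtain ⟨g', h6, h7, h8⟩ := h5 M hM h2' S hS h3
  obtain ⟨x, hx, x', hx1, hx2, hx3⟩ := ProvesNeg.exists_mem hp h3 h2 hi fun x hx => by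
    rcases h1 x hx with ⟨f, hf⟩ | hx
    · exact hf.sent hT
    · exact hx.sent hg
  rcases h1 x hx with ⟨f, hf⟩ | hx
  · obtain ⟨f', h5, -, h6⟩ := h4 f hf.1
    exact hf.not_mem hT h3 hx1 h5 h6 hx3
  · exact h8 ((h3.same (hx.trans hx1) h6 hx2).2 hx3)

omit hW in
theorem IsProof.with_cut {r : N} (hp : IsProof false I E D G W r) : IsProof true I E D G W r :=
  ⟨hp.1, hp.2.1, fun i hi => ⟨(hp.2.2 i hi).1, (hp.2.2 i hi).2.imp id Or.inl⟩⟩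

omit hY hF in
theorem not_provesNeg_false (h : ¬ ProvesNeg true F Y) : ¬ ProvesNeg false F Y := by
  rintro ⟨I, hI, E, hE, D, hD, G, hG, W, hW, r, hp, h1⟩
  exact h ⟨I, hI, E, hE, D, hD, G, hG, W, hW, r, hp.with_cut, h1⟩

omit hY hF in
theorem ProvSound.without_cut {n : ℕ} (h : ProvSound n true F Y) : ProvSound n false F Y := by
  rintro g Z hZ ⟨hg, hc, I, hI, E, hE, D, hD, G, hG, W, hW, r, hp, h1⟩
  exact h g Z hZ ⟨hg, hc, I, hI, E, hE, D, hD, G, hG, W, hW, r, hp.with_cut, h1⟩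

/-! ### Weakening by a false literal -/

/-- The code of `0 ≠ 0`. -/
noncomputable def absurdity : N := pp 1 (pp (pp 0 0) (pp 0 0))

theorem sent_absurdity : Sent Y (absurdity : N) := by
  refine (fmK_lit (by simp [TagL])).2 ⟨isTm_zero _, fun _ => isTm_zero _, fun h => ?_⟩
  exact absurd (by simp [TagE]) h

theorem same_absurdity {x : N} : Same (absurdity : N) Y x W ↔ x = absurdity := by
  rw [absurdity, same_lit (by simp [TagL])]
  constructor
  · rintro ⟨t, rfl, h, -⟩
    rw [h (by simp [TagE])]
  · rintro rfl
    exact ⟨_, rfl, fun _ => rfl, fun h => absurd (by simp [TagE]) h⟩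

theorem not_trPi_absurdity : ¬ TrPi 2 (absurdity : N) Y := by
  rintro ⟨_, ⟨-, rfl⟩, h⟩
  refine h ⟨Y, hY.out, _, _, Same.refl (fmK_neg sent_absurdity), InstEx.refl _ _, ?_, ?_⟩
  · rw [absurdity, neg_lit (by simp [TagL])]
    exact cls_lit _ _ (by simp [dl, TagL])
  refine ⟨_, ⟨(fmK_neg (sent_absurdity (Y := Y))).shape, rfl⟩, ?_⟩
  rintro ⟨W, hW, x, g, h1, h2, -, D, hD, S, hS, h3⟩
  have : Fact (W ∈ 𝒮 N) := ⟨hW⟩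
  rw [neg_neg' (sent_absurdity (Y := Y)).shape, same_absurdity] at h1
  subst h1
  have hg : g ∈ ({absurdity} : Set N) := by
    refine h2 _ (setOf_mem (P := fun x => x = absurdity) inferInstance) ⟨rfl, ?_⟩
    rintro _ b _ ⟨rfl, ⟨e, -⟩ | ⟨e, -⟩⟩
    · simp [absurdity, pp_inj] at e
    · simp [absurdity, pp_inj] at e
  obtain rfl : g = absurdity := hg
  obtain ⟨D, hD, S, hS, h4, h5, h6⟩ := (trArith_iff sent_absurdity).1 ⟨D, hD, S, hS, h3⟩
  have := (h4.lit _ _ _ (by simp [TagL]) h5).1 h6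
  exact this.2.1 rfl rfl

omit hW in
theorem IsProof.weaken {r a : N} (ha : IsFm W a)
    (hu : ∀ u, ¬ Occ u a) (hp : IsProof false I E D G W r) :
    IsProof false I E {z | z ∈ D ∨ ∃ i, i ∈ I ∧ z = pp i a} {z | z ∈ G ∨ ∃ i, i ∈ I ∧ z = pp i a}
      W r := by
  obtain ⟨h1, h2, h3⟩ := hp
  have key : ∀ {A : Set N} {i h : N}, i ∈ I → (pp i h ∈ {z | z ∈ A ∨ ∃ i, i ∈ I ∧ z = pp i a} ↔
      pp i h ∈ A ∨ h = a) := by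
    intro A i h hi
    refine or_congr Iff.rfl ⟨?_, fun e => ⟨i, hi, by rw [e]⟩⟩
    rintro ⟨j, -, e⟩
    exact (pp_inj.1 e).2
  have hj : ∀ {i n j}, Prem E i n j → j ∈ I := fun h => (h1.2.1 _ _ _ h).2.1
  refine ⟨h1, h2, fun i hi => ?_⟩
  obtain ⟨h4, h5⟩ := h3 i hi
  have kc : ∀ {f}, ConclIs D G i f → ConclIs {z | z ∈ D ∨ ∃ i, i ∈ I ∧ z = pp i a}
      {z | z ∈ G ∨ ∃ i, i ∈ I ∧ z = pp i a} i f := by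
    intro f h x
    rw [key hi, key hi, h x, or_right_comm]
  have kp : ∀ {n f}, PremIs E D G i n f → PremIs E {z | z ∈ D ∨ ∃ i, i ∈ I ∧ z = pp i a}
      {z | z ∈ G ∨ ∃ i, i ∈ I ∧ z = pp i a} i n f := by
    rintro n f ⟨j, hj1, hj2⟩
    refine ⟨j, hj1, fun x => ?_⟩
    rw [key (hj hj1), key hi, hj2 x, or_right_comm]
  refine ⟨fun x hx => ?_, h5.imp ?_ ?_⟩
  · rcases (key hi).1 hx with hx | rfl
    · exact h4 x hx
    · exact ha
  · rintro ⟨⟨t, u, h⟩, h6⟩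
    refine ⟨⟨t, u, ?_⟩, h6⟩
    rcases h with h | h | ⟨k, h⟩ | ⟨k, h⟩ | ⟨k, h⟩
    · exact Or.inl ⟨Or.inl h.1, h.2⟩
    · exact Or.inr (Or.inl ⟨Or.inl h.1, h.2⟩)
    · exact Or.inr (Or.inr (Or.inl ⟨k, Or.inl h.1, h.2⟩))
    · exact Or.inr (Or.inr (Or.inr (Or.inl ⟨k, Or.inl h.1, h.2⟩)))
    · exact Or.inr (Or.inr (Or.inr (Or.inr ⟨k, Or.inl h.1, Or.inl h.2.1, h.2.2⟩)))
  · rintro (⟨f, g, c, p, p0, p1⟩ | ⟨f, g, c, p, j, hj1, hj2⟩ | ⟨f, c, p⟩ |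
      ⟨f, t, f', c, p, ht, e, p0⟩ | ⟨f, u, f', c, p, ho, e, p0⟩ |
      ⟨f, k, f', c, p, hk, e, p0⟩ | ⟨f, u, f', c, p, e, p0⟩ | ⟨c, p, j, hj1, hj2⟩)
    · exact Or.inl ⟨f, g, kc c, p, kp p0, kp p1⟩
    · refine Or.inr (Or.inl ⟨f, g, kc c, p, j, hj1, fun x => ?_⟩)
      rw [key (hj hj1), key hi, hj2 x, or_right_comm]
    · exact Or.inr (Or.inr (Or.inl ⟨f, kc c, fun n => (p n).imp fun f' h => ⟨h.1, kp h.2⟩⟩))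
    · exact Or.inr (Or.inr (Or.inr (Or.inl ⟨f, t, f', kc c, p, ht, e, kp p0⟩)))
    · refine Or.inr (Or.inr (Or.inr (Or.inr (Or.inl ⟨f, u, f', kc c, p, fun x hx => ?_, e, kp p0⟩))))
      rcases (key hi).1 hx with hx | rfl
      · exact ho x hx
      · exact hu u
    · exact Or.inr (Or.inr (Or.inr (Or.inr (Or.inr (Or.inl ⟨f, k, f', kc c, p, hk, e, kp p0⟩)))))
    · exact Or.inr (Or.inr (Or.inr (Or.inr (Or.inr (Or.inr (Or.inl
        ⟨f, u, f', kc c, p, e, kp p0⟩))))))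
    · refine Or.inr (Or.inr (Or.inr (Or.inr (Or.inr (Or.inr (Or.inr ⟨fun x => ?_, p, j, hj1,
        fun x => ?_⟩))))))
      · rw [key hi, key hi, c x]
      · rw [key (hj hj1), key hi, hj2 x]

omit hF in
theorem ProvSound.not_provesNeg (h : ProvSound 2 false F Y) : ¬ ProvesNeg false F Y := by
  rintro ⟨I, hI, E, hE, D, hD, G, hG, W, hW, r, hp, h1, h2⟩
  have : Fact (W ∈ 𝒮 N) := ⟨hW⟩
  have : Fact (I ∈ 𝒮 N) := ⟨hI⟩
  have : Fact (D ∈ 𝒮 N) := ⟨hD⟩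
  have : Fact (G ∈ 𝒮 N) := ⟨hG⟩
  refine not_trPi_absurdity (h absurdity Y hY.out ⟨sent_absurdity, cls_lit _ _ (by simp [TagL]),
    I, hI, E, hE, _, setOf_mem (P := fun z => z ∈ D ∨ ∃ i, i ∈ I ∧ z = pp i absurdity)
      inferInstance, _, setOf_mem (P := fun z => z ∈ G ∨ ∃ i, i ∈ I ∧ z = pp i absurdity)
      inferInstance, W, hW, r, hp.weaken (sent_absurdity (Y := W)).isFm
      (sent_iff.1 (sent_absurdity (Y := W))).2, ?_, ?_, absurdity, same_absurdity.2 rfl,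
      Or.inr ⟨r, hp.1.1, rfl⟩⟩)
  · rintro x (hx | ⟨i, -, e⟩)
    · exact Or.inl (h1 x hx)
    · exact Or.inr (same_absurdity.2 (pp_inj.1 e).2)
  · exact fun f hf => (h2 f hf).imp fun x hx => ⟨hx.1, Or.inl hx.2⟩

end

/-! ### The existence of satisfaction classes -/

/-- `f` is true in `M`, if truth of its constituents is given by `S`. -/
def TrueStep (M S : Set N) (f : N) : Prop :=
  (∃ j t s, TagL j ∧ f = pp j (pp t s) ∧ LitV M j t s) ∨
  (∃ j g h, TagB j ∧ f = pp j (pp g h) ∧ ((j = 4 ∧ g ∈ S ∧ h ∈ S) ∨ (j ≠ 4 ∧ (g ∈ S ∨ h ∈ S)))) ∨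
  (∃ j g, (j = 6 ∨ j = 7) ∧ f = pp j g ∧ ((j = 6 ∧ ∀ n, inst (num n) g ∈ S) ∨
    (j ≠ 6 ∧ ∃ n, inst (num n) g ∈ S))) ∨
  (∃ j g, (j = 8 ∨ j = 9) ∧ f = pp j g ∧ ((j = 8 ∧ ∀ i, dom M i → inst2 (pp 2 i) g ∈ S) ∨
    (j ≠ 8 ∧ ∃ i, dom M i ∧ inst2 (pp 2 i) g ∈ S)))

section
variable {M S : Set N}

theorem trueStep_lit {j t s : N} (hj : TagL j) : TrueStep M S (pp j (pp t s)) ↔ LitV M j t s := by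
  constructor
  · rintro (⟨j', t', s', -, e, h⟩ | ⟨j', g, k, hj', e, -⟩ | ⟨j', g, hj', e, -⟩ | ⟨j', g, hj', e, -⟩)
    · simp only [pp_inj] at e
      obtain ⟨rfl, rfl, rfl⟩ := e
      exact h
    · exact absurd (pp_inj.1 e).1 (hj.ne_tagB hj')
    · exact absurd (pp_inj.1 e).1 (hj.ne_tagU (tagU_num hj'))
    · exact absurd (pp_inj.1 e).1 (hj.ne_tagU (tagU_set hj'))
  · exact fun h => Or.inl ⟨j, t, s, hj, rfl, h⟩

theorem trueStep_bin {j g h : N} (hj : TagB j) : TrueStep M S (pp j (pp g h)) ↔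
    if j = 4 then g ∈ S ∧ h ∈ S else g ∈ S ∨ h ∈ S := by
  constructor
  · rintro (⟨j', t', s', hj', e, -⟩ | ⟨j', g, k, -, e, h⟩ | ⟨j', g, hj', e, -⟩ | ⟨j', g, hj', e, -⟩)
    · exact absurd (pp_inj.1 e).1.symm (hj'.ne_tagB hj)
    · simp only [pp_inj] at e
      obtain ⟨rfl, rfl, rfl⟩ := e
      split_ifs with h4
      · exact (h.resolve_right fun h => h.1 h4).2
      · exact (h.resolve_left fun h => h4 h.1).2
    · exact absurd (pp_inj.1 e).1 (hj.ne_tagU (tagU_num hj'))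
    · exact absurd (pp_inj.1 e).1 (hj.ne_tagU (tagU_set hj'))
  · intro hh
    refine Or.inr (Or.inl ⟨j, g, h, hj, rfl, ?_⟩)
    split_ifs at hh with h4
    · exact Or.inl ⟨h4, hh⟩
    · exact Or.inr ⟨h4, hh⟩

theorem num_ne_set {j j' : N} (hj : j = 6 ∨ j = 7) (hj' : j' = 8 ∨ j' = 9) : j ≠ j' := by
  rcases hj with rfl | rfl <;> rcases hj' with rfl | rfl <;> norm_num

theorem trueStep_num {j g : N} (hj : j = 6 ∨ j = 7) : TrueStep M S (pp j g) ↔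
    if j = 6 then ∀ n, inst (num n) g ∈ S else ∃ n, inst (num n) g ∈ S := by
  constructor
  · rintro (⟨j', t', s', hj', e, -⟩ | ⟨j', g, k, hj', e, -⟩ | ⟨j', g, -, e, h⟩ | ⟨j', g, hj', e, -⟩)
    · exact absurd (pp_inj.1 e).1.symm (hj'.ne_tagU (tagU_num hj))
    · exact absurd (pp_inj.1 e).1.symm (hj'.ne_tagU (tagU_num hj))
    · simp only [pp_inj] at e
      obtain ⟨rfl, rfl⟩ := e
      split_ifs with h4
      · exact (h.resolve_right fun h => h.1 h4).2
      · exact (h.resolve_left fun h => h4 h.1).2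
    · exact absurd (pp_inj.1 e).1 (num_ne_set hj hj')
  · intro hh
    refine Or.inr (Or.inr (Or.inl ⟨j, g, hj, rfl, ?_⟩))
    split_ifs at hh with h4
    · exact Or.inl ⟨h4, hh⟩
    · exact Or.inr ⟨h4, hh⟩

theorem trueStep_set {j g : N} (hj : j = 8 ∨ j = 9) : TrueStep M S (pp j g) ↔
    if j = 8 then ∀ i, dom M i → inst2 (pp 2 i) g ∈ S
      else ∃ i, dom M i ∧ inst2 (pp 2 i) g ∈ S := by
  constructor
  · rintro (⟨j', t', s', hj', e, -⟩ | ⟨j', g, k, hj', e, -⟩ | ⟨j', g, hj', e, -⟩ | ⟨j', g, -, e, h⟩)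
    · exact absurd (pp_inj.1 e).1.symm (hj'.ne_tagU (tagU_set hj))
    · exact absurd (pp_inj.1 e).1.symm (hj'.ne_tagU (tagU_set hj))
    · exact absurd (pp_inj.1 e).1.symm (num_ne_set hj' hj)
    · simp only [pp_inj] at e
      obtain ⟨rfl, rfl⟩ := e
      split_ifs with h4
      · exact (h.resolve_right fun h => h.1 h4).2
      · exact (h.resolve_left fun h => h4 h.1).2
  · intro hh
    refine Or.inr (Or.inr (Or.inr ⟨j, g, hj, rfl, ?_⟩))
    split_ifs at hh with h4
    · exact Or.inl ⟨h4, hh⟩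
    · exact Or.inr ⟨h4, hh⟩

end

section
variable {M S U : Set N} [hM : Fact (M ∈ 𝒮 N)]

/-- The sentences over `M` with less than `n` logical symbols. -/
def lv (M : Set N) (n : N) : Set N := {f | Sent M f ∧ dp f < n}

instance fact_lv {n : N} : Fact (lv M n ∈ 𝒮 N) :=
  ⟨setOf_mem (P := fun f => Sent M f ∧ dp f < n) inferInstance⟩

theorem lv_bin {n j g h : N} (hj : TagB j) (hf : pp j (pp g h) ∈ lv M (n + 1)) :
    g ∈ lv M n ∧ h ∈ lv M n := by
  obtain ⟨h1, h2⟩ := hf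
  rw [dp_bin hj, ACAM.lt_add_one_iff] at h2
  have h3 := (fmK_bin hj).1 h1
  refine ⟨⟨h3.1, lt_of_lt_of_le (ACAM.lt_add_one_iff.2 le_self_add) h2⟩, h3.2, ?_⟩
  rw [add_comm (dp g)] at h2
  exact lt_of_lt_of_le (ACAM.lt_add_one_iff.2 le_self_add) h2

theorem lv_num {n j g c : N} (hj : j = 6 ∨ j = 7) (hf : pp j g ∈ lv M (n + 1)) :
    inst (num c) g ∈ lv M n := by
  obtain ⟨h1, h2⟩ := hf
  rw [dp_un (tagU_num hj), ACAM.lt_add_one_iff] at h2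
  refine ⟨fmK_inst_body hj (isTm_num 0 c) h1, ?_⟩
  rw [dp_inst ((shape_un (tagU_num hj)).1 h1.shape)]
  exact lt_of_lt_of_le (ACAM.lt_add_one_iff.2 le_rfl) h2

theorem lv_set {n j g i : N} (hj : j = 8 ∨ j = 9) (hi : dom M i) (hf : pp j g ∈ lv M (n + 1)) :
    inst2 (pp 2 i) g ∈ lv M n := by
  obtain ⟨h1, h2⟩ := hf
  rw [dp_un (tagU_set hj), ACAM.lt_add_one_iff] at h2
  refine ⟨fmK_inst2_body hj (symT_const hi) h1, ?_⟩
  rw [dp_inst2 ((shape_un (tagU_set hj)).1 h1.shape)]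
  exact lt_of_lt_of_le (ACAM.lt_add_one_iff.2 le_rfl) h2

omit hM in
theorem lv_mono {m n : N} (h : m ≤ n) : lv M m ⊆ lv M n := fun _ hf => ⟨hf.1, hf.2.trans_le h⟩

omit hM in
theorem lv_succ (n : N) : lv M n ⊆ lv M (n + 1) := lv_mono (ACAM.lt_add_one_iff.2 le_rfl).le

omit hM in
theorem TC.trueStep {D : Set N} (h : TC M D S) {f : N} (hf : f ∈ D) (hs : Shape f) :
    f ∈ S ↔ TrueStep M S f := by
  rcases hs.cases with ⟨j, t, s, hj, rfl⟩ | ⟨j, g, k, hj, rfl, hg, hk⟩ | ⟨j, g, hj, rfl, hg⟩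
  · rw [h.lit _ _ _ hj hf, trueStep_lit hj]
  · rw [(h.bin _ _ _ hj hf).2, trueStep_bin hj]
  · rcases tagU_cases hj with hq | hq
    · rw [(h.num _ _ hq hf).2, trueStep_num hq]
    · rw [(h.set _ _ hq hf).2, trueStep_set hq]

/-- Truth of sentences with at most `n` logical symbols is determined by truth of those with less
than `n` symbols. -/
theorem tc_lv_succ {n : N} (h : ∀ f ∈ lv M n, (f ∈ S ↔ f ∈ U))
    (hU : ∀ f ∈ lv M (n + 1), (f ∈ U ↔ TrueStep M S f)) : TC M (lv M (n + 1)) U where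
  sent _ hf := hf.1
  lit j t s hj hf := by rw [hU _ hf, trueStep_lit hj]
  bin j g k hj hf := by
    obtain ⟨h1, h2⟩ := lv_bin hj hf
    refine ⟨⟨lv_succ n h1, lv_succ n h2⟩, ?_⟩
    rw [hU _ hf, trueStep_bin hj, h _ h1, h _ h2]
  num j g hj hf := by
    refine ⟨fun c => lv_succ n (lv_num hj hf), ?_⟩
    rw [hU _ hf, trueStep_num hj]
    simp only [h _ (lv_num hj hf)]
  set j g hj hf := by
    refine ⟨fun i hi => lv_succ n (lv_set hj hi hf), ?_⟩
    rw [hU _ hf, trueStep_set hj]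
    split_ifs
    · exact forall_congr' fun i => forall_congr' fun hi => h _ (lv_set hj hi hf)
    · exact exists_congr fun i => and_congr_right fun hi => h _ (lv_set hj hi hf)

theorem tc_lv_iff {n : N} : TC M (lv M n) S ↔ ∀ f ∈ lv M n, (f ∈ S ↔ TrueStep M S f) := by
  refine ⟨fun h f hf => h.trueStep hf hf.1.shape, fun h => ?_⟩
  rcases eq_zero_or_succ n with rfl | ⟨m, rfl⟩
  · have : ∀ f, f ∉ lv M 0 := fun f hf => not_lt_zero' _ hf.2
    exact ⟨fun f hf => absurd hf (this _), fun _ _ _ _ hf => absurd hf (this _),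
      fun _ _ _ _ hf => absurd hf (this _), fun _ _ _ hf => absurd hf (this _),
      fun _ _ _ hf => absurd hf (this _)⟩
  · exact tc_lv_succ (fun _ _ => Iff.rfl) h

theorem TC.lv_le {m n : N} (h : TC M (lv M n) S) (hmn : m ≤ n) : TC M (lv M m) S :=
  tc_lv_iff.2 fun f hf => tc_lv_iff.1 h f (lv_mono hmn hf)

theorem tc_sents (h : ∀ n, TC M (lv M n) S) : TC M (sents M) S := by
  have key : ∀ f, Sent M f → f ∈ lv M (dp f + 1) := fun f hf =>
    ⟨hf, ACAM.lt_add_one_iff.2 le_rfl⟩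
  refine ⟨fun f hf => hf, fun j t s hj hf => (h _).lit j t s hj (key _ hf),
    fun j g k hj hf => ?_, fun j g hj hf => ?_, fun j g hj hf => ?_⟩
  · obtain ⟨⟨h1, h2⟩, h3⟩ := (h _).bin j g k hj (key _ hf)
    exact ⟨⟨h1.1, h2.1⟩, h3⟩
  · obtain ⟨h1, h3⟩ := (h _).num j g hj (key _ hf)
    exact ⟨fun n => (h1 n).1, h3⟩
  · obtain ⟨h1, h3⟩ := (h _).set j g hj (key _ hf)
    exact ⟨fun n hn => (h1 n hn).1, h3⟩

instance def_trueStep {F : Set (Set N)} [Closed F] {α : Type} [Ctx N α] {M S : Set N}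
    [Fact (M ∈ F)] [Fact (S ∈ F)] {f : α → N} [DefM F f] :
    Def F (fun a => TrueStep M S (f a)) :=
  Def.lift (P := TrueStep M S) (by unfold TrueStep; infer_instance) f

theorem def_tc_lv {V : Set N} [hV : Fact (V ∈ 𝒮 N)] {α : Type} [Ctx N α]
    {f g : α → N} [DefM 𝒮 N f] [DefM 𝒮 N g] :
    Def 𝒮 N (fun a => TC M (lv M (f a)) {x | sec V (g a) x}) := by
  refine Def.lift2 (P := fun n i => TC M (lv M n) {x | sec V i x}) ?_ f g
  simp only [tc_lv_iff]
  unfold TrueStep lv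
  simp only [Set.mem_ofPred_eq]
  infer_instance

/-- A family that belongs to a coded family closed under arithmetical comprehension has a
satisfaction class. -/
theorem exists_tc_sents {V : Set N} [hV : Fact (V ∈ 𝒮 N)]
    (hc : Closed (fam V)) (hMV : M ∈ fam V) :
    ∃ S ∈ 𝒮 N, TC M (sents M) S := by
  have hMV' : Fact (M ∈ fam V) := ⟨hMV⟩
  have hd : ∀ {α : Type} [Ctx N α] {f g : α → N} [DefM 𝒮 N f] [DefM 𝒮 N g],
      Def 𝒮 N (fun a => TC M (lv M (f a)) {x | sec V (g a) x}) := def_tc_lv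
  have hs : ∀ i, Fact ({x | sec V i x} ∈ 𝒮 N) := fun i =>
    ⟨setOf_mem inferInstance⟩
  have step : ∀ n : N, ∃ i, dom V i ∧ TC M (lv M n) {x | sec V i x} := by
    refine ind 𝒮 N ?_ fun n => ?_
    · obtain ⟨i, hi, -⟩ := hMV
      exact ⟨i, hi, tc_lv_iff.2 fun f hf => absurd hf.2 (not_lt_zero' _)⟩
    · rintro ⟨i, hi, h⟩
      have : Fact ({x | sec V i x} ∈ fam V) := ⟨i, hi, rfl⟩
      obtain ⟨j, hj, e⟩ : {x | TrueStep M {x | sec V i x} x} ∈ fam V := setOf_mem inferInstance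
      refine ⟨j, hj, e ▸ tc_lv_succ (S := {x | sec V i x}) (fun f hf => ?_) fun f _ => Iff.rfl⟩
      exact h.trueStep hf hf.1.shape
  refine ⟨{f | ∃ i, dom V i ∧ TC M (lv M (dp f + 1)) {x | sec V i x} ∧ sec V i f},
    setOf_mem inferInstance, tc_sents fun n => ?_⟩
  obtain ⟨i, hi, h⟩ := step n
  have e : ∀ f ∈ lv M n, (f ∈ {f | ∃ i, dom V i ∧ TC M (lv M (dp f + 1)) {x | sec V i x} ∧
      sec V i f} ↔ f ∈ {x | sec V i x}) := by
    intro f hf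
    have hf' : f ∈ lv M (dp f + 1) := ⟨hf.1, ACAM.lt_add_one_iff.2 le_rfl⟩
    constructor
    · rintro ⟨k, hk, h1, h2⟩
      exact (h1.agree h hf' hf).2 h2
    · refine fun h1 => ⟨i, hi, h.lv_le ?_, h1⟩
      have := hf.2
      rw [ACAM.lt_iff] at this
      obtain ⟨z, hz⟩ := this
      exact ⟨z, hz.symm ▸ rfl⟩
  rw [tc_lv_iff]
  intro f hf
  rw [e f hf, h.trueStep hf hf.1.shape]
  rcases hf.1.shape.cases with ⟨j, t, s, hj, rfl⟩ | ⟨j, g, k, hj, rfl, -, -⟩ | ⟨j, g, hj, rfl, -⟩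
  · rw [trueStep_lit hj, trueStep_lit hj]
  · obtain ⟨h1, h2⟩ := (h.bin _ _ _ hj hf).1
    rw [trueStep_bin hj, trueStep_bin hj, e _ h1, e _ h2]
  · rcases tagU_cases hj with hq | hq
    · rw [trueStep_num hq, trueStep_num hq]
      simp only [e _ ((h.num _ _ hq hf).1 _)]
    · rw [trueStep_set hq, trueStep_set hq]
      have := (h.set _ _ hq hf).1
      split_ifs
      · exact forall_congr' fun i => forall_congr' fun hi => (e _ (this i hi)).symm
      · exact exists_congr fun i => and_congr_right fun hi => (e _ (this i hi)).symm

end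

/-! ### Proof search

A state `⟨n, ν⟩` of the search consists of its stage `n = ⟨⟨f, a⟩, x⟩`, at which the formula `f` is
treated with the parameter `a`, and of a list `ν` of the formulas obtained so far. -/

/-- The formula treated in the state `s`. -/
noncomputable def stF (s : N) : N := fstN (fstN (fstN s))
/-- The parameter used in the state `s`. -/
noncomputable def stA (s : N) : N := sndN (fstN (fstN s))

/-- `h` belongs to the sequent with the end sequent `R` and the state `s`. -/
def InSt (R : Set N) (h s : N) : Prop := h ∈ R ∨ lk (sndN s) h = 1

/-- The (first) formula added to the `n`-th premise. -/
noncomputable def actA (W : Set N) (f a u n : N) : N :=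
  if f = pp 4 (pp (fstN (sndN f)) (sndN (sndN f))) then
    if n = 0 then fstN (sndN f) else sndN (sndN f)
  else if f = pp 5 (pp (fstN (sndN f)) (sndN (sndN f))) then fstN (sndN f)
  else if f = pp 6 (sndN f) then inst (num n) (sndN f)
  else if f = pp 7 (sndN f) then inst (num a) (sndN f)
  else if f = pp 8 (sndN f) then inst2 (pp 1 u) (sndN f)
  else if f = pp 9 (sndN f) ∧ (a = pp 1 (sndN a) ∨ a = pp 2 (sndN a) ∧ dom W (sndN a)) then
    inst2 a (sndN f)
  else f

/-- The second formula added to the `n`-th premise. -/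
noncomputable def actB (W : Set N) (f a u n : N) : N :=
  if f = pp 5 (pp (fstN (sndN f)) (sndN (sndN f))) then sndN (sndN f) else actA W f a u n

/-- The state of the `n`-th premise. -/
noncomputable def nextSt (W R : Set N) (s n : N) : N :=
  if InSt R (stF s) s then
    pp (fstN s + 1) (upd (upd (sndN s) (actA W (stF s) (stA s) (sndN s) n) 1)
      (actB W (stF s) (stA s) (sndN s) n) 1)
  else pp (fstN s + 1) (sndN s)

/-- There is an `n`-th premise, unless the sequent is an axiom. -/
def ValSt (R : Set N) (s n : N) : Prop :=
  n = 0 ∨ InSt R (stF s) s ∧ (stF s = pp 4 (pp (fstN (sndN (stF s))) (sndN (sndN (stF s)))) ∧ n = 1 ∨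
    stF s = pp 6 (sndN (stF s)))

def AxSt (W R : Set N) (s : N) : Prop := ∃ t u,
  (InSt R (pp 0 (pp t u)) s ∧ SameVal t u) ∨
  (InSt R (pp 1 (pp t u)) s ∧ ¬ SameVal t u) ∨
  (∃ k, InSt R (pp 2 (pp t (pp 2 k))) s ∧ ∃ n, (IsTm 0 t ∧ teval 0 t = n) ∧ sec W k n) ∨
  (∃ k, InSt R (pp 3 (pp t (pp 2 k))) s ∧ ∃ n, (IsTm 0 t ∧ teval 0 t = n) ∧ ¬ sec W k n) ∨
  (∃ k, InSt R (pp 2 (pp t (pp 1 k))) s ∧ InSt R (pp 3 (pp u (pp 1 k))) s ∧ SameVal t u)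

/-- The `n`-th premise of the node with the value `v` exists. -/
def Chi (W R : Set N) (v n : N) : Prop := v ≠ 0 ∧ ¬ AxSt W R (predN v) ∧ ValSt R (predN v) n

noncomputable def treeStep (W R : Set N) (_ j : N) (v : N → N) : N :=
  if j = 0 then 1
  else if j = pp 1 (pp (fstN (sndN j)) (sndN (sndN j))) ∧ Chi W R (v (fstN (sndN j))) (sndN (sndN j))
  then nextSt W R (predN (v (fstN (sndN j)))) (sndN (sndN j)) + 1
  else 0

/-- `s + 1`, if `j` is a node with the state `s`, and `0`, if `j` is not a node. -/
noncomputable def tree (W R : Set N) (j : N) : N := recN (treeStep W R) (0 : N) j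

section
variable {F : Set (Set N)} [hF : Closed F] {α : Type} [Ctx N α] {W R : Set N} [hW : Fact (W ∈ F)]
  [hR : Fact (R ∈ F)] {f g h k l : α → N} [DefM F f] [DefM F g] [DefM F h] [DefM F k] [DefM F l]

instance defM_stF : DefM F (fun a => stF (f a)) := by unfold stF; infer_instance
instance defM_stA : DefM F (fun a => stA (f a)) := by unfold stA; infer_instance
instance def_inSt : Def F (fun a => InSt R (f a) (g a)) := by unfold InSt; infer_instance
instance defM_actA : DefM F (fun a => actA W (f a) (g a) (h a) (k a)) := by
  unfold actA; infer_instance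
instance defM_actB : DefM F (fun a => actB W (f a) (g a) (h a) (k a)) := by
  unfold actB; infer_instance
instance defM_nextSt : DefM F (fun a => nextSt W R (f a) (g a)) := by
  unfold nextSt; infer_instance
instance def_valSt : Def F (fun a => ValSt R (f a) (g a)) := by unfold ValSt; infer_instance
instance def_sameVal : Def F (fun a => SameVal (f a) (g a)) := by unfold SameVal; infer_instance
instance def_axSt : Def F (fun a => AxSt W R (f a)) :=
  Def.lift (P := AxSt W R) (by unfold AxSt; infer_instance) f
instance def_chi : Def F (fun a => Chi W R (f a) (g a)) := by unfold Chi; infer_instance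

omit hF hW hR in
theorem treeStep_local : Local (treeStep W R) := by
  intro p j v w h
  unfold treeStep
  split_ifs with h0 h1 h2 h2
  · rfl
  all_goals
    have e : ∀ i n : N, j = pp 1 (pp i n) → v i = w i := fun i n e => h _ (by
      rw [e]; exact (le_pp_left _ _).trans_lt (lt_pp_right (by norm_num) _))
  · rw [e _ _ h1.1]
  · rw [e _ _ h1.1] at h1; exact absurd h1 h2
  · rw [← e _ _ h2.1] at h2; exact absurd h2 h1
  · rfl

theorem treeStep_def : DefM F (fun q : (N × N) × N => treeStep W R q.1.1 q.1.2 (ap q.2)) := by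
  unfold treeStep; infer_instance

instance defM_tree : DefM F (fun a => tree W R (f a)) :=
  DefM.lift2 (P := recN (treeStep W R)) (defM_recN treeStep_local treeStep_def) (fun _ => (0 : N)) f

end

section
variable {W R : Set N} [hW : Fact (W ∈ 𝒮 N)] [hR : Fact (R ∈ 𝒮 N)]

theorem tree_eq (j : N) : tree W R j = treeStep W R 0 j (tree W R) :=
  recN_eq 𝒮 N treeStep_local treeStep_def 0 j

theorem tree_zero : tree W R (0 : N) = 1 := by rw [tree_eq, treeStep, if_pos rfl]

theorem pp_one_ne_zero (x : N) : pp 1 x ≠ 0 := by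
  rw [← pp_zero, Ne, pp_inj]; simp

theorem tree_child (i n : N) : tree W R (pp 1 (pp i n)) =
    if Chi W R (tree W R i) n then nextSt W R (predN (tree W R i)) n + 1 else 0 := by
  rw [tree_eq, treeStep, if_neg (pp_one_ne_zero _)]
  simp

theorem tree_ne_zero {j : N} (hj : j ≠ 0) (h : tree W R j ≠ 0) :
    ∃ i n, j = pp 1 (pp i n) ∧ Chi W R (tree W R i) n := by
  rw [tree_eq, treeStep, if_neg hj] at h
  split_ifs at h with h1
  · exact ⟨_, _, h1.1, h1.2⟩
  · exact absurd rfl h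

omit hW hR in
theorem inSt_nextSt {h s n : N} : InSt R h (nextSt W R s n) ↔ InSt R h s ∨
    InSt R (stF s) s ∧ (h = actA W (stF s) (stA s) (sndN s) n ∨
      h = actB W (stF s) (stA s) (sndN s) n) := by
  unfold nextSt
  split_ifs with h1
  · unfold InSt
    rw [sndN_pp, lk_upd, lk_upd]
    unfold InSt at h1
    simp only [h1, true_and]
    split_ifs with h2 h3
    · simp [h2]
    · simp [h3]
    · rw [eq_comm] at h2 h3
      simp [h2, h3]
  · simp [InSt] at h1 ⊢
    simp [h1]

omit hW hR in
theorem fstN_nextSt (s n : N) : fstN (nextSt W R s n) = fstN s + 1 := by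
  unfold nextSt; split_ifs <;> simp

theorem actA_bin {j g h a u n : N} (hj : TagB j) :
    actA W (pp j (pp g h)) a u n = if j = 4 ∧ n ≠ 0 then h else g := by
  rcases hj with rfl | rfl
  · unfold actA; by_cases hn : n = 0 <;> simp [hn]
  · unfold actA; simp

omit hW hR in
theorem actB_or {g h a u n : N} : actB W (pp 5 (pp g h)) a u n = h := by
  unfold actB; simp

theorem actA_all {g a u n : N} : actA W (pp 6 g) a u n = inst (num n) g := by
  unfold actA; simp
theorem actA_ex {g a u n : N} : actA W (pp 7 g) a u n = inst (num a) g := by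
  unfold actA; simp
theorem actA_all2 {g a u n : N} : actA W (pp 8 g) a u n = inst2 (pp 1 u) g := by
  unfold actA; simp

/-- `s` is a symbol for a free variable or a constant in `W`. -/
def IsSy (W : Set N) (s : N) : Prop := s = pp 1 (sndN s) ∨ s = pp 2 (sndN s) ∧ dom W (sndN s)

instance def_isSy {F : Set (Set N)} [Closed F] {α : Type} [Ctx N α] [Fact (W ∈ F)] {f : α → N}
    [DefM F f] : Def F (fun a => IsSy W (f a)) := by unfold IsSy; infer_instance

theorem actA_ex2 {g a u n : N} (ha : IsSy W a) : actA W (pp 9 g) a u n = inst2 a g := by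
  unfold IsSy at ha; unfold actA; simp [pp_inj, ha]
theorem actA_ex2_of_not {g a u n : N} (ha : ¬ IsSy W a) : actA W (pp 9 g) a u n = pp 9 g := by
  unfold IsSy at ha; unfold actA; simp [pp_inj, ha]
theorem actA_lit {j t s a u n : N} (hj : TagL j) : actA W (pp j (pp t s)) a u n = pp j (pp t s) := by
  rcases hj with rfl | rfl | rfl | rfl <;> (unfold actA; simp)
theorem actB_of_ne {f a u n : N} (h : ∀ g h, f ≠ pp 5 (pp g h)) :
    actB W f a u n = actA W f a u n := if_neg (h _ _)

/-! #### Fresh variables -/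

theorem lt_of_lk_ne_zero {ν x : N} : lk ν x ≠ 0 → x < ν := by
  refine sind 𝒮 N (P := fun ν => lk ν x ≠ 0 → x < ν) (fun ν ih h => ?_) ν
  rw [lk, recN_eq 𝒮 N lkStep_local lkStep_def, lkStep] at h
  split_ifs at h with h1 h2
  · rw [h1, h2]
    exact (le_pp_left _ _).trans_lt
      ((le_pp_left _ _).trans_lt (lt_pp_right (by norm_num) _))
  · have := ih (sndN (sndN ν)) (by
      conv_rhs => rw [h1]
      exact (le_pp_right _ _).trans_lt (lt_pp_right (by norm_num) _)) h
    refine this.trans ?_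
    conv_rhs => rw [h1]
    exact (le_pp_right _ _).trans_lt (lt_pp_right (by norm_num) _)
  · exact absurd rfl h

theorem Occ.le {u f : N} : Occ u f → u ≤ f := by
  refine form_ind 𝒮 N (P := fun f => Occ u f → u ≤ f) ?_ ?_ ?_ ?_ f
  · intro j t s hj h
    rw [(occ_lit hj).1 h |>.2]
    exact (le_pp_right _ _).trans ((le_pp_right _ _).trans (le_pp_right _ _))
  · intro j g h hj ih ih' ho
    rcases (occ_bin hj).1 ho with h1 | h1
    · exact (ih h1).trans ((le_pp_left _ _).trans (le_pp_right _ _))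
    · exact (ih' h1).trans ((le_pp_right _ _).trans (le_pp_right _ _))
  · intro j g hj ih ho
    exact (ih ((occ_un hj).1 ho)).trans (le_pp_right _ _)
  · intro x hx ho
    exact absurd ho (occ_junk hx)

theorem not_occ_of_inSt (hRs : ∀ h ∈ R, Sent W h) {s h : N} (hh : InSt R h s) :
    ¬ Occ (sndN s) h := by
  rcases hh with hh | hh
  · exact (sent_iff.1 (hRs h hh)).2 _
  · intro ho
    exact absurd ((lt_of_lk_ne_zero (by rw [hh]; exact one_ne_zero)).trans_le ho.le) (lt_irrefl _)

end

section
variable {W R : Set N} [hW : Fact (W ∈ 𝒮 N)] [hR : Fact (R ∈ 𝒮 N)]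

/-- The state of the node `j`. -/
noncomputable def stOf (W R : Set N) (j : N) : N := predN (tree W R j)

instance defM_stOf {F : Set (Set N)} [Closed F] {α : Type} [Ctx N α] [Fact (W ∈ F)] [Fact (R ∈ F)]
    {f : α → N} [DefM F f] : DefM F (fun a => stOf W R (f a)) := by unfold stOf; infer_instance

/-- The nodes of the search tree. -/
def searchI (W R : Set N) : Set N := {j | tree W R j ≠ 0}
/-- The edges of the search tree. -/
def searchE (W R : Set N) : Set N :=
  {z | ∃ i n, Chi W R (tree W R i) n ∧ z = pp (pp i n) (pp 1 (pp i n))}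
/-- The sequents of the search tree. -/
def searchD (W R : Set N) : Set N :=
  {z | ∃ i h, tree W R i ≠ 0 ∧ InSt R h (stOf W R i) ∧ z = pp i h}

instance fact_searchI : Fact (searchI W R ∈ 𝒮 N) :=
  ⟨setOf_mem (P := fun j => tree W R j ≠ 0) inferInstance⟩
instance fact_searchE : Fact (searchE W R ∈ 𝒮 N) :=
  ⟨setOf_mem (P := fun z => ∃ i n, Chi W R (tree W R i) n ∧ z = pp (pp i n) (pp 1 (pp i n)))
    inferInstance⟩
instance fact_searchD : Fact (searchD W R ∈ 𝒮 N) :=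
  ⟨setOf_mem (P := fun z => ∃ i h, tree W R i ≠ 0 ∧ InSt R h (stOf W R i) ∧ z = pp i h)
    inferInstance⟩

omit hW hR in
theorem prem_search {i n j : N} : Prem (searchE W R) i n j ↔
    Chi W R (tree W R i) n ∧ j = pp 1 (pp i n) := by
  constructor
  · rintro ⟨i', n', h, e⟩
    simp only [pp_inj] at e
    obtain ⟨⟨rfl, rfl⟩, rfl⟩ := e
    exact ⟨h, rfl⟩
  · rintro ⟨h, rfl⟩
    exact ⟨i, n, h, rfl⟩

omit hW hR in
theorem mem_searchD {i h : N} : pp i h ∈ searchD W R ↔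
    tree W R i ≠ 0 ∧ InSt R h (stOf W R i) := by
  constructor
  · rintro ⟨i', h', h1, h2, e⟩
    obtain ⟨rfl, rfl⟩ := pp_inj.1 e
    exact ⟨h1, h2⟩
  · exact fun h1 => ⟨i, h, h1.1, h1.2, rfl⟩

theorem stOf_zero : stOf W R (0 : N) = 0 := by
  have : predN ((0 : N) + 1) = 0 := predN_succ 0
  rwa [zero_add, ← tree_zero (W := W) (R := R)] at this

theorem stOf_child {i n : N} (h : Chi W R (tree W R i) n) : tree W R (pp 1 (pp i n)) ≠ 0 ∧
    stOf W R (pp 1 (pp i n)) = nextSt W R (stOf W R i) n := by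
  unfold stOf
  rw [tree_child, if_pos h]
  exact ⟨by simp, predN_succ _⟩

theorem isTree_search : IsTree (searchI W R) (searchE W R) 0 := by
  refine ⟨?_, ?_, ?_, ?_, ?_, ?_⟩
  · show tree W R 0 ≠ 0
    rw [tree_zero]; exact one_ne_zero
  · intro i n j h
    obtain ⟨hc, rfl⟩ := prem_search.1 h
    exact ⟨hc.1, (stOf_child hc).1, pp_one_ne_zero _⟩
  · rintro i n j k ⟨h, h'⟩
    rw [(prem_search.1 h).2, (prem_search.1 h').2]
  · rintro j ⟨h1, h2⟩
    obtain ⟨i, n, rfl, h⟩ := tree_ne_zero h2 h1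
    exact ⟨i, n, prem_search.2 ⟨h, rfl⟩⟩
  · rintro i n k m j ⟨h, h'⟩
    have := (prem_search.1 h).2.symm.trans (prem_search.1 h').2
    simp only [pp_inj] at this
    exact this.2
  · rintro X hX ⟨h0, hs⟩ i
    have : Fact (X ∈ 𝒮 N) := ⟨hX⟩
    refine sind 𝒮 N (P := fun i => i ∈ searchI W R → i ∈ X) (fun i ih hi => ?_) i
    by_cases h : i = 0
    · rwa [h]
    · obtain ⟨k, n, rfl, hc⟩ := tree_ne_zero h hi
      refine hs k n _ ⟨ih k ?_ hc.1, prem_search.2 ⟨hc, rfl⟩⟩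
      exact (le_pp_left _ _).trans_lt (lt_pp_right (by norm_num) _)

theorem isFm_act {f a u n : N} (hf : IsFm W f) :
    IsFm W (actA W f a u n) ∧ IsFm W (actB W f a u n) := by
  rcases hf.shape.cases with ⟨j, t, s, hj, rfl⟩ | ⟨j, g, k, hj, rfl, -, -⟩ | ⟨j, g, hj, rfl, -⟩
  · rw [actB_of_ne (fun g h e => hj.ne_tagB (by simp [TagB]) (pp_inj.1 e).1), actA_lit hj]
    exact ⟨hf, hf⟩
  · obtain ⟨h1, h2⟩ := (fmK_bin hj).1 hf
    have h3 : IsFm W (actA W (pp j (pp g k)) a u n) := by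
      rw [actA_bin hj]; split_ifs
      · exact h2
      · exact h1
    refine ⟨h3, ?_⟩
    by_cases h5 : j = 5
    · subst h5
      rw [actB_or]; exact h2
    · rwa [actB_of_ne fun g h e => h5 (pp_inj.1 e).1]
  · rw [actB_of_ne (fun g h e => TagB.ne_tagU (by simp [TagB]) hj (pp_inj.1 e).1.symm), and_self]
    rcases hj with rfl | rfl | rfl | rfl
    · rw [actA_all]; exact fmK_inst_body (by simp) (isTm_num 0 n) hf
    · rw [actA_ex]; exact fmK_inst_body (by simp) (isTm_num 0 a) hf
    · rw [actA_all2]; exact fmK_inst2_body (by simp) (fun l => symT_free trivial u l) hf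
    · by_cases ha : IsSy W a
      · rw [actA_ex2 ha]
        refine fmK_inst2_body (by simp) (fun l => ?_) hf
        rcases ha with ha | ⟨ha, hd⟩
        · rw [ha]; exact symT_free trivial _ l
        · rw [ha]; exact symT_const hd l
      · rw [actA_ex2_of_not ha]; exact hf

theorem isFm_of_inSt (hRs : ∀ h ∈ R, Sent W h) (i : N) :
    tree W R i ≠ 0 → ∀ h, InSt R h (stOf W R i) → IsFm W h := by
  refine sind 𝒮 N (P := fun i => tree W R i ≠ 0 → ∀ h, InSt R h (stOf W R i) → IsFm W h)
    (fun i ih hi h hh => ?_) i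
  by_cases h0 : i = 0
  · subst h0
    rw [stOf_zero] at hh
    rcases hh with hh | hh
    · exact (hRs h hh).isFm
    · refine absurd (lt_of_lk_ne_zero (by rw [hh]; exact one_ne_zero)) ?_
      rw [← pp_zero, sndN_pp]
      exact not_lt_zero' h
  · obtain ⟨k, n, rfl, hc⟩ := tree_ne_zero h0 hi
    rw [(stOf_child hc).2, inSt_nextSt] at hh
    have ihk := ih k ((le_pp_left _ _).trans_lt (lt_pp_right (by norm_num) _)) hc.1
    rcases hh with hh | ⟨hf, rfl | rfl⟩
    · exact ihk h hh
    · exact (isFm_act (ihk _ hf)).1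
    · exact (isFm_act (ihk _ hf)).2

theorem isProof_search (hRs : ∀ h ∈ R, Sent W h) (hwf : IsWF (searchI W R) (searchE W R)) :
    IsProof false (searchI W R) (searchE W R) (searchD W R) (searchD W R) W 0 := by
  refine ⟨isTree_search, hwf, fun i (hi : tree W R i ≠ 0) => ⟨fun h hh => ?_, ?_⟩⟩
  · exact isFm_of_inSt hRs i hi h (mem_searchD.1 hh).2
  by_cases hax : AxSt W R (stOf W R i)
  · refine Or.inl ⟨?_, fun n j h => (prem_search.1 h).1.2.1 hax⟩
    obtain ⟨t, u, h⟩ := hax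
    refine ⟨t, u, ?_⟩
    simpa only [mem_searchD, ne_eq, hi, not_false_eq_true, true_and] using h
  refine Or.inr ?_
  show RuleAt _ _ _ _ _
  have child : ∀ {n}, ValSt R (stOf W R i) n → ∃ j, Prem (searchE W R) i n j ∧
      ∀ h, pp j h ∈ searchD W R ↔ pp i h ∈ searchD W R ∨ InSt R (stF (stOf W R i)) (stOf W R i) ∧
        (h = actA W (stF (stOf W R i)) (stA (stOf W R i)) (sndN (stOf W R i)) n ∨
          h = actB W (stF (stOf W R i)) (stA (stOf W R i)) (sndN (stOf W R i)) n) := by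
    intro n hn
    have hc : Chi W R (tree W R i) n := ⟨hi, hax, hn⟩
    refine ⟨_, prem_search.2 ⟨hc, rfl⟩, fun h => ?_⟩
    rw [mem_searchD, mem_searchD, (stOf_child hc).2, inSt_nextSt]
    simp only [ne_eq, (stOf_child hc).1, hi, not_false_eq_true, true_and]
  have val : ∀ {n j}, Prem (searchE W R) i n j → ValSt R (stOf W R i) n :=
    fun h => (prem_search.1 h).1.2.2
  have fresh : ∀ h, pp i h ∈ searchD W R → ¬ Occ (sndN (stOf W R i)) h := fun h hh =>
    not_occ_of_inSt hRs (mem_searchD.1 hh).2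
  have fm : ∀ h, pp i h ∈ searchD W R → IsFm W h := fun h hh =>
    isFm_of_inSt hRs i hi h (mem_searchD.1 hh).2
  have hmem : InSt R (stF (stOf W R i)) (stOf W R i) ↔
      pp i (stF (stOf W R i)) ∈ searchD W R := by
    rw [mem_searchD]; simp [hi]
  unfold ValSt at child val
  rw [hmem] at child val
  generalize stF (stOf W R i) = f at child val
  generalize stA (stOf W R i) = a at child
  generalize sndN (stOf W R i) = u at child fresh
  have rep : (pp i f ∈ searchD W R → (∀ n j, Prem (searchE W R) i n j → n = 0) ∧
      actA W f a u 0 = f ∧ actB W f a u 0 = f) →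
      RuleAt (searchE W R) (searchD W R) (searchD W R) W i := by
    intro hf
    obtain ⟨j, hj, h⟩ := child (n := 0) (Or.inl rfl)
    refine Or.inr (Or.inr (Or.inr (Or.inr (Or.inr (Or.inr (Or.inr
      ⟨fun _ => Iff.rfl, fun n k hk => ?_, j, hj, fun x => ?_⟩))))))
    · by_cases hfi : pp i f ∈ searchD W R
      · exact (hf hfi).1 n k hk
      · exact (val hk).resolve_right fun h => hfi h.1
    · rw [h]
      refine or_iff_left_of_imp ?_
      rintro ⟨h1, h2⟩
      rw [(hf h1).2.1, (hf h1).2.2, or_self] at h2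
      rwa [h2]
  by_cases hf : pp i f ∈ searchD W R
  swap
  · exact rep fun h => absurd h hf
  have concl : ConclIs (searchD W R) (searchD W R) i f := fun h =>
    (or_iff_left_of_imp fun e => by rwa [e]).symm
  have premIs : ∀ {n g}, n = 0 ∨ pp i f ∈ searchD W R ∧
      (f = pp 4 (pp (fstN (sndN f)) (sndN (sndN f))) ∧ n = 1 ∨ f = pp 6 (sndN f)) →
      actA W f a u n = g → actB W f a u n = g →
      PremIs (searchE W R) (searchD W R) (searchD W R) i n g := by
    intro n g hn h1 h2
    obtain ⟨j, hj, h⟩ := child hn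
    refine ⟨j, hj, fun x => ?_⟩
    rw [h, h1, h2]
    simp [hf]
  rcases (fm f hf).shape.cases with ⟨j, t, s, hj, rfl⟩ | ⟨j, g, k, hj, rfl, -, -⟩ | ⟨j, g, hj, rfl, hg⟩
  · refine rep fun _ => ⟨fun n k hk => ?_, actA_lit hj, ?_⟩
    · refine (val hk).resolve_right ?_
      rintro ⟨-, ⟨e, -⟩ | e⟩
      · exact hj.ne_tagB (by simp [TagB]) (pp_inj.1 e).1
      · exact hj.ne_tagU (by simp [TagU]) (pp_inj.1 e).1
    · rw [actB_of_ne (fun g h e => hj.ne_tagB (by simp [TagB]) (pp_inj.1 e).1), actA_lit hj]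
  · rcases hj with rfl | rfl
    · refine Or.inl ⟨g, k, concl, fun n j hj => ?_, premIs (Or.inl rfl) ?_ ?_,
        premIs (Or.inr ⟨hf, Or.inl ⟨by simp, rfl⟩⟩) ?_ ?_⟩
      · refine (val hj).imp id ?_
        rintro ⟨-, ⟨-, h⟩ | h⟩
        · exact h
        · simp at h
      · rw [actA_bin (by simp [TagB])]; simp
      · rw [actB_of_ne (by simp), actA_bin (by simp [TagB])]; simp
      · rw [actA_bin (by simp [TagB])]; simp
      · rw [actB_of_ne (by simp), actA_bin (by simp [TagB])]; simp
    · obtain ⟨j, hj, h⟩ := child (n := 0) (Or.inl rfl)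
      refine Or.inr (Or.inl ⟨g, k, concl, fun n j hj => ?_, j, hj, fun x => ?_⟩)
      · refine (val hj).resolve_right ?_
        rintro ⟨-, ⟨h, -⟩ | h⟩
        · simp at h
        · simp at h
      · rw [h, actB_or, actA_bin (by simp [TagB])]
        simp [hf]
  · have hB : ∀ n, actB W (pp j g) a u n = actA W (pp j g) a u n := fun n =>
      actB_of_ne (fun g h e => TagB.ne_tagU (by simp [TagB]) hj (pp_inj.1 e).1.symm)
    have p1 : j ≠ 6 → Prem1 (searchE W R) i := by
      intro h6 n k hk
      refine (val hk).resolve_right ?_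
      rintro ⟨-, ⟨e, -⟩ | e⟩
      · exact TagB.ne_tagU (by simp [TagB]) hj (pp_inj.1 e).1.symm
      · exact h6 (pp_inj.1 e).1
    have hgI : ∀ {j}, (j = 6 ∨ j = 7) → pp i (pp j g) ∈ searchD W R → InstOK g := fun hj hf =>
      ((fmK_num hj).1 (fm _ hf)).instOK
    rcases hj with rfl | rfl | rfl | rfl
    · refine Or.inr (Or.inr (Or.inl ⟨g, concl, fun n => ⟨_, ⟨hgI (by simp) hf, rfl⟩, ?_⟩⟩))
      refine premIs (Or.inr ⟨hf, Or.inr (by simp)⟩) actA_all ?_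
      rw [hB, actA_all]
    · refine Or.inr (Or.inr (Or.inr (Or.inl ⟨g, num a, _, concl, p1 (by norm_num), isTm_num 0 a,
        ⟨hgI (by simp) hf, rfl⟩, premIs (Or.inl rfl) actA_ex ?_⟩)))
      rw [hB, actA_ex]
    · refine Or.inr (Or.inr (Or.inr (Or.inr (Or.inl ⟨g, u, _, concl, p1 (by norm_num), fresh,
        ⟨hg, rfl⟩, premIs (Or.inl rfl) actA_all2 ?_⟩))))
      rw [hB, actA_all2]
    · by_cases ha : IsSy W a
      · rcases id ha with ha' | ⟨ha', hd⟩
        · refine Or.inr (Or.inr (Or.inr (Or.inr (Or.inr (Or.inr (Or.inl ⟨g, sndN a, _, concl,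
            p1 (by norm_num), ⟨hg, rfl⟩, premIs (Or.inl rfl) ?_ ?_⟩))))))
          · rw [actA_ex2 ha, ← ha']
          · rw [hB, actA_ex2 ha, ← ha']
        · refine Or.inr (Or.inr (Or.inr (Or.inr (Or.inr (Or.inl ⟨g, sndN a, _, concl,
            p1 (by norm_num), hd, ⟨hg, rfl⟩, premIs (Or.inl rfl) ?_ ?_⟩)))))
          · rw [actA_ex2 ha, ← ha']
          · rw [hB, actA_ex2 ha, ← ha']
      · exact rep fun _ => ⟨p1 (by norm_num), actA_ex2_of_not ha, by rw [hB, actA_ex2_of_not ha]⟩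

theorem root_search (h : N) : pp 0 h ∈ searchD W R ↔ h ∈ R := by
  rw [mem_searchD, stOf_zero, tree_zero]
  refine ⟨fun hh => hh.2.resolve_right fun h1 => ?_, fun hh => ⟨one_ne_zero, Or.inl hh⟩⟩
  refine absurd (lt_of_lk_ne_zero (by rw [h1]; exact one_ne_zero)) ?_
  rw [← pp_zero, sndN_pp]
  exact not_lt_zero' h

end

/-- A set of formulas that is closed under downward steps in the search for a proof, and that
contains no axioms. -/
structure Hintikka (W H : Set N) : Prop where
  fm : ∀ f ∈ H, IsFm W f
  eq : ∀ t u, pp 0 (pp t u) ∈ H → ¬ SameVal t u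
  neq : ∀ t u, pp 1 (pp t u) ∈ H → SameVal t u
  mem : ∀ t k, pp 2 (pp t (pp 2 k)) ∈ H → IsTm 0 t → ¬ sec W k (teval 0 t)
  nmem : ∀ t k, pp 3 (pp t (pp 2 k)) ∈ H → IsTm 0 t → sec W k (teval 0 t)
  free : ∀ t u k, pp 2 (pp t (pp 1 k)) ∈ H → pp 3 (pp u (pp 1 k)) ∈ H → ¬ SameVal t u
  and : ∀ g h, pp 4 (pp g h) ∈ H → g ∈ H ∨ h ∈ H
  or : ∀ g h, pp 5 (pp g h) ∈ H → g ∈ H ∧ h ∈ H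
  all : ∀ g, pp 6 g ∈ H → ∃ n, inst (num n) g ∈ H
  ex : ∀ g, pp 7 g ∈ H → ∀ n, inst (num n) g ∈ H
  all2 : ∀ g, pp 8 g ∈ H → ∃ u, inst2 (pp 1 u) g ∈ H
  ex2 : ∀ g, pp 9 g ∈ H → ∀ s, IsSy W s → inst2 s g ∈ H

section
variable {W R : Set N} [hW : Fact (W ∈ 𝒮 N)] [hR : Fact (R ∈ 𝒮 N)]

/-- The states along an infinite branch of the search tree. -/
theorem exists_branch (hRs : ∀ h ∈ R, Sent W h) (h : ¬ IsWF (searchI W R) (searchE W R)) :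
    ∃ q : N → N, DefM 𝒮 N (fun p : N × N => q p.2) ∧
      ∀ k, (∀ h, InSt R h (q k) → IsFm W h) ∧ ¬ AxSt W R (q k) ∧
        ∃ n, q (k + 1) = nextSt W R (q k) n := by
  unfold IsWF at h
  push Not at h
  obtain ⟨X, hX, ⟨i, hi, hiX⟩, h⟩ := h
  have : Fact (X ∈ 𝒮 N) := ⟨hX⟩
  have hdp : ∀ {α : Type} [Ctx N α] (f g k : α → N) [DefM 𝒮 N f] [DefM 𝒮 N g] [DefM 𝒮 N k],
      Def 𝒮 N (fun a => Prem (searchE W R) (f a) (g a) (k a)) := by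
    intro α _ f g k _ _ _
    unfold Prem; infer_instance
  let st : N → N := fun i => leastN (fun j => j ∈ X ∧ ∃ n, Prem (searchE W R) i n j)
  have hst : DefM 𝒮 N (fun q : N × N => st q.2) := by
    show DefM 𝒮 N (fun q : N × N => leastN (fun j => j ∈ X ∧
      ∃ n, Prem (searchE W R) q.2 n j))
    infer_instance
  have hit : DefM 𝒮 N (fun q : N × N => iterN (fun _ => st) i q.2) :=
    DefM.lift2 (P := iterN (fun _ => st)) (defM_iterN (st := fun _ => st) hst) (fun _ => i)
      (fun q : N × N => q.2)
  have hit' : ∀ {α : Type} [Ctx N α] (f : α → N) [DefM 𝒮 N f],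
      DefM 𝒮 N (fun a => iterN (fun _ => st) i (f a)) :=
    fun f => DefM.lift hit f
  have step : ∀ j ∈ searchI W R, j ∈ X → st j ∈ X ∧ ∃ n, Prem (searchE W R) j n (st j) := by
    intro j hj hjX
    refine leastN_spec 𝒮 N (P := fun k => k ∈ X ∧ ∃ n, Prem (searchE W R) j n k) ?_
    obtain ⟨n, k, h1, h2⟩ := h j hj hjX
    exact ⟨k, h2, n, h1⟩
  have inv : ∀ k : N, iterN (fun _ => st) i k ∈ searchI W R ∧ iterN (fun _ => st) i k ∈ X := by
    refine ind 𝒮 N ?_ fun k ih => ?_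
    · rw [iterN_zero (st := fun _ => st) hst]; exact ⟨hi, hiX⟩
    · rw [iterN_succ (st := fun _ => st) hst]
      obtain ⟨h1, n, h2⟩ := step _ ih.1 ih.2
      exact ⟨(isTree_search.2.1 _ _ _ h2).2.1, h1⟩
  refine ⟨fun k => stOf W R (iterN (fun _ => st) i k), inferInstance, fun k => ?_⟩
  obtain ⟨h1, h2⟩ := inv k
  obtain ⟨h3, n, h4⟩ := step _ h1 h2
  obtain ⟨h5, h6⟩ := prem_search.1 h4
  refine ⟨isFm_of_inSt hRs _ h1, h5.2.1, n, ?_⟩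
  show stOf W R (iterN (fun _ => st) i (k + 1)) = _
  rw [iterN_succ (st := fun _ => st) hst, h6, (stOf_child h5).2]

theorem exists_hintikka (hRs : ∀ h ∈ R, Sent W h) (h : ¬ IsWF (searchI W R) (searchE W R)) :
    ∃ H ∈ 𝒮 N, R ⊆ H ∧ Hintikka W H := by
  obtain ⟨q, hq, h⟩ := exists_branch hRs h
  have hq' : ∀ {α : Type} [Ctx N α] (f : α → N) [DefM 𝒮 N f],
      DefM 𝒮 N (fun a => q (f a)) := fun f => DefM.lift hq f
  have mono : ∀ {f k} m, InSt R f (q k) → InSt R f (q (k + m)) := by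
    intro f k m hf
    refine ind 𝒮 N (P := fun m => InSt R f (q (k + m))) (by rwa [add_zero]) (fun m ih => ?_) m
    obtain ⟨-, -, n, e⟩ := h (k + m)
    rw [← add_assoc, e, inSt_nextSt]
    exact Or.inl ih
  have len : ∀ k, fstN (q k) = fstN (q 0) + k := by
    refine ind 𝒮 N (by rw [add_zero]) fun k ih => ?_
    obtain ⟨-, -, n, e⟩ := h k
    rw [e, fstN_nextSt, ih, add_assoc]
  have treat : ∀ f, (∃ k, InSt R f (q k)) → ∀ a, ∃ u n, (∃ k, InSt R (actA W f a u n) (q k)) ∧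
      ∃ k, InSt R (actB W f a u n) (q k) := by
    rintro f ⟨k, hk⟩ a
    obtain ⟨m, hm⟩ := exists_add_of_le (le_pp_right (pp f a) (fstN (q 0) + k))
    have e : fstN (q (k + m)) = pp (pp f a) (fstN (q 0) + k) := by rw [len, hm, add_assoc]
    obtain ⟨-, -, n, e'⟩ := h (k + m)
    have e1 : stF (q (k + m)) = f := by unfold stF; rw [e]; simp
    have e2 : stA (q (k + m)) = a := by unfold stA; rw [e]; simp
    refine ⟨sndN (q (k + m)), n, ⟨k + m + 1, ?_⟩, k + m + 1, ?_⟩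
    · rw [e', inSt_nextSt, e1, e2]; exact Or.inr ⟨mono m hk, Or.inl rfl⟩
    · rw [e', inSt_nextSt, e1, e2]; exact Or.inr ⟨mono m hk, Or.inr rfl⟩
  refine ⟨{f | ∃ k, InSt R f (q k)}, setOf_mem inferInstance, fun f hf => ⟨0, Or.inl hf⟩, ?_, ?_, ?_,
    ?_, ?_, ?_, ?_, ?_, ?_, ?_, ?_, ?_⟩
  · rintro f ⟨k, hk⟩
    exact (h k).1 f hk
  · rintro t u ⟨k, hk⟩ hv
    exact (h k).2.1 ⟨t, u, Or.inl ⟨hk, hv⟩⟩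
  · rintro t u ⟨k, hk⟩
    by_contra hv
    exact (h k).2.1 ⟨t, u, Or.inr (Or.inl ⟨hk, hv⟩)⟩
  · rintro t c ⟨k, hk⟩ ht hv
    exact (h k).2.1 ⟨t, t, Or.inr (Or.inr (Or.inl ⟨c, hk, _, ⟨ht, rfl⟩, hv⟩))⟩
  · rintro t c ⟨k, hk⟩ ht
    by_contra hv
    exact (h k).2.1 ⟨t, t, Or.inr (Or.inr (Or.inr (Or.inl ⟨c, hk, _, ⟨ht, rfl⟩, hv⟩)))⟩
  · rintro t u c ⟨k, hk⟩ ⟨m, hm⟩ hv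
    have h1 := mono m hk
    have h2 := mono k hm
    rw [add_comm] at h2
    exact (h (k + m)).2.1 ⟨t, u, Or.inr (Or.inr (Or.inr (Or.inr ⟨c, h1, h2, hv⟩)))⟩
  · intro g g' hf
    obtain ⟨u, n, h1, -⟩ := treat _ hf 0
    rw [actA_bin (by simp [TagB])] at h1
    split_ifs at h1
    · exact Or.inr h1
    · exact Or.inl h1
  · intro g g' hf
    obtain ⟨u, n, h1, h2⟩ := treat _ hf 0
    rw [actA_bin (by simp [TagB]), if_neg (by simp)] at h1
    rw [actB_or] at h2
    exact ⟨h1, h2⟩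
  · intro g hf
    obtain ⟨u, n, h1, -⟩ := treat _ hf 0
    rw [actA_all] at h1
    exact ⟨n, h1⟩
  · intro g hf a
    obtain ⟨u, n, h1, -⟩ := treat _ hf a
    rwa [actA_ex] at h1
  · intro g hf
    obtain ⟨u, n, h1, -⟩ := treat _ hf 0
    rw [actA_all2] at h1
    exact ⟨u, h1⟩
  · intro g hf s hs
    obtain ⟨u, n, h1, -⟩ := treat _ hf s
    rwa [actA_ex2 hs] at h1

end

/-! ### The model given by a Hintikka set -/

/-- The family of sets, indexed by the symbols for free variables and constants, that refutes the
formulas in `H`. -/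
def hmod (W H : Set N) : Set N := {z | ∃ s, IsSy W s ∧ (z = pp s 0 ∨ ∃ x, z = pp s (x + 1) ∧
  (s = pp 2 (sndN s) ∧ sec W (sndN s) x ∨
    s = pp 1 (sndN s) ∧ ∃ t, pp 3 (pp t s) ∈ H ∧ IsTm 0 t ∧ teval 0 t = x))}

/-- Free variables and constants are replaced by constants for the sets in `hmod W H`. -/
noncomputable def toH (_ _ s : N) : N := if s = pp 0 (sndN s) then s else pp 2 s

/-- The inverse of `toH`. -/
noncomputable def ofH (_ _ s : N) : N :=
  if s = pp 2 (sndN s) ∧ (sndN s = pp 1 (sndN (sndN s)) ∨ sndN s = pp 2 (sndN (sndN s))) then sndN s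
  else s

instance ren_toH : Ren (toH : N → N → N → N) where
  defM := by unfold toH; infer_instance
  const _ _ _ := rfl
  bound p l s k := by
    unfold toH
    split_ifs with h1
    · rfl
    · refine iff_of_false (by simp) ?_
      rintro rfl
      exact h1 (by rw [sndN_pp])

instance ren_ofH : Ren (ofH : N → N → N → N) where
  defM := by unfold ofH; infer_instance
  const _ _ _ := rfl
  bound p l s k := by
    unfold ofH
    split_ifs with h1
    · obtain ⟨h1, h2⟩ := h1
      refine iff_of_false ?_ (by rw [h1]; simp)
      rcases h2 with h2 | h2
      · rw [h2]; simp
      · rw [h2]; simp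
    · rfl

theorem toH_bound (i : N) : toH 0 0 (pp 0 i) = pp 0 i := by unfold toH; simp
theorem ofH_bound (i : N) : ofH 0 0 (pp 0 i) = pp 0 i := by
  unfold ofH; simp

section
variable {W H : Set N} [hW : Fact (W ∈ 𝒮 N)] [hH : Fact (H ∈ 𝒮 N)]

omit hW in
theorem ofH_sy {s : N} (hs : IsSy W s) : ofH 0 0 (pp 2 s) = s := by
  unfold ofH; rw [sndN_pp, if_pos ⟨rfl, hs.imp id fun h => h.1⟩]
omit hW in
theorem toH_sy {s : N} (hs : IsSy W s) : toH 0 0 s = pp 2 s := by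
  unfold toH; rw [if_neg]
  rcases hs with hs | ⟨hs, -⟩
  · rw [hs]; simp
  · rw [hs]; simp

instance fact_hmod : Fact (hmod W H ∈ 𝒮 N) := by
  constructor
  unfold hmod
  have : ∀ {α : Type} [Ctx N α] (f : α → N) [DefM 𝒮 N f],
    Def 𝒮 N (fun a => IsSy W (f a)) := fun f => def_isSy
  exact setOf_mem inferInstance

omit hW hH in
theorem dom_hmod {s : N} : dom (hmod W H) s ↔ IsSy W s := by
  constructor
  · rintro ⟨s', h, e | ⟨x, e, -⟩⟩
    · rw [(pp_inj.1 e).1]; exact h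
    · exact absurd (pp_inj.1 e).2.symm (by simp)
  · exact fun h => ⟨s, h, Or.inl rfl⟩

omit hW hH in
theorem sec_hmod {s x : N} : sec (hmod W H) s x ↔ IsSy W s ∧
    (s = pp 2 (sndN s) ∧ sec W (sndN s) x ∨
      s = pp 1 (sndN s) ∧ ∃ t, pp 3 (pp t s) ∈ H ∧ IsTm 0 t ∧ teval 0 t = x) := by
  constructor
  · rintro ⟨s', h, e | ⟨y, e, h'⟩⟩
    · exact absurd (pp_inj.1 e).2 (by simp)
    · obtain ⟨rfl, e1⟩ := pp_inj.1 e
      obtain rfl : x = y := by simpa using e1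
      exact ⟨h, h'⟩
  · exact fun h => ⟨s, h.1, Or.inr ⟨x, rfl, h.2⟩⟩

omit hW hH in
theorem sec_hmod_const {c x : N} (hc : dom W c) : sec (hmod W H) (pp 2 c) x ↔ sec W c x := by
  have h1 : IsSy W (pp 2 c) := Or.inr (by rw [sndN_pp]; exact ⟨rfl, hc⟩)
  rw [sec_hmod]
  simp [h1, pp_inj]

omit hW hH in
theorem sec_hmod_free {u x : N} : sec (hmod W H) (pp 1 u) x ↔
    ∃ t, pp 3 (pp t (pp 1 u)) ∈ H ∧ IsTm 0 t ∧ teval 0 t = x := by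
  have h1 : IsSy W (pp 1 u) := Or.inl (by rw [sndN_pp])
  rw [sec_hmod]
  simp [h1, pp_inj]

theorem Hintikka.not_litV (h : Hintikka W H) {j t s : N} (hj : TagL j)
    (hs : ¬ TagE j → IsSy W (sndN s))
    (hf : pp j (pp t (if TagE j then s else sndN s)) ∈ H) :
    ¬ LitV (hmod W H) j t s := by
  intro hl
  obtain ⟨h1, h2, -⟩ := (fmK_lit hj).1 (h.fm _ hf)
  rcases hj with rfl | rfl | rfl | rfl
  · rw [if_pos (by simp [TagE])] at hf h2
    exact h.eq _ _ hf ⟨h1, h2 (by simp [TagE]), hl.1 rfl⟩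
  · rw [if_pos (by simp [TagE])] at hf
    exact hl.2.1 rfl (h.neq _ _ hf).2.2
  · rw [if_neg (by simp [TagE])] at hf
    have hl' := hl.2.2.1 rfl
    rcases hs (by simp [TagE]) with e | ⟨e, hd⟩
    · rw [e] at hf hl'
      obtain ⟨t', h3, h4, h5⟩ := sec_hmod_free.1 hl'
      exact h.free _ _ _ hf h3 ⟨h1, h4, h5.symm⟩
    · rw [e] at hf hl'
      exact h.mem _ _ hf h1 ((sec_hmod_const hd).1 hl')
  · rw [if_neg (by simp [TagE])] at hf
    refine hl.2.2.2 rfl ?_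
    rcases hs (by simp [TagE]) with e | ⟨e, hd⟩
    · rw [e] at hf ⊢
      exact sec_hmod_free.2 ⟨t, hf, h1, rfl⟩
    · rw [e] at hf ⊢
      exact (sec_hmod_const hd).2 (h.nmem _ _ hf h1)

theorem Hintikka.refuting (h : Hintikka W H) :
    Refuting (hmod W H) (fun x => Sent (hmod W H) x ∧ rn ofH 0 x ∈ H) where
  lit j t s hj := by
    rintro ⟨h1, h2⟩
    obtain ⟨-, -, h3⟩ := Sent.lit_sym hj h1
    rw [rn_lit hj] at h2
    refine h.not_litV hj (fun hE => ?_) ?_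
    · obtain ⟨i, rfl, hi⟩ := h3 hE
      rw [sndN_pp]; exact dom_hmod.1 hi
    · split_ifs at h2 ⊢ with hE
      · exact h2
      · obtain ⟨i, rfl, hi⟩ := h3 hE
        rw [sndN_pp]
        rwa [ofH_sy (dom_hmod.1 hi)] at h2
  bin j g k hj := by
    rintro ⟨h1, h2⟩
    rw [rn_bin hj] at h2
    obtain ⟨h3, h4⟩ := (fmK_bin hj).1 h1
    rcases hj with rfl | rfl
    · rw [if_pos rfl]
      exact (h.and _ _ h2).imp (fun h => ⟨h3, h⟩) fun h => ⟨h4, h⟩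
    · rw [if_neg (by norm_num)]
      obtain ⟨h5, h6⟩ := h.or _ _ h2
      exact ⟨⟨h3, h5⟩, h4, h6⟩
  num j g hj := by
    rintro ⟨h1, h2⟩
    have hg := (shape_un (tagU_num hj)).1 h1.shape
    have hi : ∀ n, Sent (hmod W H) (inst (num n) g) := fun n => fmK_inst_body hj (isTm_num 0 n) h1
    rw [rn_un (tagU_num hj) hg] at h2
    simp only [rn_inst hg]
    rcases hj with rfl | rfl
    · rw [if_pos rfl]
      exact (h.all _ h2).imp fun n hn => ⟨hi n, hn⟩
    · rw [if_neg (by norm_num)]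
      exact fun n => ⟨hi n, h.ex _ h2 n⟩
  set j g hj := by
    rintro ⟨h1, h2⟩
    have hg := (shape_un (tagU_set hj)).1 h1.shape
    have hi : ∀ i, dom (hmod W H) i → Sent (hmod W H) (inst2 (pp 2 i) g) := fun i hi =>
      fmK_inst2_body hj (symT_const hi) h1
    rw [rn_un (tagU_set hj) hg] at h2
    simp only [rn_inst2 hg]
    rcases hj with rfl | rfl
    · rw [if_pos rfl]
      obtain ⟨u, hu⟩ := h.all2 _ h2
      have hs : IsSy W (pp 1 u) := Or.inl (by rw [sndN_pp])
      refine ⟨pp 1 u, dom_hmod.2 hs, hi _ (dom_hmod.2 hs), ?_⟩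
      rwa [ofH_sy hs]
    · rw [if_neg (by norm_num)]
      intro i hd
      refine ⟨hi i hd, ?_⟩
      rw [ofH_sy (dom_hmod.1 hd)]
      exact h.ex2 _ h2 i (dom_hmod.1 hd)

theorem sent_toH {y : N} (hy : Sent W y) : Sent (hmod W H) (rn toH 0 y) := by
  refine rn_sent (fun b s hs => ?_) hy
  rcases hs with ⟨i, hi, rfl⟩ | hs | ⟨i, rfl, hi⟩
  · rw [toH_bound]; exact Or.inl ⟨i, hi, rfl⟩
  · exact absurd hs.1 id
  · have : IsSy W (pp 2 i) := Or.inr (by rw [sndN_pp]; exact ⟨rfl, hi⟩)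
    rw [toH_sy this]
    exact symT_const (dom_hmod.2 this) _

theorem ofH_toH {y : N} (hy : Sent W y) : rn ofH 0 (rn toH 0 y) = y := by
  unfold rn
  rw [fmap_fmap (T3 := idT) (S3 := idT) (q3 := 0) (k3 := 0) (l3 := 0) (fun _ _ _ => rfl)
    (fun b s hs => ?_) hy]
  · exact fmap_id (fun _ _ _ => rfl) (fun _ _ _ => rfl) hy
  · rw [ren_ofH.const, ren_toH.const]
    rcases hs with ⟨i, hi, rfl⟩ | hs | ⟨i, rfl, hi⟩
    · rw [toH_bound, ofH_bound]; rfl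
    · exact absurd hs.1 id
    · have : IsSy W (pp 2 i) := Or.inr (by rw [sndN_pp]; exact ⟨rfl, hi⟩)
      rw [toH_sy this, ofH_sy this]; rfl

omit hW hH in
theorem matchI_hmod {i : N} (hi : dom W i) : matchI W (hmod W H) i (pp 2 i) :=
  ⟨dom_hmod.2 (Or.inr (by rw [sndN_pp]; exact ⟨rfl, hi⟩)), fun _ => (sec_hmod_const hi).symm⟩

theorem same_toH {y : N} (hy : Sent W y) : Same y W (rn toH 0 y) (hmod W H) := by
  have h1 := Same.exists (W := hmod W H) hy fun i hi => ⟨_, matchI_hmod hi⟩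
  refine ⟨h1.1, ?_, ?_⟩
  · refine wf_fmap false (fun _ _ _ => trivial) (fun b s hs => ?_) hy
    rw [ren_toH.const]
    rcases hs with ⟨i, hi, rfl⟩ | hs | ⟨i, rfl, hi⟩
    · rw [toH_bound]; exact Or.inl ⟨i, rfl⟩
    · exact absurd hs.1 id
    · have : IsSy W (pp 2 i) := Or.inr (by rw [sndN_pp]; exact ⟨rfl, hi⟩)
      rw [toH_sy this]
      exact Or.inr (Or.inr ⟨_, rfl, dom_hmod.2 this, i, (matchI_hmod hi).symm hi⟩)
  · unfold sm rn
    rw [fmap_fmap (T3 := idT) (S3 := canS W (hmod W H)) (q3 := 0) (k3 := 0) (l3 := 0)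
      (fun _ _ _ => rfl) (fun b s hs => ?_) hy]
    · rfl
    · rw [ren_toH.const]
      rcases hs with ⟨i, hi, rfl⟩ | hs | ⟨i, rfl, hi⟩
      · rw [toH_bound, canS_eq_bound.2 rfl, canS_eq_bound.2 rfl]
      · exact absurd hs.1 id
      · have : IsSy W (pp 2 i) := Or.inr (by rw [sndN_pp]; exact ⟨rfl, hi⟩)
        rw [toH_sy this]
        exact (canS_congr (fun x => (sec_hmod_const hi).symm) ⟨_, matchI_hmod hi⟩).symm

end

/-! ### Completeness of cut-free proofs -/

/-- The family `Y`, preceded by the set `X`. -/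
def consFam (X Y : Set N) : Set N := {z | z = pp 0 0 ∨ (∃ x, x ∈ X ∧ z = pp 0 (x + 1)) ∨
  ∃ i, (dom Y i ∧ z = pp (i + 1) 0) ∨ ∃ x, sec Y i x ∧ z = pp (i + 1) (x + 1)}

section
variable {X Y F : Set N} [hX : Fact (X ∈ 𝒮 N)] [hY : Fact (Y ∈ 𝒮 N)] [hF : Fact (F ∈ 𝒮 N)]

instance fact_consFam : Fact (consFam X Y ∈ 𝒮 N) :=
  ⟨by unfold consFam; exact setOf_mem inferInstance⟩

omit hX hY in
theorem dom_consFam_zero : dom (consFam X Y) 0 := Or.inl rfl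

omit hX hY in
theorem sec_consFam_zero {x : N} : sec (consFam X Y) 0 x ↔ x ∈ X := by
  unfold sec consFam
  simp only [Set.mem_ofPred_eq, pp_inj]
  simp
  intro i _ e
  exact absurd e.symm (by simp)

omit hX hY in
theorem matchI_consFam {i : N} (hi : dom Y i) : matchI Y (consFam X Y) i (i + 1) := by
  refine ⟨Or.inr (Or.inr ⟨i, Or.inl ⟨hi, rfl⟩⟩), fun x => ?_⟩
  unfold sec consFam
  simp [pp_inj, sec]

theorem rn_code {σ : N → N → N → N} [hσ : Ren σ] {φ : Fm} (h : φ.IsSentence) :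
    rn σ 0 ((φ.code : ℕ) : N) = ((φ.code : ℕ) : N) := by
  have h1 : Wf tmT symB 0 ((φ.code : ℕ) : N) 0 0 := by
    have := wf_code (N := N) φ h
    rwa [Nat.cast_zero] at this
  refine fmap_id (fun _ _ _ => rfl) (fun b s hs => ?_) h1
  obtain ⟨i, -, rfl⟩ := hs
  exact (hσ.bound _ _ _ _).2 rfl

theorem sm_code {φ : Fm} (h : φ.IsSentence) :
    sm Y X ((φ.code : ℕ) : N) = ((φ.code : ℕ) : N) := by
  have h1 : Wf tmT symB 0 ((φ.code : ℕ) : N) 0 0 := by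
    have := wf_code (N := N) φ h
    rwa [Nat.cast_zero] at this
  refine fmap_id (fun _ _ _ => rfl) (fun b s hs => ?_) h1
  obtain ⟨i, -, rfl⟩ := hs
  exact canS_eq_bound.2 rfl

/-- If there is no cut-free proof of `¬T`, every set belongs to a family, closed under arithmetical
comprehension, in which the negations of the axioms of `T` are refuted. -/
theorem exists_refuting {A : List Fm} (hA : ∀ σ ∈ A, σ.IsSentence)
    (hACA : ∀ α ∈ ACA0, Proves {σ | σ ∈ A} α) (hT : IsTheory F Y)
    (hc : ∀ σ ∈ A, ((σ.code : ℕ) : N) ∈ F) (hn : ¬ ProvesNeg false F Y) :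
    ∃ M ∈ 𝒮 N, Closed (fam M) ∧ X ∈ fam M ∧
      ∃ P : N → Prop, Def 𝒮 N (fun p : N × N => P p.2) ∧ Refuting M P ∧
        ∀ f ∈ F, ∃ f', Same f Y f' M ∧ Sent M f' ∧ P (neg f') := by
  let W := consFam X Y
  let R : Set N := {h | ∃ f, f ∈ F ∧ h = neg (sm Y W f)}
  have hR : Fact (R ∈ 𝒮 N) := ⟨setOf_mem inferInstance⟩
  have hYW : ∀ i, dom Y i → ∃ j, matchI Y W i j := fun i hi => ⟨_, matchI_consFam hi⟩
  have hsame : ∀ f ∈ F, Same f Y (sm Y W f) W := fun f hf => Same.exists (hT f hf) hYW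
  have hsent : ∀ f ∈ F, Sent W (sm Y W f) := fun f hf => (hsame f hf).sent (hT f hf)
  have hRs : ∀ h ∈ R, Sent W h := by
    rintro _ ⟨f, hf, rfl⟩
    exact fmK_neg (hsent f hf)
  have hwf : ¬ IsWF (searchI W R) (searchE W R) := by
    intro hwf
    refine hn ⟨_, fact_searchI.out, _, fact_searchE.out, _, fact_searchD.out, _, fact_searchD.out,
      W, fact_consFam.out, 0, isProof_search hRs hwf, fun h hh => ?_, fun f hf => ?_⟩
    · obtain ⟨f, hf, rfl⟩ := (root_search h).1 hh
      exact ⟨f, hf, _, ⟨(hT f hf).shape, rfl⟩, (hsame f hf).neg⟩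
    · exact ⟨neg (sm Y W f), ⟨hf, _, ⟨(hT f hf).shape, rfl⟩, (hsame f hf).neg⟩,
        (root_search _).2 ⟨f, hf, rfl⟩⟩
  obtain ⟨H, hH, hRH, h⟩ := exists_hintikka hRs hwf
  have : Fact (H ∈ 𝒮 N) := ⟨hH⟩
  have hP : ∀ f ∈ F, Sent (hmod W H) (neg (rn toH 0 (sm Y W f))) ∧
      rn ofH 0 (neg (rn toH 0 (sm Y W f))) ∈ H := by
    intro f hf
    refine ⟨fmK_neg (sent_toH (hsent f hf)), ?_⟩
    rw [rn_neg (rn_shape (hsent f hf).shape), ofH_toH (hsent f hf)]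
    exact hRH ⟨f, hf, rfl⟩
  have hd : dom (hmod W H) (pp 2 0) := (matchI_hmod dom_consFam_zero).1
  refine ⟨hmod W H, fact_hmod.out, ?_, ⟨pp 2 0, hd, ?_⟩, _, ?_, h.refuting, fun f hf => ?_⟩
  · refine closed_fam hA hACA ⟨_, hd⟩ fun σ hσ => ⟨_, h.refuting, ?_⟩
    have := hP _ (hc σ hσ)
    rw [sm_code (hA σ hσ), rn_code (hA σ hσ), (shape_code σ).2] at this
    exact this
  · ext x
    exact (sec_consFam_zero.symm.trans (sec_hmod_const dom_consFam_zero).symm)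
  · infer_instance
  · exact ⟨_, (hsame f hf).trans (same_toH (hsent f hf)), sent_toH (hsent f hf), hP f hf⟩

theorem EverySetInModel.of_not_provesNeg {A : List Fm} (hA : ∀ σ ∈ A, σ.IsSentence)
    (hACA : ∀ α ∈ ACA0, Proves {σ | σ ∈ A} α) (hT : IsTheory F Y)
    (hc : ∀ σ ∈ A, ((σ.code : ℕ) : N) ∈ F) (hn : ¬ ProvesNeg false F Y) : EverySetInModel F Y := by
  intro X hX
  have : Fact (X ∈ 𝒮 N) := ⟨hX⟩
  obtain ⟨M, hM, h1, h2, P, hP, h3, h4⟩ := exists_refuting (X := X) hA hACA hT hc hn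
  have : Fact (M ∈ 𝒮 N) := ⟨hM⟩
  obtain ⟨V, hV, h5, h6, -⟩ := exists_refuting (X := M) hA hACA hT hc hn
  have : Fact (V ∈ 𝒮 N) := ⟨hV⟩
  obtain ⟨S, hS, h7⟩ := exists_tc_sents h5 h6
  have : Fact (S ∈ 𝒮 N) := ⟨hS⟩
  refine ⟨M, hM, memFam_iff.2 h2, h2.imp fun i hi => hi.1, fun f hf => ?_⟩
  obtain ⟨f', h8, h9, h10⟩ := h4 f hf
  have h11 : Sent M (neg f') := fmK_neg h9
  refine models_iff.2 ⟨S, hS, h7, f', h8, h9, ?_⟩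
  by_contra h12
  exact h3.not_mem h7 hP h11 h10 ((h7.neg_mem h9 h11).2 h12)

end

/-! ### The axioms of `ACA₀` are sentences -/

theorem Tm.Closed.sub_var {t : Tm} {k : ℕ} (h : t.Closed k) : (t.sub .var).Closed k := by
  induction t <;> simp_all [Tm.Closed, Tm.sub]

theorem Fm.Closed.sub_ren {φ : Fm} : ∀ {k l m : ℕ} {σ : ℕ → Tm} {ρ : ℕ → ℕ},
    (∀ i, σ i = .var i) → (∀ i < l, ρ i < m) → φ.Closed k l → (φ.sub σ ρ).Closed k m := by
  have tm : ∀ {t : Tm} {k : ℕ} {σ : ℕ → Tm}, (∀ i, σ i = .var i) → t.Closed k →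
      (t.sub σ).Closed k := by
    intro t k σ hσ h
    obtain rfl : σ = .var := funext hσ
    exact h.sub_var
  have up : ∀ {σ : ℕ → Tm}, (∀ i, σ i = .var i) → ∀ i, upN σ i = .var i := by
    rintro σ hσ (_ | i)
    · rfl
    · simp [upN, hσ, Tm.sub, shiftN]
  have ups : ∀ {l m : ℕ} {ρ : ℕ → ℕ}, (∀ i < l, ρ i < m) → ∀ i < l + 1, upS ρ i < m + 1 := by
    rintro l m ρ hρ (_ | i) hi
    · exact Nat.succ_pos _
    · exact Nat.succ_lt_succ (hρ i (by omega))
  induction φ <;> intro k l m σ ρ hσ hρ h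
  case eq | neq => exact ⟨tm hσ h.1, tm hσ h.2⟩
  case mem | nmem => exact ⟨tm hσ h.1, hρ _ h.2⟩
  case and ih ih' | or ih ih' => exact ⟨ih hσ hρ h.1, ih' hσ hρ h.2⟩
  case all ih | ex ih => exact ih (up hσ) hρ h
  case all2 ih | ex2 ih => exact ih hσ (ups hρ) h

theorem closed_all_iter {φ : Fm} {k l : ℕ} (a : ℕ) (h : φ.Closed (k + a) l) :
    (Fm.all^[a] φ).Closed k l := by
  induction a generalizing k with
  | zero => exact h
  | succ a ih =>
    rw [Function.iterate_succ_apply']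
    exact ih (k := k + 1) (by rwa [Nat.add_right_comm])

theorem closed_all2_iter {φ : Fm} {k l : ℕ} (b : ℕ) (h : φ.Closed k (l + b)) :
    (Fm.all2^[b] φ).Closed k l := by
  induction b generalizing l with
  | zero => exact h
  | succ b ih =>
    rw [Function.iterate_succ_apply']
    exact ih (l := l + 1) (by rwa [Nat.add_right_comm])

theorem isSentence_of_mem_ACA0 {α : Fm} (h : α ∈ ACA0) : α.IsSentence := by
  cases h with
  | comp φ a b _ hc =>
    refine closed_all2_iter b (closed_all_iter a ?_)
    rw [Nat.zero_add, Nat.zero_add]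
    have h1 : (φ.sub .var Nat.succ).Closed (a + 1) (b + 1) :=
      hc.sub_ren (fun _ => rfl) fun i hi => Nat.succ_lt_succ hi
    have h2 := neg_closed _ h1
    exact ⟨⟨⟨Nat.succ_pos _, Nat.succ_pos _⟩, h1⟩, h2, Nat.succ_pos _, Nat.succ_pos _⟩
  | _ => simp [Fm.IsSentence, inductionAxiom, Fm.Closed, Fm.imp, Fm.neg, Tm.Closed]

section
variable {F Y : Set N} [hF : Fact (F ∈ 𝒮 N)] [hY : Fact (Y ∈ 𝒮 N)]

theorem strong_of_contains {A : List Fm} (hA : ∀ σ ∈ A, σ.IsSentence)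
    (hACA : ∀ α ∈ ACA0, Proves {σ | σ ∈ A} α) (hT : IsTheory F Y)
    (hc : ∀ σ ∈ A, ((σ.code : ℕ) : N) ∈ F) : Strong F Y := fun M hM h =>
  have : Fact (M ∈ 𝒮 N) := ⟨hM⟩
  ModelsTh.closed hA hACA hT hc h

end
end SOA

open SOA in
theorem theorem3 (A : List Fm) (hA : ∀ σ ∈ A, σ.IsSentence)
    (hACA : ∀ α ∈ ACA0, Proves {σ | σ ∈ A} α) :
    Proves ACA0 (Form.toFm (allS fun F => allS fun Y =>
      isTheory F Y ⋏ contains A F ⟶'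
        (omegaRFN 1 F Y ⟷' omegaRFN 2 F Y) ⋏
        (omegaRFN 2 F Y ⟷' everySetInModel F Y) ⋏
        (everySetInModel F Y ⟷' ∼(provesNeg true F Y)) ⋏
        (∼(provesNeg true F Y) ⟷' ∼(provesNeg false F Y)) ⋏
        (∼(provesNeg false F Y) ⟷' provSound 2 true F Y) ⋏
        (provSound 2 true F Y ⟷' provSound 2 false F Y))) := by
  refine Proves.complete (fun φ => isSentence_of_mem_ACA0) _ fun N _ S hS hsound e E hE => ?_
  let _ : ACAM N := ⟨S, hS, hsound⟩
  refine (den_allS (c := ⟨0, 0, e, E⟩) (h := fun F _ => den_allS (h := fun Y _ =>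
    by infer_instance))).out.2 ?_
  intro F hF Y hY
  have : Fact (F ∈ 𝒮 N) := ⟨hF⟩
  have : Fact (Y ∈ 𝒮 N) := ⟨hY⟩
  rintro ⟨hT, hc⟩
  have hs := strong_of_contains hA hACA hT hc
  have h13 : OmegaRFN 1 F Y → EverySetInModel F Y := EverySetInModel.of_omegaRFN
  have h32 : EverySetInModel F Y → OmegaRFN 2 F Y := OmegaRFN.two_of_models hs
  have h21 : OmegaRFN 2 F Y → OmegaRFN 1 F Y := OmegaRFN.one_of_two
  have h34 : EverySetInModel F Y → ¬ ProvesNeg true F Y := fun h => h.not_provesNeg hT hs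
  have h36 : EverySetInModel F Y → ProvSound 2 true F Y := fun h => h.provSound hT hs
  have h45 : ¬ ProvesNeg true F Y → ¬ ProvesNeg false F Y := not_provesNeg_false
  have h67 : ProvSound 2 true F Y → ProvSound 2 false F Y := ProvSound.without_cut
  have h75 : ProvSound 2 false F Y → ¬ ProvesNeg false F Y := ProvSound.not_provesNeg
  have h53 : ¬ ProvesNeg false F Y → EverySetInModel F Y :=
    EverySetInModel.of_not_provesNeg hA hACA hT hc
  exact ⟨⟨fun h => h32 (h13 h), h21⟩, ⟨fun h => h13 (h21 h), h32⟩, ⟨h34, fun h => h53 (h45 h)⟩,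
    ⟨h45, fun h => h34 (h53 h)⟩, ⟨fun h => h36 (h53 h), fun h => h75 (h67 h)⟩,
    ⟨h67, fun h => h36 (h53 (h75 h))⟩⟩
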